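/- \textbf{Setting.} Let $r\ge 0$ be an integer, $U\subset\mathbb R^3$ open, and $h:U\to\mathbb R$ of class $C^{\max(r+1,2)}$ with $0$ as a regular value; put $\Sigma=h^{-1}(0)$. Let $\Omega^r$ be the set of pairs $Z=(X,Y)$ of $C^r$ vector fields on $U$ (in addition Lipschitz if $r=0$), with the topology of uniform convergence on $U$ of all derivatives of order at most $r$. The pair $Z$ stands for the discontinuous system $\dot x=X(x)$ if $h(x)>0$, $\dot x=Y(x)$ if $h(x)<0$, whose trajectories are defined by Filippov's convention: they are the absolutely continuous curves whose velocity is, at almost every time, $X$ where $h>0$, $Y$ where $h<0$, and in the segment $[X,Y]$ on $\Sigma$. Write $Xh=dh(X)$, $X^2h=d(Xh)(X)$ and $$\Sigma^s=\{x\in\Sigma: Xh<0<Yh\},\qquad \Sigma^e=\{x\in\Sigma: Yh<0<Xh\},\qquad \widetilde Z=\frac{Yh\,X-Xh\,Y}{Yh-Xh}.$$ A \emph{sliding Shilnikov orbit} of $Z$ is a set $\Gamma$ obtained as follows. There are $p\in\Sigma^s$ (resp. $p\in\Sigma^e$) with $\widetilde Z(p)=0$ such that $\widetilde Z|_\Sigma$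 is differentiable at $p$ and its linearization on $T_p\Sigma$ has eigenvalues $a\pm ib$ with $b\ne0$ and $a>0$ (resp. $a<0$), and $q\in\partial\Sigma^s$ (resp. $q\in\partial\Sigma^e$) with $Xh(q)=0$, $Xh$ differentiable at $q$, $X^2h(q)>0$ and $Yh(q)>0$ (resp. $Yh(q)<0$), such that: the orbit of $\widetilde Z$ through $q$ stays in $\Sigma^s$ for all negative times and converges to $p$ backward in time (resp. stays in $\Sigma^e$ for all positive times and converges to $p$ forward in time); and the orbit of $X$ through $q$ reaches $p$ at a time $t_0>0$ (resp. $t_0<0$), with $h>0$ strictly between the times $0$ and $t_0$. $\Gamma$ is the union of these two orbit arcs, including $p$ and $q$. A \emph{sliding periodic orbit} of $Z$ is the image of a periodic Filippov trajectory that stays in $\Sigma^s\cup\Sigma^e$ during some time interval and that is not contained in $\Sigma$. Let $Z_0\in\Omega^r$ have a sliding Shilnikov orbit $\Gamma_0$. An \emph{unfolding} of $Z_0$ with respect to $\Gamma_0$ is a one-parameter family $Z_\alpha\in\Omega^r$ ($\alpha\in\mathbb R$ near $0$) with $Z_\alpha\to Z_0$ in $\Omega^r$ as $\alpha\to0$,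 for which there is a neighbourhood $V$ of $\Gamma_0$ such that $Z_\alpha$ has no sliding Shilnikov orbit contained in $V$ for all small $\alpha\neq0$. \textbf{Theorem B.} Let $Z_0\in\Omega^r$ have a sliding Shilnikov orbit $\Gamma_0$, and let $Z_\alpha\in\Omega^r$ be an unfolding of $Z_0$ with respect to $\Gamma_0$. Then: (a) every neighbourhood $G\subset\mathbb R^3$ of $\Gamma_0$ contains a countably infinite family of pairwise distinct sliding periodic orbits of $Z_0$; (b) there is $\alpha_0>0$ such that for every $0<|\alpha|<\alpha_0$ there is a neighbourhood $G_\alpha\subset\mathbb R^3$ of $\Gamma_0$ containing a finite number $N(\alpha)>0$ of sliding periodic orbits of $Z_\alpha$, and $N(\alpha)\to\infty$ as $\alpha\to0$; if $r\ge1$, these $N(\alpha)$ orbits are all the sliding periodic orbits of $Z_\alpha$ contained in $G_\alpha$; (c) for every neighbourhood $G\subset\mathbb R^3$ of $\Gamma_0$ there is $\alpha_0>0$ such that for every $0<|\alpha|<\alpha_0$ the set $G$ contains a finite number $N_G(\alpha)>0$ of pairwise distinct sliding periodic orbits of $Z_\alpha$, with $N_G(\alpha)\to\infty$ as $\alpha\to0$;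 if $r\ge1$, they can be chosen so that they are all the sliding periodic orbits of $Z_\alpha$ contained in some neighbourhood $G'\subset G$ of $\Gamma_0$ (depending on $\alpha$). -/

import Mathlib

open Set Filter Topology MeasureTheory

/-- The Euclidean space `ℝ³`. -/
abbrev E3 : Type := EuclideanSpace ℝ (Fin 3)

/-- A piecewise vector field `Z = (X, Y)`: `X` acts where `h > 0`, `Y` acts where `h < 0`. -/
structure PWField where
  X : E3 → E3
  Y : E3 → E3

namespace PWField

/-- The derivative `Xh(x) = ⟨∇h(x), X(x)⟩` of `h` in the direction of `X`. -/
noncomputable def lieDeriv (X : E3 → E3) (h : E3 → ℝ) (x : E3) : ℝ :=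
  fderiv ℝ h x (X x)

/-- The switching surface `Σ = h⁻¹(0)` (inside the domain `U`). -/
def switching (U : Set E3) (h : E3 → ℝ) : Set E3 := {x | x ∈ U ∧ h x = 0}

/-- The sliding region `Σˢ`. -/
def slidingRegion (U : Set E3) (h : E3 → ℝ) (Z : PWField) : Set E3 :=
  {x | x ∈ switching U h ∧ lieDeriv Z.X h x < 0 ∧ 0 < lieDeriv Z.Y h x}

/-- The escaping region `Σᵉ`. -/
def escapingRegion (U : Set E3) (h : E3 → ℝ) (Z : PWField) : Set E3 :=
  {x | x ∈ switching U h ∧ 0 < lieDeriv Z.X h x ∧ lieDeriv Z.Y h x < 0}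

/-- The sliding vector field `(Yh · X - Xh · Y) / (Yh - Xh)`. -/
noncomputable def slidingField (h : E3 → ℝ) (Z : PWField) (x : E3) : E3 :=
  (lieDeriv Z.Y h x - lieDeriv Z.X h x)⁻¹ •
    (lieDeriv Z.Y h x • Z.X x - lieDeriv Z.X h x • Z.Y x)

/-- The set of admissible velocities of the Filippov convention. -/
def velocities (h : E3 → ℝ) (Z : PWField) (x : E3) : Set E3 :=
  {v | (0 < h x ∧ v = Z.X x) ∨ (h x < 0 ∧ v = Z.Y x) ∨
    (h x = 0 ∧ v ∈ segment ℝ (Z.X x) (Z.Y x))}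

/-- A complete trajectory of `ẋ = Z(x)` in `U` in the sense of Filippov.  (The set of admissible
velocities is locally bounded, so that the absolutely continuous solutions of the differential
inclusion are the locally Lipschitz ones.) -/
def IsTrajectory (U : Set E3) (h : E3 → ℝ) (Z : PWField) (γ : ℝ → E3) : Prop :=
  LocallyLipschitz γ ∧ (∀ t, γ t ∈ U) ∧
    ∀ᵐ t : ℝ, ∃ v ∈ velocities h Z (γ t), HasDerivAt γ v t

/-- `P` is a sliding periodic orbit of `Z`: the image of a periodic Filippov trajectory that slides
along `Σˢ ∪ Σᵉ` during some time interval and that also leaves `Σ` (so it is not constant, and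
not merely a closed orbit of the sliding vector field). -/
def IsSlidingPeriodicOrbit (U : Set E3) (h : E3 → ℝ) (Z : PWField) (P : Set E3) : Prop :=
  ∃ (γ : ℝ → E3) (T : ℝ), 0 < T ∧ IsTrajectory U h Z γ ∧ Function.Periodic γ T ∧
    (∃ a b : ℝ, a < b ∧ ∀ t ∈ Ioo a b, γ t ∈ slidingRegion U h Z ∪ escapingRegion U h Z) ∧
    (∃ t, h (γ t) ≠ 0) ∧
    P = range γ

/-- `p ∈ Σ` is a zero of the sliding vector field at which its linearization on the tangent plane
`T_pΣ = ker dh(p)` has the pair of non-real eigenvalues `a ± i b`: if `w = u + i v`, then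
`A w = (a + i b) w` for the linearization `A`. -/
def IsFocusWith (U : Set E3) (h : E3 → ℝ) (Z : PWField) (p : E3) (a b : ℝ) : Prop :=
  slidingField h Z p = 0 ∧ b ≠ 0 ∧
    ∃ A : E3 →L[ℝ] E3, HasFDerivWithinAt (slidingField h Z) A (switching U h) p ∧
      ∃ u v : E3, fderiv ℝ h p u = 0 ∧ fderiv ℝ h p v = 0 ∧ (u ≠ 0 ∨ v ≠ 0) ∧
        A u = a • u - b • v ∧ A v = b • u + a • v

/-- `q ∈ Σ` is a visible fold of `X`: `Xh(q) = 0` and `X²h(q) > 0`. -/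
def IsVisibleFold (U : Set E3) (h : E3 → ℝ) (X : E3 → E3) (q : E3) : Prop :=
  q ∈ switching U h ∧ lieDeriv X h q = 0 ∧
    DifferentiableAt ℝ (lieDeriv X h) q ∧ 0 < lieDeriv X (lieDeriv X h) q

/-- A sliding Shilnikov orbit `Γ` through a pseudo saddle-focus `p ∈ Σˢ` (an unstable focus of the
sliding vector field) and a visible fold `q ∈ ∂Σˢ` of `X`: the sliding orbit `σ` of `q` tends to
`p` backward in time, and the `X`-orbit `ξ` of `q` reaches `p` after the time `t₀ > 0`. -/
def IsShilnikovSliding (U : Set E3) (h : E3 → ℝ) (Z : PWField) (Γ : Set E3) : Prop :=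
  ∃ p q : E3,
    p ∈ slidingRegion U h Z ∧ (∃ a b : ℝ, 0 < a ∧ IsFocusWith U h Z p a b) ∧
    q ∈ closure (slidingRegion U h Z) \ slidingRegion U h Z ∧
    IsVisibleFold U h Z.X q ∧ 0 < lieDeriv Z.Y h q ∧
    ∃ (σ ξ : ℝ → E3) (t₀ : ℝ),
      (σ 0 = q ∧ ContinuousOn σ (Iic 0) ∧
        (∀ t < 0, σ t ∈ slidingRegion U h Z ∧ HasDerivAt σ (slidingField h Z (σ t)) t) ∧
        Tendsto σ atBot (𝓝 p)) ∧
      (0 < t₀ ∧ ξ 0 = q ∧ ξ t₀ = p ∧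
        (∀ t ∈ Icc 0 t₀, HasDerivWithinAt ξ (Z.X (ξ t)) (Icc 0 t₀) t) ∧
        (∀ t ∈ Ioo 0 t₀, ξ t ∈ U ∧ 0 < h (ξ t))) ∧
      Γ = σ '' Iic 0 ∪ ξ '' Icc 0 t₀

/-- A sliding Shilnikov orbit `Γ` through a pseudo saddle-focus `p ∈ Σᵉ` (a stable focus of the
sliding vector field) and a visible fold `q ∈ ∂Σᵉ` of `X`: the sliding orbit `σ` of `q` tends to
`p` forward in time, and the `X`-orbit `ξ` of `q` reaches `p` at the time `t₀ < 0`. -/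
def IsShilnikovEscaping (U : Set E3) (h : E3 → ℝ) (Z : PWField) (Γ : Set E3) : Prop :=
  ∃ p q : E3,
    p ∈ escapingRegion U h Z ∧ (∃ a b : ℝ, a < 0 ∧ IsFocusWith U h Z p a b) ∧
    q ∈ closure (escapingRegion U h Z) \ escapingRegion U h Z ∧
    IsVisibleFold U h Z.X q ∧ lieDeriv Z.Y h q < 0 ∧
    ∃ (σ ξ : ℝ → E3) (t₀ : ℝ),
      (σ 0 = q ∧ ContinuousOn σ (Ici 0) ∧
        (∀ t > 0, σ t ∈ escapingRegion U h Z ∧ HasDerivAt σ (slidingField h Z (σ t)) t) ∧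
        Tendsto σ atTop (𝓝 p)) ∧
      (t₀ < 0 ∧ ξ 0 = q ∧ ξ t₀ = p ∧
        (∀ t ∈ Icc t₀ 0, HasDerivWithinAt ξ (Z.X (ξ t)) (Icc t₀ 0) t) ∧
        (∀ t ∈ Ioo t₀ 0, ξ t ∈ U ∧ 0 < h (ξ t))) ∧
      Γ = σ '' Ici 0 ∪ ξ '' Icc t₀ 0

/-- `Γ` is a sliding Shilnikov orbit of `Z`. -/
def IsSlidingShilnikovOrbit (U : Set E3) (h : E3 → ℝ) (Z : PWField) (Γ : Set E3) : Prop :=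
  IsShilnikovSliding U h Z Γ ∨ IsShilnikovEscaping U h Z Γ

/-- `Z = (X, Y)` belongs to `Ωʳ`: both fields are of class `Cʳ`, and Lipschitz if `r = 0`. -/
def InOmega (r : ℕ) (U : Set E3) (Z : PWField) : Prop :=
  ContDiffOn ℝ r Z.X U ∧ ContDiffOn ℝ r Z.Y U ∧
    (r = 0 → (∃ K, LipschitzOnWith K Z.X U) ∧ ∃ K, LipschitzOnWith K Z.Y U)

/-- `Z α → Z 0` in the topology of `Ωʳ` as `α → 0`: all derivatives of order at most `r`
converge uniformly. -/
def TendstoOmega (r : ℕ) (U : Set E3) (Z : ℝ → PWField) : Prop :=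
  ∀ i ≤ r,
    TendstoUniformlyOn (fun α => iteratedFDeriv ℝ i (Z α).X) (iteratedFDeriv ℝ i (Z 0).X)
      (𝓝 0) U ∧
    TendstoUniformlyOn (fun α => iteratedFDeriv ℝ i (Z α).Y) (iteratedFDeriv ℝ i (Z 0).Y)
      (𝓝 0) U

/-- `Z α` is an unfolding of `Z 0` with respect to the sliding Shilnikov orbit `Γ₀`: a
one-parameter family in `Ωʳ` through `Z 0`, continuous at `α = 0`, for which the connection is
broken for `α ≠ 0`, i.e. `Z α` has no sliding Shilnikov orbit near `Γ₀`. -/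
def IsUnfolding (r : ℕ) (U : Set E3) (h : E3 → ℝ) (Z : ℝ → PWField) (Γ₀ : Set E3) : Prop :=
  (∀ᶠ α in 𝓝 0, InOmega r U (Z α)) ∧ TendstoOmega r U Z ∧
    ∃ V ∈ 𝓝ˢ Γ₀, ∀ᶠ α in 𝓝[≠] 0, ∀ Γ ⊆ V, ¬ IsSlidingShilnikovOrbit U h (Z α) Γ

/-- The sliding periodic orbits of `Z` contained in `G`. -/
def slidingPeriodicOrbitsIn (U : Set E3) (h : E3 → ℝ) (Z : PWField) (G : Set E3) :
    Set (Set E3) :=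
  {P | IsSlidingPeriodicOrbit U h Z P ∧ P ⊆ G}

end PWField

/-! ### Lipschitz curves and almost everywhere derivative bounds -/

section AeCalculus

variable {E : Type*} [NormedAddCommGroup E] [NormedSpace ℝ E]

theorem ae_differentiableAt_of_lipschitzOnWith_Icc [FiniteDimensional ℝ E] {f : ℝ → E} {a b : ℝ}
    (hf : ∃ C, LipschitzOnWith C f (Icc a b)) :
    ∀ᵐ t, t ∈ Ioo a b → DifferentiableAt ℝ f t := by
  obtain ⟨C, hC⟩ := hf
  have h := hC.ae_differentiableWithinAt_real measurableSet_Icc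
  rw [ae_restrict_iff' measurableSet_Icc] at h
  filter_upwards [h] with t ht hab
  exact (ht (Ioo_subset_Icc_self hab)).differentiableAt (Icc_mem_nhds hab.1 hab.2)

theorem le_of_ae_hasDerivAt_nonpos {f : ℝ → ℝ} {a b : ℝ} (hab : a ≤ b)
    (hf : ∃ C, LipschitzOnWith C f (Icc a b))
    (hd : ∀ᵐ t, t ∈ Ioo a b → ∀ d, HasDerivAt f d t → d ≤ 0) : f b ≤ f a := by
  have hdiff := ae_differentiableAt_of_lipschitzOnWith_Icc hf
  obtain ⟨C, hC⟩ := hf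
  have hac : AbsolutelyContinuousOnInterval f a b :=
    LipschitzOnWith.absolutelyContinuousOnInterval (K := C) (by rwa [uIcc_of_le hab])
  have hint := hac.integral_deriv_eq_sub
  have hle : ∫ x in a..b, deriv f x ≤ 0 := by
    rw [intervalIntegral.integral_of_le hab, integral_Ioc_eq_integral_Ioo]
    refine setIntegral_nonpos_of_ae_restrict ?_
    rw [EventuallyLE, ae_restrict_iff' measurableSet_Ioo]
    filter_upwards [hd, hdiff] with t h1 h2 h3
    exact h1 h3 _ (h2 h3).hasDerivAt
  linarith

theorem HasDerivAt.abs_le_norm_of_norm {g : ℝ → E} {v : E} {t d : ℝ} (hg : HasDerivAt g v t)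
    (hd : HasDerivAt (fun s => ‖g s‖) d t) : d ≤ ‖v‖ := by
  have h1 := hg.tendsto_slope_zero_right
  have h2 := hd.tendsto_slope_zero_right
  refine le_of_tendsto_of_tendsto h2 h1.norm ?_
  filter_upwards [self_mem_nhdsWithin] with s hs
  have hs : (0 : ℝ) < s := hs
  rw [smul_eq_mul, norm_smul, Real.norm_of_nonneg (by positivity)]
  gcongr
  exact norm_sub_norm_le _ _

theorem HasDerivAt.of_abs {u : ℝ → ℝ} {u' d t : ℝ} (hu : HasDerivAt u u' t)
    (hd : HasDerivAt (fun s => |u s|) d t) :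
    (0 < u t ∧ d = u') ∨ (u t < 0 ∧ d = -u') ∨ (u t = 0 ∧ u' = 0 ∧ d = 0) := by
  rcases lt_trichotomy (u t) 0 with h | h | h
  · refine Or.inr (Or.inl ⟨h, ?_⟩)
    refine hd.unique (hu.neg.congr_of_eventuallyEq ?_)
    filter_upwards [hu.continuousAt.eventually_lt continuousAt_const h] with s hs
    simp [abs_of_neg hs]
  · refine Or.inr (Or.inr ⟨h, ?_⟩)
    have hmin : IsLocalMin (fun s => |u s|) t := by
      filter_upwards with s
      simp [h]
    have hd0 : d = 0 := hmin.hasDerivAt_eq_zero hd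
    refine ⟨?_, hd0⟩
    subst hd0
    have h1 := hu.tendsto_slope_zero_right
    have h2 := hd.tendsto_slope_zero_right
    have h3 : Tendsto (fun s : ℝ => |s⁻¹ • (u (t + s) - u t)|) (𝓝[>] 0) (𝓝 0) := by
      refine h2.congr' ?_
      filter_upwards [self_mem_nhdsWithin] with s hs
      have hs : (0 : ℝ) < s := hs
      simp [h, abs_mul, abs_of_pos hs]
    exact abs_eq_zero.mp (tendsto_nhds_unique h1.abs h3)
  · refine Or.inl ⟨h, ?_⟩
    refine hd.unique (hu.congr_of_eventuallyEq ?_)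
    filter_upwards [continuousAt_const.eventually_lt hu.continuousAt h] with s hs
    simp [abs_of_pos hs]

theorem norm_sub_le_of_ae_hasDerivAt {g : ℝ → E} {a b B : ℝ} (hab : a ≤ b)
    (hg : ∃ C, LipschitzOnWith C g (Icc a b))
    (hd : ∀ᵐ t, t ∈ Ioo a b → ∃ v, HasDerivAt g v t ∧ ‖v‖ ≤ B) :
    ‖g b - g a‖ ≤ B * (b - a) := by
  obtain ⟨C, hC⟩ := hg
  have hl1 : LipschitzOnWith (C + ‖B‖₊) (fun t => ‖g t - g a‖ - B * (t - a)) (Icc a b) := by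
    refine LipschitzOnWith.sub ?_ ?_
    · refine LipschitzOnWith.of_dist_le_mul fun x hx y hy => ?_
      have h1 := abs_norm_sub_norm_le (g x - g a) (g y - g a)
      rw [sub_sub_sub_cancel_right] at h1
      have h2 := hC.dist_le_mul x hx y hy
      rw [dist_eq_norm (g x)] at h2
      rw [Real.dist_eq]
      exact h1.trans h2
    · refine LipschitzOnWith.of_dist_le_mul fun x _ y _ => ?_
      simp only [Real.dist_eq, coe_nnnorm, Real.norm_eq_abs]
      rw [← abs_mul]
      exact le_of_eq (by ring_nf)
  have := le_of_ae_hasDerivAt_nonpos hab ⟨_, hl1⟩ (by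
    filter_upwards [hd] with t ht htab d hdd
    obtain ⟨v, hv, hvB⟩ := ht htab
    have h1 : HasDerivAt (fun s => B * (s - a)) B t := by
      simpa using ((hasDerivAt_id t).sub_const a).const_mul B
    have h2 : HasDerivAt (fun s => ‖g s - g a‖) (d + B) t := by
      refine (hdd.add h1).congr_of_eventuallyEq (Eventually.of_forall fun s => ?_)
      simp
    have := HasDerivAt.abs_le_norm_of_norm (hv.sub_const (g a)) h2
    linarith)
  simp only [sub_self, norm_zero, mul_zero] at this
  linarith

theorem le_exp_mul_of_ae_hasDerivAt {f : ℝ → ℝ} {a b L η : ℝ} (hab : a ≤ b) (hL : 0 ≤ L)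
    (hη : 0 ≤ η) (hf : ∃ C, LipschitzOnWith C f (Icc a b))
    (hd : ∀ᵐ t, t ∈ Ioo a b → ∀ d, HasDerivAt f d t → d ≤ L * f t + η) :
    f b ≤ Real.exp (L * (b - a)) * (f a + η * (b - a)) := by
  obtain ⟨C, hC⟩ := hf
  have hexp : ∃ C', LipschitzOnWith C' (fun t => Real.exp (-(L * (t - a)))) (Icc a b) := by
    have : ContDiff ℝ 1 (fun t : ℝ => Real.exp (-(L * (t - a)))) := by fun_prop
    exact this.contDiffOn.exists_lipschitzOnWith (by decide) (convex_Icc _ _) isCompact_Icc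
  obtain ⟨C', hC'⟩ := hexp
  have hmul : ∃ C'', LipschitzOnWith C'' (fun t => Real.exp (-(L * (t - a))) * f t - η * (t - a))
      (Icc a b) := by
    obtain ⟨M, hM⟩ := (isCompact_Icc (a := a) (b := b)).exists_bound_of_continuousOn
      hC.continuousOn
    obtain ⟨M', hM'⟩ := (isCompact_Icc (a := a) (b := b)).exists_bound_of_continuousOn
      hC'.continuousOn
    refine ⟨‖M'‖₊ * C + ‖M‖₊ * C' + ‖η‖₊, LipschitzOnWith.of_dist_le_mul fun x hx y hy => ?_⟩
    have e1 := hC.dist_le_mul x hx y hy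
    have e2 := hC'.dist_le_mul x hx y hy
    have e3 := hM y hy
    have e4 := hM' x hx
    simp only [Real.dist_eq] at e1 e2 ⊢
    push_cast
    simp only [Real.norm_eq_abs] at *
    set p := Real.exp (-(L * (x - a)))
    set q := Real.exp (-(L * (y - a)))
    have : p * f x - η * (x - a) - (q * f y - η * (y - a))
      = p * (f x - f y) + f y * (p - q) - η * (x - y) := by ring
    rw [this]
    calc |p * (f x - f y) + f y * (p - q) - η * (x - y)|
        ≤ |p * (f x - f y) + f y * (p - q)| + |η * (x - y)| := abs_sub _ _
      _ ≤ |p * (f x - f y)| + |f y * (p - q)| + |η * (x - y)| := by gcongr; exact abs_add_le _ _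
      _ ≤ |M'| * (C * |x - y|) + |M| * (C' * |x - y|) + |η| * |x - y| := by
        have e5 := e4.trans (le_abs_self _)
        have e6 := e3.trans (le_abs_self _)
        rw [abs_mul, abs_mul, abs_mul]
        exact add_le_add_left (add_le_add (mul_le_mul e5 e1 (abs_nonneg _) (abs_nonneg _))
          (mul_le_mul e6 e2 (abs_nonneg _) (abs_nonneg _))) _
      _ = (|M'| * C + |M| * C' + |η|) * |x - y| := by ring
  have := le_of_ae_hasDerivAt_nonpos hab hmul (by
    filter_upwards [hd, ae_differentiableAt_of_lipschitzOnWith_Icc ⟨C, hC⟩] with t ht hdf htab d hdd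
    have h0 := (hdf htab).hasDerivAt
    have h1 : HasDerivAt (fun s => Real.exp (-(L * (s - a))) * f s - η * (s - a))
        (Real.exp (-(L * (t - a))) * (-L) * f t + Real.exp (-(L * (t - a))) * deriv f t - η) t := by
      have e1 : HasDerivAt (fun s : ℝ => -(L * (s - a))) (-L) t := by
        have := ((hasDerivAt_id t).sub_const a).const_mul (-L)
        simpa [neg_mul] using this
      have e2 : HasDerivAt (fun s => η * (s - a)) η t := by
        simpa using ((hasDerivAt_id t).sub_const a).const_mul η
      exact (e1.exp.mul h0).sub e2
    rw [hdd.unique h1]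
    have h2 := ht htab _ h0
    have h3 : Real.exp (-(L * (t - a))) ≤ 1 := by
      rw [Real.exp_le_one_iff]
      have := htab.1
      nlinarith [mul_nonneg hL (sub_nonneg.mpr htab.1.le)]
    have h4 := Real.exp_pos (-(L * (t - a)))
    nlinarith)
  simp only [sub_self, mul_zero, neg_zero, Real.exp_zero, one_mul, sub_zero] at this
  rw [Real.exp_neg] at this
  have h5 := Real.exp_pos (L * (b - a))
  have h6 : (Real.exp (L * (b - a)))⁻¹ * f b ≤ f a + η * (b - a) := by linarith
  calc f b = Real.exp (L * (b - a)) * ((Real.exp (L * (b - a)))⁻¹ * f b) := by field_simp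
    _ ≤ _ := by gcongr

theorem le_max_of_ae_hasDerivAt {u : ℝ → ℝ} {a b c : ℝ} (hab : a ≤ b) (hc : 0 ≤ c)
    (hu : ∃ C, LipschitzOnWith C u (Icc a b))
    (hd : ∀ᵐ t, t ∈ Ioo a b → 0 < u t → ∀ d, HasDerivAt u d t → d ≤ -c) :
    u b ≤ max (u a - c * (b - a)) 0 := by
  by_contra! hcon
  obtain ⟨h1, h2⟩ := max_lt_iff.mp hcon
  have hcont : ContinuousOn u (Icc a b) := hu.choose_spec.continuousOn
  -- the last time at which `u` is nonpositive, if any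
  have key : ∀ a' ∈ Icc a b, (∀ t ∈ Ioo a' b, 0 < u t) → u b ≤ u a' - c * (b - a') := by
    intro a' ha' hpos
    obtain ⟨C, hC⟩ := hu
    have hl : LipschitzOnWith (C + ‖c‖₊) (fun t => u t + c * (t - a')) (Icc a' b) := by
      refine (hC.mono (Icc_subset_Icc_left ha'.1)).add
        (LipschitzOnWith.of_dist_le_mul fun x _ y _ => ?_)
      simp only [Real.dist_eq, coe_nnnorm, Real.norm_eq_abs]
      rw [← abs_mul]
      exact le_of_eq (by ring_nf)
    have := le_of_ae_hasDerivAt_nonpos ha'.2 ⟨_, hl⟩ (by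
      filter_upwards [hd] with t ht htab d hdd
      have e2 : HasDerivAt (fun s => c * (s - a')) c t := by
        simpa using ((hasDerivAt_id t).sub_const a').const_mul c
      have e3 : HasDerivAt u (d - c) t := by
        refine (hdd.sub e2).congr_of_eventuallyEq (Eventually.of_forall fun s => ?_)
        simp
      have := ht ⟨ha'.1.trans_lt htab.1, htab.2⟩ (hpos t htab) _ e3
      linarith)
    simp only [sub_self, mul_zero, add_zero] at this
    linarith
  by_cases hall : ∀ t ∈ Ioo a b, 0 < u t
  · exact absurd (key a (left_mem_Icc.mpr hab) hall) (not_le.mpr h1)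
  · push Not at hall
    obtain ⟨t0, ht0, hut0⟩ := hall
    set S := {t ∈ Icc a b | u t ≤ 0} with hS
    have hScomp : IsCompact S := by
      have : IsClosed S := hcont.preimage_isClosed_of_isClosed isClosed_Icc isClosed_Iic
      exact isCompact_Icc.of_isClosed_subset this (fun t ht => ht.1)
    obtain ⟨m, hm, hmax⟩ := hScomp.exists_isGreatest ⟨t0, Ioo_subset_Icc_self ht0, hut0⟩
    have := key m hm.1 (fun t ht => by
      by_contra! hcon
      have := hmax ⟨⟨hm.1.1.trans ht.1.le, ht.2.le⟩, hcon⟩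
      exact absurd ht.1 (not_lt.mpr this))
    have h3 := hm.2
    have h4 := hm.1.2
    nlinarith [mul_nonneg hc (sub_nonneg.mpr h4)]

theorem slope_mem_of_ae_hasDerivAt {g : ℝ → E} {a b : ℝ} {S : Set E}
    (hab : a < b) (hg : ∃ C, LipschitzOnWith C g (Icc a b)) (hS : Convex ℝ S) (hSc : IsClosed S)
    (hd : ∀ᵐ t, t ∈ Ioo a b → ∃ v ∈ S, HasDerivAt g v t) :
    (b - a)⁻¹ • (g b - g a) ∈ S := by
  by_contra hcon
  obtain ⟨f, u, hfu, hu⟩ := geometric_hahn_banach_closed_point hS hSc hcon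
  obtain ⟨C, hC⟩ := hg
  have hl : LipschitzOnWith (‖f‖₊ * C + ‖u‖₊) (fun t => f (g t) - u * (t - a)) (Icc a b) := by
    refine (f.lipschitz.comp_lipschitzOnWith hC).sub
      (LipschitzOnWith.of_dist_le_mul fun x _ y _ => ?_)
    simp only [Real.dist_eq, coe_nnnorm, Real.norm_eq_abs]
    rw [← abs_mul]
    exact le_of_eq (by ring_nf)
  have := le_of_ae_hasDerivAt_nonpos hab.le ⟨_, hl⟩ (by
    filter_upwards [hd] with t ht htab d hdd
    obtain ⟨v, hvS, hv⟩ := ht htab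
    have e2 : HasDerivAt (fun s => u * (s - a)) u t := by
      simpa using ((hasDerivAt_id t).sub_const a).const_mul u
    have e3 : HasDerivAt (fun s => f (g s)) (f v) t := f.hasFDerivAt.comp_hasDerivAt t hv
    rw [hdd.unique (e3.sub e2)]
    have := hfu v hvS
    linarith)
  simp only [sub_self, mul_zero, sub_zero] at this
  rw [map_smul, map_sub, smul_eq_mul] at hu
  have h2 : 0 < b - a := sub_pos.mpr hab
  have h3 : u * (b - a) < f (g b) - f (g a) := by
    calc u * (b - a) < ((b - a)⁻¹ * (f (g b) - f (g a))) * (b - a) := by gcongr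
      _ = _ := by field_simp
  linarith

theorem hasDerivWithinAt_of_ae_hasDerivAt {g w : ℝ → E} {a b : ℝ}
    (hg : ∃ C, LipschitzOnWith C g (Icc a b)) (hw : ContinuousOn w (Icc a b))
    (hd : ∀ᵐ t, t ∈ Ioo a b → HasDerivAt g (w t) t) {t : ℝ} (ht : t ∈ Icc a b) :
    HasDerivWithinAt g (w t) (Icc a b) t := by
  rw [hasDerivWithinAt_iff_isLittleO, Asymptotics.isLittleO_iff]
  intro ε hε
  have hwt := Metric.continuousWithinAt_iff.mp (hw t ht) ε hε
  obtain ⟨δ, hδ, hwδ⟩ := hwt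
  filter_upwards [inter_mem_nhdsWithin (Icc a b) (Metric.ball_mem_nhds t hδ)] with s hs
  obtain ⟨C, hC⟩ := hg
  have main : ∀ p ∈ Icc a b, ∀ q ∈ Icc a b, p ≤ q → p ∈ Metric.ball t δ → q ∈ Metric.ball t δ →
      ‖(g q - q • w t) - (g p - p • w t)‖ ≤ ε * (q - p) := by
    intro p hp q hq hpq hpt hqt
    have hsub : Icc p q ⊆ Icc a b := Icc_subset_Icc hp.1 hq.2
    refine norm_sub_le_of_ae_hasDerivAt (g := fun x => g x - x • w t) hpq ?_ ?_
    · refine ⟨C + ‖w t‖₊, (hC.mono hsub).sub (LipschitzOnWith.of_dist_le_mul fun x _ y _ => ?_)⟩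
      rw [dist_eq_norm, ← sub_smul, norm_smul, mul_comm, dist_eq_norm]
      rfl
    · filter_upwards [hd] with r hr hrpq
      have hrab : r ∈ Ioo a b := ⟨hp.1.trans_lt hrpq.1, hrpq.2.trans_le hq.2⟩
      refine ⟨w r - w t, (hr hrab).sub (by simpa using (hasDerivAt_id r).smul_const (w t)), ?_⟩
      rw [← dist_eq_norm]
      refine (hwδ (Ioo_subset_Icc_self hrab) ?_).le
      rw [Real.ball_eq_Ioo] at hpt hqt
      rw [← Metric.mem_ball, Real.ball_eq_Ioo]
      exact ⟨hpt.1.trans hrpq.1, hrpq.2.trans hqt.2⟩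
  rcases le_total t s with h | h
  · have := main t ht s hs.1 h (Metric.mem_ball_self hδ) hs.2
    rw [Real.norm_of_nonneg (sub_nonneg.mpr h)]
    have e : g s - g t - (s - t) • w t = (g s - s • w t) - (g t - t • w t) := by module
    rwa [e]
  · have := main s hs.1 t ht h hs.2 (Metric.mem_ball_self hδ)
    rw [Real.norm_of_nonpos (sub_nonpos.mpr h), neg_sub]
    have e : g s - g t - (s - t) • w t = -((g t - t • w t) - (g s - s • w t)) := by module
    rwa [e, norm_neg]

end AeCalculus

namespace PWField

/-! ### Approximate Filippov trajectories and their stability -/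

/-- The convex combination `l X + (1 - l) Y`. -/
noncomputable def blend (Z : PWField) (l : ℝ) (x : E3) : E3 := l • Z.X x + (1 - l) • Z.Y x

/-- The weights `l` for which `l X + (1 - l) Y` is an admissible velocity at `x`. -/
def Admissible (h : E3 → ℝ) (x : E3) (l : ℝ) : Prop :=
  l ∈ Icc (0 : ℝ) 1 ∧ (0 < h x → l = 1) ∧ (h x < 0 → l = 0)

/-- On `(a, b)` the curve `γ` obeys the Filippov convention for `Z`, up to an error `η` in the
velocity. -/
def Follows (h : E3 → ℝ) (Z : PWField) (η a b : ℝ) (γ : ℝ → E3) : Prop :=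
  LocallyLipschitz γ ∧ ∀ᵐ t, t ∈ Ioo a b → ∃ v, HasDerivAt γ v t ∧
    ∃ l, Admissible h (γ t) l ∧ ‖v - blend Z l (γ t)‖ ≤ η

/-- Quantitative regularity of `h` and `Z` on `K`, and transversality `Yh - Xh ≥ c` of the
discontinuity to the switching surface. -/
structure Controlled (h : E3 → ℝ) (Z : PWField) (K : Set E3) (L c ρ : ℝ) : Prop where
  one_le : 1 ≤ L
  c_pos : 0 < c
  rho_pos : 0 < ρ
  differentiableAt : ∀ x ∈ K, DifferentiableAt ℝ h x
  lip_h : ∀ x ∈ K, ∀ y ∈ K, |h x - h y| ≤ L * ‖x - y‖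
  lip_dh : ∀ x ∈ K, ∀ y ∈ K, ‖fderiv ℝ h x - fderiv ℝ h y‖ ≤ L * ‖x - y‖
  lip_X : ∀ x ∈ K, ∀ y ∈ K, ‖Z.X x - Z.X y‖ ≤ L * ‖x - y‖
  lip_Y : ∀ x ∈ K, ∀ y ∈ K, ‖Z.Y x - Z.Y y‖ ≤ L * ‖x - y‖
  dh_le : ∀ x ∈ K, ‖fderiv ℝ h x‖ ≤ L
  X_le : ∀ x ∈ K, ‖Z.X x‖ ≤ L
  Y_le : ∀ x ∈ K, ‖Z.Y x‖ ≤ L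
  gap : ∀ x ∈ K, |h x| ≤ ρ → c ≤ lieDeriv Z.Y h x - lieDeriv Z.X h x

theorem LocallyLipschitz.exists_lipschitzOnWith_Icc {γ : ℝ → E3} (hγ : LocallyLipschitz γ)
    (a b : ℝ) : ∃ C, LipschitzOnWith C γ (Icc a b) :=
  (hγ.locallyLipschitzOn).exists_lipschitzOnWith_of_compact isCompact_Icc

theorem Follows.mono {h : E3 → ℝ} {Z : PWField} {η η' a b a' b' : ℝ} {γ : ℝ → E3}
    (hγ : Follows h Z η a b γ) (hη : η ≤ η') (ha : a ≤ a') (hb : b' ≤ b) :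
    Follows h Z η' a' b' γ := by
  refine ⟨hγ.1, ?_⟩
  filter_upwards [hγ.2] with t ht htab
  obtain ⟨v, hv, l, hl, hle⟩ := ht ⟨ha.trans_lt htab.1, htab.2.trans_le hb⟩
  exact ⟨v, hv, l, hl, hle.trans hη⟩

theorem Follows.change {h : E3 → ℝ} {Z Z' : PWField} {η δ a b : ℝ} {γ : ℝ → E3}
    (hγ : Follows h Z η a b γ) (hX : ∀ t ∈ Ioo a b, ‖Z.X (γ t) - Z'.X (γ t)‖ ≤ δ)
    (hY : ∀ t ∈ Ioo a b, ‖Z.Y (γ t) - Z'.Y (γ t)‖ ≤ δ) : Follows h Z' (η + δ) a b γ := by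
  refine ⟨hγ.1, ?_⟩
  filter_upwards [hγ.2] with t ht htab
  obtain ⟨v, hv, l, hl, hle⟩ := ht htab
  refine ⟨v, hv, l, hl, ?_⟩
  have e : v - blend Z' l (γ t) = (v - blend Z l (γ t)) +
      (l • (Z.X (γ t) - Z'.X (γ t)) + (1 - l) • (Z.Y (γ t) - Z'.Y (γ t))) := by
    simp only [blend]; module
  rw [e]
  refine (norm_add_le _ _).trans (add_le_add hle ((norm_add_le _ _).trans ?_))
  rw [norm_smul, norm_smul, Real.norm_of_nonneg hl.1.1, Real.norm_of_nonneg (sub_nonneg.mpr hl.1.2)]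
  have h1 := mul_le_mul_of_nonneg_left (hX t htab) hl.1.1
  have h2 := mul_le_mul_of_nonneg_left (hY t htab) (sub_nonneg.mpr hl.1.2)
  linarith

theorem Follows.comp_add {h : E3 → ℝ} {Z : PWField} {η a b : ℝ} {γ : ℝ → E3}
    (hγ : Follows h Z η a b γ) (s : ℝ) : Follows h Z η (a - s) (b - s) (fun t => γ (t + s)) := by
  refine ⟨hγ.1.comp (LipschitzWith.id.add (LipschitzWith.const s)).locallyLipschitz, ?_⟩
  have := (measurePreserving_add_right volume s).quasiMeasurePreserving.ae hγ.2
  filter_upwards [this] with t ht htab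
  obtain ⟨v, hv, l, hl, hle⟩ := ht ⟨by linarith [htab.1], by linarith [htab.2]⟩
  exact ⟨v, HasDerivAt.comp_add_const t s hv, l, hl, hle⟩

namespace Controlled

variable {h : E3 → ℝ} {Z : PWField} {K : Set E3} {L c ρ : ℝ}

/-- The constant in the differential inequalities below. -/
noncomputable def rate (L c ρ : ℝ) : ℝ := 3 * L ^ 2 + (2 * L ^ 2 + c) * L / ρ

theorem rate_ge (H : Controlled h Z K L c ρ) : 3 * L ^ 2 ≤ rate L c ρ := by
  have := H.one_le; have := H.c_pos; have := H.rho_pos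
  have : 0 ≤ (2 * L ^ 2 + c) * L / ρ := by positivity
  simp only [rate]; linarith

theorem rate_pos (H : Controlled h Z K L c ρ) : 0 < rate L c ρ := by
  have := H.one_le
  have := H.rate_ge
  nlinarith

theorem velocity_sub_le (H : Controlled h Z K L c ρ) {x y vx vy : E3} {l m η : ℝ}
    (hx : x ∈ K) (hy : y ∈ K) (hm : m ∈ Icc (0 : ℝ) 1)
    (hvx : ‖vx - blend Z l x‖ ≤ η) (hvy : ‖vy - blend Z m y‖ ≤ η) :
    ‖(vx - vy) - (l - m) • (Z.X x - Z.Y x)‖ ≤ L * ‖x - y‖ + 2 * η := by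
  have e : (vx - vy) - (l - m) • (Z.X x - Z.Y x) = ((vx - blend Z l x) - (vy - blend Z m y)) +
      (m • (Z.X x - Z.X y) + (1 - m) • (Z.Y x - Z.Y y)) := by
    simp only [blend]; module
  rw [e]
  have h1 := norm_sub_le (vx - blend Z l x) (vy - blend Z m y)
  have h2 : ‖m • (Z.X x - Z.X y) + (1 - m) • (Z.Y x - Z.Y y)‖ ≤ L * ‖x - y‖ := by
    refine (norm_add_le _ _).trans ?_
    rw [norm_smul, norm_smul, Real.norm_of_nonneg hm.1, Real.norm_of_nonneg (sub_nonneg.mpr hm.2)]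
    have h1 := mul_le_mul_of_nonneg_left (H.lip_X x hx y hy) hm.1
    have h2 := mul_le_mul_of_nonneg_left (H.lip_Y x hx y hy) (sub_nonneg.mpr hm.2)
    linarith
  refine (norm_add_le _ _).trans ?_
  linarith

theorem blend_le (H : Controlled h Z K L c ρ) {x : E3} {l : ℝ} (hx : x ∈ K)
    (hl : l ∈ Icc (0 : ℝ) 1) : ‖blend Z l x‖ ≤ L := by
  refine (norm_add_le _ _).trans ?_
  rw [norm_smul, norm_smul, Real.norm_of_nonneg hl.1, Real.norm_of_nonneg (sub_nonneg.mpr hl.2)]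
  have h1 := mul_le_mul_of_nonneg_left (H.X_le x hx) hl.1
  have h2 := mul_le_mul_of_nonneg_left (H.Y_le x hx) (sub_nonneg.mpr hl.2)
  linarith

theorem deriv_sub_le (H : Controlled h Z K L c ρ) {x y vx vy : E3} {l m η : ℝ}
    (hx : x ∈ K) (hy : y ∈ K) (hm : m ∈ Icc (0 : ℝ) 1) (hη : η ≤ 1)
    (hvx : ‖vx - blend Z l x‖ ≤ η) (hvy : ‖vy - blend Z m y‖ ≤ η) :
    |(fderiv ℝ h x vx - fderiv ℝ h y vy) - (l - m) * (lieDeriv Z.X h x - lieDeriv Z.Y h x)|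
      ≤ 3 * L ^ 2 * (‖x - y‖ + η) := by
  have hL := H.one_le
  have hη0 : 0 ≤ η := (norm_nonneg _).trans hvx
  have e : (fderiv ℝ h x vx - fderiv ℝ h y vy) - (l - m) * (lieDeriv Z.X h x - lieDeriv Z.Y h x)
      = fderiv ℝ h x ((vx - vy) - (l - m) • (Z.X x - Z.Y x))
        + (fderiv ℝ h x - fderiv ℝ h y) vy := by
    simp only [map_sub, map_smul, lieDeriv, smul_eq_mul, _root_.sub_apply]; ring
  rw [e]
  have h1 := (fderiv ℝ h x).le_of_opNorm_le (H.dh_le x hx) ((vx - vy) - (l - m) • (Z.X x - Z.Y x))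
  have h2 := (fderiv ℝ h x - fderiv ℝ h y).le_of_opNorm_le (H.lip_dh x hx y hy) vy
  have h3 := H.velocity_sub_le hx hy hm hvx hvy
  have h4 : ‖vy‖ ≤ 2 * L := by
    have := norm_sub_norm_le vy (blend Z m y)
    have := H.blend_le hy hm
    linarith
  refine (abs_add_le _ _).trans ?_
  rw [← Real.norm_eq_abs, ← Real.norm_eq_abs]
  have h5 : L * ‖(vx - vy) - (l - m) • (Z.X x - Z.Y x)‖ ≤ L * (L * ‖x - y‖ + 2 * η) := by gcongr
  have h6 : L * ‖x - y‖ * ‖vy‖ ≤ L * ‖x - y‖ * (2 * L) := by gcongr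
  nlinarith [norm_nonneg (x - y), mul_nonneg (sub_nonneg.mpr hL) hη0,
    mul_nonneg (sub_nonneg.mpr hL) (mul_nonneg (sub_nonneg.mpr hL) hη0)]

/-- The crucial monotonicity: the height difference of two trajectories decreases at a rate that
controls the difference of their weights. -/
theorem abs_deriv_le (H : Controlled h Z K L c ρ) {x y vx vy : E3} {l m η d u' : ℝ}
    (hx : x ∈ K) (hy : y ∈ K) (hl : Admissible h x l) (hm : Admissible h y m) (hη : η ≤ 1)
    (hvx : ‖vx - blend Z l x‖ ≤ η) (hvy : ‖vy - blend Z m y‖ ≤ η)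
    (hu' : u' = fderiv ℝ h x vx - fderiv ℝ h y vy)
    (hd : (0 < h x - h y ∧ d = u') ∨ (h x - h y < 0 ∧ d = -u') ∨
      (h x - h y = 0 ∧ u' = 0 ∧ d = 0)) :
    d ≤ -c * |l - m| + rate L c ρ * (‖x - y‖ + η) := by
  have hL := H.one_le
  have hc := H.c_pos
  have hρ := H.rho_pos
  have hη0 : 0 ≤ η := (norm_nonneg _).trans hvx
  have hR := H.deriv_sub_le hx hy hm.1 hη hvx hvy
  rw [← hu'] at hR
  set S := lieDeriv Z.X h x - lieDeriv Z.Y h x with hS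
  set N := ‖x - y‖ + η with hN
  have hN0 : 0 ≤ N := by positivity
  have hrate : 3 * L ^ 2 * N ≤ rate L c ρ * N := by gcongr; exact H.rate_ge
  have hSabs : |S| ≤ 2 * L ^ 2 := by
    have e : S = fderiv ℝ h x (Z.X x - Z.Y x) := by simp [hS, lieDeriv]
    rw [e, ← Real.norm_eq_abs]
    refine ((fderiv ℝ h x).le_of_opNorm_le (H.dh_le x hx) _).trans ?_
    have := norm_sub_le (Z.X x) (Z.Y x)
    have := H.X_le x hx
    have := H.Y_le x hx
    nlinarith
  obtain ⟨hR1, hR2⟩ := abs_le.mp hR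
  by_cases hρx : |h x| ≤ ρ
  · have hgap := H.gap x hx hρx
    have hSc : S ≤ -c := by linarith
    rcases hd with ⟨h1, h2⟩ | ⟨h1, h2⟩ | ⟨h1, h2, h3⟩
    · have hlm : m ≤ l := by
        by_contra! hcon
        have : ¬ h y < 0 := fun h0 => by
          have := hm.2.2 h0
          have := hl.1.1
          linarith
        have := hl.2.1 (by linarith)
        have := hm.1.2
        linarith
      rw [abs_of_nonneg (sub_nonneg.mpr hlm)]
      nlinarith [mul_nonneg (sub_nonneg.mpr hlm) (sub_nonneg.mpr hSc)]
    · have hlm : l ≤ m := by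
        by_contra! hcon
        have : ¬ h x < 0 := fun h0 => by
          have := hl.2.2 h0
          have := hm.1.1
          linarith
        have := hm.2.1 (by linarith)
        have := hl.1.2
        linarith
      rw [abs_of_nonpos (sub_nonpos.mpr hlm)]
      nlinarith [mul_nonneg (sub_nonneg.mpr hlm) (sub_nonneg.mpr hSc)]
    · have h4 : |(l - m) * S| ≤ 3 * L ^ 2 * N := by
        rw [h2, zero_sub, abs_neg] at hR
        exact hR
      rw [abs_mul] at h4
      have h5 : c ≤ |S| := by rw [abs_of_neg (by linarith)]; linarith
      nlinarith [mul_le_mul_of_nonneg_left h5 (abs_nonneg (l - m))]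
  · by_cases hlm : l = m
    · subst hlm
      simp only [sub_self, zero_mul, sub_zero] at hR1 hR2
      rw [sub_self, abs_zero, mul_zero, zero_add]
      rcases hd with ⟨h1, h2⟩ | ⟨h1, h2⟩ | ⟨h1, h2, h3⟩ <;> linarith
    · have hbig : ρ ≤ |h x - h y| := by
        push Not at hρx
        rcases le_or_gt 0 (h x) with h0 | h0
        · rw [abs_of_nonneg h0] at hρx
          have hl1 := hl.2.1 (by linarith)
          have : ¬ 0 < h y := fun h5 => hlm (by rw [hl1, hm.2.1 h5])
          rw [abs_of_nonneg (by linarith)]; linarith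
        · rw [abs_of_neg h0] at hρx
          have hl1 := hl.2.2 h0
          have : ¬ h y < 0 := fun h5 => hlm (by rw [hl1, hm.2.2 h5])
          rw [abs_of_neg (by linarith)]; linarith
      have h1 : ρ ≤ L * N := hbig.trans ((H.lip_h x hx y hy).trans (by
        gcongr; linarith))
      have hlm1 : |l - m| ≤ 1 := by
        rw [abs_le]; constructor <;> linarith [hl.1.1, hl.1.2, hm.1.1, hm.1.2]
      have h2 : |(l - m) * S| ≤ 2 * L ^ 2 := by
        rw [abs_mul]; nlinarith [abs_nonneg (l - m), abs_nonneg S]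
      obtain ⟨h3, h4⟩ := abs_le.mp h2
      have h5 : |u'| ≤ 2 * L ^ 2 + 3 * L ^ 2 * N := by
        rw [abs_le]; constructor <;> linarith
      have h6 : d ≤ |u'| := by
        rcases hd with ⟨_, h⟩ | ⟨_, h⟩ | ⟨_, h, h'⟩
        · rw [h]; exact le_abs_self _
        · rw [h]; exact neg_le_abs _
        · rw [h']; exact abs_nonneg _
      have h7 : (2 * L ^ 2 + c) ≤ (2 * L ^ 2 + c) * L / ρ * N := by
        rw [mul_div_assoc, mul_assoc]
        refine le_mul_of_one_le_right (by positivity) ?_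
        rw [div_mul_eq_mul_div, le_div_iff₀ hρ]
        linarith
      have h8 : c * |l - m| ≤ c := by nlinarith
      simp only [rate]
      nlinarith

theorem deriv_norm_add_le (H : Controlled h Z K L c ρ) {F : Type*} [NormedAddCommGroup F]
    [NormedSpace ℝ F] (π : E3 →L[ℝ] F) (w : F) {κ η a b : ℝ} (hη : η ≤ 1) {x y : ℝ → E3}
    (hx : Follows h Z η a b x) (hy : Follows h Z η a b y)
    (hxK : ∀ t ∈ Icc a b, x t ∈ K) (hyK : ∀ t ∈ Icc a b, y t ∈ K)
    (hκ : ∀ t ∈ Icc a b, ‖π (Z.X (x t) - Z.Y (x t))‖ ≤ κ) :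
    (∃ C, LipschitzOnWith C (fun t => ‖π (x t - y t) - w‖ + κ / c * |h (x t) - h (y t)|)
      (Icc a b)) ∧
    ∀ᵐ t, t ∈ Ioo a b → ∀ d,
      HasDerivAt (fun t => ‖π (x t - y t) - w‖ + κ / c * |h (x t) - h (y t)|) d t →
      d ≤ (‖π‖ + κ / c) * rate L c ρ * (‖x t - y t‖ + η) := by
  have hL := H.one_le
  have hc := H.c_pos
  obtain ⟨C1, hC1⟩ := LocallyLipschitz.exists_lipschitzOnWith_Icc hx.1 a b
  obtain ⟨C2, hC2⟩ := LocallyLipschitz.exists_lipschitzOnWith_Icc hy.1 a b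
  have hN : ∃ C, LipschitzOnWith C (fun t => ‖π (x t - y t) - w‖) (Icc a b) := by
    refine ⟨‖π‖₊ * (C1 + C2), LipschitzOnWith.of_dist_le_mul fun s hs t ht => ?_⟩
    have e1 := (hC1.sub hC2).dist_le_mul s hs t ht
    rw [Real.dist_eq]
    refine (abs_norm_sub_norm_le _ _).trans ?_
    rw [sub_sub_sub_cancel_right, ← map_sub]
    refine (π.le_opNorm _).trans ?_
    rw [← dist_eq_norm]
    push_cast at e1 ⊢
    rw [mul_assoc]
    exact mul_le_mul_of_nonneg_left e1 (norm_nonneg _)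
  have hA : ∃ C, LipschitzOnWith C (fun t => |h (x t) - h (y t)|) (Icc a b) := by
    refine ⟨⟨L, by linarith⟩ * (C1 + C2), LipschitzOnWith.of_dist_le_mul fun s hs t ht => ?_⟩
    have e1 := hC1.dist_le_mul s hs t ht
    have e2 := hC2.dist_le_mul s hs t ht
    rw [dist_eq_norm] at e1 e2
    rw [Real.dist_eq]
    refine (abs_abs_sub_abs_le_abs_sub _ _).trans ?_
    have e3 := H.lip_h _ (hxK s hs) _ (hxK t ht)
    have e4 := H.lip_h _ (hyK s hs) _ (hyK t ht)
    have e : h (x s) - h (y s) - (h (x t) - h (y t)) =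
      (h (x s) - h (x t)) - (h (y s) - h (y t)) := by ring
    rw [e]
    refine (abs_sub _ _).trans ?_
    change _ ≤ L * (C1 + C2) * dist s t
    have e5 := mul_le_mul_of_nonneg_left e1 (by linarith : 0 ≤ L)
    have e6 := mul_le_mul_of_nonneg_left e2 (by linarith : 0 ≤ L)
    linarith
  obtain ⟨CN, hCN⟩ := hN
  obtain ⟨CA, hCA⟩ := hA
  refine ⟨⟨CN + ‖κ / c‖₊ * CA, hCN.add (LipschitzOnWith.of_dist_le_mul fun s hs t ht => ?_)⟩, ?_⟩
  · have := hCA.dist_le_mul s hs t ht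
    rw [Real.dist_eq] at this ⊢
    rw [← mul_sub, abs_mul]
    push_cast
    rw [mul_assoc, Real.norm_eq_abs]
    exact mul_le_mul_of_nonneg_left this (abs_nonneg _)
  filter_upwards [hx.2, hy.2, ae_differentiableAt_of_lipschitzOnWith_Icc ⟨CN, hCN⟩,
    ae_differentiableAt_of_lipschitzOnWith_Icc ⟨CA, hCA⟩] with t h1 h2 h3 h4 ht d hd
  obtain ⟨vx, hvx, l, hl, hvxl⟩ := h1 ht
  obtain ⟨vy, hvy, m, hm, hvym⟩ := h2 ht
  have hxt := hxK t (Ioo_subset_Icc_self ht)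
  have hyt := hyK t (Ioo_subset_Icc_self ht)
  have hdN := (h3 ht).hasDerivAt
  have hdA := (h4 ht).hasDerivAt
  set dN := deriv (fun t => ‖π (x t - y t) - w‖) t
  set dA := deriv (fun t => |h (x t) - h (y t)|) t
  rw [hd.unique (hdN.add (hdA.const_mul (κ / c)))]
  have hη0 : 0 ≤ η := (norm_nonneg _).trans hvxl
  have hκ0 : 0 ≤ κ := (norm_nonneg _).trans (hκ t (Ioo_subset_Icc_self ht))
  have hhx : HasDerivAt (fun s => h (x s)) (fderiv ℝ h (x t) vx) t :=
    (H.differentiableAt _ hxt).hasFDerivAt.comp_hasDerivAt t hvx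
  have hhy : HasDerivAt (fun s => h (y s)) (fderiv ℝ h (y t) vy) t :=
    (H.differentiableAt _ hyt).hasFDerivAt.comp_hasDerivAt t hvy
  have hA := H.abs_deriv_le hxt hyt hl hm hη hvxl hvym rfl ((hhx.sub hhy).of_abs hdA)
  have hN1 : dN ≤ ‖π (vx - vy)‖ := by
    refine HasDerivAt.abs_le_norm_of_norm (g := fun s => π (x s - y s) - w) ?_ hdN
    exact (π.hasFDerivAt.comp_hasDerivAt t (hvx.sub hvy)).sub_const w
  have hN2 : ‖π (vx - vy)‖ ≤ |l - m| * κ + ‖π‖ * rate L c ρ * (‖x t - y t‖ + η) := by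
    have e : π (vx - vy) = (l - m) • π (Z.X (x t) - Z.Y (x t)) +
        π ((vx - vy) - (l - m) • (Z.X (x t) - Z.Y (x t))) := by
      rw [← map_smul, ← map_add]; congr 1; abel
    rw [e]
    refine (norm_add_le _ _).trans (add_le_add ?_ ?_)
    · rw [norm_smul, Real.norm_eq_abs]
      exact mul_le_mul_of_nonneg_left (hκ t (Ioo_subset_Icc_self ht)) (abs_nonneg _)
    · refine (π.le_opNorm _).trans ?_
      rw [mul_assoc]
      refine mul_le_mul_of_nonneg_left ?_ (norm_nonneg _)
      refine (H.velocity_sub_le hxt hyt hm.1 hvxl hvym).trans ?_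
      have h5 := H.rate_ge
      have h6 : L ≤ rate L c ρ := by nlinarith
      have h7 : 2 ≤ rate L c ρ := by nlinarith
      rw [mul_add]
      gcongr
  have hκc : 0 ≤ κ / c := by positivity
  have e1 : κ / c * dA ≤ κ / c * (-c * |l - m| + rate L c ρ * (‖x t - y t‖ + η)) :=
    mul_le_mul_of_nonneg_left hA hκc
  have e2 : κ / c * (-c * |l - m|) = -(|l - m| * κ) := by field_simp
  rw [mul_add, e2] at e1
  nlinarith

/-- Displacement estimate along a linear map `π` that almost kills the jump `X - Y`. -/
theorem displacement_le (H : Controlled h Z K L c ρ) {F : Type*} [NormedAddCommGroup F]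
    [NormedSpace ℝ F] (π : E3 →L[ℝ] F) {κ η a b B : ℝ} (hη0 : 0 ≤ η) (hη : η ≤ 1) (hab : a ≤ b)
    {x y : ℝ → E3}
    (hx : Follows h Z η a b x) (hy : Follows h Z η a b y)
    (hxK : ∀ t ∈ Icc a b, x t ∈ K) (hyK : ∀ t ∈ Icc a b, y t ∈ K)
    (hκ : ∀ t ∈ Icc a b, ‖π (Z.X (x t) - Z.Y (x t))‖ ≤ κ)
    (hB : ∀ t ∈ Icc a b, ‖x t - y t‖ ≤ B) :
    ‖π (x b - y b) - π (x a - y a)‖ ≤ κ / c * |h (x a) - h (y a)| +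
      (‖π‖ + κ / c) * rate L c ρ * (B + η) * (b - a) := by
  obtain ⟨⟨C, hC⟩, hd⟩ := H.deriv_norm_add_le π (π (x a - y a)) hη hx hy hxK hyK hκ
  have hc := H.c_pos
  have hr := H.rate_pos
  have hκ0 : 0 ≤ κ := (norm_nonneg _).trans (hκ a (left_mem_Icc.mpr hab))
  have hB0 : 0 ≤ B := (norm_nonneg _).trans (hB a (left_mem_Icc.mpr hab))
  set E := (‖π‖ + κ / c) * rate L c ρ * (B + η) with hE
  have hE0 : 0 ≤ E := by positivity
  have := le_exp_mul_of_ae_hasDerivAt hab le_rfl hE0 ⟨C, hC⟩ (by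
    filter_upwards [hd] with t ht htab d hdd
    refine (ht htab d hdd).trans ?_
    rw [zero_mul, zero_add]
    have := hB t (Ioo_subset_Icc_self htab)
    have h0 : 0 ≤ (‖π‖ + κ / c) * rate L c ρ := by positivity
    exact mul_le_mul_of_nonneg_left (by linarith) h0)
  simp only [zero_mul, Real.exp_zero, one_mul, sub_self, norm_zero, zero_add] at this
  have h0 : 0 ≤ κ / c * |h (x b) - h (y b)| := by positivity
  linarith

/-- The Lipschitz constant of the forward flow over a time `T`. -/
noncomputable def flowConst (L c ρ T : ℝ) : ℝ :=
  Real.exp ((1 + 2 * L / c) * rate L c ρ * T) *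
    (1 + 2 * L / c * L + (1 + 2 * L / c) * rate L c ρ * T)

theorem flowConst_mono (H : Controlled h Z K L c ρ) {T T' : ℝ} (h0 : 0 ≤ T) (hT : T ≤ T') :
    flowConst L c ρ T ≤ flowConst L c ρ T' := by
  have := H.one_le; have := H.c_pos; have := H.rate_pos
  unfold flowConst
  gcongr

theorem one_le_flowConst (H : Controlled h Z K L c ρ) {T : ℝ} (h0 : 0 ≤ T) :
    1 ≤ flowConst L c ρ T := by
  refine le_trans ?_ (H.flowConst_mono le_rfl h0)
  have := H.one_le; have := H.c_pos
  have : 0 ≤ 2 * L / c * L := by positivity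
  simp only [flowConst, mul_zero, Real.exp_zero]
  linarith

/-- Forward stability of Filippov trajectories. -/
theorem norm_sub_le (H : Controlled h Z K L c ρ) {η a b : ℝ} (hη0 : 0 ≤ η) (hη : η ≤ 1)
    (hab : a ≤ b) {x y : ℝ → E3}
    (hx : Follows h Z η a b x) (hy : Follows h Z η a b y)
    (hxK : ∀ t ∈ Icc a b, x t ∈ K) (hyK : ∀ t ∈ Icc a b, y t ∈ K) :
    ‖x b - y b‖ ≤ flowConst L c ρ (b - a) * (‖x a - y a‖ + η) := by
  have hL := H.one_le
  have hc := H.c_pos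
  have hr := H.rate_pos
  obtain ⟨⟨C, hC⟩, hd⟩ := H.deriv_norm_add_le (ContinuousLinearMap.id ℝ E3) 0 hη hx hy hxK hyK
    (κ := 2 * L) (fun t ht => by
      have := _root_.norm_sub_le (Z.X (x t)) (Z.Y (x t))
      have := H.X_le _ (hxK t ht)
      have := H.Y_le _ (hxK t ht)
      simp only [ContinuousLinearMap.coe_id', id_eq]
      linarith)
  have hid : ‖ContinuousLinearMap.id ℝ E3‖ ≤ 1 := ContinuousLinearMap.norm_id_le
  simp only [ContinuousLinearMap.coe_id', id_eq, sub_zero] at hC hd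
  set R := (1 + 2 * L / c) * rate L c ρ with hR
  have hR0 : 0 ≤ R := by positivity
  have := le_exp_mul_of_ae_hasDerivAt hab hR0 (mul_nonneg hR0 hη0) ⟨C, hC⟩ (by
    filter_upwards [hd] with t ht htab d hdd
    refine (ht htab d hdd).trans ?_
    rw [← mul_add]
    have h0 : 0 ≤ 2 * L / c * |h (x t) - h (y t)| := by positivity
    calc _ ≤ R * (‖x t - y t‖ + η) := by rw [hR]; gcongr
      _ ≤ _ := by gcongr; linarith)
  have ha := left_mem_Icc.mpr hab
  have h1 := H.lip_h _ (hxK a ha) _ (hyK a ha)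
  have h2 : 2 * L / c * |h (x a) - h (y a)| ≤ 2 * L / c * (L * ‖x a - y a‖) := by gcongr
  have h3 : 0 ≤ 2 * L / c * |h (x b) - h (y b)| := by positivity
  have hba : 0 ≤ b - a := sub_nonneg.mpr hab
  have h4 : 0 ≤ 2 * L / c * L := by positivity
  calc ‖x b - y b‖ ≤ Real.exp (R * (b - a)) * (‖x a - y a‖ + 2 * L / c * |h (x a) - h (y a)|
        + R * η * (b - a)) := by linarith
    _ ≤ Real.exp (R * (b - a)) * ((1 + 2 * L / c * L + R * (b - a)) * (‖x a - y a‖ + η)) := by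
      refine mul_le_mul_of_nonneg_left ?_ (Real.exp_pos _).le
      have h5 : 0 ≤ R * (b - a) * ‖x a - y a‖ := by positivity
      nlinarith
    _ = _ := by rw [flowConst, ← hR]; ring

end Controlled

end PWField

namespace PWField

/-! ### Existence and closure of Filippov trajectories -/

theorem admissible_eventually {h : E3 → ℝ} {x : E3} (hc : ContinuousAt h x) :
    ∀ᶠ z in 𝓝 x, ∀ l, Admissible h z l → Admissible h x l := by
  rcases lt_trichotomy (h x) 0 with h0 | h0 | h0
  · filter_upwards [hc.eventually_lt continuousAt_const h0] with z hz l hl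
    exact ⟨hl.1, fun h => absurd h0 h.not_gt, fun _ => hl.2.2 hz⟩
  · exact Eventually.of_forall fun z l hl =>
      ⟨hl.1, fun h => absurd h0 h.ne', fun h => absurd h0 h.ne⟩
  · filter_upwards [continuousAt_const.eventually_lt hc h0] with z hz l hl
    exact ⟨hl.1, fun _ => hl.2.1 hz, fun h => absurd h0 h.not_gt⟩

theorem isCompact_convex_blend (h : E3 → ℝ) (Z : PWField) (x : E3) :
    IsCompact ((fun l => blend Z l x) '' {l | Admissible h x l}) ∧
      Convex ℝ ((fun l => blend Z l x) '' {l | Admissible h x l}) := by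
  constructor
  · refine IsCompact.image ?_ (by unfold blend; fun_prop)
    refine isCompact_Icc.of_isClosed_subset ?_ (fun l hl => hl.1 : _ ⊆ Icc (0 : ℝ) 1)
    have : {l | Admissible h x l} = Icc (0 : ℝ) 1 ∩ ({l | 0 < h x → l = 1} ∩ {l | h x < 0 → l = 0}) :=
      rfl
    rw [this]
    refine isClosed_Icc.inter (IsClosed.inter ?_ ?_)
    · by_cases h0 : 0 < h x <;> simp [h0]
    · by_cases h0 : h x < 0 <;> simp [h0]
  · rintro _ ⟨l, hl, rfl⟩ _ ⟨m, hm, rfl⟩ a b ha hb hab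
    refine ⟨a * l + b * m, ⟨?_, fun h0 => ?_, fun h0 => ?_⟩, ?_⟩
    · exact (convex_Icc (0 : ℝ) 1) hl.1 hm.1 ha hb hab
    · rw [hl.2.1 h0, hm.2.1 h0]; linarith
    · rw [hl.2.2 h0, hm.2.2 h0]; ring
    · simp only [blend]
      have : 1 - (a * l + b * m) = a * (1 - l) + b * (1 - m) := by linear_combination -hab
      rw [this]
      module

/-- The velocity of a limit of approximate Filippov trajectories is admissible. -/
theorem velocity_of_tendsto {h : E3 → ℝ} {Z : PWField} {K : Set E3} {F : Filter ℕ} [F.NeBot]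
    (hh : ContinuousOn h K) (hX : ContinuousOn Z.X K) (hY : ContinuousOn Z.Y K)
    {M : NNReal} {a b : ℝ} {γn : ℕ → ℝ → E3} {γ : ℝ → E3} {ε : ℕ → ℝ}
    (hlip : ∀ n, LipschitzWith M (γn n)) (hlim : ∀ t, Tendsto (fun n => γn n t) F (𝓝 (γ t)))
    (hε : Tendsto ε F (𝓝 0))
    (hγn : ∀ n, ∀ᵐ s, s ∈ Ioo a b → ∃ v z l, HasDerivAt (γn n) v s ∧ ‖z - γn n s‖ ≤ ε n ∧
      (z ∈ K → Admissible h z l ∧ v = blend Z l z))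
    {t : ℝ} (ht : t ∈ Ioo a b) (htK : γ t ∈ interior K) {v : E3} (hv : HasDerivAt γ v t) :
    ∃ l, Admissible h (γ t) l ∧ v = blend Z l (γ t) := by
  set x := γ t with hx
  have hKn : K ∈ 𝓝 x := mem_interior_iff_mem_nhds.mp htK
  set S := (fun l => blend Z l x) '' {l | Admissible h x l} with hS
  obtain ⟨hSc, hSx⟩ := isCompact_convex_blend h Z x
  suffices hsuff : ∀ e > 0, v ∈ Metric.cthickening e S by
    have : v ∈ closure S := by
      rw [Metric.closure_eq_iInter_cthickening]
      exact mem_iInter₂.mpr hsuff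
    rw [hSc.isClosed.closure_eq] at this
    obtain ⟨l, hl, hlv⟩ := this
    exact ⟨l, hl, hlv.symm⟩
  intro e he
  have hXx := hX.continuousAt hKn
  have hYx := hY.continuousAt hKn
  have hnear : ∀ᶠ z in 𝓝 x, z ∈ K ∧ ∀ l, Admissible h z l → blend Z l z ∈ Metric.cthickening e S := by
    filter_upwards [hKn, admissible_eventually (hh.continuousAt hKn),
      Metric.continuousAt_iff'.mp hXx e he, Metric.continuousAt_iff'.mp hYx e he] with z h0 h1 h2 h3
    refine ⟨h0, fun l hl => ?_⟩
    refine Metric.mem_cthickening_of_dist_le _ (blend Z l x) _ _ ⟨l, h1 l hl, rfl⟩ ?_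
    rw [dist_eq_norm] at h2 h3 ⊢
    have e1 : blend Z l z - blend Z l x = l • (Z.X z - Z.X x) + (1 - l) • (Z.Y z - Z.Y x) := by
      simp only [blend]; module
    rw [e1]
    refine (norm_add_le _ _).trans ?_
    have hl1 := hl.1.1
    have hl2 : 0 ≤ 1 - l := sub_nonneg.mpr hl.1.2
    rw [norm_smul, norm_smul, Real.norm_of_nonneg hl1, Real.norm_of_nonneg hl2]
    nlinarith
  obtain ⟨r, hr, hball⟩ := Metric.eventually_nhds_iff.mp hnear
  have hclosed : IsClosed (Metric.cthickening e S) := Metric.isClosed_cthickening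
  have hconv : Convex ℝ (Metric.cthickening e S) := hSx.cthickening e
  -- difference quotients over short intervals
  have hquot : ∀ᶠ s in 𝓝[>] (0 : ℝ), s⁻¹ • (γ (t + s) - γ t) ∈ Metric.cthickening e S := by
    have h1 : ∀ᶠ s in 𝓝[>] (0 : ℝ), t + s < b := by
      have : ContinuousAt (fun s : ℝ => t + s) 0 := by fun_prop
      exact (this.eventually_lt continuousAt_const (by simpa using ht.2)).filter_mono
        nhdsWithin_le_nhds
    have h2 : ∀ᶠ s in 𝓝[>] (0 : ℝ), M * s < r / 3 := by
      have : ContinuousAt (fun s : ℝ => M * s) 0 := by fun_prop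
      exact (this.eventually_lt continuousAt_const (by simpa using by positivity)).filter_mono
        nhdsWithin_le_nhds
    filter_upwards [h1, h2, self_mem_nhdsWithin] with s hs1 hs2 hs3
    have hs3 : 0 < s := hs3
    have hq : Tendsto (fun n => s⁻¹ • (γn n (t + s) - γn n t)) F (𝓝 (s⁻¹ • (γ (t + s) - γ t))) :=
      ((hlim _).sub (hlim _)).const_smul _
    refine hclosed.mem_of_tendsto hq ?_
    filter_upwards [Metric.tendsto_nhds.mp (hlim t) (r / 3) (by positivity),
      hε.eventually_lt_const (show (0 : ℝ) < r / 3 by positivity)] with n hn1 hn2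
    have := slope_mem_of_ae_hasDerivAt (g := γn n) (a := t) (b := t + s)
      (S := Metric.cthickening e S) (by linarith) ⟨M, (hlip n).lipschitzOnWith⟩ hconv hclosed (by
        filter_upwards [hγn n] with τ hτ hτt
        obtain ⟨v', z, l, hv', hz, hzl⟩ := hτ ⟨ht.1.trans hτt.1, hτt.2.trans hs1⟩
        have hd1 : dist (γn n τ) (γn n t) < r / 3 := by
          refine ((hlip n).dist_le_mul _ _).trans_lt (lt_of_le_of_lt ?_ hs2)
          refine mul_le_mul_of_nonneg_left ?_ M.2
          rw [Real.dist_eq, abs_of_pos (by linarith [hτt.1])]; linarith [hτt.2]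
        have hd2 : dist z x < r := by
          rw [← dist_eq_norm] at hz
          have := dist_triangle4 z (γn n τ) (γn n t) x
          linarith
        obtain ⟨hzK, hb⟩ := hball hd2
        obtain ⟨hl, rfl⟩ := hzl hzK
        exact ⟨_, hb l hl, hv'⟩)
    rwa [add_sub_cancel_left] at this
  exact hclosed.mem_of_tendsto hv.tendsto_slope_zero_right hquot

theorem exists_euler {f : E3 → E3} {M : NNReal} (hf : ∀ x, ‖f x‖ ≤ M) (x₀ : E3) (n : ℕ) :
    ∃ γ : ℝ → E3, LipschitzWith M γ ∧ γ 0 = x₀ ∧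
      ∀ᵐ s, 0 < s → ∃ z, HasDerivAt γ (f z) s ∧ ‖z - γ s‖ ≤ M * (1 / ((n : ℝ) + 1)) := by
  set N : ℝ := (n : ℝ) + 1 with hN
  have hN0 : 0 < N := by positivity
  set z : ℕ → E3 := fun k => Nat.rec x₀ (fun _ y => y + (1 / N) • f y) k with hz
  have hz1 : ∀ k, z (k + 1) = z k + (1 / N) • f (z k) := fun k => rfl
  set g : ℝ → E3 := fun s => f (z ⌊N * s⌋₊) with hg
  have hgm : Measurable g :=
    (measurable_from_nat (f := fun k => f (z k))).comp
      (Nat.measurable_floor.comp (measurable_const_mul N))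
  have hgi : ∀ a b : ℝ, IntervalIntegrable g volume a b := fun a b =>
    (intervalIntegrable_const (c := (M : ℝ))).mono_fun hgm.aestronglyMeasurable
      (Eventually.of_forall fun s => by simpa using (hf _).trans (le_abs_self _))
  set γ : ℝ → E3 := fun t => x₀ + ∫ s in (0 : ℝ)..t, g s with hγ
  have hlip : LipschitzWith M γ := by
    refine LipschitzWith.of_dist_le_mul fun t u => ?_
    rw [dist_eq_norm, hγ]
    simp only [add_sub_add_left_eq_sub]
    rw [intervalIntegral.integral_interval_sub_left (hgi _ _) (hgi _ _), Real.dist_eq]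
    exact intervalIntegral.norm_integral_le_of_norm_le_const fun s _ => hf _
  have hcell : ∀ k : ℕ, ∀ s : ℝ, s ∈ Ioo (k / N) ((k + 1) / N) → ⌊N * s⌋₊ = k := by
    intro k s hs
    have h1 : (k : ℝ) < N * s := by rw [mul_comm]; exact (div_lt_iff₀ hN0).mp hs.1
    have h2 : N * s < k + 1 := by rw [mul_comm]; exact (lt_div_iff₀ hN0).mp hs.2
    exact (Nat.floor_eq_iff ((Nat.cast_nonneg k).trans h1.le)).mpr ⟨h1.le, h2⟩
  have hgrid : ∀ k : ℕ, γ (k / N) = z k := by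
    intro k
    induction k with
    | zero => simp [hγ, hz]
    | succ k ih =>
      have hle : (k : ℝ) / N ≤ (k + 1) / N := by gcongr; linarith
      have : ∫ s in (k / N : ℝ)..((k + 1) / N), g s = (1 / N) • f (z k) := by
        rw [intervalIntegral.integral_of_le hle, integral_Ioc_eq_integral_Ioo,
          setIntegral_congr_fun (g := fun _ => f (z k)) measurableSet_Ioo
            (fun s hs => by simp only [hg]; rw [hcell k s hs])]
        rw [setIntegral_const, Real.volume_real_Ioo_of_le hle]
        congr 1; ring
      rw [hz1, ← this, ← ih, hγ]
      simp only [Nat.cast_add, Nat.cast_one]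
      rw [add_assoc, intervalIntegral.integral_add_adjacent_intervals (hgi _ _) (hgi _ _)]
  refine ⟨γ, hlip, by simp [hγ], ?_⟩
  have hcount : (range fun k : ℕ => (k : ℝ) / N).Countable := countable_range _
  have hnull : ∀ᵐ s : ℝ, s ∉ range fun k : ℕ => (k : ℝ) / N :=
    measure_eq_zero_iff_ae_notMem.mp (hcount.measure_zero volume)
  filter_upwards [hnull] with s hs hs0
  set k := ⌊N * s⌋₊ with hk
  have hNs : 0 ≤ N * s := by positivity
  have h1 : (k : ℝ) / N < s := by
    refine lt_of_le_of_ne ?_ (fun h => hs ⟨k, h⟩)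
    rw [div_le_iff₀ hN0, mul_comm]
    exact Nat.floor_le hNs
  have h2 : s < (k + 1) / N := by
    rw [lt_div_iff₀ hN0, mul_comm]
    exact Nat.lt_floor_add_one _
  refine ⟨z k, ?_, ?_⟩
  · have hcont : ∀ᶠ u in 𝓝 s, g u = f (z k) := by
      filter_upwards [Ioo_mem_nhds h1 h2] with u hu
      simp only [hg]; rw [hcell k u hu]
    have hga : ContinuousAt g s := (continuousAt_const (y := f (z k))).congr
      (hcont.mono fun u hu => hu.symm)
    have := intervalIntegral.integral_hasDerivAt_right (hgi 0 s)
      (hgm.stronglyMeasurable.stronglyMeasurableAtFilter) hga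
    rw [hcont.self_of_nhds] at this
    exact this.const_add x₀
  · rw [← hgrid k, ← dist_eq_norm]
    refine (hlip.dist_le_mul _ _).trans (mul_le_mul_of_nonneg_left ?_ M.2)
    rw [Real.dist_eq, abs_of_neg (by linarith)]
    have : ((k : ℝ) + 1) / N = k / N + 1 / N := by ring
    linarith

/-- Pointwise limits along an ultrafilter of uniformly Lipschitz curves that are bounded at one
time. -/
theorem exists_ultralimit {M : NNReal} {γn : ℕ → ℝ → E3} (hlip : ∀ n, LipschitzWith M (γn n))
    (F : Ultrafilter ℕ) {K : Set E3} (hK : IsCompact K) (h0 : ∀ n, γn n 0 ∈ K) :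
    ∃ γ : ℝ → E3, LipschitzWith M γ ∧ ∀ t, Tendsto (fun n => γn n t) F (𝓝 (γ t)) := by
  have hex : ∀ t, ∃ x, Tendsto (fun n => γn n t) F (𝓝 x) := by
    intro t
    have hcomp : IsCompact (Metric.cthickening (M * |t|) K) := hK.cthickening
    obtain ⟨x, -, hx⟩ := hcomp.ultrafilter_le_nhds (F.map fun n => γn n t) (by
      rw [Ultrafilter.coe_map]
      refine tendsto_principal.mpr (Eventually.of_forall fun n => ?_)
      refine Metric.mem_cthickening_of_dist_le _ (γn n 0) _ _ (h0 n) ?_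
      simpa [Real.dist_eq] using (hlip n).dist_le_mul t 0)
    exact ⟨x, hx⟩
  choose γ hγ using hex
  refine ⟨γ, LipschitzWith.of_dist_le_mul fun t u => ?_, hγ⟩
  exact le_of_tendsto ((hγ t).dist (hγ u)) (Eventually.of_forall fun n => (hlip n).dist_le_mul t u)

/-- Peano's theorem for Filippov systems. -/
theorem exists_trajectory {h : E3 → ℝ} {Z : PWField} {K : Set E3} {M : NNReal}
    (hh : ContinuousOn h K) (hX : ContinuousOn Z.X K) (hY : ContinuousOn Z.Y K)
    (hXM : ∀ x ∈ K, ‖Z.X x‖ ≤ M) (hYM : ∀ x ∈ K, ‖Z.Y x‖ ≤ M) (x₀ : E3) :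
    ∃ γ : ℝ → E3, LipschitzWith M γ ∧ γ 0 = x₀ ∧
      ∀ᵐ t, 0 < t → γ t ∈ interior K →
        ∃ v, HasDerivAt γ v t ∧ ∃ l, Admissible h (γ t) l ∧ v = blend Z l (γ t) := by
  classical
  set w : E3 → ℝ := fun x => if 0 ≤ h x then 1 else 0 with hw
  set f : E3 → E3 := fun x => if x ∈ K then blend Z (w x) x else 0 with hf
  have hadm : ∀ x, Admissible h x (w x) := by
    intro x
    by_cases h0 : 0 ≤ h x
    · simp [hw, h0, Admissible, not_lt.mpr h0]
    · simp [hw, h0, Admissible, not_le.mp h0, not_lt.mpr (not_le.mp h0).le]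
  have hfM : ∀ x, ‖f x‖ ≤ M := by
    intro x
    by_cases hx : x ∈ K
    · by_cases h0 : 0 ≤ h x
      · simpa [hf, hx, hw, h0, blend] using hXM x hx
      · simpa [hf, hx, hw, h0, blend] using hYM x hx
    · simp [hf, hx]
  choose γn hlip h0 hder using fun n => exists_euler hfM x₀ n
  obtain ⟨γ, hγ, hlim⟩ := exists_ultralimit hlip (hyperfilter ℕ) (isCompact_singleton (x := x₀))
    (fun n => h0 n)
  refine ⟨γ, hγ, ?_, ?_⟩
  · exact tendsto_nhds_unique (hlim 0) (by simp only [h0]; exact tendsto_const_nhds)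
  filter_upwards [hγ.ae_differentiableAt_real] with t ht ht0 htK
  refine ⟨_, ht.hasDerivAt, ?_⟩
  refine velocity_of_tendsto (F := (hyperfilter ℕ : Filter ℕ)) hh hX hY (a := 0) (b := t + 1)
    (ε := fun n => M * (1 / ((n : ℝ) + 1))) hlip hlim ?_ ?_ ⟨ht0, by linarith⟩ htK ht.hasDerivAt
  · have := (tendsto_one_div_add_atTop_nhds_zero_nat (𝕜 := ℝ)).const_mul (M : ℝ)
    rw [mul_zero] at this
    exact this.mono_left Nat.hyperfilter_le_atTop
  · intro n
    filter_upwards [hder n] with s hs hs0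
    obtain ⟨z, hz, hzs⟩ := hs hs0.1
    exact ⟨_, z, w z, hz, hzs, fun hzK => ⟨hadm z, by simp [hf, hzK]⟩⟩

theorem forall_mem_Icc_of_first_exit {X : Type*} [TopologicalSpace X] {γ : ℝ → X} {a b : ℝ}
    {O : Set X} (hO : IsOpen O) (hγ : ContinuousOn γ (Icc a b))
    (H : ∀ t ∈ Icc a b, (∀ s ∈ Ico a t, γ s ∈ O) → γ t ∈ O) : ∀ t ∈ Icc a b, γ t ∈ O := by
  by_contra! hcon
  obtain ⟨t, ht, htO⟩ := hcon
  have hcomp : IsCompact (Icc a b ∩ γ ⁻¹' Oᶜ) :=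
    isCompact_Icc.of_isClosed_subset
      (hγ.preimage_isClosed_of_isClosed isClosed_Icc hO.isClosed_compl) inter_subset_left
  obtain ⟨m, hm, hmin⟩ := hcomp.exists_isLeast ⟨t, ht, htO⟩
  refine hm.2 (H m hm.1 fun s hs => ?_)
  by_contra hsO
  exact absurd (hmin ⟨⟨hs.1, hs.2.le.trans hm.1.2⟩, hsO⟩) (not_le.mpr hs.2)

/-- A trajectory of a system close to `Z`, starting close to a given trajectory of `Z`, exists as
long as the latter and stays close to it. -/
theorem Controlled.exists_shadow {h : E3 → ℝ} {Z Z' : PWField} {K : Set E3} {L c ρ : ℝ}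
    (H : Controlled h Z K L c ρ) (hK : IsClosed K) {η a b r : ℝ} (hη0 : 0 ≤ η) (hη : η ≤ 1)
    (hab : a ≤ b)
    (hX' : ContinuousOn Z'.X K) (hY' : ContinuousOn Z'.Y K)
    (hX : ∀ x ∈ K, ‖Z'.X x - Z.X x‖ ≤ η) (hY : ∀ x ∈ K, ‖Z'.Y x - Z.Y x‖ ≤ η)
    {x : ℝ → E3} (hx : Follows h Z 0 a b x)
    (hr : ∀ t ∈ Icc a b, Metric.closedBall (x t) r ⊆ interior K) {x₀ : E3}
    (hx₀ : flowConst L c ρ (b - a) * (‖x₀ - x a‖ + η) ≤ r) :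
    ∃ γ : ℝ → E3, γ a = x₀ ∧ Follows h Z' 0 a b γ ∧
      (∃ M, LipschitzWith M γ) ∧
      ∀ t ∈ Icc a b, γ t ∈ interior K ∧
        ‖γ t - x t‖ ≤ flowConst L c ρ (b - a) * (‖x₀ - x a‖ + η) := by
  have hhK : ContinuousOn h K := fun y hy => (H.differentiableAt y hy).continuousAt.continuousWithinAt
  have hL := H.one_le
  have hr0 : 0 ≤ r := by
    have := H.one_le_flowConst (sub_nonneg.mpr hab)
    exact le_trans (by positivity) hx₀
  obtain ⟨γ₁, hlip, h0, hder⟩ := exists_trajectory (M := ⟨L + 1, by linarith⟩) hhK hX' hY'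
    (fun y hy => by
      have := norm_sub_norm_le (Z'.X y) (Z.X y)
      have := hX y hy
      have := H.X_le y hy
      change _ ≤ L + 1
      linarith)
    (fun y hy => by
      have := norm_sub_norm_le (Z'.Y y) (Z.Y y)
      have := hY y hy
      have := H.Y_le y hy
      change _ ≤ L + 1
      linarith) x₀
  set γ : ℝ → E3 := fun t => γ₁ (t - a) with hγ
  have hγlip : LipschitzWith ⟨L + 1, by linarith⟩ γ := by
    refine LipschitzWith.of_dist_le_mul fun s t => ?_
    have := hlip.dist_le_mul (s - a) (t - a)
    rwa [dist_sub_right] at this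
  have hγa : γ a = x₀ := by simp [hγ, h0]
  have hγder : ∀ᵐ t, a < t → γ t ∈ interior K →
      ∃ v, HasDerivAt γ v t ∧ ∃ l, Admissible h (γ t) l ∧ v = blend Z' l (γ t) := by
    have := (measurePreserving_sub_right volume a).quasiMeasurePreserving.ae hder
    filter_upwards [this] with t ht hat htK
    obtain ⟨v, hv, l, hl⟩ := ht (sub_pos.mpr hat) htK
    exact ⟨v, HasDerivAt.comp_sub_const t a hv, l, hl⟩
  have hfollow : ∀ t ∈ Icc a b, (∀ s ∈ Ico a t, γ s ∈ interior K) → Follows h Z' 0 a t γ := by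
    intro t ht hts
    refine ⟨hγlip.locallyLipschitz, ?_⟩
    filter_upwards [hγder] with s hs hsat
    obtain ⟨v, hv, l, hl, hlv⟩ := hs hsat.1 (hts s (Ioo_subset_Ico_self hsat))
    exact ⟨v, hv, l, hl, by simp [hlv]⟩
  have hclose : ∀ t ∈ Icc a b, (∀ s ∈ Ico a t, γ s ∈ interior K) →
      ‖γ t - x t‖ ≤ flowConst L c ρ (b - a) * (‖x₀ - x a‖ + η) := by
    intro t ht hts
    have hxK : ∀ s ∈ Icc a b, x s ∈ K := fun s hs =>
      interior_subset (hr s hs (Metric.mem_closedBall_self hr0))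
    rcases eq_or_lt_of_le ht.1 with hat | hat
    · subst hat
      rw [hγa]
      have := H.one_le_flowConst (sub_nonneg.mpr hab)
      nlinarith [norm_nonneg (x₀ - x a)]
    have hKt : ∀ s ∈ Icc a t, γ s ∈ K := by
      intro s hs
      have hcl : s ∈ closure (Ico a t) := by rw [closure_Ico hat.ne]; exact hs
      have : γ s ∈ closure K :=
        (hγlip.continuous.continuousAt.continuousWithinAt).mem_closure hcl
          (fun u hu => interior_subset (hts u hu))
      rwa [hK.closure_eq] at this
    have hF := hfollow t ht hts
    have := H.norm_sub_le hη0 hη ht.1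
      ((hF.change (δ := η) (fun s hs => hX _ (hKt s (Ioo_subset_Icc_self hs)))
        (fun s hs => hY _ (hKt s (Ioo_subset_Icc_self hs)))).mono (by simp) le_rfl le_rfl)
      (hx.mono hη0 le_rfl ht.2) hKt (fun s hs => hxK s ⟨hs.1, hs.2.trans ht.2⟩)
    rw [hγa] at this
    refine this.trans (mul_le_mul_of_nonneg_right ?_ (by positivity))
    exact H.flowConst_mono (sub_nonneg.mpr ht.1) (by linarith [ht.2])
  have hin := forall_mem_Icc_of_first_exit isOpen_interior hγlip.continuous.continuousOn
    (fun t ht hts => hr t ht (by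
      rw [Metric.mem_closedBall, dist_eq_norm]
      exact (hclose t ht hts).trans hx₀))
  exact ⟨γ, hγa, hfollow b (right_mem_Icc.mpr hab) (fun s hs => hin s (Ico_subset_Icc_self hs)),
    ⟨_, hγlip⟩, fun t ht => ⟨hin t ht, hclose t ht (fun s hs => hin s ⟨hs.1, hs.2.le.trans ht.2⟩)⟩⟩

end PWField

theorem LipschitzOnWith.lipschitzWith_of_Iic_Ici {X : Type*} [PseudoMetricSpace X] {C : NNReal}
    {f : ℝ → X} {a : ℝ} (h1 : LipschitzOnWith C f (Iic a)) (h2 : LipschitzOnWith C f (Ici a)) :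
    LipschitzWith C f := by
  have key : ∀ x y, x ≤ y → dist (f x) (f y) ≤ C * dist x y := by
    intro x y hxy
    rcases le_total y a with h | h
    · exact h1.dist_le_mul x (hxy.trans h) y h
    rcases le_total a x with h' | h'
    · exact h2.dist_le_mul x h' y h
    have e1 := h1.dist_le_mul x h' a self_mem_Iic
    have e2 := h2.dist_le_mul a self_mem_Ici y h
    rw [Real.dist_eq, abs_of_nonpos (by linarith)] at e1 e2 ⊢
    refine (dist_triangle _ (f a) _).trans ?_
    linarith
  refine LipschitzWith.of_dist_le_mul fun x y => ?_
  rcases le_total x y with h | h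
  · exact key x y h
  · rw [dist_comm, dist_comm x]; exact key y x h

namespace PWField

theorem continuousOn_fderiv {U : Set E3} {h : E3 → ℝ} (hU : IsOpen U) (hh : ContDiffOn ℝ 2 h U) :
    ContinuousOn (fderiv ℝ h) U :=
  hh.continuousOn_fderiv_of_isOpen hU (by norm_num)

theorem continuousOn_lieDeriv {U : Set E3} {h : E3 → ℝ} {X : E3 → E3} (hU : IsOpen U)
    (hh : ContDiffOn ℝ 2 h U) (hX : ContinuousOn X U) : ContinuousOn (lieDeriv X h) U :=
  (continuousOn_fderiv hU hh).clm_apply hX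

theorem slidingField_eq_blend {h : E3 → ℝ} {Z : PWField} {x : E3}
    (hx : lieDeriv Z.Y h x - lieDeriv Z.X h x ≠ 0) :
    slidingField h Z x =
      blend Z (lieDeriv Z.Y h x / (lieDeriv Z.Y h x - lieDeriv Z.X h x)) x := by
  have e : 1 - lieDeriv Z.Y h x / (lieDeriv Z.Y h x - lieDeriv Z.X h x) =
      -(lieDeriv Z.X h x / (lieDeriv Z.Y h x - lieDeriv Z.X h x)) := by
    field_simp; ring
  rw [slidingField, blend, e, smul_sub, smul_smul, smul_smul, neg_smul, ← sub_eq_add_neg,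
    inv_mul_eq_div, inv_mul_eq_div]

theorem fderiv_slidingField {h : E3 → ℝ} {Z : PWField} (x : E3) :
    fderiv ℝ h x (slidingField h Z x) = 0 := by
  simp only [slidingField, map_smul, map_sub, smul_eq_mul]
  change _ * (lieDeriv Z.Y h x * lieDeriv Z.X h x - lieDeriv Z.X h x * lieDeriv Z.Y h x) = 0
  ring

theorem continuousOn_slidingField {U : Set E3} {h : E3 → ℝ} {Z : PWField} (hU : IsOpen U)
    (hh : ContDiffOn ℝ 2 h U) (hX : ContinuousOn Z.X U) (hY : ContinuousOn Z.Y U) :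
    ContinuousOn (slidingField h Z) {x ∈ U | lieDeriv Z.Y h x - lieDeriv Z.X h x ≠ 0} := by
  have h1 := (continuousOn_lieDeriv hU hh hX).mono (sep_subset U
    (fun x => lieDeriv Z.Y h x - lieDeriv Z.X h x ≠ 0))
  have h2 := (continuousOn_lieDeriv hU hh hY).mono (sep_subset U
    (fun x => lieDeriv Z.Y h x - lieDeriv Z.X h x ≠ 0))
  have h3 := hX.mono (sep_subset U (fun x => lieDeriv Z.Y h x - lieDeriv Z.X h x ≠ 0))
  have h4 := hY.mono (sep_subset U (fun x => lieDeriv Z.Y h x - lieDeriv Z.X h x ≠ 0))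
  exact ((h2.sub h1).inv₀ fun x hx => hx.2).smul ((h2.smul h3).sub (h1.smul h4))

theorem slidingField_of_lieDeriv_eq_zero {h : E3 → ℝ} {Z : PWField} {x : E3}
    (h1 : lieDeriv Z.X h x = 0) (h2 : lieDeriv Z.Y h x ≠ 0) : slidingField h Z x = Z.X x := by
  simp [slidingField, h1, smul_smul, h2]

/-- On a compact set where the jump is transversal to the switching surface, the system is
quantitatively controlled. -/
theorem exists_controlled {U : Set E3} {h : E3 → ℝ} {Z : PWField} (hU : IsOpen U)
    (hh : ContDiffOn ℝ 2 h U) (hX : LocallyLipschitzOn U Z.X) (hY : LocallyLipschitzOn U Z.Y)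
    {K : Set E3} (hK : IsCompact K) (hKU : K ⊆ U)
    (hgap : ∀ x ∈ K, h x = 0 → 0 < lieDeriv Z.Y h x - lieDeriv Z.X h x) :
    ∃ L c ρ, Controlled h Z K L c ρ := by
  have hdh : LocallyLipschitzOn U (fderiv ℝ h) := by
    intro x hx
    have h1 : ContDiffAt ℝ 1 (fderiv ℝ h) x :=
      (hh.contDiffAt (hU.mem_nhds hx)).fderiv_right (by norm_num)
    obtain ⟨C, t, ht, hC⟩ := h1.exists_lipschitzOnWith
    exact ⟨C, t, mem_nhdsWithin_of_mem_nhds ht, hC⟩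
  have hhl : LocallyLipschitzOn U h := by
    intro x hx
    have h1 : ContDiffAt ℝ 1 h x := (hh.contDiffAt (hU.mem_nhds hx)).of_le (by norm_num)
    obtain ⟨C, t, ht, hC⟩ := h1.exists_lipschitzOnWith
    exact ⟨C, t, mem_nhdsWithin_of_mem_nhds ht, hC⟩
  obtain ⟨C1, hC1⟩ := (hX.mono hKU).exists_lipschitzOnWith_of_compact hK
  obtain ⟨C2, hC2⟩ := (hY.mono hKU).exists_lipschitzOnWith_of_compact hK
  obtain ⟨C3, hC3⟩ := (hhl.mono hKU).exists_lipschitzOnWith_of_compact hK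
  obtain ⟨C4, hC4⟩ := (hdh.mono hKU).exists_lipschitzOnWith_of_compact hK
  obtain ⟨B1, hB1⟩ := hK.exists_bound_of_continuousOn hC1.continuousOn
  obtain ⟨B2, hB2⟩ := hK.exists_bound_of_continuousOn hC2.continuousOn
  obtain ⟨B4, hB4⟩ := hK.exists_bound_of_continuousOn hC4.continuousOn
  have hg : ContinuousOn (fun x => lieDeriv Z.Y h x - lieDeriv Z.X h x) K :=
    ((continuousOn_lieDeriv hU hh hY.continuousOn).sub
      (continuousOn_lieDeriv hU hh hX.continuousOn)).mono hKU
  have hhK : ContinuousOn h K := hC3.continuousOn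
  obtain ⟨c, hc, hcK⟩ : ∃ c > 0, ∀ x ∈ K, h x = 0 →
      c < lieDeriv Z.Y h x - lieDeriv Z.X h x := by
    have hcomp : IsCompact (K ∩ h ⁻¹' {0}) :=
      hK.of_isClosed_subset (hhK.preimage_isClosed_of_isClosed hK.isClosed isClosed_singleton)
        inter_subset_left
    rcases (K ∩ h ⁻¹' {0}).eq_empty_or_nonempty with he | hne
    · exact ⟨1, one_pos, fun x hx h0 => absurd (he ▸ ⟨hx, h0⟩ : x ∈ (∅ : Set E3)) (by simp)⟩
    · obtain ⟨x0, hx0, hmin⟩ := hcomp.exists_isMinOn hne (hg.mono inter_subset_left)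
      have hpos := hgap x0 hx0.1 hx0.2
      refine ⟨_, half_pos hpos, fun x hx h0 => ?_⟩
      have h1 : lieDeriv Z.Y h x0 - lieDeriv Z.X h x0 ≤ lieDeriv Z.Y h x - lieDeriv Z.X h x :=
        hmin ⟨hx, h0⟩
      linarith
  obtain ⟨ρ, hρ, hρK⟩ : ∃ ρ > 0, ∀ x ∈ K, |h x| ≤ ρ →
      c ≤ lieDeriv Z.Y h x - lieDeriv Z.X h x := by
    set S := K ∩ (fun x => lieDeriv Z.Y h x - lieDeriv Z.X h x) ⁻¹' Iic c with hS
    have hcomp : IsCompact S :=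
      hK.of_isClosed_subset (hg.preimage_isClosed_of_isClosed hK.isClosed isClosed_Iic)
        inter_subset_left
    rcases S.eq_empty_or_nonempty with he | hne
    · refine ⟨1, one_pos, fun x hx _ => ?_⟩
      by_contra! hcon
      exact absurd (he ▸ ⟨hx, hcon.le⟩ : x ∈ (∅ : Set E3)) (by simp)
    · obtain ⟨x0, hx0, hmin⟩ := hcomp.exists_isMinOn hne (hhK.abs.mono inter_subset_left)
      have hpos : 0 < |h x0| := by
        rw [abs_pos]
        intro h0
        exact absurd (hcK x0 hx0.1 h0) (not_lt.mpr hx0.2)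
      refine ⟨_, half_pos hpos, fun x hx h0 => ?_⟩
      by_contra! hcon
      have h1 : |h x0| ≤ |h x| := hmin ⟨hx, hcon.le⟩
      linarith
  set L : ℝ := 1 + C1 + C2 + C3 + C4 + |B1| + |B2| + |B4| with hL
  have e1 : (C1 : ℝ) ≤ L := by
    have := C2.2; have := C3.2; have := C4.2; have := abs_nonneg B1; have := abs_nonneg B2
    have := abs_nonneg B4; simp only [NNReal.val_eq_coe] at *; linarith
  have e2 : (C2 : ℝ) ≤ L := by
    have := C1.2; have := C3.2; have := C4.2; have := abs_nonneg B1; have := abs_nonneg B2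
    have := abs_nonneg B4; simp only [NNReal.val_eq_coe] at *; linarith
  have e3 : (C3 : ℝ) ≤ L := by
    have := C1.2; have := C2.2; have := C4.2; have := abs_nonneg B1; have := abs_nonneg B2
    have := abs_nonneg B4; simp only [NNReal.val_eq_coe] at *; linarith
  have e4 : (C4 : ℝ) ≤ L := by
    have := C1.2; have := C2.2; have := C3.2; have := abs_nonneg B1; have := abs_nonneg B2
    have := abs_nonneg B4; simp only [NNReal.val_eq_coe] at *; linarith
  have e0 : 1 + |B1| + |B2| + |B4| ≤ L := by
    have := C1.2; have := C2.2; have := C3.2; have := C4.2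
    simp only [NNReal.val_eq_coe] at *; linarith
  have f1 := le_abs_self B1
  have f2 := le_abs_self B2
  have f4 := le_abs_self B4
  have g1 := abs_nonneg B1
  have g2 := abs_nonneg B2
  have g4 := abs_nonneg B4
  refine ⟨L, c, ρ, by linarith, hc, hρ, fun x hx => ?_, fun x hx y hy => ?_, fun x hx y hy => ?_,
    fun x hx y hy => ?_, fun x hx y hy => ?_, fun x hx => (hB4 x hx).trans (by linarith),
    fun x hx => (hB1 x hx).trans (by linarith), fun x hx => (hB2 x hx).trans (by linarith), hρK⟩
  · exact (hh.contDiffAt (hU.mem_nhds (hKU hx))).differentiableAt (by norm_num)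
  · rw [← Real.dist_eq, ← dist_eq_norm]
    exact (hC3.dist_le_mul x hx y hy).trans (by gcongr)
  · rw [← dist_eq_norm, ← dist_eq_norm]
    exact (hC4.dist_le_mul x hx y hy).trans (by gcongr)
  · rw [← dist_eq_norm, ← dist_eq_norm]
    exact (hC1.dist_le_mul x hx y hy).trans (by gcongr)
  · rw [← dist_eq_norm, ← dist_eq_norm]
    exact (hC2.dist_le_mul x hx y hy).trans (by gcongr)

/-- The data of a sliding Shilnikov connection: the sliding orbit `σ` of `q`, emanating from `p`,
and the orbit `ξ` of `X` from `q` to `p`. -/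
structure Connection (U : Set E3) (h : E3 → ℝ) (Z : PWField) (p q : E3) (σ ξ : ℝ → E3)
    (t₀ : ℝ) : Prop where
  isOpen : IsOpen U
  smooth : ContDiffOn ℝ 2 h U
  lip_X : LocallyLipschitzOn U Z.X
  lip_Y : LocallyLipschitzOn U Z.Y
  p_mem : p ∈ slidingRegion U h Z
  p_zero : slidingField h Z p = 0
  q_mem : q ∈ switching U h
  Xh_q : lieDeriv Z.X h q = 0
  XXh_q : 0 < lieDeriv Z.X (lieDeriv Z.X h) q
  Yh_q : 0 < lieDeriv Z.Y h q
  σ_zero : σ 0 = q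
  σ_cont : ContinuousOn σ (Iic 0)
  σ_slide : ∀ t < 0, σ t ∈ slidingRegion U h Z ∧ HasDerivAt σ (slidingField h Z (σ t)) t
  σ_lim : Tendsto σ atBot (𝓝 p)
  t₀_pos : 0 < t₀
  ξ_zero : ξ 0 = q
  ξ_end : ξ t₀ = p
  ξ_deriv : ∀ t ∈ Icc 0 t₀, HasDerivWithinAt ξ (Z.X (ξ t)) (Icc 0 t₀) t
  ξ_pos : ∀ t ∈ Ioo 0 t₀, ξ t ∈ U ∧ 0 < h (ξ t)

/-- The complete trajectory that follows the connection and stays at `p` afterwards. -/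
noncomputable def loop (p : E3) (σ ξ : ℝ → E3) (t₀ : ℝ) (t : ℝ) : E3 :=
  if t ≤ 0 then σ t else if t ≤ t₀ then ξ t else p

/-- The velocity of `loop`, extended continuously beyond the arrival at `p`. -/
noncomputable def loopVel (h : E3 → ℝ) (Z : PWField) (p : E3) (σ ξ : ℝ → E3) (t₀ : ℝ) (t : ℝ) :
    E3 :=
  if t ≤ 0 then slidingField h Z (loop p σ ξ t₀ t) else Z.X (loop p σ ξ t₀ t)

namespace Connection

variable {U : Set E3} {h : E3 → ℝ} {Z : PWField} {p q : E3} {σ ξ : ℝ → E3} {t₀ : ℝ}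

theorem loop_nonpos {t : ℝ} (ht : t ≤ 0) : loop p σ ξ t₀ t = σ t := if_pos ht

theorem loop_mid (C : Connection U h Z p q σ ξ t₀) {t : ℝ} (ht : t ∈ Icc 0 t₀) :
    loop p σ ξ t₀ t = ξ t := by
  rcases eq_or_lt_of_le ht.1 with h0 | h0
  · rw [← h0, loop_nonpos le_rfl, C.σ_zero, C.ξ_zero]
  · rw [loop, if_neg (not_le.mpr h0), if_pos ht.2]

theorem loop_ge (C : Connection U h Z p q σ ξ t₀) {t : ℝ} (ht : t₀ ≤ t) :
    loop p σ ξ t₀ t = p := by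
  rcases eq_or_lt_of_le ht with h0 | h0
  · rw [← h0, C.loop_mid ⟨C.t₀_pos.le, le_rfl⟩, C.ξ_end]
  · rw [loop, if_neg (not_le.mpr (C.t₀_pos.trans h0)), if_neg (not_le.mpr h0)]

theorem range_loop (C : Connection U h Z p q σ ξ t₀) :
    range (loop p σ ξ t₀) = σ '' Iic 0 ∪ ξ '' Icc 0 t₀ := by
  ext x
  constructor
  · rintro ⟨t, rfl⟩
    rcases le_total t 0 with h | h
    · exact Or.inl ⟨t, h, (loop_nonpos h).symm⟩
    rcases le_total t t₀ with h' | h'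
    · exact Or.inr ⟨t, ⟨h, h'⟩, (C.loop_mid ⟨h, h'⟩).symm⟩
    · exact Or.inr ⟨t₀, ⟨C.t₀_pos.le, le_rfl⟩, by rw [C.loop_ge h', C.ξ_end]⟩
  · rintro (⟨t, ht, rfl⟩ | ⟨t, ht, rfl⟩)
    · exact ⟨t, loop_nonpos ht⟩
    · exact ⟨t, C.loop_mid ht⟩

theorem loop_mem (C : Connection U h Z p q σ ξ t₀) (t : ℝ) : loop p σ ξ t₀ t ∈ U := by
  rcases lt_or_ge t 0 with h | h
  · rw [loop_nonpos h.le]; exact (C.σ_slide t h).1.1.1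
  rcases eq_or_lt_of_le h with h1 | h1
  · rw [← h1, loop_nonpos le_rfl, C.σ_zero]; exact C.q_mem.1
  rcases lt_or_ge t t₀ with h' | h'
  · rw [C.loop_mid ⟨h, h'.le⟩]; exact (C.ξ_pos t ⟨h1, h'⟩).1
  · rw [C.loop_ge h']; exact C.p_mem.1.1

theorem h_loop_nonpos (C : Connection U h Z p q σ ξ t₀) {t : ℝ} (ht : t ≤ 0) :
    h (loop p σ ξ t₀ t) = 0 := by
  rw [loop_nonpos ht]
  rcases eq_or_lt_of_le ht with h0 | h0
  · rw [h0, C.σ_zero]; exact C.q_mem.2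
  · exact (C.σ_slide t h0).1.1.2

theorem h_loop_pos (C : Connection U h Z p q σ ξ t₀) {t : ℝ} (ht : t ∈ Ioo 0 t₀) :
    0 < h (loop p σ ξ t₀ t) := by
  rw [C.loop_mid (Ioo_subset_Icc_self ht)]; exact (C.ξ_pos t ht).2

theorem h_loop_ge (C : Connection U h Z p q σ ξ t₀) {t : ℝ} (ht : t₀ ≤ t) :
    h (loop p σ ξ t₀ t) = 0 := by
  rw [C.loop_ge ht]; exact C.p_mem.1.2

theorem lieDeriv_loop (C : Connection U h Z p q σ ξ t₀) {t : ℝ} (ht : t ≤ 0) :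
    lieDeriv Z.X h (loop p σ ξ t₀ t) ≤ 0 ∧ 0 < lieDeriv Z.Y h (loop p σ ξ t₀ t) := by
  rw [loop_nonpos ht]
  rcases eq_or_lt_of_le ht with h0 | h0
  · rw [h0, C.σ_zero]; exact ⟨C.Xh_q.le, C.Yh_q⟩
  · exact ⟨(C.σ_slide t h0).1.2.1.le, (C.σ_slide t h0).1.2.2⟩

theorem tendsto_loop_atBot (C : Connection U h Z p q σ ξ t₀) :
    Tendsto (loop p σ ξ t₀) atBot (𝓝 p) := by
  refine C.σ_lim.congr' ?_
  filter_upwards [eventually_le_atBot (0 : ℝ)] with t ht using (loop_nonpos ht).symm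

theorem continuous_loop (C : Connection U h Z p q σ ξ t₀) : Continuous (loop p σ ξ t₀) := by
  have h1 : ContinuousOn (loop p σ ξ t₀) (Iic 0) :=
    C.σ_cont.congr fun t ht => loop_nonpos ht
  have h2 : ContinuousOn (loop p σ ξ t₀) (Icc 0 t₀) :=
    (show ContinuousOn ξ (Icc 0 t₀) from fun t ht => (C.ξ_deriv t ht).continuousWithinAt).congr
      fun t ht => C.loop_mid ht
  have h3 : ContinuousOn (loop p σ ξ t₀) (Ici t₀) :=
    continuousOn_const.congr fun t ht => C.loop_ge ht
  have h4 := (h1.union_of_isClosed h2 isClosed_Iic isClosed_Icc).union_of_isClosed h3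
    (isClosed_Iic.union isClosed_Icc) isClosed_Ici
  rw [Iic_union_Icc_eq_Iic C.t₀_pos.le, Iic_union_Ici] at h4
  exact continuousOn_univ.mp h4

theorem isCompact_range_loop (C : Connection U h Z p q σ ξ t₀) :
    IsCompact (range (loop p σ ξ t₀)) := by
  have h0 : p ∈ range (loop p σ ξ t₀) := ⟨t₀, C.loop_ge le_rfl⟩
  have h1 : range (loop p σ ξ t₀) = insert p (range (loop p σ ξ t₀)) :=
    (insert_eq_of_mem h0).symm
  rw [h1]
  refine Tendsto.isCompact_insert_range_of_cocompact ?_ C.continuous_loop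
  rw [cocompact_eq_atBot_atTop]
  refine C.tendsto_loop_atBot.sup (tendsto_const_nhds.congr' ?_)
  filter_upwards [eventually_ge_atTop t₀] with t ht using (C.loop_ge ht).symm

theorem lieDeriv_of_mem_range (C : Connection U h Z p q σ ξ t₀) {x : E3}
    (hx : x ∈ range (loop p σ ξ t₀)) (h0 : h x = 0) :
    lieDeriv Z.X h x ≤ 0 ∧ 0 < lieDeriv Z.Y h x := by
  obtain ⟨t, rfl⟩ := hx
  rcases le_or_gt t 0 with ht | ht
  · exact C.lieDeriv_loop ht
  rcases lt_or_ge t t₀ with ht' | ht'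
  · exact absurd h0 (C.h_loop_pos ⟨ht, ht'⟩).ne'
  · rw [C.loop_ge ht']; exact ⟨C.p_mem.2.1.le, C.p_mem.2.2⟩

theorem hasDerivAt_loop (C : Connection U h Z p q σ ξ t₀) {t : ℝ} (h0 : t ≠ 0) (h1 : t < t₀) :
    HasDerivAt (loop p σ ξ t₀) (loopVel h Z p σ ξ t₀ t) t := by
  rcases lt_or_gt_of_ne h0 with ht | ht
  · rw [loopVel, if_pos ht.le, loop_nonpos ht.le]
    refine (C.σ_slide t ht).2.congr_of_eventuallyEq ?_
    filter_upwards [Iio_mem_nhds ht] with s hs using loop_nonpos hs.le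
  · rw [loopVel, if_neg (not_le.mpr ht), C.loop_mid ⟨ht.le, h1.le⟩]
    refine ((C.ξ_deriv t ⟨ht.le, h1.le⟩).hasDerivAt (Icc_mem_nhds ht h1)).congr_of_eventuallyEq ?_
    filter_upwards [Icc_mem_nhds ht h1] with s hs using C.loop_mid hs

theorem hasDerivAt_loop_gt (C : Connection U h Z p q σ ξ t₀) {t : ℝ} (h1 : t₀ < t) :
    HasDerivAt (loop p σ ξ t₀) 0 t := by
  refine (hasDerivAt_const t p).congr_of_eventuallyEq ?_
  filter_upwards [Ioi_mem_nhds h1] with s hs using C.loop_ge (le_of_lt hs)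

theorem loopVel_zero (C : Connection U h Z p q σ ξ t₀) : loopVel h Z p σ ξ t₀ 0 = Z.X q := by
  rw [loopVel, if_pos le_rfl, loop_nonpos le_rfl, C.σ_zero]
  exact slidingField_of_lieDeriv_eq_zero C.Xh_q C.Yh_q.ne'

theorem loopVel_nonneg (C : Connection U h Z p q σ ξ t₀) {t : ℝ} (ht : 0 ≤ t) :
    loopVel h Z p σ ξ t₀ t = Z.X (loop p σ ξ t₀ t) := by
  rcases eq_or_lt_of_le ht with h0 | h0
  · rw [← h0, C.loopVel_zero, loop_nonpos le_rfl, C.σ_zero]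
  · rw [loopVel, if_neg (not_le.mpr h0)]

theorem loopVel_nonpos {t : ℝ} (ht : t ≤ 0) :
    loopVel h Z p σ ξ t₀ t = slidingField h Z (loop p σ ξ t₀ t) := if_pos ht

theorem isCompact_range_inter (C : Connection U h Z p q σ ξ t₀) :
    IsCompact (range (loop p σ ξ t₀) ∩ h ⁻¹' {0}) := by
  have hcont : ContinuousOn h (range (loop p σ ξ t₀)) :=
    C.smooth.continuousOn.mono (by rintro _ ⟨t, rfl⟩; exact C.loop_mem t)
  exact C.isCompact_range_loop.of_isClosed_subset
    (hcont.preimage_isClosed_of_isClosed C.isCompact_range_loop.isClosed isClosed_singleton)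
    inter_subset_left

theorem exists_lipschitzWith_loop (C : Connection U h Z p q σ ξ t₀) :
    ∃ M, LipschitzWith M (loop p σ ξ t₀) := by
  have hsf := continuousOn_slidingField C.isOpen C.smooth C.lip_X.continuousOn
    C.lip_Y.continuousOn
  obtain ⟨M1, hM1⟩ := C.isCompact_range_inter.exists_bound_of_continuousOn (hsf.mono (by
    rintro x ⟨⟨t, rfl⟩, h0⟩
    have := C.lieDeriv_of_mem_range ⟨t, rfl⟩ h0
    exact ⟨C.loop_mem t, by linarith [this.1, this.2]⟩))
  obtain ⟨M2, hM2⟩ := C.isCompact_range_loop.exists_bound_of_continuousOn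
    (C.lip_X.continuousOn.mono (by rintro _ ⟨t, rfl⟩; exact C.loop_mem t))
  set M : NNReal := ⟨max 0 (max M1 M2), le_max_left _ _⟩ with hM
  have hvel : ∀ t, ‖loopVel h Z p σ ξ t₀ t‖₊ ≤ M := by
    intro t
    change ‖loopVel h Z p σ ξ t₀ t‖ ≤ max 0 (max M1 M2)
    rcases le_total t 0 with ht | ht
    · rw [loopVel_nonpos ht]
      exact (hM1 _ ⟨⟨t, rfl⟩, C.h_loop_nonpos ht⟩).trans ((le_max_left _ _).trans (le_max_right _ _))
    · rw [C.loopVel_nonneg ht]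
      exact (hM2 _ ⟨t, rfl⟩).trans ((le_max_right _ _).trans (le_max_right _ _))
  have key : ∀ s : Set ℝ, IsOpen s → Convex ℝ s →
      (∀ t ∈ s, ∃ v, HasDerivAt (loop p σ ξ t₀) v t ∧ ‖v‖₊ ≤ M) →
      LipschitzOnWith M (loop p σ ξ t₀) (closure s) := by
    intro s _ hs hd
    choose! v hv hvM using hd
    exact (hs.lipschitzOnWith_of_nnnorm_hasDerivWithin_le
      (fun t ht => (hv t ht).hasDerivWithinAt) hvM).closure C.continuous_loop.continuousOn
  have k1 := key (Iio 0) isOpen_Iio (convex_Iio 0) fun t ht =>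
    ⟨_, C.hasDerivAt_loop (ne_of_lt ht) (lt_trans ht C.t₀_pos), hvel t⟩
  have k2 := key (Ioo 0 t₀) isOpen_Ioo (convex_Ioo 0 t₀) fun t ht =>
    ⟨_, C.hasDerivAt_loop ht.1.ne' ht.2, hvel t⟩
  have k3 := key (Ioi t₀) isOpen_Ioi (convex_Ioi t₀) fun t ht =>
    ⟨_, C.hasDerivAt_loop_gt ht, by simp⟩
  rw [closure_Iio] at k1
  rw [closure_Ioo C.t₀_pos.ne] at k2
  rw [closure_Ioi] at k3
  refine ⟨M, LipschitzOnWith.lipschitzWith_of_Iic_Ici (a := 0) k1 ?_⟩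
  have hproj : LipschitzOnWith M (fun t => loop p σ ξ t₀ (min t t₀)) (Ici 0) := by
    refine LipschitzOnWith.of_dist_le_mul fun x hx y hy => ?_
    refine (k2.dist_le_mul _ ⟨le_min hx C.t₀_pos.le, min_le_right _ _⟩ _
      ⟨le_min hy C.t₀_pos.le, min_le_right _ _⟩).trans (mul_le_mul_of_nonneg_left ?_ M.2)
    rw [Real.dist_eq, Real.dist_eq]
    simpa using abs_min_sub_min_le_max x t₀ y t₀
  have hmin : ∀ t, loop p σ ξ t₀ (min t t₀) = loop p σ ξ t₀ t := by
    intro t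
    rcases le_total t t₀ with h' | h'
    · rw [min_eq_left h']
    · rw [min_eq_right h', C.loop_ge h', C.loop_ge le_rfl]
  simpa only [hmin] using hproj

theorem admissible_slidingField {x : E3} (hx : h x = 0) (h1 : lieDeriv Z.X h x ≤ 0)
    (h2 : 0 < lieDeriv Z.Y h x) :
    ∃ l, Admissible h x l ∧ slidingField h Z x = blend Z l x := by
  refine ⟨_, ⟨⟨?_, ?_⟩, fun h0 => absurd hx h0.ne', fun h0 => absurd hx h0.ne⟩,
    slidingField_eq_blend (by linarith)⟩
  · exact div_nonneg h2.le (by linarith)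
  · rw [div_le_one (by linarith)]; linarith

theorem follows_loop (C : Connection U h Z p q σ ξ t₀) (a b : ℝ) :
    Follows h Z 0 a b (loop p σ ξ t₀) := by
  obtain ⟨M, hM⟩ := C.exists_lipschitzWith_loop
  refine ⟨hM.locallyLipschitz, ?_⟩
  have hnull : ∀ᵐ t : ℝ, t ∉ ({0, t₀} : Set ℝ) :=
    measure_eq_zero_iff_ae_notMem.mp (((finite_singleton t₀).insert 0).measure_zero volume)
  filter_upwards [hnull] with t ht _
  simp only [mem_insert_iff, mem_singleton_iff, not_or] at ht
  rcases lt_or_gt_of_ne ht.1 with h0 | h0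
  · obtain ⟨l, hl, hle⟩ := admissible_slidingField (C.h_loop_nonpos h0.le) (C.lieDeriv_loop h0.le).1
      (C.lieDeriv_loop h0.le).2
    refine ⟨_, C.hasDerivAt_loop h0.ne (h0.trans C.t₀_pos), l, hl, ?_⟩
    rw [loopVel_nonpos h0.le, hle, sub_self, norm_zero]
  rcases lt_or_gt_of_ne ht.2 with h1 | h1
  · have hpos := C.h_loop_pos ⟨h0, h1⟩
    refine ⟨_, C.hasDerivAt_loop h0.ne' h1, 1, ⟨by simp, fun _ => rfl, fun h => absurd hpos h.not_gt⟩, ?_⟩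
    rw [C.loopVel_nonneg h0.le]
    simp [blend]
  · obtain ⟨l, hl, hle⟩ := admissible_slidingField C.p_mem.1.2 C.p_mem.2.1.le C.p_mem.2.2
    refine ⟨0, C.hasDerivAt_loop_gt h1, l, ?_, ?_⟩
    · rwa [C.loop_ge h1.le]
    · rw [C.loop_ge h1.le, ← hle, C.p_zero, sub_self, norm_zero]

theorem follows_const {x : E3} (hx : h x = 0) (h1 : lieDeriv Z.X h x ≤ 0)
    (h2 : 0 < lieDeriv Z.Y h x) (h3 : slidingField h Z x = 0) (a b : ℝ) :
    Follows h Z 0 a b (fun _ => x) := by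
  obtain ⟨l, hl, hle⟩ := admissible_slidingField hx h1 h2
  exact ⟨(LipschitzWith.const x).locallyLipschitz, Eventually.of_forall fun t _ =>
    ⟨0, hasDerivAt_const t x, l, hl, by rw [← hle, h3, sub_self, norm_zero]⟩⟩

theorem follows_const_of_pos {x : E3} (hx : 0 < h x) (h3 : Z.X x = 0) (a b : ℝ) :
    Follows h Z 0 a b (fun _ => x) :=
  ⟨(LipschitzWith.const x).locallyLipschitz, Eventually.of_forall fun t _ =>
    ⟨0, hasDerivAt_const t x, 1, ⟨by simp, fun _ => rfl, fun h => absurd hx h.not_gt⟩,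
      by simp [blend, h3]⟩⟩

/-- There are arbitrarily thin compact neighbourhoods of the connection on which the system is
controlled. -/
theorem exists_cthickening (C : Connection U h Z p q σ ξ t₀) {G : Set E3}
    (hG : G ∈ 𝓝ˢ (range (loop p σ ξ t₀))) :
    ∃ R > 0, Metric.cthickening R (range (loop p σ ξ t₀)) ⊆ G ∧
      Metric.cthickening R (range (loop p σ ξ t₀)) ⊆ U ∧
      ∀ x ∈ Metric.cthickening R (range (loop p σ ξ t₀)), h x = 0 →
        0 < lieDeriv Z.Y h x ∧ 0 < lieDeriv Z.Y h x - lieDeriv Z.X h x := by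
  have hXh := continuousOn_lieDeriv C.isOpen C.smooth C.lip_X.continuousOn
  have hYh := continuousOn_lieDeriv C.isOpen C.smooth C.lip_Y.continuousOn
  have hnhds : ∀ x ∈ range (loop p σ ξ t₀), ∀ᶠ y in 𝓝 x, y ∈ G ∧ y ∈ U ∧
      (h y = 0 → 0 < lieDeriv Z.Y h y ∧ 0 < lieDeriv Z.Y h y - lieDeriv Z.X h y) := by
    intro x hx
    have hxU : x ∈ U := by obtain ⟨t, rfl⟩ := hx; exact C.loop_mem t
    have hUx := C.isOpen.mem_nhds hxU
    have hGx : G ∈ 𝓝 x := mem_nhdsSet_iff_forall.mp hG x hx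
    by_cases h0 : h x = 0
    · obtain ⟨h1, h2⟩ := C.lieDeriv_of_mem_range hx h0
      have c1 := hXh.continuousAt hUx
      have c2 := hYh.continuousAt hUx
      filter_upwards [hGx, hUx, continuousAt_const.eventually_lt c2 h2,
        (continuousAt_const (y := (0 : ℝ))).eventually_lt (c2.sub c1) (by
          simp only [Pi.sub_apply]; linarith)] with y g1 g2 g3 g4
      exact ⟨g1, g2, fun _ => ⟨g3, g4⟩⟩
    · filter_upwards [hGx, hUx, (C.smooth.continuousOn.continuousAt hUx).eventually_ne h0]
        with y g1 g2 g3
      exact ⟨g1, g2, fun h => absurd h g3⟩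
  have hset : {y | y ∈ G ∧ y ∈ U ∧
      (h y = 0 → 0 < lieDeriv Z.Y h y ∧ 0 < lieDeriv Z.Y h y - lieDeriv Z.X h y)} ∈
      𝓝ˢ (range (loop p σ ξ t₀)) := mem_nhdsSet_iff_forall.mpr hnhds
  obtain ⟨O, hO, hΓO, hOs⟩ := mem_nhdsSet_iff_exists.mp hset
  obtain ⟨R, hR, hRO⟩ := C.isCompact_range_loop.exists_cthickening_subset_open hO hΓO
  exact ⟨R, hR, fun x hx => (hOs (hRO hx)).1, fun x hx => (hOs (hRO hx)).2.1,
    fun x hx => (hOs (hRO hx)).2.2⟩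

end Connection

/-- The sliding field is Lipschitz where the weights are admissible. -/
theorem Controlled.slidingField_sub_le {h : E3 → ℝ} {Z : PWField} {K : Set E3} {L c ρ : ℝ}
    (H : Controlled h Z K L c ρ) {x y : E3} (hx : x ∈ K) (hy : y ∈ K) (hxρ : |h x| ≤ ρ)
    (hyρ : |h y| ≤ ρ) (h1 : lieDeriv Z.X h y ≤ 0) (h2 : 0 ≤ lieDeriv Z.Y h y) :
    ‖slidingField h Z x - slidingField h Z y‖ ≤ (6 * L ^ 3 / c + L) * ‖x - y‖ := by
  have hL := H.one_le
  have hc := H.c_pos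
  have gx := H.gap x hx hxρ
  have gy := H.gap y hy hyρ
  have ex := slidingField_eq_blend (Z := Z) (h := h) (x := x) (by linarith)
  have ey := slidingField_eq_blend (Z := Z) (h := h) (x := y) (by linarith)
  set l := lieDeriv Z.Y h x / (lieDeriv Z.Y h x - lieDeriv Z.X h x)
  set m := lieDeriv Z.Y h y / (lieDeriv Z.Y h y - lieDeriv Z.X h y)
  have hm : m ∈ Icc (0 : ℝ) 1 :=
    ⟨div_nonneg h2 (by linarith), by rw [div_le_one (by linarith)]; linarith⟩
  have hvx : ‖slidingField h Z x - blend Z l x‖ ≤ 0 := by rw [ex, sub_self, norm_zero]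
  have hvy : ‖slidingField h Z y - blend Z m y‖ ≤ 0 := by rw [ey, sub_self, norm_zero]
  have d1 := H.deriv_sub_le hx hy hm zero_le_one hvx hvy
  rw [fderiv_slidingField, fderiv_slidingField, sub_zero, zero_sub, abs_neg, abs_mul, add_zero] at d1
  have d2 : |l - m| * c ≤ 3 * L ^ 2 * ‖x - y‖ := by
    refine le_trans (mul_le_mul_of_nonneg_left ?_ (abs_nonneg _)) d1
    rw [abs_of_neg (by linarith)]; linarith
  have d3 := H.velocity_sub_le hx hy hm hvx hvy
  have d4 : ‖Z.X x - Z.Y x‖ ≤ 2 * L := by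
    have := _root_.norm_sub_le (Z.X x) (Z.Y x)
    have := H.X_le x hx
    have := H.Y_le x hx
    linarith
  have d5 : ‖slidingField h Z x - slidingField h Z y‖ ≤
      L * ‖x - y‖ + 2 * 0 + |l - m| * (2 * L) := by
    have := norm_sub_norm_le (slidingField h Z x - slidingField h Z y) ((l - m) • (Z.X x - Z.Y x))
    rw [norm_smul, Real.norm_eq_abs] at this
    have := mul_le_mul_of_nonneg_left d4 (abs_nonneg (l - m))
    linarith
  have d6 : |l - m| ≤ 3 * L ^ 2 * ‖x - y‖ / c := by rwa [le_div_iff₀ hc]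
  calc _ ≤ _ := d5
    _ ≤ L * ‖x - y‖ + 2 * 0 + 3 * L ^ 2 * ‖x - y‖ / c * (2 * L) := by gcongr
    _ = _ := by ring

namespace Connection

variable {U : Set E3} {h : E3 → ℝ} {Z : PWField} {p q : E3} {σ ξ : ℝ → E3} {t₀ : ℝ}

theorem exists_lipschitzWith_loopVel (C : Connection U h Z p q σ ξ t₀) :
    ∃ M, LipschitzWith M (loopVel h Z p σ ξ t₀) := by
  obtain ⟨M, hM⟩ := C.exists_lipschitzWith_loop
  have hsub : range (loop p σ ξ t₀) ⊆ U := by rintro _ ⟨t, rfl⟩; exact C.loop_mem t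
  obtain ⟨L, c, ρ, H⟩ := exists_controlled C.isOpen C.smooth C.lip_X C.lip_Y
    C.isCompact_range_loop hsub (fun x hx h0 => by
      have := C.lieDeriv_of_mem_range hx h0
      linarith [this.1, this.2])
  have hL := H.one_le
  have hc := H.c_pos
  have hρ := H.rho_pos
  set A : NNReal := ⟨6 * L ^ 3 / c + L, by positivity⟩ with hA
  refine ⟨A * M, LipschitzOnWith.lipschitzWith_of_Iic_Ici (a := 0) ?_ ?_⟩
  · refine LipschitzOnWith.of_dist_le_mul fun x hx y hy => ?_
    rw [loopVel_nonpos hx, loopVel_nonpos hy, dist_eq_norm]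
    refine (H.slidingField_sub_le ⟨x, rfl⟩ ⟨y, rfl⟩ (by rw [C.h_loop_nonpos hx, abs_zero]; exact hρ.le)
      (by rw [C.h_loop_nonpos hy, abs_zero]; exact hρ.le) (C.lieDeriv_loop hy).1
      (C.lieDeriv_loop hy).2.le).trans ?_
    rw [NNReal.coe_mul, mul_assoc, ← dist_eq_norm]
    exact mul_le_mul_of_nonneg_left (hM.dist_le_mul _ _) A.2
  · refine LipschitzOnWith.of_dist_le_mul fun x hx y hy => ?_
    rw [C.loopVel_nonneg hx, C.loopVel_nonneg hy, dist_eq_norm]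
    refine (H.lip_X _ ⟨x, rfl⟩ _ ⟨y, rfl⟩).trans ?_
    rw [NNReal.coe_mul, mul_assoc, ← dist_eq_norm]
    refine mul_le_mul ?_ (hM.dist_le_mul _ _) dist_nonneg A.2
    change L ≤ 6 * L ^ 3 / c + L
    have : 0 ≤ 6 * L ^ 3 / c := by positivity
    linarith

end Connection

end PWField

namespace PWField

/-! ### Coordinates near the pseudo-focus -/

/-- A linear projection `π` along `X(p)` onto the tangent plane of the switching surface at `p`,
identified with `ℂ` by `ι`. -/
structure TangentCoord (h : E3 → ℝ) (Z : PWField) (p : E3) (π : E3 →L[ℝ] ℂ) (ι : ℂ →L[ℝ] E3) :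
    Prop where
  X_ne : fderiv ℝ h p (Z.X p) ≠ 0
  π_X : π (Z.X p) = 0
  π_ι : ∀ w, π (ι w) = w
  dh_ι : ∀ w, fderiv ℝ h p (ι w) = 0
  decomp : ∀ e, e = ι (π e) + (fderiv ℝ h p e / fderiv ℝ h p (Z.X p)) • Z.X p

theorem exists_tangentCoord {h : E3 → ℝ} {Z : PWField} {p u v : E3} {A : E3 →L[ℝ] E3} {a b : ℝ}
    (hX : fderiv ℝ h p (Z.X p) ≠ 0) (hb : b ≠ 0) (hu : fderiv ℝ h p u = 0)
    (hv : fderiv ℝ h p v = 0) (huv : u ≠ 0 ∨ v ≠ 0) (hAu : A u = a • u - b • v)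
    (hAv : A v = b • u + a • v) :
    ∃ (π : E3 →L[ℝ] ℂ) (ι : ℂ →L[ℝ] E3) (β : ℝ), 0 < β ∧ TangentCoord h Z p π ι ∧
      ∀ w, π (A (ι w)) = (a + β * Complex.I) * w := by
  wlog hbpos : 0 < b generalizing b v
  · refine this (b := -b) (v := -v) (neg_ne_zero.mpr hb) (by rw [map_neg, hv, neg_zero])
      (huv.imp id neg_ne_zero.mpr) ?_ ?_ (by
        rcases lt_or_gt_of_ne hb with h | h
        · linarith
        · exact absurd h hbpos)
    · rw [hAu]; module
    · rw [map_neg, hAv]; module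
  set ι : ℂ →L[ℝ] E3 :=
    Complex.reCLM.smulRight u - Complex.imCLM.smulRight v with hι
  have hιa : ∀ w : ℂ, ι w = w.re • u - w.im • v := fun w => by simp [hι]
  have hdhι : ∀ w, fderiv ℝ h p (ι w) = 0 := fun w => by
    rw [hιa, map_sub, map_smul, map_smul, hu, hv]; simp
  have hιinj : ∀ w, ι w = 0 → w = 0 := by
    intro w hw
    have h1 := hw
    rw [hιa] at h1
    have h2 : A (w.re • u - w.im • v) = 0 := by rw [h1, map_zero]
    rw [map_sub, map_smul, map_smul, hAu, hAv] at h2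
    have h3 : b • (w.im • u + w.re • v) = 0 := by
      have : b • (w.im • u + w.re • v) = a • (w.re • u - w.im • v) -
        (w.re • (a • u - b • v) - w.im • (b • u + a • v)) := by module
      rw [this, h1, h2, smul_zero, sub_zero]
    have h4 := (smul_eq_zero.mp h3).resolve_left hb
    have h5 : (w.re ^ 2 + w.im ^ 2) • u = 0 := by
      have : (w.re ^ 2 + w.im ^ 2) • u = w.re • (w.re • u - w.im • v) +
        w.im • (w.im • u + w.re • v) := by module
      rw [this, h1, h4, smul_zero, smul_zero, add_zero]
    have h6 : (w.re ^ 2 + w.im ^ 2) • v = 0 := by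
      have : (w.re ^ 2 + w.im ^ 2) • v = w.re • (w.im • u + w.re • v) -
        w.im • (w.re • u - w.im • v) := by module
      rw [this, h1, h4, smul_zero, smul_zero, sub_zero]
    have h7 : w.re ^ 2 + w.im ^ 2 = 0 := by
      rcases huv with h | h
      · exact (smul_eq_zero.mp h5).resolve_right h
      · exact (smul_eq_zero.mp h6).resolve_right h
    have h8 : w.re = 0 := by nlinarith [sq_nonneg w.re, sq_nonneg w.im]
    have h9 : w.im = 0 := by nlinarith [sq_nonneg w.re, sq_nonneg w.im]
    exact Complex.ext h8 h9
  set T : (ℂ × ℝ) →L[ℝ] E3 := ι.coprod ((1 : ℝ →L[ℝ] ℝ).smulRight (Z.X p)) with hT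
  have hTa : ∀ (w : ℂ) (z : ℝ), T (w, z) = ι w + z • Z.X p := fun w z => by simp [hT]
  have hTinj : Function.Injective T := by
    rw [injective_iff_map_eq_zero]
    rintro ⟨w, z⟩ hwz
    rw [hTa] at hwz
    have h1 : fderiv ℝ h p (ι w + z • Z.X p) = 0 := by rw [hwz, map_zero]
    rw [map_add, hdhι, map_smul, zero_add, smul_eq_mul] at h1
    have hz := (mul_eq_zero.mp h1).resolve_right hX
    rw [hz, zero_smul, add_zero] at hwz
    rw [hιinj w hwz, hz]; rfl
  have hfr : Module.finrank ℝ (ℂ × ℝ) = Module.finrank ℝ E3 := by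
    simp [Module.finrank_prod]
  set Te := LinearEquiv.ofInjectiveOfFinrankEq T.toLinearMap hTinj hfr with hTe
  have hTeT : ∀ x, Te x = T x := fun x => rfl
  set π : E3 →L[ℝ] ℂ :=
    LinearMap.toContinuousLinearMap ((LinearMap.fst ℝ ℂ ℝ).comp Te.symm.toLinearMap) with hπ
  have hπT : ∀ (w : ℂ) (z : ℝ), π (ι w + z • Z.X p) = w := by
    intro w z
    rw [← hTa, ← hTeT]
    simp [hπ]
  refine ⟨π, ι, b, hbpos, ⟨hX, ?_, fun w => ?_, hdhι, fun e => ?_⟩, fun w => ?_⟩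
  · simpa using hπT 0 1
  · simpa using hπT w 0
  · obtain ⟨⟨w, z⟩, rfl⟩ := Te.surjective e
    rw [hTeT, hTa, hπT, map_add, hdhι, map_smul, zero_add, smul_eq_mul, mul_div_cancel_right₀ _ hX]
  · have : A (ι w) = ι ((a + b * Complex.I) * w) := by
      rw [hιa, hιa, map_sub, map_smul, map_smul, hAu, hAv]
      simp only [Complex.mul_re, Complex.mul_im, Complex.add_re, Complex.add_im, Complex.ofReal_re,
        Complex.ofReal_im, Complex.I_re, Complex.I_im]
      module
    rw [this]
    simpa using hπT ((a + b * Complex.I) * w) 0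

/-- A Lipschitz parametrization `ψ` of the switching surface near `p`, inverse to `π (· - p)`. -/
structure SurfaceChart (U : Set E3) (h : E3 → ℝ) (Z : PWField) (p : E3) (π : E3 →L[ℝ] ℂ)
    (ψ : ℂ → E3) (r C r' : ℝ) : Prop where
  r_pos : 0 < r
  r'_pos : 0 < r'
  C_pos : 0 < C
  ψ_zero : ψ 0 = p
  π_ψ : ∀ w ∈ Metric.ball (0 : ℂ) r, π (ψ w - p) = w
  ψ_mem : ∀ w ∈ Metric.ball (0 : ℂ) r, ψ w ∈ U
  h_ψ : ∀ w ∈ Metric.ball (0 : ℂ) r, h (ψ w) = 0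
  diff : ∀ w ∈ Metric.ball (0 : ℂ) r, DifferentiableAt ℝ ψ w
  trans : ∀ w ∈ Metric.ball (0 : ℂ) r, fderiv ℝ h (ψ w) (Z.X p) ≠ 0
  lip : ∀ w ∈ Metric.ball (0 : ℂ) r, ∀ w' ∈ Metric.ball (0 : ℂ) r, ‖ψ w - ψ w'‖ ≤ C * ‖w - w'‖
  surj : ∀ x, ‖x - p‖ < r' → h x = 0 → π (x - p) ∈ Metric.ball (0 : ℂ) r ∧ ψ (π (x - p)) = x

theorem exists_surfaceChart {U : Set E3} {h : E3 → ℝ} {Z : PWField} {p : E3} (hU : IsOpen U)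
    (hh : ContDiffOn ℝ 2 h U) (hp : p ∈ U) (hp0 : h p = 0) {π : E3 →L[ℝ] ℂ} {ι : ℂ →L[ℝ] E3}
    (T : TangentCoord h Z p π ι) :
    ∃ ψ r C r', SurfaceChart U h Z p π ψ r C r' := by
  set Φ : E3 → ℂ × ℝ := fun x => (π (x - p), h x) with hΦ
  have hcd : ContDiffAt ℝ 1 Φ p := by
    refine ContDiffAt.prodMk ?_ ((hh.contDiffAt (hU.mem_nhds hp)).of_le (by norm_num))
    exact (π.contDiff.comp (contDiff_id.sub contDiff_const)).contDiffAt
  have hinj : Function.Injective (π.prod (fderiv ℝ h p)) := by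
    rw [injective_iff_map_eq_zero]
    intro e he
    have h1 : π e = 0 := congrArg Prod.fst he
    have h2 : fderiv ℝ h p e = 0 := congrArg Prod.snd he
    have := T.decomp e
    rw [h1, h2, map_zero, zero_div, zero_smul, add_zero] at this
    exact this
  have hfr : Module.finrank ℝ E3 = Module.finrank ℝ (ℂ × ℝ) := by
    simp [Module.finrank_prod]
  set Te : E3 ≃L[ℝ] ℂ × ℝ :=
    (LinearEquiv.ofInjectiveOfFinrankEq (π.prod (fderiv ℝ h p)).toLinearMap hinj
      hfr).toContinuousLinearEquiv with hTe
  have hder : HasFDerivAt Φ (Te : E3 →L[ℝ] ℂ × ℝ) p := by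
    have h1 : HasFDerivAt (fun x => π (x - p)) π p :=
      π.hasFDerivAt.comp p ((hasFDerivAt_id p).sub_const p)
    have h2 : HasFDerivAt h (fderiv ℝ h p) p :=
      ((hh.contDiffAt (hU.mem_nhds hp)).differentiableAt (by norm_num)).hasFDerivAt
    have : (Te : E3 →L[ℝ] ℂ × ℝ) = π.prod (fderiv ℝ h p) := by ext x <;> rfl
    rw [this]
    exact h1.prodMk h2
  have hstr := hcd.hasStrictFDerivAt' hder (by norm_num)
  have hΦp : Φ p = 0 := by simp [hΦ, hp0]
  set ψ0 := hcd.localInverse hder (by norm_num) with hψ0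
  have hψcd : ContDiffAt ℝ 1 ψ0 (Φ p) := hcd.to_localInverse hder (by norm_num)
  have hleft : ∀ᶠ x in 𝓝 p, ψ0 (Φ x) = x := hstr.eventually_left_inverse
  have hright : ∀ᶠ y in 𝓝 (Φ p), Φ (ψ0 y) = y := hstr.eventually_right_inverse
  have hψp : ψ0 (Φ p) = p := hleft.self_of_nhds
  rw [hΦp] at hψcd hright hψp
  set j : ℂ → ℂ × ℝ := fun w => (w, 0) with hj
  have hjc : ContinuousAt j 0 := by fun_prop
  set ψ : ℂ → E3 := fun w => ψ0 (j w) with hψ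
  have hψcd' : ContDiffAt ℝ 1 ψ 0 := by
    refine ContDiffAt.comp (g := ψ0) (f := j) 0 hψcd ?_
    exact (contDiff_id.prodMk contDiff_const).contDiffAt
  have hψ0p : ψ 0 = p := hψp
  obtain ⟨C, t, ht, hC⟩ := hψcd'.exists_lipschitzOnWith
  have hd : ∀ᶠ w in 𝓝 (0 : ℂ), DifferentiableAt ℝ ψ w := by
    have := hψcd'.eventually (by simp)
    filter_upwards [this] with w hw using hw.differentiableAt (by norm_num)
  have hUw : ∀ᶠ w in 𝓝 (0 : ℂ), ψ w ∈ U :=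
    hψcd'.continuousAt.eventually_mem (by rw [hψ0p]; exact hU.mem_nhds hp)
  have htr : ∀ᶠ w in 𝓝 (0 : ℂ), fderiv ℝ h (ψ w) (Z.X p) ≠ 0 := by
    have h1 : ContinuousAt (fun x => fderiv ℝ h x (Z.X p)) (ψ 0) := by
      rw [hψ0p]
      exact ((continuousOn_fderiv hU hh).continuousAt (hU.mem_nhds hp)).clm_apply continuousAt_const
    have h2 : ContinuousAt (fun w => fderiv ℝ h (ψ w) (Z.X p)) 0 :=
      ContinuousAt.comp (f := ψ) (g := fun x => fderiv ℝ h x (Z.X p)) h1 hψcd'.continuousAt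
    exact h2.eventually_ne (by rw [hψ0p]; exact T.X_ne)
  have hr : ∀ᶠ w in 𝓝 (0 : ℂ), Φ (ψ w) = j w := hjc.eventually hright
  have hall : ∀ᶠ w in 𝓝 (0 : ℂ), w ∈ t ∧ DifferentiableAt ℝ ψ w ∧ ψ w ∈ U ∧
      fderiv ℝ h (ψ w) (Z.X p) ≠ 0 ∧ Φ (ψ w) = j w := by
    filter_upwards [ht, hd, hUw, htr, hr] with w h1 h2 h3 h4 h5 using ⟨h1, h2, h3, h4, h5⟩
  obtain ⟨r, hr0, hball⟩ := Metric.eventually_nhds_iff.mp hall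
  have hnear : ∀ᶠ x in 𝓝 p, ψ0 (Φ x) = x ∧ ‖π (x - p)‖ < r := by
    have hc : ContinuousAt (fun x => ‖π (x - p)‖) p := by fun_prop
    filter_upwards [hleft, hc.eventually_lt continuousAt_const (by simpa using hr0)] with x h1 h2
      using ⟨h1, h2⟩
  obtain ⟨r', hr'0, hr'⟩ := Metric.eventually_nhds_iff.mp hnear
  refine ⟨ψ, r, C + 1, r', hr0, hr'0, by positivity, hψ0p, fun w hw => ?_, fun w hw => ?_,
    fun w hw => ?_, fun w hw => ?_, fun w hw => ?_, fun w hw w' hw' => ?_, fun x hx hx0 => ?_⟩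
  · exact congrArg Prod.fst (hball hw).2.2.2.2
  · exact (hball hw).2.2.1
  · exact congrArg Prod.snd (hball hw).2.2.2.2
  · exact (hball hw).2.1
  · exact (hball hw).2.2.2.1
  · rw [← dist_eq_norm, ← dist_eq_norm]
    refine (hC.dist_le_mul w (hball hw).1 w' (hball hw').1).trans ?_
    gcongr
    linarith
  · rw [← dist_eq_norm] at hx
    obtain ⟨h1, h2⟩ := hr' hx
    refine ⟨by simpa using h2, ?_⟩
    have : j (π (x - p)) = Φ x := by simp [hj, hΦ, hx0]
    change ψ0 (j _) = x
    rw [this, h1]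

namespace SurfaceChart

variable {U : Set E3} {h : E3 → ℝ} {Z : PWField} {p : E3} {π : E3 →L[ℝ] ℂ} {ι : ℂ →L[ℝ] E3}
  {ψ : ℂ → E3} {r C r' : ℝ}

theorem norm_sub_le (S : SurfaceChart U h Z p π ψ r C r') {w : ℂ} (hw : w ∈ Metric.ball (0 : ℂ) r) :
    ‖ψ w - p‖ ≤ C * ‖w‖ := by
  simpa [S.ψ_zero] using S.lip w hw 0 (Metric.mem_ball_self S.r_pos)

theorem continuousOn (S : SurfaceChart U h Z p π ψ r C r') :
    ContinuousOn ψ (Metric.ball (0 : ℂ) r) :=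
  fun w hw => (S.diff w hw).continuousAt.continuousWithinAt

/-- A curve on the surface whose projection follows a tangent field follows that field. -/
theorem hasDerivAt (S : SurfaceChart U h Z p π ψ r C r') (T : TangentCoord h Z p π ι)
    (hU : IsOpen U) (hh : ContDiffOn ℝ 2 h U)
    {w : ℝ → ℂ} {t : ℝ} {s : E3} (hwt : w t ∈ Metric.ball (0 : ℂ) r)
    (hs : fderiv ℝ h (ψ (w t)) s = 0) (hw : HasDerivAt w (π s) t) :
    HasDerivAt (fun τ => ψ (w τ)) s t := by
  have h1 : HasDerivAt (fun τ => ψ (w τ)) (fderiv ℝ ψ (w t) (π s)) t :=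
    (S.diff _ hwt).hasFDerivAt.comp_hasDerivAt t hw
  set v := fderiv ℝ ψ (w t) (π s) with hv
  have hev : ∀ᶠ τ in 𝓝 t, w τ ∈ Metric.ball (0 : ℂ) r :=
    hw.continuousAt.eventually_mem (Metric.isOpen_ball.mem_nhds hwt)
  have h2 : π v = π s := by
    have e1 : HasDerivAt (fun τ => π (ψ (w τ) - p)) (π v) t :=
      π.hasFDerivAt.comp_hasDerivAt t (h1.sub_const p)
    have e2 : HasDerivAt (fun τ => π (ψ (w τ) - p)) (π s) t := by
      refine hw.congr_of_eventuallyEq ?_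
      filter_upwards [hev] with τ hτ using S.π_ψ _ hτ
    exact e1.unique e2
  have h3 : fderiv ℝ h (ψ (w t)) v = 0 := by
    have hd : DifferentiableAt ℝ h (ψ (w t)) :=
      (hh.contDiffAt (hU.mem_nhds (S.ψ_mem _ hwt))).differentiableAt (by norm_num)
    have e1 : HasDerivAt (fun τ => h (ψ (w τ))) (fderiv ℝ h (ψ (w t)) v) t :=
      hd.hasFDerivAt.comp_hasDerivAt t h1
    have e2 : HasDerivAt (fun τ => h (ψ (w τ))) 0 t := by
      refine (hasDerivAt_const t (0 : ℝ)).congr_of_eventuallyEq ?_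
      filter_upwards [hev] with τ hτ using S.h_ψ _ hτ
    exact e1.unique e2
  have h4 : v - s = (fderiv ℝ h p (v - s) / fderiv ℝ h p (Z.X p)) • Z.X p := by
    have := T.decomp (v - s)
    rwa [map_sub π, h2, sub_self, map_zero, zero_add] at this
  have h5 : fderiv ℝ h (ψ (w t)) (v - s) = 0 := by rw [map_sub, h3, hs, sub_zero]
  rw [h4, map_smul, smul_eq_mul] at h5
  have h6 := (mul_eq_zero.mp h5).resolve_right (S.trans _ hwt)
  rw [h6, zero_smul] at h4
  rwa [sub_eq_zero.mp h4] at h1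

/-- In the chart the sliding field is asymptotic to its linearization. -/
theorem focus_asymptotics (S : SurfaceChart U h Z p π ψ r C r') (T : TangentCoord h Z p π ι)
    (hU : IsOpen U) (hh : ContDiffOn ℝ 2 h U) (hpU : p ∈ U) (hp0 : h p = 0)
    {A : E3 →L[ℝ] E3} (hA : HasFDerivWithinAt (slidingField h Z) A (switching U h) p)
    (hzero : slidingField h Z p = 0) {μ : ℂ} (hμ : ∀ w, π (A (ι w)) = μ * w) {κ : ℝ} (hκ : 0 < κ) :
    ∃ r₁ > 0, r₁ ≤ r ∧ ∀ w, ‖w‖ < r₁ → ‖π (slidingField h Z (ψ w)) - μ * w‖ ≤ κ * ‖w‖ := by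
  have hC := S.C_pos
  have hψ0 : Tendsto ψ (𝓝 0) (𝓝 p) := by
    have := (S.diff 0 (Metric.mem_ball_self S.r_pos)).continuousAt.tendsto
    rwa [S.ψ_zero] at this
  have hd : HasFDerivAt h (fderiv ℝ h p) p :=
    ((hh.contDiffAt (hU.mem_nhds hpU)).differentiableAt (by norm_num)).hasFDerivAt
  set B := ‖π‖ * ‖A‖ * (‖Z.X p‖ / |fderiv ℝ h p (Z.X p)|) with hB
  have hB0 : 0 ≤ B := by positivity
  set e := κ / (C * (‖π‖ + B + 1)) with he
  have he0 : 0 < e := by positivity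
  have h1 := (hasFDerivWithinAt_iff_isLittleO.mp hA).def he0
  have h2 := (hasFDerivAt_iff_isLittleO.mp hd).def he0
  have hball : ∀ᶠ w in 𝓝 (0 : ℂ), w ∈ Metric.ball (0 : ℂ) r := Metric.ball_mem_nhds _ S.r_pos
  have hψs : Tendsto ψ (𝓝 0) (𝓝[switching U h] p) := by
    refine tendsto_nhdsWithin_iff.mpr ⟨hψ0, ?_⟩
    filter_upwards [hball] with w hw using ⟨S.ψ_mem w hw, S.h_ψ w hw⟩
  have hall := (hψs.eventually h1).and ((hψ0.eventually h2).and hball)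
  obtain ⟨r₁, hr₁, hr₁b⟩ := Metric.eventually_nhds_iff.mp hall
  refine ⟨min r₁ r, lt_min hr₁ S.r_pos, min_le_right _ _, fun w hw => ?_⟩
  obtain ⟨g1, g2, g3⟩ := hr₁b (y := w) (by simpa using hw.trans_le (min_le_left _ _))
  rw [hzero, sub_zero] at g1
  rw [S.h_ψ w g3, hp0, sub_zero, zero_sub, norm_neg] at g2
  have g4 := S.norm_sub_le g3
  have hdec := T.decomp (ψ w - p)
  rw [S.π_ψ w g3] at hdec
  set z := fderiv ℝ h p (ψ w - p) / fderiv ℝ h p (Z.X p) with hz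
  have g5 : π (slidingField h Z (ψ w)) - μ * w =
      π (slidingField h Z (ψ w) - A (ψ w - p)) + π (A (z • Z.X p)) := by
    rw [← hμ w]
    conv_rhs => rw [hdec]
    simp only [map_sub, map_add]
    abel
  rw [g5]
  have g6 : ‖π (slidingField h Z (ψ w) - A (ψ w - p))‖ ≤ ‖π‖ * (e * (C * ‖w‖)) := by
    refine (π.le_opNorm _).trans (mul_le_mul_of_nonneg_left (g1.trans ?_) (norm_nonneg _))
    gcongr
  have g7 : ‖π (A (z • Z.X p))‖ ≤ B * (e * (C * ‖w‖)) := by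
    refine (π.le_opNorm _).trans ?_
    have : ‖A (z • Z.X p)‖ ≤ ‖A‖ * (‖z‖ * ‖Z.X p‖) := by
      rw [← norm_smul]; exact A.le_opNorm _
    refine (mul_le_mul_of_nonneg_left this (norm_nonneg _)).trans ?_
    have hzle : ‖z‖ ≤ e * (C * ‖w‖) / |fderiv ℝ h p (Z.X p)| := by
      rw [hz, norm_div, Real.norm_eq_abs (fderiv ℝ h p (Z.X p))]
      gcongr
      exact g2.trans (by gcongr)
    calc ‖π‖ * (‖A‖ * (‖z‖ * ‖Z.X p‖))
        ≤ ‖π‖ * (‖A‖ * (e * (C * ‖w‖) / |fderiv ℝ h p (Z.X p)| * ‖Z.X p‖)) := by gcongr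
      _ = _ := by rw [hB]; ring
  refine (norm_add_le _ _).trans ((add_le_add g6 g7).trans ?_)
  have g8 : e * (C * (‖π‖ + B + 1)) = κ := by rw [he]; field_simp
  have : 0 ≤ e * C * ‖w‖ := by positivity
  calc _ = e * (C * (‖π‖ + B)) * ‖w‖ := by ring
    _ ≤ e * (C * (‖π‖ + B)) * ‖w‖ + e * C * ‖w‖ := le_add_of_nonneg_right this
    _ = e * (C * (‖π‖ + B + 1)) * ‖w‖ := by ring
    _ = _ := by rw [g8]

end SurfaceChart

end PWField

/-! ### Flows in logarithmic coordinates around a focus -/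

section LogFlow

theorem norm_sub_smul_le_of_deriv {ω : ℝ → ℂ} {v : ℝ → ℂ} {μ : ℂ} {κ a b : ℝ}
    (hω : ∀ t ∈ Icc a b, HasDerivWithinAt ω (v t) (Icc a b) t)
    (hv : ∀ t ∈ Icc a b, ‖v t - μ‖ ≤ κ) {s t : ℝ} (hs : s ∈ Icc a b) (ht : t ∈ Icc a b)
    (hst : s ≤ t) : ‖(ω t - ω s) - (t - s) * μ‖ ≤ κ * (t - s) := by
  have hd : ∀ x ∈ Icc a b, HasDerivWithinAt (fun x : ℝ => ω x - x * μ) (v x - μ) (Icc a b) x := by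
    intro x hx
    have h1 : HasDerivWithinAt (fun x : ℝ => (x : ℂ) * μ) μ (Icc a b) x := by
      simpa using (Complex.ofRealCLM.hasDerivAt (x := x)).hasDerivWithinAt.mul_const μ
    exact (hω x hx).sub h1
  have := (convex_Icc a b).norm_image_sub_le_of_norm_hasDerivWithin_le hd hv hs ht
  rw [Real.norm_of_nonneg (sub_nonneg.mpr hst)] at this
  refine le_trans (le_of_eq ?_) this
  congr 1
  ring

theorem exists_solution_of_bounded_lipschitz {g : ℂ → ℂ} {B K : NNReal} (hB : ∀ z, ‖g z‖ ≤ B)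
    (hK : LipschitzWith K g) {T : ℝ} (hT : 0 ≤ T) (z : ℂ) :
    ∃ ω : ℝ → ℂ, ω 0 = z ∧ ∀ t ∈ Icc 0 T, HasDerivAt ω (g (ω t)) t := by
  have h0 : (0 : ℝ) ∈ Icc (-1) (T + 1) := ⟨by norm_num, by linarith⟩
  have hP : IsPicardLindelof (fun _ => g) (⟨0, h0⟩ : Icc (-1) (T + 1)) z
      (B * ⟨T + 1, by linarith⟩) 0 B K := by
    refine IsPicardLindelof.of_time_independent (fun x _ => hB x) hK.lipschitzOnWith ?_
    have : max (T + 1 - 0) (0 - -1) = T + 1 := by rw [max_eq_left] <;> linarith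
    simp only [NNReal.coe_zero, sub_zero]
    refine mul_le_mul_of_nonneg_left ?_ B.2
    simp only [sub_zero] at this
    exact this.le
  obtain ⟨ω, hω0, hω⟩ := hP.exists_eq_forall_mem_Icc_hasDerivWithinAt₀
  refine ⟨ω, hω0, fun t ht => (hω t ⟨by linarith [ht.1], by linarith [ht.2]⟩).hasDerivAt
    (Icc_mem_nhds (by linarith [ht.1]) (by linarith [ht.2]))⟩

/-- Clamp the real part. -/
noncomputable def clampRe (r₀ r₁ : ℝ) (z : ℂ) : ℂ := ⟨max r₀ (min r₁ z.re), z.im⟩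

theorem clampRe_eq {r₀ r₁ : ℝ} {z : ℂ} (h0 : r₀ ≤ z.re) (h1 : z.re ≤ r₁) :
    clampRe r₀ r₁ z = z := by
  simp [clampRe, min_eq_right h1, max_eq_right h0]

theorem lipschitzWith_clampRe (r₀ r₁ : ℝ) : LipschitzWith 1 (clampRe r₀ r₁) := by
  refine LipschitzWith.of_dist_le_mul fun z w => ?_
  rw [NNReal.coe_one, one_mul, Complex.dist_eq_re_im, Complex.dist_eq_re_im]
  refine Real.sqrt_le_sqrt (add_le_add ?_ le_rfl)
  rw [sq_le_sq]
  simp only [clampRe]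
  have h1 : |max r₀ (min r₁ z.re) - max r₀ (min r₁ w.re)| ≤ |min r₁ z.re - min r₁ w.re| := by
    simpa using abs_max_sub_max_le_max r₀ (min r₁ z.re) r₀ (min r₁ w.re)
  have h2 : |min r₁ z.re - min r₁ w.re| ≤ |z.re - w.re| := by
    simpa using abs_min_sub_min_le_max r₁ z.re r₁ w.re
  exact h1.trans h2

theorem lipschitzOnWith_exp (r : ℝ) :
    LipschitzOnWith ⟨Real.exp r, (Real.exp_pos r).le⟩ Complex.exp {z | z.re ≤ r} := by
  refine (convex_halfSpace_re_le r).lipschitzOnWith_of_nnnorm_hasDerivWithin_le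
    (f' := Complex.exp) (fun z _ => (Complex.hasDerivAt_exp z).hasDerivWithinAt) fun z hz => ?_
  change ‖Complex.exp z‖ ≤ Real.exp r
  rw [Complex.norm_exp]
  exact Real.exp_le_exp.mpr hz

/-- The field `f` in logarithmic coordinates, frozen outside the annulus of definition. -/
noncomputable def logField (f : ℂ → ℂ) (r₀ r₁ : ℝ) (z : ℂ) : ℂ :=
  f (Complex.exp (clampRe r₀ r₁ z)) / Complex.exp (clampRe r₀ r₁ z)

variable {f : ℂ → ℂ} {r₀ r₁ : ℝ} {μ : ℂ} {κ : ℝ}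

theorem exp_clampRe_mem (h01 : r₀ ≤ r₁) (z : ℂ) :
    Real.exp r₀ ≤ ‖Complex.exp (clampRe r₀ r₁ z)‖ ∧ ‖Complex.exp (clampRe r₀ r₁ z)‖ ≤ Real.exp r₁ := by
  rw [Complex.norm_exp]
  simp only [clampRe]
  exact ⟨Real.exp_le_exp.mpr (le_max_left _ _), Real.exp_le_exp.mpr (max_le h01 (min_le_left _ _))⟩

theorem norm_logField_sub_le (h01 : r₀ ≤ r₁)
    (hf : ∀ w : ℂ, Real.exp r₀ ≤ ‖w‖ → ‖w‖ ≤ Real.exp r₁ → ‖f w - μ * w‖ ≤ κ * ‖w‖) (z : ℂ) :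
    ‖logField f r₀ r₁ z - μ‖ ≤ κ := by
  obtain ⟨h1, h2⟩ := exp_clampRe_mem h01 z
  set W := Complex.exp (clampRe r₀ r₁ z) with hW
  have hW0 : W ≠ 0 := Complex.exp_ne_zero _
  have hWn : 0 < ‖W‖ := norm_pos_iff.mpr hW0
  have e : logField f r₀ r₁ z - μ = (f W - μ * W) / W := by
    rw [logField, ← hW]; field_simp
  rw [e, norm_div, div_le_iff₀ hWn]
  exact hf W h1 h2

theorem exists_lipschitzWith_logField (h01 : r₀ ≤ r₁) {Kf : NNReal}
    (hf : LipschitzOnWith Kf f {w | Real.exp r₀ ≤ ‖w‖ ∧ ‖w‖ ≤ Real.exp r₁})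
    (hb : ∀ w : ℂ, Real.exp r₀ ≤ ‖w‖ → ‖w‖ ≤ Real.exp r₁ → ‖f w - μ * w‖ ≤ κ * ‖w‖) :
    ∃ K, LipschitzWith K (logField f r₀ r₁) := by
  set W : ℂ → ℂ := fun z => Complex.exp (clampRe r₀ r₁ z) with hW
  have hWl : ∀ z z', ‖W z - W z'‖ ≤ Real.exp r₁ * ‖z - z'‖ := by
    intro z z'
    have hmem : ∀ y, clampRe r₀ r₁ y ∈ {y : ℂ | y.re ≤ r₁} := fun y =>
      max_le h01 (min_le_left _ _)
    have h1 := (lipschitzOnWith_exp r₁).dist_le_mul _ (hmem z) _ (hmem z')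
    have h2 := (lipschitzWith_clampRe r₀ r₁).dist_le_mul z z'
    rw [← dist_eq_norm, ← dist_eq_norm]
    rw [NNReal.coe_one, one_mul] at h2
    exact h1.trans (mul_le_mul_of_nonneg_left h2 (Real.exp_pos _).le)
  set B := ‖μ‖ + |κ| with hB
  have hB0 : 0 ≤ B := by positivity
  refine ⟨⟨Real.exp r₁ / Real.exp r₀ * (Kf + B), by positivity⟩,
    LipschitzWith.of_dist_le_mul fun z z' => ?_⟩
  obtain ⟨h1, h2⟩ := exp_clampRe_mem h01 z
  obtain ⟨h1', h2'⟩ := exp_clampRe_mem h01 z'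
  have hg' : ‖logField f r₀ r₁ z'‖ ≤ B := by
    have := norm_logField_sub_le h01 hb z'
    have := norm_sub_norm_le (logField f r₀ r₁ z') μ
    have := le_abs_self κ
    rw [hB]; linarith
  have hW0 : W z ≠ 0 := Complex.exp_ne_zero _
  have hW0' : W z' ≠ 0 := Complex.exp_ne_zero _
  have e : logField f r₀ r₁ z - logField f r₀ r₁ z' =
      ((f (W z) - f (W z')) - logField f r₀ r₁ z' * (W z - W z')) / W z := by
    change f (W z) / W z - f (W z') / W z' = ((f (W z) - f (W z')) - f (W z') / W z' * (W z - W z')) / W z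
    field_simp
    ring
  have h3 := hf.dist_le_mul (W z) ⟨h1, h2⟩ (W z') ⟨h1', h2'⟩
  rw [dist_eq_norm, dist_eq_norm] at h3
  rw [dist_eq_norm, dist_eq_norm, e, norm_div]
  change _ ≤ Real.exp r₁ / Real.exp r₀ * (Kf + B) * ‖z - z'‖
  have h4 : ‖(f (W z) - f (W z')) - logField f r₀ r₁ z' * (W z - W z')‖
      ≤ (Kf + B) * (Real.exp r₁ * ‖z - z'‖) := by
    refine (norm_sub_le _ _).trans ?_
    rw [norm_mul, add_mul]
    have h5 := hWl z z'
    refine add_le_add (h3.trans (mul_le_mul_of_nonneg_left h5 Kf.2)) ?_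
    exact mul_le_mul hg' h5 (norm_nonneg _) hB0
  calc _ ≤ (Kf + B) * (Real.exp r₁ * ‖z - z'‖) / Real.exp r₀ := by
        gcongr
    _ = _ := by ring

/-- A shooting argument around a focus: a curve `E` of starting points (in logarithmic
coordinates) whose trajectories overshoot a moving target on one end and undershoot it on the other
end contains a point whose trajectory hits its target. -/
theorem exists_spiral_hit {a β r₀ r₁ s₀ s₁ ρ Θ : ℝ} (ha : κ < a) (hβ : κ < β) (hκ : 0 < κ)
    (h01 : r₀ ≤ r₁) (hs : s₀ ≤ s₁) {Kf : NNReal}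
    (hf : LipschitzOnWith Kf f {w | Real.exp r₀ ≤ ‖w‖ ∧ ‖w‖ ≤ Real.exp r₁})
    (hb : ∀ w : ℂ, Real.exp r₀ ≤ ‖w‖ → ‖w‖ ≤ Real.exp r₁ →
      ‖f w - (a + β * Complex.I) * w‖ ≤ κ * ‖w‖)
    {E : ℝ → ℂ} (hE : ContinuousOn E (Icc s₀ s₁)) (hEr : ∀ s ∈ Icc s₀ s₁, r₀ ≤ (E s).re)
    (hEΘ : ∀ s ∈ Icc s₀ s₁, (E s).im ≤ Θ) (hρ : ρ + s₁ ≤ r₁)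
    (hlow : (E s₀).re + (a + κ) * ((Θ - (E s₀).im) / (β - κ)) ≤ ρ + s₀)
    (hhigh : ρ + s₁ ≤ (E s₁).re + (a - κ) * ((Θ - (E s₁).im) / (β + κ))) :
    ∃ s ∈ Icc s₀ s₁, ∃ τ ≥ 0, ∃ ω : ℝ → ℂ, ω 0 = E s ∧ ω τ = (ρ + s : ℝ) + Θ * Complex.I ∧
      ∀ t ∈ Icc 0 τ, (E s).re ≤ (ω t).re ∧ (ω t).re ≤ r₁ ∧
        HasDerivAt (fun x => Complex.exp (ω x)) (f (Complex.exp (ω t))) t := by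
  set μ : ℂ := a + β * Complex.I with hμ
  have hμre : μ.re = a := by simp [hμ]
  have hμim : μ.im = β := by simp [hμ]
  set g := logField f r₀ r₁ with hg
  have hgμ : ∀ z, ‖g z - μ‖ ≤ κ := norm_logField_sub_le h01 hb
  obtain ⟨K, hK⟩ := exists_lipschitzWith_logField h01 hf hb
  set B : NNReal := ⟨‖μ‖ + κ, by positivity⟩ with hB
  have hgB : ∀ z, ‖g z‖ ≤ B := fun z => by
    have := hgμ z
    have := norm_sub_norm_le (g z) μ
    change _ ≤ ‖μ‖ + κ
    linarith
  obtain ⟨m, hm⟩ : ∃ m, ∀ s ∈ Icc s₀ s₁, -m ≤ (E s).im := by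
    obtain ⟨m, hm⟩ := isCompact_Icc.exists_bound_of_continuousOn hE
    refine ⟨m, fun s hs => ?_⟩
    have h1 := hm s hs
    have h2 := (abs_le.mp (Complex.abs_im_le_norm (E s))).1
    linarith
  have hs0 : s₀ ∈ Icc s₀ s₁ := left_mem_Icc.mpr hs
  have hs1 : s₁ ∈ Icc s₀ s₁ := right_mem_Icc.mpr hs
  set T := (Θ + m) / (β - κ) with hT
  have hβκ : 0 < β - κ := by linarith
  have hT0 : 0 ≤ T := div_nonneg (by linarith [hm s₀ hs0, hEΘ s₀ hs0]) hβκ.le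
  choose ω hω0 hω using fun s => exists_solution_of_bounded_lipschitz hgB hK hT0 (E s)
  have hest : ∀ s, ∀ x ∈ Icc 0 T, ∀ y ∈ Icc 0 T, x ≤ y →
      ‖(ω s y - ω s x) - (y - x) * μ‖ ≤ κ * (y - x) := by
    intro s x hx y hy hxy
    exact norm_sub_smul_le_of_deriv (fun t ht => (hω s t ht).hasDerivWithinAt) (fun t _ => hgμ _)
      hx hy hxy
  have hestre : ∀ s, ∀ x ∈ Icc 0 T, ∀ y ∈ Icc 0 T, x ≤ y →
      (a - κ) * (y - x) ≤ (ω s y).re - (ω s x).re ∧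
      (ω s y).re - (ω s x).re ≤ (a + κ) * (y - x) := by
    intro s x hx y hy hxy
    have h1 := (Complex.abs_re_le_norm _).trans (hest s x hx y hy hxy)
    have e : ((ω s y - ω s x) - (y - x) * μ).re = (ω s y).re - (ω s x).re - (y - x) * a := by
      simp [hμre]
    rw [e, abs_le] at h1
    constructor <;> nlinarith [h1.1, h1.2]
  have hestim : ∀ s, ∀ x ∈ Icc 0 T, ∀ y ∈ Icc 0 T, x ≤ y →
      (β - κ) * (y - x) ≤ (ω s y).im - (ω s x).im ∧
      (ω s y).im - (ω s x).im ≤ (β + κ) * (y - x) := by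
    intro s x hx y hy hxy
    have h1 := (Complex.abs_im_le_norm _).trans (hest s x hx y hy hxy)
    have e : ((ω s y - ω s x) - (y - x) * μ).im = (ω s y).im - (ω s x).im - (y - x) * β := by
      simp [hμim]
    rw [e, abs_le] at h1
    constructor <;> nlinarith [h1.1, h1.2]
  have hcont : ∀ s, ContinuousOn (ω s) (Icc 0 T) := fun s t ht =>
    (hω s t ht).continuousAt.continuousWithinAt
  have h0T : (0 : ℝ) ∈ Icc 0 T := left_mem_Icc.mpr hT0
  have hTT : T ∈ Icc 0 T := right_mem_Icc.mpr hT0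
  -- hitting times
  have hhit : ∀ s ∈ Icc s₀ s₁, ∃ τ ∈ Icc 0 T, (ω s τ).im = Θ := by
    intro s hs
    have hc : ContinuousOn (fun t => (ω s t).im) (Icc 0 T) :=
      Complex.continuous_im.comp_continuousOn (hcont s)
    have h1 := (hestim s 0 h0T T hTT hT0).1
    have h2 : (β - κ) * (T - 0) = Θ + m := by rw [hT]; field_simp; ring
    have h3 := hm s hs
    rw [hω0] at h1
    refine intermediate_value_Icc hT0 hc ⟨?_, ?_⟩
    · simp only [hω0]; exact hEΘ s hs
    · show Θ ≤ (ω s T).im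
      linarith
  choose! τ hτ hτΘ using hhit
  -- stability
  have hstab : ∀ s s', ∀ t ∈ Icc 0 T, ‖ω s t - ω s' t‖ ≤ ‖E s - E s'‖ * Real.exp (K * T) := by
    intro s s' t ht
    have := dist_le_of_trajectories_ODE (v := fun _ => g) (fun _ => hK) (hcont s)
      (fun t ht => (hω s t (Ico_subset_Icc_self ht)).hasDerivWithinAt) (hcont s')
      (fun t ht => (hω s' t (Ico_subset_Icc_self ht)).hasDerivWithinAt)
      (le_refl (dist (ω s 0) (ω s' 0))) t ht
    rw [dist_eq_norm, dist_eq_norm, hω0, hω0] at this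
    refine this.trans ?_
    gcongr
    linarith [ht.2]
  have hτstab : ∀ s ∈ Icc s₀ s₁, ∀ s' ∈ Icc s₀ s₁,
      (β - κ) * |τ s - τ s'| ≤ ‖E s - E s'‖ * Real.exp (K * T) := by
    have key : ∀ s ∈ Icc s₀ s₁, ∀ s' ∈ Icc s₀ s₁, τ s' ≤ τ s →
        (β - κ) * |τ s - τ s'| ≤ ‖E s - E s'‖ * Real.exp (K * T) := by
      intro s hs s' hs' hle
      rw [abs_of_nonneg (sub_nonneg.mpr hle)]
      have h1 := (hestim s' _ (hτ s' hs') _ (hτ s hs) hle).1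
      rw [hτΘ s' hs'] at h1
      have h2 := (Complex.abs_im_le_norm _).trans (hstab s s' (τ s) (hτ s hs))
      rw [Complex.sub_im, hτΘ s hs, abs_le] at h2
      linarith [h2.1]
    intro s hs s' hs'
    rcases le_total (τ s') (τ s) with h | h
    · exact key s hs s' hs' h
    · rw [abs_sub_comm, norm_sub_rev]; exact key s' hs' s hs h
  have hF : ContinuousOn (fun s => (ω s (τ s)).re - (ρ + s)) (Icc s₀ s₁) := by
    refine ContinuousOn.sub ?_ (by fun_prop)
    set A := Real.exp (K * T) + (a + κ) / (β - κ) * Real.exp (K * T) with hA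
    have key : ∀ s ∈ Icc s₀ s₁, ∀ s' ∈ Icc s₀ s₁,
        |(ω s (τ s)).re - (ω s' (τ s')).re| ≤ A * ‖E s - E s'‖ := by
      have key' : ∀ s ∈ Icc s₀ s₁, ∀ s' ∈ Icc s₀ s₁, τ s' ≤ τ s →
          |(ω s (τ s)).re - (ω s' (τ s')).re| ≤ A * ‖E s - E s'‖ := by
        intro s hs s' hs' hle
        have h1 := (Complex.abs_re_le_norm _).trans (hstab s s' (τ s) (hτ s hs))
        have h2 := hestre s' _ (hτ s' hs') _ (hτ s hs) hle
        have h3 := hτstab s hs s' hs'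
        rw [abs_of_nonneg (sub_nonneg.mpr hle)] at h3
        rw [Complex.sub_re] at h1
        have h4 : τ s - τ s' ≤ ‖E s - E s'‖ * Real.exp (K * T) / (β - κ) := by
          rw [le_div_iff₀ hβκ]; linarith
        have h5 : (a + κ) * (τ s - τ s') ≤
          (a + κ) * (‖E s - E s'‖ * Real.exp (K * T) / (β - κ)) := by
          gcongr
          linarith
        have e : (ω s (τ s)).re - (ω s' (τ s')).re = ((ω s (τ s)).re - (ω s' (τ s)).re) +
          ((ω s' (τ s)).re - (ω s' (τ s')).re) := by ring
        have h6 : 0 ≤ (ω s' (τ s)).re - (ω s' (τ s')).re :=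
          le_trans (mul_nonneg (by linarith) (sub_nonneg.mpr hle)) h2.1
        rw [e]
        refine (abs_add_le _ _).trans ?_
        rw [abs_of_nonneg h6]
        calc _ ≤ ‖E s - E s'‖ * Real.exp (K * T) +
              (a + κ) * (‖E s - E s'‖ * Real.exp (K * T) / (β - κ)) := by linarith [h2.2]
          _ = A * ‖E s - E s'‖ := by rw [hA]; ring
      intro s hs s' hs'
      rcases le_total (τ s') (τ s) with h | h
      · exact key' s hs s' hs' h
      · rw [abs_sub_comm, norm_sub_rev]; exact key' s' hs' s hs h
    intro s hs
    rw [ContinuousWithinAt, tendsto_iff_norm_sub_tendsto_zero]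
    have hlim : Tendsto (fun s' => A * ‖E s' - E s‖) (𝓝[Icc s₀ s₁] s) (𝓝 0) := by
      have := ((((hE s hs).tendsto.sub (tendsto_const_nhds (x := E s))).norm).const_mul A)
      rw [sub_self, norm_zero, mul_zero] at this
      exact this
    refine squeeze_zero' (Eventually.of_forall fun _ => norm_nonneg _) ?_ hlim
    filter_upwards [self_mem_nhdsWithin] with s' hs'
    exact key s' hs' s hs
  have hlow' : (ω s₀ (τ s₀)).re - (ρ + s₀) ≤ 0 := by
    have h1 := (hestre s₀ 0 h0T _ (hτ s₀ hs0) (hτ s₀ hs0).1).2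
    have h2 := (hestim s₀ 0 h0T _ (hτ s₀ hs0) (hτ s₀ hs0).1).1
    rw [hω0, sub_zero] at h1 h2
    rw [hτΘ s₀ hs0] at h2
    have h3 : τ s₀ ≤ (Θ - (E s₀).im) / (β - κ) := by rw [le_div_iff₀ hβκ]; linarith
    have h4 : (a + κ) * τ s₀ ≤ (a + κ) * ((Θ - (E s₀).im) / (β - κ)) := by
      gcongr; linarith
    linarith
  have hhigh' : 0 ≤ (ω s₁ (τ s₁)).re - (ρ + s₁) := by
    have h1 := (hestre s₁ 0 h0T _ (hτ s₁ hs1) (hτ s₁ hs1).1).1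
    have h2 := (hestim s₁ 0 h0T _ (hτ s₁ hs1) (hτ s₁ hs1).1).2
    rw [hω0, sub_zero] at h1 h2
    rw [hτΘ s₁ hs1] at h2
    have h3 : (Θ - (E s₁).im) / (β + κ) ≤ τ s₁ := by
      rw [div_le_iff₀ (by linarith)]; linarith
    have h4 : (a - κ) * ((Θ - (E s₁).im) / (β + κ)) ≤ (a - κ) * τ s₁ := by
      gcongr
    linarith
  obtain ⟨s, hss, hsF⟩ := intermediate_value_Icc hs hF ⟨hlow', hhigh'⟩
  simp only at hsF
  refine ⟨s, hss, τ s, (hτ s hss).1, ω s, hω0 s, ?_, fun t ht => ?_⟩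
  · refine Complex.ext ?_ ?_
    · simp; linarith
    · simpa using hτΘ s hss
  have htT : t ∈ Icc 0 T := ⟨ht.1, ht.2.trans (hτ s hss).2⟩
  have h1 := (hestre s 0 h0T t htT ht.1).1
  have h2 := (hestre s t htT _ (hτ s hss) ht.2).1
  rw [hω0, sub_zero] at h1
  have h3 : 0 ≤ (a - κ) * t := mul_nonneg (by linarith) ht.1
  have h4 : 0 ≤ (a - κ) * (τ s - t) := mul_nonneg (by linarith) (by linarith [ht.2])
  have h5 : (ω s t).re ≤ r₁ := by linarith [hss.2]
  refine ⟨by linarith, h5, ?_⟩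
  have hd := (hω s t htT).cexp
  have hcl : clampRe r₀ r₁ (ω s t) = ω s t := clampRe_eq (by linarith [hEr s hss]) h5
  have : Complex.exp (ω s t) * g (ω s t) = f (Complex.exp (ω s t)) := by
    rw [hg, logField, hcl]
    field_simp
  rwa [this] at hd

end LogFlow

/-! ### Continuous logarithms with bounded argument -/

section BoundedLog

/-- `z` has a continuous logarithm on `S` whose imaginary part is bounded. -/
def HasBoundedLog (S : Set ℝ) (z : ℝ → ℂ) : Prop :=
  ∃ (E : ℝ → ℂ) (B : ℝ), ContinuousOn E S ∧ ∀ s ∈ S, Complex.exp (E s) = z s ∧ |(E s).im| ≤ B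

theorem mem_slitPlane_of_norm_sub_one_le {z : ℂ} (hz : ‖z - 1‖ ≤ 1 / 2) : z ∈ Complex.slitPlane := by
  refine Or.inl ?_
  have h1 := (Complex.abs_re_le_norm _).trans hz
  rw [Complex.sub_re, Complex.one_re, abs_le] at h1
  linarith [h1.1]

theorem div_mem_slitPlane {z z' : ℂ} (hz : z ≠ 0) (h : ‖z' - z‖ ≤ 1 / 2 * ‖z‖) :
    z' / z ∈ Complex.slitPlane := by
  refine mem_slitPlane_of_norm_sub_one_le ?_
  have e : z' / z - 1 = (z' - z) / z := by field_simp
  rw [e, norm_div, div_le_iff₀ (norm_pos_iff.mpr hz)]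
  exact h

theorem HasBoundedLog.step {S : Set ℝ} {z z' : ℝ → ℂ} (H : HasBoundedLog S z)
    (hz' : ContinuousOn z' S) (h : ∀ s ∈ S, ‖z' s - z s‖ ≤ 1 / 2 * ‖z s‖) :
    HasBoundedLog S z' := by
  obtain ⟨E, B, hE, hEB⟩ := H
  have hne : ∀ s ∈ S, z s ≠ 0 := fun s hs => by rw [← (hEB s hs).1]; exact Complex.exp_ne_zero _
  have hz : ContinuousOn z S :=
    (Complex.continuous_exp.comp_continuousOn hE).congr fun s hs => (hEB s hs).1.symm
  refine ⟨fun s => E s + Complex.log (z' s / z s), B + Real.pi,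
    hE.add ((hz'.div hz hne).clog fun s hs => div_mem_slitPlane (hne s hs) (h s hs)),
    fun s hs => ⟨?_, ?_⟩⟩
  · have h1 := Complex.slitPlane_ne_zero (div_mem_slitPlane (hne s hs) (h s hs))
    rw [Complex.exp_add, Complex.exp_log h1, (hEB s hs).1, mul_div_cancel₀ _ (hne s hs)]
  · rw [Complex.add_im, Complex.log_im]
    exact (abs_add_le _ _).trans (add_le_add (hEB s hs).2 (Complex.abs_arg_le_pi _))

/-- Transport of a bounded logarithm along a one-parameter family, by small steps. -/
theorem HasBoundedLog.transport {S : Set ℝ} {z : ℝ → ℝ → ℂ} {a b θ : ℝ} (hab : a ≤ b) (hθ : 0 < θ)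
    (hz : ∀ t ∈ Icc a b, ContinuousOn (z t) S)
    (h : ∀ t ∈ Icc a b, ∀ t' ∈ Icc a b, t ≤ t' → t' - t ≤ θ → ∀ s ∈ S,
      ‖z t' s - z t s‖ ≤ 1 / 2 * ‖z t s‖) (H : HasBoundedLog S (z a)) : HasBoundedLog S (z b) := by
  have key : ∀ n : ℕ, ∀ t ∈ Icc a b, t - a ≤ n * θ → HasBoundedLog S (z t) := by
    intro n
    induction n with
    | zero =>
      intro t ht hta
      have : t = a := le_antisymm (by simpa using hta) ht.1
      rwa [this]
    | succ n ih =>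
      intro t ht hta
      push_cast at hta
      have hm : max a (t - θ) ∈ Icc a b := ⟨le_max_left _ _, max_le hab (by linarith [ht.2])⟩
      refine HasBoundedLog.step (ih _ hm ?_) (hz t ht) (h _ hm t ht (max_le ht.1 (by linarith)) ?_)
      · rw [sub_le_iff_le_add]
        refine max_le ?_ (by linarith)
        have : 0 ≤ n * θ := by positivity
        linarith
      · have := le_max_right a (t - θ); linarith
  obtain ⟨n, hn⟩ := exists_nat_ge ((b - a) / θ)
  exact key n b (right_mem_Icc.mpr hab) (by rwa [div_le_iff₀ hθ] at hn)

theorem exp_mul_le_of_steps {g : ℝ → ℝ} {a b C : ℝ} (hab : a ≤ b) (hC : 0 ≤ C)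
    (hg0 : ∀ t ∈ Icc a b, 0 ≤ g t)
    (hg : ∀ s ∈ Icc a b, ∀ t ∈ Icc a b, s ≤ t → (1 - C * (t - s)) * g s ≤ g t) :
    Real.exp (-(2 * C * (b - a))) * g a ≤ g b := by
  obtain ⟨n, hn⟩ := exists_nat_gt (2 * C * (b - a))
  have hba : 0 ≤ b - a := sub_nonneg.mpr hab
  have hn0 : (0 : ℝ) < n := lt_of_le_of_lt (by positivity) hn
  set θ := (b - a) / n with hθ
  have hθ0 : 0 ≤ θ := by positivity
  have hnθ : n * θ = b - a := by rw [hθ]; field_simp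
  have hCθ : C * θ ≤ 1 / 2 := by
    rw [hθ, ← mul_div_assoc, div_le_iff₀ hn0]; linarith
  have h1 : Real.exp (-(2 * (C * θ))) ≤ 1 - C * θ := by
    rw [Real.exp_neg, inv_le_comm₀ (Real.exp_pos _) (by linarith)]
    have h2 := Real.add_one_le_exp (2 * (C * θ))
    refine le_trans ?_ h2
    rw [inv_le_iff_one_le_mul₀ (by linarith)]
    have : 0 ≤ C * θ := by positivity
    nlinarith
  have key : ∀ k : ℕ, k ≤ n → Real.exp (-(2 * (C * θ))) ^ k * g a ≤ g (a + k * θ) := by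
    intro k
    induction k with
    | zero => simp
    | succ k ih =>
      intro hk
      have hk' : (k : ℝ) + 1 ≤ n := by exact_mod_cast hk
      have hk0 : (0 : ℝ) ≤ k := Nat.cast_nonneg k
      have m1 : a + k * θ ∈ Icc a b := ⟨by nlinarith, by nlinarith⟩
      have m2 : a + (k + 1) * θ ∈ Icc a b := ⟨by nlinarith, by nlinarith⟩
      have h2 := hg _ m1 _ m2 (by nlinarith)
      have e : a + (k + 1) * θ - (a + k * θ) = θ := by ring
      rw [e] at h2
      push_cast
      refine le_trans ?_ h2
      rw [pow_succ]
      have h3 := ih (by omega)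
      calc _ = Real.exp (-(2 * (C * θ))) * (Real.exp (-(2 * (C * θ))) ^ k * g a) := by ring
        _ ≤ Real.exp (-(2 * (C * θ))) * g (a + k * θ) := by gcongr
        _ ≤ _ := mul_le_mul_of_nonneg_right h1 (hg0 _ m1)
  have h2 := key n le_rfl
  rw [hnθ, ← Real.exp_nat_mul] at h2
  have e1 : (n : ℝ) * -(2 * (C * θ)) = -(2 * C * (b - a)) := by rw [← hnθ]; ring
  rw [e1, add_sub_cancel] at h2
  exact h2

end BoundedLog

/-! ### Continuous families of projections along a path of directions -/

section ProjectionPath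

variable {E F : Type*} [NormedAddCommGroup E] [InnerProductSpace ℝ E] [NormedAddCommGroup F]
  [NormedSpace ℝ F]

theorem exists_projection_path {u : ℝ → E} {a b : ℝ} (hab : a ≤ b) (hu : Continuous u)
    (hne : ∀ t ∈ Icc a b, u t ≠ 0) (π : E →L[ℝ] F) (hπu : π (u b) = 0)
    (hπ : ∀ x, π x = 0 → ∃ r : ℝ, x = r • u b) :
    ∃ P : ℝ → E →L[ℝ] F, ContinuousOn P (Icc a b) ∧ P b = π ∧ ∀ t ∈ Icc a b, P t (u t) = 0 ∧
      ∀ x, P t x = 0 → ∃ r : ℝ, x = r • u t := by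
  -- nearby directions are not orthogonal
  obtain ⟨θ, hθ, hnear⟩ : ∃ θ > 0, ∀ s ∈ Icc a b, ∀ t ∈ Icc a b, |s - t| ≤ θ →
      inner ℝ (u s) (u t) ≠ 0 := by
    obtain ⟨m, hm, hmin⟩ := isCompact_Icc.exists_isMinOn (nonempty_Icc.mpr hab)
      hu.norm.continuousOn
    have hm0 : 0 < ‖u m‖ := norm_pos_iff.mpr (hne m hm)
    have huc := isCompact_Icc.uniformContinuousOn_of_continuous (hu.continuousOn (s := Icc a b))
    rw [Metric.uniformContinuousOn_iff] at huc
    obtain ⟨θ, hθ, h⟩ := huc ‖u m‖ hm0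
    refine ⟨θ / 2, by positivity, fun s hs t ht hst h0 => ?_⟩
    have h1 := h s hs t ht (by rw [Real.dist_eq]; linarith)
    rw [dist_eq_norm] at h1
    have h2 := norm_sub_sq_real (u s) (u t)
    rw [h0] at h2
    have h3 : ‖u m‖ ≤ ‖u s‖ := hmin hs
    have h4 : ‖u m‖ ≤ ‖u t‖ := hmin ht
    nlinarith [norm_nonneg (u s - u t)]
  have key : ∀ n : ℕ, ∀ a' ∈ Icc a b, b - a' ≤ n * θ →
      ∃ P : ℝ → E →L[ℝ] F, ContinuousOn P (Icc a' b) ∧ P b = π ∧ ∀ t ∈ Icc a' b, P t (u t) = 0 ∧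
        ∀ x, P t x = 0 → ∃ r : ℝ, x = r • u t := by
    intro n
    induction n with
    | zero =>
      intro a' ha' hn
      have : a' = b := le_antisymm ha'.2 (by simpa using hn)
      refine ⟨fun _ => π, continuousOn_const, rfl, fun t ht => ?_⟩
      have htb : t = b := le_antisymm ht.2 (this ▸ ht.1)
      rw [htb]
      exact ⟨hπu, hπ⟩
    | succ n ih =>
      intro a' ha' hn
      push_cast at hn
      set m := min b (a' + θ) with hm
      have hmI : m ∈ Icc a b := ⟨le_min hab (by linarith [ha'.1]), min_le_left _ _⟩
      have ham : a' ≤ m := le_min ha'.2 (by linarith)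
      obtain ⟨P, hPc, hPb, hP⟩ := ih m hmI (by
        rw [sub_le_iff_le_add, ← sub_le_iff_le_add']
        refine le_min ?_ (by linarith)
        have : 0 ≤ n * θ := by positivity
        linarith)
      have hmm : m ∈ Icc m b := left_mem_Icc.mpr hmI.2
      set Q : ℝ → E →L[ℝ] F := fun t => P (max t m) -
        ((inner ℝ (u m) (u (min t m)))⁻¹ • innerSL ℝ (u m)).smulRight (P m (u (min t m))) with hQ
      have hmin : ∀ t ∈ Icc a' b, min t m ∈ Icc a b ∧ |m - min t m| ≤ θ := by
        intro t ht
        refine ⟨⟨le_min (ha'.1.trans ht.1) hmI.1, (min_le_left _ _).trans ht.2⟩, ?_⟩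
        rw [abs_of_nonneg (sub_nonneg.mpr (min_le_right _ _)), sub_le_comm]
        refine le_min ?_ (by linarith)
        have := min_le_right b (a' + θ)
        linarith [ht.1]
      have hQge : ∀ t, m ≤ t → Q t = P t := by
        intro t ht
        simp only [hQ, max_eq_left ht, min_eq_right ht, (hP m hmm).1]
        ext x; simp
      refine ⟨Q, ?_, ?_, fun t ht => ?_⟩
      · refine ContinuousOn.sub ?_ ?_
        · refine hPc.comp (by fun_prop) fun t ht => ⟨le_max_right _ _, max_le ht.2 hmI.2⟩
        · have h1 : ContinuousOn (fun t => (inner ℝ (u m) (u (min t m)))⁻¹) (Icc a' b) := by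
            refine ContinuousOn.inv₀ (by fun_prop) fun t ht => ?_
            exact hnear m hmI _ (hmin t ht).1 (hmin t ht).2
          have h2 : Continuous fun t => P m (u (min t m)) := by fun_prop
          have h3 : ContinuousOn (fun t => (inner ℝ (u m) (u (min t m)))⁻¹ • innerSL ℝ (u m))
            (Icc a' b) := h1.smul continuousOn_const
          exact ((ContinuousLinearMap.smulRightL ℝ E F).continuous.comp_continuousOn h3).clm_apply
            h2.continuousOn
      · rw [hQge b hmI.2, hPb]
      · rcases le_total m t with hmt | hmt
        · rw [hQge t hmt]; exact hP t ⟨hmt, ht.2⟩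
        · have h0 := hnear m hmI _ (hmin t ht).1 (hmin t ht).2
          simp only [hQ, max_eq_right hmt, min_eq_left hmt] at h0 ⊢
          simp only [_root_.sub_apply, ContinuousLinearMap.smulRight_apply,
            _root_.smul_apply, innerSL_apply_apply, smul_eq_mul]
          refine ⟨by rw [inv_mul_cancel₀ h0, one_smul, sub_self], fun x hx => ?_⟩
          rw [← map_smul, ← map_sub] at hx
          obtain ⟨r, hr⟩ := (hP m hmm).2 _ hx
          set k := (inner ℝ (u m) (u t))⁻¹ * inner ℝ (u m) x with hk
          have h1 : inner ℝ (u m) (x - k • u t) = 0 := by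
            rw [inner_sub_right, inner_smul_right, hk]; field_simp; ring
          rw [hr, inner_smul_right] at h1
          have h2 : inner ℝ (u m) (u m) ≠ 0 := inner_self_ne_zero.mpr (hne m hmI)
          have h3 : r = 0 := by
            rcases mul_eq_zero.mp h1 with h | h
            · exact h
            · exact absurd h h2
          rw [h3, zero_smul, sub_eq_zero] at hr
          exact ⟨k, hr⟩
  obtain ⟨n, hn⟩ := exists_nat_ge ((b - a) / θ)
  exact key n a (left_mem_Icc.mpr hab) (by rwa [div_le_iff₀ hθ] at hn)

theorem exists_projection_bound [FiniteDimensional ℝ E] {u : ℝ → E} {a b : ℝ} (hu : Continuous u)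
    (hne : ∀ t ∈ Icc a b, u t ≠ 0) {P : ℝ → E →L[ℝ] F} (hPc : ContinuousOn P (Icc a b))
    (hP : ∀ t ∈ Icc a b, P t (u t) = 0 ∧ ∀ x, P t x = 0 → ∃ r : ℝ, x = r • u t) :
    ∃ C > 0, ∀ t ∈ Icc a b, ∀ x, ∃ k : ℝ, |k| ≤ C * ‖x‖ ∧ ‖x - k • u t‖ ≤ C * ‖P t x‖ := by
  set S : Set (ℝ × E) := (Icc a b ×ˢ Metric.sphere 0 1) ∩ {y | inner ℝ (u y.1) y.2 = 0} with hS
  have hSc : IsCompact S := (isCompact_Icc.prod (isCompact_sphere 0 1)).inter_right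
    (isClosed_eq (by fun_prop) continuous_const)
  have hf : ContinuousOn (fun y : ℝ × E => ‖P y.1 y.2‖) S := by
    refine ContinuousOn.norm (ContinuousOn.clm_apply ?_ continuousOn_snd)
    exact hPc.comp continuousOn_fst fun y hy => hy.1.1
  have hpos : ∀ y ∈ S, 0 < ‖P y.1 y.2‖ := by
    rintro ⟨t, x⟩ ⟨⟨ht, hx⟩, hin⟩
    refine norm_pos_iff.mpr fun h0 => ?_
    obtain ⟨r, hr⟩ := (hP t ht).2 x h0
    have hx1 : ‖x‖ = 1 := by simpa using hx
    change inner ℝ (u t) x = 0 at hin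
    have h1 : inner ℝ (u t) (u t) ≠ 0 := inner_self_ne_zero.mpr (hne t ht)
    rw [hr, inner_smul_right] at hin
    rcases mul_eq_zero.mp hin with h | h
    · rw [hr, h, zero_smul, norm_zero] at hx1; norm_num at hx1
    · exact h1 h
  obtain ⟨m, hm, hmS⟩ : ∃ m > 0, ∀ y ∈ S, m ≤ ‖P y.1 y.2‖ := by
    rcases S.eq_empty_or_nonempty with he | hSn
    · exact ⟨1, one_pos, fun y hy => by rw [he] at hy; exact absurd hy (notMem_empty y)⟩
    · obtain ⟨y, hy, hmin⟩ := hSc.exists_isMinOn hSn hf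
      exact ⟨_, hpos y hy, fun y' hy' => hmin hy'⟩
  obtain ⟨d, hd, hdu⟩ : ∃ d > 0, ∀ t ∈ Icc a b, d ≤ ‖u t‖ := by
    rcases (Icc a b).eq_empty_or_nonempty with he | hn
    · exact ⟨1, one_pos, fun y hy => by rw [he] at hy; exact absurd hy (notMem_empty y)⟩
    · obtain ⟨t, ht, hmin⟩ := isCompact_Icc.exists_isMinOn hn hu.norm.continuousOn
      exact ⟨_, norm_pos_iff.mpr (hne t ht), fun y hy => hmin hy⟩
  refine ⟨max (1 / d) (1 / m), by positivity, fun t ht x => ?_⟩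
  have hut : 0 < ‖u t‖ := hd.trans_le (hdu t ht)
  set k := inner ℝ (u t) x / ‖u t‖ ^ 2 with hk
  refine ⟨k, ?_, ?_⟩
  · have h1 := abs_real_inner_le_norm (u t) x
    rw [hk, abs_div, abs_of_pos (by positivity : 0 < ‖u t‖ ^ 2), div_le_iff₀ (by positivity)]
    refine h1.trans ?_
    have h2 : 1 ≤ max (1 / d) (1 / m) * ‖u t‖ := by
      have : 1 / d * ‖u t‖ ≥ 1 := by rw [ge_iff_le, one_div, ← div_eq_inv_mul, le_div_iff₀ hd]; linarith [hdu t ht]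
      exact this.trans (mul_le_mul_of_nonneg_right (le_max_left _ _) hut.le)
    have h3 : 0 ≤ ‖u t‖ * ‖x‖ := by positivity
    calc ‖u t‖ * ‖x‖ ≤ (max (1 / d) (1 / m) * ‖u t‖) * (‖u t‖ * ‖x‖) := le_mul_of_one_le_left h3 h2
      _ = _ := by ring
  · set y := x - k • u t with hy
    have hPy : P t y = P t x := by rw [hy, map_sub, map_smul, (hP t ht).1, smul_zero, sub_zero]
    have hin : inner ℝ (u t) y = 0 := by
      rw [hy, inner_sub_right, inner_smul_right, real_inner_self_eq_norm_sq, hk]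
      field_simp
      ring
    rcases eq_or_ne y 0 with h0 | h0
    · rw [h0, norm_zero]; positivity
    · have hyn : 0 < ‖y‖ := norm_pos_iff.mpr h0
      have h1 := hmS (t, ‖y‖⁻¹ • y) ⟨⟨ht, by simp [norm_smul, hyn.ne']⟩, by
        change inner ℝ (u t) (‖y‖⁻¹ • y) = 0
        rw [inner_smul_right, hin, mul_zero]⟩
      simp only [map_smul, norm_smul, norm_inv, norm_norm, hPy] at h1
      rw [← div_eq_inv_mul, le_div_iff₀ hyn] at h1
      calc ‖y‖ = 1 / m * (m * ‖y‖) := by field_simp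
        _ ≤ 1 / m * ‖P t x‖ := by gcongr
        _ ≤ _ := mul_le_mul_of_nonneg_right (le_max_right _ _) (norm_nonneg _)

end ProjectionPath

namespace PWField

namespace Controlled

variable {h : E3 → ℝ} {Z : PWField} {K : Set E3} {L c ρ : ℝ}

theorem lipschitzOnWith_comp (H : Controlled h Z K L c ρ) {x : ℝ → E3} {a b : ℝ}
    (hx : LocallyLipschitz x) (hxK : ∀ t ∈ Icc a b, x t ∈ K) :
    ∃ C, LipschitzOnWith C (fun t => h (x t)) (Icc a b) := by
  obtain ⟨C, hC⟩ := LocallyLipschitz.exists_lipschitzOnWith_Icc hx a b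
  have hL : 0 ≤ L := zero_le_one.trans H.one_le
  refine ⟨⟨L, hL⟩ * C, LipschitzOnWith.of_dist_le_mul fun s hs t ht => ?_⟩
  have h1 := H.lip_h _ (hxK s hs) _ (hxK t ht)
  have h2 := hC.dist_le_mul s hs t ht
  rw [dist_eq_norm] at h2
  rw [Real.dist_eq]
  change _ ≤ L * C * _
  rw [mul_assoc]
  exact h1.trans (mul_le_mul_of_nonneg_left h2 hL)

/-- Where `Xh < 0 < Yh`, trajectories are attracted by the switching surface. -/
theorem abs_h_le (H : Controlled h Z K L c ρ) {x : ℝ → E3} {η a b m : ℝ} (hab : a ≤ b)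
    (hm : 0 ≤ m) (hx : Follows h Z η a b x)
    (hxK : ∀ t ∈ Icc a b, x t ∈ K ∧ lieDeriv Z.X h (x t) ≤ -(m + L * η) ∧
      m + L * η ≤ lieDeriv Z.Y h (x t)) :
    |h (x b)| ≤ max (|h (x a)| - m * (b - a)) 0 := by
  obtain ⟨C, hC⟩ := H.lipschitzOnWith_comp hx.1 fun t ht => (hxK t ht).1
  have hL : 0 ≤ L := zero_le_one.trans H.one_le
  have hder : ∀ t ∈ Ioo a b, ∀ v w d : E3, True → ‖v - w‖ ≤ η →
      |fderiv ℝ h (x t) v - fderiv ℝ h (x t) w| ≤ L * η := by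
    intro t ht v w _ _ hvw
    rw [← map_sub, ← Real.norm_eq_abs]
    refine ((fderiv ℝ h (x t)).le_of_opNorm_le (H.dh_le _ (hxK t (Ioo_subset_Icc_self ht)).1)
      (v - w)).trans (mul_le_mul_of_nonneg_left hvw hL)
  have h1 := le_max_of_ae_hasDerivAt hab hm ⟨C, hC⟩ (by
    filter_upwards [hx.2] with t ht htab hpos d hd
    obtain ⟨v, hv, l, hl, hle⟩ := ht htab
    obtain ⟨hK, hX, hY⟩ := hxK t (Ioo_subset_Icc_self htab)
    have hd' := ((H.differentiableAt _ hK).hasFDerivAt.comp_hasDerivAt t hv).unique hd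
    have hl1 := hl.2.1 hpos
    subst hl1
    have e : blend Z 1 (x t) = Z.X (x t) := by simp [blend]
    rw [e] at hle
    have h2 := hder t htab _ _ 0 trivial hle
    rw [abs_le] at h2
    change _ ≤ -(m + L * η) at hX
    rw [lieDeriv] at hX
    linarith [h2.2])
  have h2 := le_max_of_ae_hasDerivAt (u := fun t => - h (x t)) hab hm ⟨C, hC.neg⟩ (by
    filter_upwards [hx.2] with t ht htab hpos d hd
    obtain ⟨v, hv, l, hl, hle⟩ := ht htab
    obtain ⟨hK, hX, hY⟩ := hxK t (Ioo_subset_Icc_self htab)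
    have hd' := (((H.differentiableAt _ hK).hasFDerivAt.comp_hasDerivAt t hv).neg).unique hd
    have hl1 := hl.2.2 (by linarith)
    subst hl1
    have e : blend Z 0 (x t) = Z.Y (x t) := by simp [blend]
    rw [e] at hle
    have h2 := hder t htab _ _ 0 trivial hle
    rw [abs_le] at h2
    rw [lieDeriv] at hY
    linarith [h2.1])
  have h3 := le_abs_self (h (x a))
  have h4 := neg_abs_le (h (x a))
  refine abs_le'.mpr ⟨h1.trans (max_le_max ?_ le_rfl), h2.trans (max_le_max ?_ le_rfl)⟩ <;> linarith

/-- The constant in the estimate of the change of the displacement over a short time. -/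
noncomputable def stepConst (L c ρ T : ℝ) : ℝ :=
  ((1 + 2 * L / c) * rate L c ρ + L) * flowConst L c ρ T

theorem stepConst_pos (H : Controlled h Z K L c ρ) {T : ℝ} (hT : 0 ≤ T) :
    0 < stepConst L c ρ T := by
  have := H.one_le; have := H.c_pos; have := H.rate_pos
  have := H.one_le_flowConst hT
  unfold stepConst
  positivity

/-- Over a short time, the displacement between two trajectories changes little, if initially they
are at the same height or if they stay above the switching surface. -/
theorem step_le (H : Controlled h Z K L c ρ) {x y : ℝ → E3} {s t T : ℝ} (hst : s ≤ t)
    (hT : t - s ≤ T) (hx : Follows h Z 0 s t x) (hy : Follows h Z 0 s t y)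
    (hxK : ∀ r ∈ Icc s t, x r ∈ K) (hyK : ∀ r ∈ Icc s t, y r ∈ K)
    (hc : h (x s) = h (y s) ∨ ∀ r ∈ Icc s t, 0 < h (x r) ∧ 0 < h (y r)) :
    ‖(x t - y t) - (x s - y s)‖ ≤ stepConst L c ρ T * (t - s) * ‖x s - y s‖ := by
  have hL := H.one_le
  have hc0 := H.c_pos
  have hr := H.rate_pos
  have hT0 : 0 ≤ T := (sub_nonneg.mpr hst).trans hT
  have hF := H.one_le_flowConst hT0
  have hB : ∀ r ∈ Icc s t, ‖x r - y r‖ ≤ flowConst L c ρ T * ‖x s - y s‖ := by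
    intro r hr
    have h1 := H.norm_sub_le le_rfl zero_le_one hr.1 (hx.mono le_rfl le_rfl hr.2)
      (hy.mono le_rfl le_rfl hr.2) (fun r' hr' => hxK r' ⟨hr'.1, hr'.2.trans hr.2⟩)
      (fun r' hr' => hyK r' ⟨hr'.1, hr'.2.trans hr.2⟩)
    rw [add_zero] at h1
    refine h1.trans (mul_le_mul_of_nonneg_right ?_ (norm_nonneg _))
    exact H.flowConst_mono (sub_nonneg.mpr hr.1) (by linarith [hr.2])
  have hts : 0 ≤ t - s := sub_nonneg.mpr hst
  rcases hc with hc | hc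
  · have h1 := H.displacement_le (ContinuousLinearMap.id ℝ E3) le_rfl zero_le_one hst hx hy hxK hyK
      (κ := 2 * L) (fun r hr => by
        have := _root_.norm_sub_le (Z.X (x r)) (Z.Y (x r))
        have := H.X_le _ (hxK r hr)
        have := H.Y_le _ (hxK r hr)
        simp only [ContinuousLinearMap.coe_id', id_eq]
        linarith) hB
    have hid : ‖ContinuousLinearMap.id ℝ E3‖ ≤ 1 := ContinuousLinearMap.norm_id_le
    simp only [ContinuousLinearMap.coe_id', id_eq, hc, sub_self, abs_zero, mul_zero, zero_add,
      add_zero] at h1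
    refine h1.trans ?_
    unfold stepConst
    calc _ ≤ (1 + 2 * L / c) * rate L c ρ * (flowConst L c ρ T * ‖x s - y s‖) * (t - s) := by
          gcongr
      _ ≤ ((1 + 2 * L / c) * rate L c ρ + L) * (flowConst L c ρ T * ‖x s - y s‖) * (t - s) := by
          gcongr; linarith
      _ = _ := by ring
  · obtain ⟨C1, hC1⟩ := LocallyLipschitz.exists_lipschitzOnWith_Icc hx.1 s t
    obtain ⟨C2, hC2⟩ := LocallyLipschitz.exists_lipschitzOnWith_Icc hy.1 s t
    have h1 := norm_sub_le_of_ae_hasDerivAt (B := L * (flowConst L c ρ T * ‖x s - y s‖)) hst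
      ⟨_, hC1.sub hC2⟩ (by
        filter_upwards [hx.2, hy.2] with r hr1 hr2 hr
        obtain ⟨v, hv, l, hl, hle⟩ := hr1 hr
        obtain ⟨w, hw, l', hl', hle'⟩ := hr2 hr
        have hrI := Ioo_subset_Icc_self hr
        have e1 := hl.2.1 (hc r hrI).1
        have e2 := hl'.2.1 (hc r hrI).2
        subst e1 e2
        rw [norm_le_zero_iff, sub_eq_zero] at hle hle'
        refine ⟨v - w, hv.sub hw, ?_⟩
        rw [hle, hle']
        simp only [blend, one_smul, sub_self, zero_smul, add_zero]
        exact (H.lip_X _ (hxK r hrI) _ (hyK r hrI)).trans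
          (mul_le_mul_of_nonneg_left (hB r hrI) (by linarith)))
    refine h1.trans ?_
    unfold stepConst
    have h2 : 0 ≤ (1 + 2 * L / c) * rate L c ρ := by positivity
    calc _ = L * (flowConst L c ρ T * ‖x s - y s‖) * (t - s) := rfl
      _ ≤ ((1 + 2 * L / c) * rate L c ρ + L) * (flowConst L c ρ T * ‖x s - y s‖) * (t - s) := by
          gcongr; linarith
      _ = _ := by ring

end Controlled

/-- A trajectory in `K` over `[a, t₁]` that slides up to the time `-δ` and is above the switching
surface from the time `δ` on. -/
structure Takeoff (h : E3 → ℝ) (Z : PWField) (K : Set E3) (a δ t₁ : ℝ) (x : ℝ → E3) : Prop where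
  follows : Follows h Z 0 a t₁ x
  mem : ∀ t ∈ Icc a t₁, x t ∈ K
  slide : ∀ t ∈ Icc a (-δ), h (x t) = 0
  fly : ∀ t ∈ Icc δ t₁, 0 < h (x t)

namespace Takeoff

variable {h : E3 → ℝ} {Z : PWField} {K : Set E3} {L c ρ a δ t₁ T : ℝ} {x y : ℝ → E3}

theorem step_le (hx : Takeoff h Z K a δ t₁ x) (hy : Takeoff h Z K a δ t₁ y)
    (H : Controlled h Z K L c ρ) (hT : t₁ - a ≤ T) {s t : ℝ} (hs : a ≤ s) (hst : s ≤ t)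
    (ht : t ≤ t₁) (hsδ : s ≤ -δ ∨ δ ≤ s) :
    ‖(x t - y t) - (x s - y s)‖ ≤ Controlled.stepConst L c ρ T * (t - s) * ‖x s - y s‖ := by
  refine H.step_le hst (by linarith) (hx.follows.mono le_rfl hs ht)
    (hy.follows.mono le_rfl hs ht) (fun r hr => hx.mem r ⟨hs.trans hr.1, hr.2.trans ht⟩)
    (fun r hr => hy.mem r ⟨hs.trans hr.1, hr.2.trans ht⟩) ?_
  rcases hsδ with h1 | h1
  · exact Or.inl (by rw [hx.slide s ⟨hs, h1⟩, hy.slide s ⟨hs, h1⟩])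
  · exact Or.inr fun r hr => ⟨hx.fly r ⟨h1.trans hr.1, hr.2.trans ht⟩,
      hy.fly r ⟨h1.trans hr.1, hr.2.trans ht⟩⟩

/-- Trajectories do not merge before landing. -/
theorem norm_sub_ge (hx : Takeoff h Z K a δ t₁ x) (hy : Takeoff h Z K a δ t₁ y)
    (H : Controlled h Z K L c ρ) (hT : t₁ - a ≤ T) (hδ : 0 < δ) (haδ : a ≤ -δ) (hδt : δ ≤ t₁)
    (hδC : Controlled.stepConst L c ρ T * (2 * δ) ≤ 1 / 2)
    {t : ℝ} (hta : a ≤ t) (ht : t ≤ t₁) (htδ : t ≤ -δ ∨ δ ≤ t) :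
    1 / 2 * Real.exp (-(2 * Controlled.stepConst L c ρ T * T)) * ‖x a - y a‖ ≤ ‖x t - y t‖ := by
  have hT0 : 0 ≤ T := by linarith
  set C := Controlled.stepConst L c ρ T with hC
  have hC0 : 0 < C := H.stepConst_pos hT0
  have hstep : ∀ s t, a ≤ s → s ≤ t → t ≤ t₁ → (s ≤ -δ ∨ δ ≤ s) →
      (1 - C * (t - s)) * ‖x s - y s‖ ≤ ‖x t - y t‖ := by
    intro s t h1 h2 h3 h4
    have h5 := hx.step_le hy H hT h1 h2 h3 h4
    have h6 := norm_sub_norm_le (x s - y s) (x t - y t)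
    rw [norm_sub_rev (x s - y s) (x t - y t)] at h6
    rw [← hC] at h5
    linarith
  have hslide : ∀ t, a ≤ t → t ≤ -δ →
      Real.exp (-(2 * C * (t - a))) * ‖x a - y a‖ ≤ ‖x t - y t‖ := by
    intro t h1 h2
    exact exp_mul_le_of_steps (g := fun t => ‖x t - y t‖) h1 hC0.le (fun _ _ => norm_nonneg _)
      fun s hs r hr hsr => hstep s r hs.1 hsr (by linarith [hr.2]) (Or.inl (hs.2.trans h2))
  have hN := norm_nonneg (x a - y a)
  rcases htδ with h1 | h1
  · refine le_trans ?_ (hslide t hta h1)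
    refine mul_le_mul_of_nonneg_right ?_ hN
    have : Real.exp (-(2 * C * T)) ≤ Real.exp (-(2 * C * (t - a))) := by
      refine Real.exp_le_exp.mpr (neg_le_neg ?_)
      gcongr; linarith
    linarith [Real.exp_pos (-(2 * C * T))]
  · have h2 := hslide (-δ) haδ le_rfl
    have h3 := hstep (-δ) δ haδ (by linarith) hδt (Or.inl le_rfl)
    have h4 := exp_mul_le_of_steps (g := fun t => ‖x t - y t‖) h1 hC0.le (fun _ _ => norm_nonneg _)
      fun s hs r hr hsr => hstep s r (by linarith [hs.1]) hsr (hr.2.trans ht) (Or.inr hs.1)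
    have h5 : 1 / 2 * ‖x (-δ) - y (-δ)‖ ≤ ‖x δ - y δ‖ := by
      refine le_trans (mul_le_mul_of_nonneg_right ?_ (norm_nonneg _)) h3
      have : δ - -δ = 2 * δ := by ring
      rw [this]; linarith
    refine le_trans ?_ h4
    calc _ ≤ 1 / 2 * (Real.exp (-(2 * C * (t - δ))) * Real.exp (-(2 * C * (-δ - a)))) *
          ‖x a - y a‖ := by
          rw [← Real.exp_add]
          gcongr
          nlinarith
      _ = Real.exp (-(2 * C * (t - δ))) * (1 / 2 * (Real.exp (-(2 * C * (-δ - a))) *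
          ‖x a - y a‖)) := by ring
      _ ≤ Real.exp (-(2 * C * (t - δ))) * (1 / 2 * ‖x (-δ) - y (-δ)‖) := by gcongr
      _ ≤ _ := by gcongr

end Takeoff

end PWField

theorem HasBoundedLog.of_hasDerivAt {z : ℝ → ℂ} {ζ : ℂ} (hz : HasDerivAt z ζ 0) (h0 : z 0 = 0)
    (hζ : ζ ≠ 0) : ∃ s₁ > 0, ∀ s₂ ≤ s₁, ContinuousOn z (Ioc 0 s₂) → HasBoundedLog (Ioc 0 s₂) z := by
  have hζ' : 0 < ‖ζ‖ := norm_pos_iff.mpr hζ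
  have h1 := (hasDerivAt_iff_isLittleO.mp hz).def (half_pos hζ')
  obtain ⟨s₁, hs₁, hb⟩ := Metric.eventually_nhds_iff.mp h1
  refine ⟨s₁ / 2, by positivity, fun s₂ hs₂ hc => ?_⟩
  refine HasBoundedLog.step (z := fun s => s * ζ) ⟨fun s => Real.log s + Complex.log ζ,
    |(Complex.log ζ).im|, ?_, fun s hs => ⟨?_, ?_⟩⟩ hc fun s hs => ?_
  · refine ContinuousOn.add ?_ continuousOn_const
    refine Complex.continuous_ofReal.comp_continuousOn ?_
    exact Real.continuousOn_log.mono fun s hs => hs.1.ne'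
  · rw [Complex.exp_add, Complex.exp_log hζ, ← Complex.ofReal_exp, Real.exp_log hs.1]
  · simp
  · have h2 := hb (y := s) (by rw [Real.dist_eq, sub_zero, abs_of_pos hs.1]; linarith [hs.2])
    simp only [h0, sub_zero, Complex.real_smul] at h2
    rw [norm_mul, Complex.norm_real]
    linarith

/-- A positive continuous function on a compact set is uniformly positive nearby. -/
theorem IsCompact.exists_margin {Q U : Set E3} {f : E3 → ℝ} (hQ : IsCompact Q) (hU : IsOpen U)
    (hQU : Q ⊆ U) (hf : ContinuousOn f U) (hpos : ∀ x ∈ Q, 0 < f x) :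
    ∃ m > 0, ∃ ε > 0, ∀ x ∈ Q, ∀ y, ‖y - x‖ ≤ ε → m ≤ f y := by
  obtain ⟨m, hm, hmQ⟩ : ∃ m > 0, ∀ x ∈ Q, m ≤ f x := by
    rcases Q.eq_empty_or_nonempty with he | hn
    · exact ⟨1, one_pos, fun y hy => by rw [he] at hy; exact absurd hy (notMem_empty y)⟩
    · obtain ⟨x, hx, hmin⟩ := hQ.exists_isMinOn hn (hf.mono hQU)
      exact ⟨_, hpos x hx, fun y hy => hmin hy⟩
  have ho : IsOpen (U ∩ f ⁻¹' Ioi (m / 2)) := hf.isOpen_inter_preimage hU isOpen_Ioi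
  obtain ⟨ε, hε, hsub⟩ := hQ.exists_cthickening_subset_open ho fun x hx =>
    ⟨hQU hx, by have := hmQ x hx; simp only [mem_preimage, mem_Ioi]; linarith⟩
  refine ⟨m / 2, by positivity, ε, hε, fun x hx y hy => ?_⟩
  have := hsub (Metric.mem_cthickening_of_dist_le y x ε Q hx (by rwa [dist_eq_norm]))
  exact this.2.le

namespace PWField

/-- A sliding Shilnikov connection together with coordinates at its focus. -/
structure SaddleFocus (U : Set E3) (h : E3 → ℝ) (Z : PWField) (p q : E3) (σ ξ : ℝ → E3) (t₀ : ℝ)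
    (π : E3 →L[ℝ] ℂ) (ι : ℂ →L[ℝ] E3) (ψ : ℂ → E3) (r Cψ r' a β : ℝ) : Prop where
  conn : Connection U h Z p q σ ξ t₀
  coord : TangentCoord h Z p π ι
  chart : SurfaceChart U h Z p π ψ r Cψ r'
  a_pos : 0 < a
  β_pos : 0 < β
  asymp : ∀ κ > 0, ∃ r₁ > 0, r₁ ≤ r ∧ ∀ w, ‖w‖ < r₁ →
    ‖π (slidingField h Z (ψ w)) - (a + β * Complex.I) * w‖ ≤ κ * ‖w‖

namespace Connection

variable {U : Set E3} {h : E3 → ℝ} {Z : PWField} {p q : E3} {σ ξ : ℝ → E3} {t₀ : ℝ}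

/-- A compact neighbourhood of the connection on which the system is controlled. -/
theorem exists_controlled (C : Connection U h Z p q σ ξ t₀) {G : Set E3}
    (hG : G ∈ 𝓝ˢ (range (loop p σ ξ t₀))) :
    ∃ R > 0, ∃ K, K = Metric.cthickening R (range (loop p σ ξ t₀)) ∧ IsCompact K ∧ K ⊆ G ∧ K ⊆ U ∧
      (∀ x ∈ K, h x = 0 → 0 < lieDeriv Z.Y h x ∧ 0 < lieDeriv Z.Y h x - lieDeriv Z.X h x) ∧
      ∃ L c ρ, Controlled h Z K L c ρ := by
  obtain ⟨R, hR, h1, h2, h3⟩ := C.exists_cthickening hG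
  have hc : IsCompact (Metric.cthickening R (range (loop p σ ξ t₀))) :=
    C.isCompact_range_loop.cthickening
  exact ⟨R, hR, _, rfl, hc, h1, h2, h3, PWField.exists_controlled C.isOpen C.smooth C.lip_X C.lip_Y
    hc h2 fun x hx hx0 => (h3 x hx hx0).2⟩

theorem mem_cthickening (t : ℝ) {R : ℝ} {x : E3} (hx : ‖x - loop p σ ξ t₀ t‖ ≤ R) :
    x ∈ Metric.cthickening R (range (loop p σ ξ t₀)) :=
  Metric.mem_cthickening_of_dist_le _ _ _ _ (mem_range_self t) (by rwa [dist_eq_norm])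

theorem loop_eq_of_follows_const (C : Connection U h Z p q σ ξ t₀) {t t' : ℝ} (htt : t ≤ t')
    (hf : Follows h Z 0 t t' fun _ => loop p σ ξ t₀ t) :
    loop p σ ξ t₀ t' = loop p σ ξ t₀ t := by
  obtain ⟨R, hR, K, hK, -, -, -, -, L, c, ρ, H⟩ := C.exists_controlled univ_mem
  have hmem : ∀ s, loop p σ ξ t₀ s ∈ K := fun s => by
    rw [hK]; exact mem_cthickening s (by rw [sub_self, norm_zero]; exact hR.le)
  have := H.norm_sub_le le_rfl zero_le_one htt (C.follows_loop t t') hf (fun s _ => hmem s)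
    fun s _ => hmem t
  rw [sub_self, norm_zero, add_zero, mul_zero] at this
  exact sub_eq_zero.mp (norm_le_zero_iff.mp this)

theorem loopVel_ne_zero (C : Connection U h Z p q σ ξ t₀) {t : ℝ} (ht : t ≤ t₀) :
    loopVel h Z p σ ξ t₀ t ≠ 0 := by
  intro h0
  rcases lt_trichotomy t 0 with h1 | h1 | h1
  · rw [loopVel_nonpos h1.le] at h0
    obtain ⟨h2, h3⟩ := C.lieDeriv_loop h1.le
    have h4 := C.loop_eq_of_follows_const (t := t) (t' := t₀ / 2) (by linarith [C.t₀_pos])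
      (follows_const (C.h_loop_nonpos h1.le) h2 h3 h0 _ _)
    have h5 := C.h_loop_pos (t := t₀ / 2) ⟨by linarith [C.t₀_pos], by linarith [C.t₀_pos]⟩
    rw [h4, C.h_loop_nonpos h1.le] at h5
    exact lt_irrefl _ h5
  · rw [h1, C.loopVel_zero] at h0
    have := C.XXh_q
    rw [lieDeriv, h0, map_zero] at this
    exact lt_irrefl _ this
  · rw [C.loopVel_nonneg h1.le] at h0
    rcases ht.lt_or_eq with h2 | h2
    · have h3 := C.h_loop_pos ⟨h1, h2⟩
      have h4 := C.loop_eq_of_follows_const h2.le (follows_const_of_pos h3 h0 _ _)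
      rw [← h4, C.h_loop_ge le_rfl] at h3
      exact lt_irrefl _ h3
    · rw [C.loop_ge h2.ge] at h0
      have := C.p_mem.2.1
      rw [lieDeriv, h0, map_zero] at this
      exact lt_irrefl _ this

theorem loop_ne_p (C : Connection U h Z p q σ ξ t₀) {t : ℝ} (ht : t ≤ 0) :
    loop p σ ξ t₀ t ≠ p := by
  intro h0
  refine C.loopVel_ne_zero (t := t) (by linarith [C.t₀_pos]) ?_
  rw [loopVel_nonpos ht, h0, C.p_zero]

/-- Where the loop is transversal to the switching surface from both sides, nearby approximate
trajectories are attracted by the surface. -/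
theorem exists_attraction (C : Connection U h Z p q σ ξ t₀) {K : Set E3} {L c ρ R : ℝ}
    (H : Controlled h Z K L c ρ) (hR : 0 < R)
    (hK : Metric.cthickening R (range (loop p σ ξ t₀)) ⊆ K) {a' b' : ℝ}
    (hX : ∀ t ∈ Icc a' b', lieDeriv Z.X h (loop p σ ξ t₀ t) < 0)
    (hY : ∀ t ∈ Icc a' b', 0 < lieDeriv Z.Y h (loop p σ ξ t₀ t)) :
    ∃ m > 0, ∃ ε > 0, (∀ t ∈ Icc a' b', ∀ y, ‖y - loop p σ ξ t₀ t‖ ≤ ε →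
        lieDeriv Z.X h y ≤ -m ∧ m ≤ lieDeriv Z.Y h y) ∧
      ∀ η ≤ ε, ∀ x s t, a' ≤ s → s ≤ t → t ≤ b' → Follows h Z η s t x →
      (∀ r ∈ Icc s t, ‖x r - loop p σ ξ t₀ r‖ ≤ ε) → |h (x t)| ≤ max (|h (x s)| - m * (t - s)) 0 := by
  have hQ : IsCompact (loop p σ ξ t₀ '' Icc a' b') := isCompact_Icc.image C.continuous_loop
  have hQU : loop p σ ξ t₀ '' Icc a' b' ⊆ U := by rintro _ ⟨t, -, rfl⟩; exact C.loop_mem t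
  obtain ⟨m₁, hm₁, ε₁, hε₁, h1⟩ := hQ.exists_margin C.isOpen hQU
    (continuousOn_lieDeriv C.isOpen C.smooth C.lip_X.continuousOn).neg
    (by rintro _ ⟨t, ht, rfl⟩; exact neg_pos.mpr (hX t ht))
  obtain ⟨m₂, hm₂, ε₂, hε₂, h2⟩ := hQ.exists_margin C.isOpen hQU
    (continuousOn_lieDeriv C.isOpen C.smooth C.lip_Y.continuousOn)
    (by rintro _ ⟨t, ht, rfl⟩; exact hY t ht)
  set m := min m₁ m₂ with hm
  have hm0 : 0 < m := lt_min hm₁ hm₂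
  have hL : 0 < L := zero_lt_one.trans_le H.one_le
  have hXY : ∀ t ∈ Icc a' b', ∀ y, ‖y - loop p σ ξ t₀ t‖ ≤ min ε₁ ε₂ →
      lieDeriv Z.X h y ≤ -m ∧ m ≤ lieDeriv Z.Y h y := by
    intro t ht y hy
    have e1 := h1 _ (mem_image_of_mem _ ht) y (hy.trans (min_le_left _ _))
    have e2 := h2 _ (mem_image_of_mem _ ht) y (hy.trans (min_le_right _ _))
    have := min_le_left m₁ m₂
    have := min_le_right m₁ m₂
    rw [Pi.neg_apply] at e1
    constructor <;> linarith
  refine ⟨m / 2, by positivity, min (min ε₁ ε₂) (min R (m / (2 * L))), by positivity, ?_, ?_⟩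
  · intro t ht y hy
    obtain ⟨e1, e2⟩ := hXY t ht y (hy.trans (min_le_left _ _))
    constructor <;> linarith
  · intro η hη x s t hs hst ht hx hcl
    refine H.abs_h_le hst (by positivity) hx fun r hr => ?_
    have hε := hcl r hr
    obtain ⟨e1, e2⟩ := hXY r ⟨hs.trans hr.1, hr.2.trans ht⟩ _ (hε.trans (min_le_left _ _))
    have e3 : L * η ≤ m / 2 := by
      have := hη.trans ((min_le_right _ _).trans (min_le_right _ _))
      rw [le_div_iff₀ (by positivity)] at this
      linarith
    exact ⟨hK (mem_cthickening r (hε.trans ((min_le_right _ _).trans (min_le_left _ _)))),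
      by linarith, by linarith⟩

/-- Approximate trajectories near the loop slide up to the time `-δ` and fly from the time `δ`. -/
theorem exists_takeoff (C : Connection U h Z p q σ ξ t₀) (hXneg : ∀ t < 0, lieDeriv Z.X h (σ t) < 0)
    {K : Set E3} {L c ρ R : ℝ}
    (H : Controlled h Z K L c ρ) (hR : 0 < R)
    (hK : Metric.cthickening R (range (loop p σ ξ t₀)) ⊆ K) {τ δ t₁ : ℝ} (hδ : 0 < δ)
    (ht₁ : t₁ < t₀) :
    ∃ m > 0, ∃ ε > 0, ε ≤ R ∧ (∀ t ∈ Icc (-τ) (-δ), ∀ y, ‖y - loop p σ ξ t₀ t‖ ≤ ε →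
        lieDeriv Z.X h y ≤ -m ∧ m ≤ lieDeriv Z.Y h y) ∧
      (∀ t ∈ Icc δ t₁, ∀ y, ‖y - loop p σ ξ t₀ t‖ ≤ ε → 0 < h y) ∧
      ∀ η ≤ ε, ∀ x, Follows h Z η (-τ) (-δ) x → h (x (-τ)) = 0 →
        (∀ t ∈ Icc (-τ) (-δ), ‖x t - loop p σ ξ t₀ t‖ ≤ ε) → ∀ t ∈ Icc (-τ) (-δ), h (x t) = 0 := by
  obtain ⟨m, hm, ε₁, hε₁, h1, h2⟩ := C.exists_attraction H hR hK (a' := -τ) (b' := -δ)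
    (fun t ht => by rw [loop_nonpos (by linarith [ht.2])]; exact hXneg t (by linarith [ht.2]))
    (fun t ht => (C.lieDeriv_loop (by linarith [ht.2])).2)
  have hQ : IsCompact (loop p σ ξ t₀ '' Icc δ t₁) := isCompact_Icc.image C.continuous_loop
  have hQU : loop p σ ξ t₀ '' Icc δ t₁ ⊆ U := by rintro _ ⟨t, -, rfl⟩; exact C.loop_mem t
  obtain ⟨m₂, hm₂, ε₂, hε₂, h3⟩ := hQ.exists_margin C.isOpen hQU C.smooth.continuousOn (by
    rintro _ ⟨t, ht, rfl⟩; exact C.h_loop_pos ⟨hδ.trans_le ht.1, ht.2.trans_lt ht₁⟩)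
  refine ⟨m, hm, min R (min ε₁ ε₂), by positivity, min_le_left _ _, fun t ht y hy => ?_,
    fun t ht y hy => ?_, fun η hη x hx hx0 hcl t ht => ?_⟩
  · exact h1 t ht y (hy.trans ((min_le_right _ _).trans (min_le_left _ _)))
  · exact hm₂.trans_le (h3 _ (mem_image_of_mem _ ht) y
      (hy.trans ((min_le_right _ _).trans (min_le_right _ _))))
  · have := h2 η (hη.trans ((min_le_right _ _).trans (min_le_left _ _))) x (-τ) t le_rfl ht.1 ht.2
      (hx.mono le_rfl le_rfl ht.2) fun r hr => (hcl r ⟨hr.1, hr.2.trans ht.2⟩).trans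
        ((min_le_right _ _).trans (min_le_left _ _))
    rw [hx0, abs_zero, zero_sub, max_eq_right] at this
    · exact abs_nonpos_iff.mp this
    · have := mul_nonneg hm.le (sub_nonneg.mpr ht.1); linarith

/-- Approximate trajectories near the loop land on the switching surface. -/
theorem exists_landing (C : Connection U h Z p q σ ξ t₀) {K : Set E3} {L c ρ R : ℝ}
    (H : Controlled h Z K L c ρ) (hR : 0 < R)
    (hK : Metric.cthickening R (range (loop p σ ξ t₀)) ⊆ K) {δ : ℝ} (hδ : 0 < δ) :
    ∃ ν > 0, ν ≤ t₀ ∧ ∃ ε > 0, ∀ η ≤ ε, ∀ x, Follows h Z η (t₀ - ν) (t₀ + δ) x →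
        (∀ t ∈ Icc (t₀ - ν) (t₀ + δ), ‖x t - loop p σ ξ t₀ t‖ ≤ ε) → h (x (t₀ + δ)) = 0 := by
  have hop : IsOpen {x | x ∈ U ∧ lieDeriv Z.X h x < 0 ∧ 0 < lieDeriv Z.Y h x} := by
    have e : {x | x ∈ U ∧ lieDeriv Z.X h x < 0 ∧ 0 < lieDeriv Z.Y h x} =
      (U ∩ lieDeriv Z.X h ⁻¹' Iio 0) ∩ (U ∩ lieDeriv Z.Y h ⁻¹' Ioi 0) := by
      ext x; simp only [mem_ofPred_eq, mem_inter_iff, mem_preimage, mem_Iio, mem_Ioi]; tauto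
    rw [e]
    exact ((continuousOn_lieDeriv C.isOpen C.smooth C.lip_X.continuousOn).isOpen_inter_preimage
      C.isOpen isOpen_Iio).inter ((continuousOn_lieDeriv C.isOpen C.smooth
        C.lip_Y.continuousOn).isOpen_inter_preimage C.isOpen isOpen_Ioi)
  have hpm : loop p σ ξ t₀ t₀ ∈ {x | x ∈ U ∧ lieDeriv Z.X h x < 0 ∧ 0 < lieDeriv Z.Y h x} := by
    rw [C.loop_ge le_rfl]
    exact ⟨C.p_mem.1.1, C.p_mem.2⟩
  obtain ⟨ν₀, hν₀, hν⟩ := Metric.eventually_nhds_iff.mp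
    (C.continuous_loop.continuousAt.eventually_mem (hop.mem_nhds hpm))
  have hwin : ∀ t ∈ Icc (t₀ - ν₀ / 2) (t₀ + δ), loop p σ ξ t₀ t ∈
      {x | x ∈ U ∧ lieDeriv Z.X h x < 0 ∧ 0 < lieDeriv Z.Y h x} := by
    intro t ht
    rcases le_total t t₀ with h1 | h1
    · refine hν ?_
      rw [Real.dist_eq, abs_sub_comm, abs_of_nonneg (by linarith)]
      linarith [ht.1]
    · rw [C.loop_ge h1, ← C.loop_ge le_rfl]; exact hpm
  obtain ⟨m, hm, ε₁, hε₁, -, h2⟩ := C.exists_attraction H hR hK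
    (fun t ht => (hwin t ht).2.1) (fun t ht => (hwin t ht).2.2)
  have hL : 0 < L := zero_lt_one.trans_le H.one_le
  have hmδ : 0 < m * δ / 2 := by positivity
  have hhc : ContinuousAt (fun t => h (loop p σ ξ t₀ t)) t₀ :=
    ContinuousAt.comp (f := loop p σ ξ t₀)
      (C.smooth.continuousOn.continuousAt (C.isOpen.mem_nhds (C.loop_mem t₀)))
      C.continuous_loop.continuousAt
  obtain ⟨ν₁, hν₁, hν'⟩ := Metric.continuousAt_iff.mp hhc _ hmδ
  set ν := min (ν₀ / 2) (min (ν₁ / 2) t₀) with hνd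
  have hν0 : 0 < ν := by have := C.t₀_pos; positivity
  refine ⟨ν, hν0, (min_le_right _ _).trans (min_le_right _ _), min (min ε₁ R) (m * δ / (2 * L)),
    by positivity, fun η hη x hx hcl => ?_⟩
  have hst : t₀ - ν ≤ t₀ + δ := by linarith
  have h3 := h2 η (hη.trans ((min_le_left _ _).trans (min_le_left _ _))) x (t₀ - ν) (t₀ + δ)
    (by have := min_le_left (ν₀ / 2) (min (ν₁ / 2) t₀); linarith) hst le_rfl hx
    fun r hr => (hcl r hr).trans ((min_le_left _ _).trans (min_le_left _ _))
  have h4 := hcl _ (left_mem_Icc.mpr hst)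
  have h5 := H.lip_h _ (hK (mem_cthickening _ (h4.trans ((min_le_left _ _).trans
    (min_le_right _ _))))) _ (hK (mem_cthickening (t₀ - ν) (by
      rw [sub_self, norm_zero]; exact hR.le)))
  have h6 : L * ‖x (t₀ - ν) - loop p σ ξ t₀ (t₀ - ν)‖ ≤ m * δ / 2 := by
    have := h4.trans (min_le_right _ _)
    rw [le_div_iff₀ (by positivity)] at this
    linarith
  have h7 := hν' (x := t₀ - ν) (by
    rw [Real.dist_eq, sub_sub_cancel_left, abs_neg, abs_of_pos hν0]
    have := (min_le_right (ν₀ / 2) (min (ν₁ / 2) t₀)).trans (min_le_left _ _)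
    linarith)
  rw [C.h_loop_ge le_rfl, dist_zero_right, Real.norm_eq_abs] at h7
  have h8 : |h (x (t₀ - ν))| ≤ m * δ := by
    have := abs_sub_abs_le_abs_sub (h (x (t₀ - ν))) (h (loop p σ ξ t₀ (t₀ - ν)))
    linarith
  rw [max_eq_right] at h3
  · exact abs_nonpos_iff.mp h3
  · nlinarith

end Connection

end PWField

theorem norm_le_of_affine_combination {μ : ℂ} {s l β e : ℝ} (hβ : 0 < β) (hμ : β ≤ μ.im)
    (hs : 0 ≤ s) (he : e ≤ β / 4) (hs1 : s * (1 + ‖μ‖ / β) ≤ 1 / 4) :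
    s / (2 * (1 + ‖μ‖ / β)) ≤ ‖(s : ℂ) - l * μ‖ - e * |l| - s ^ 2 := by
  set X := ‖(s : ℂ) - l * μ‖ with hX
  have h1 : |l| * β ≤ X := by
    have h := Complex.abs_im_le_norm ((s : ℂ) - l * μ)
    have e1 : ((s : ℂ) - l * μ).im = -(l * μ.im) := by simp
    rw [e1, abs_neg, abs_mul, abs_of_pos (hβ.trans_le hμ)] at h
    exact (mul_le_mul_of_nonneg_left hμ (abs_nonneg l)).trans h
  have h2 : s - |l| * ‖μ‖ ≤ X := by
    have h := norm_sub_norm_le (s : ℂ) (l * μ)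
    rw [norm_mul, Complex.norm_real, Complex.norm_real, Real.norm_of_nonneg hs,
      Real.norm_eq_abs] at h
    exact h
  have hl : |l| ≤ X / β := by rwa [le_div_iff₀ hβ]
  have h3 : s ≤ (1 + ‖μ‖ / β) * X := by
    have := mul_le_mul_of_nonneg_right hl (norm_nonneg μ)
    calc s ≤ X + |l| * ‖μ‖ := by linarith
      _ ≤ X + X / β * ‖μ‖ := by linarith
      _ = _ := by ring
  have hk : 0 < 1 + ‖μ‖ / β := by positivity
  have hX0 : 0 ≤ X := norm_nonneg _
  have h4 : e * |l| ≤ X / 4 := by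
    calc e * |l| ≤ β / 4 * |l| := by gcongr
      _ ≤ X / 4 := by linarith
  have h5 : s ^ 2 ≤ X / 4 := by
    calc s ^ 2 = s * s := sq s
      _ ≤ s * ((1 + ‖μ‖ / β) * X) := by gcongr
      _ = (s * (1 + ‖μ‖ / β)) * X := by ring
      _ ≤ 1 / 4 * X := by gcongr
      _ = X / 4 := by ring
  rw [div_le_iff₀ (by positivity)]
  calc s ≤ (1 + ‖μ‖ / β) * X := h3
    _ ≤ (X - e * |l| - s ^ 2) * (2 * (1 + ‖μ‖ / β)) := by nlinarith

namespace PWField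

namespace SaddleFocus

variable {U : Set E3} {h : E3 → ℝ} {Z : PWField} {p q : E3} {σ ξ : ℝ → E3} {t₀ : ℝ}
  {π : E3 →L[ℝ] ℂ} {ι : ℂ →L[ℝ] E3} {ψ : ℂ → E3} {r Cψ r' a β : ℝ}

/-- The section `s ↦ ψ (w₀ eˢ)` through a point of the connection near the focus, transversal to
the connection. -/
structure Section (p : E3) (σ ξ : ℝ → E3) (t₀ : ℝ) (ψ : ℂ → E3) (r τ s₁ l₀ c₀ : ℝ) (w₀ : ℂ) :
    Prop where
  τ_pos : 0 < τ
  s₁_pos : 0 < s₁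
  s₁_le : s₁ ≤ 1
  l₀_pos : 0 < l₀
  c₀_pos : 0 < c₀
  w₀_ne : w₀ ≠ 0
  lt : ‖w₀‖ * Real.exp s₁ < r
  eq : ψ w₀ = loop p σ ξ t₀ (-τ)
  trans : ∀ s ∈ Icc 0 s₁, ∀ l, |l| ≤ l₀ →
    c₀ * s ≤ ‖ψ (w₀ * Complex.exp s) - loop p σ ξ t₀ (-τ + l)‖

theorem exists_section (F : SaddleFocus U h Z p q σ ξ t₀ π ι ψ r Cψ r' a β) {r₂ : ℝ}
    (hr₂ : 0 < r₂) (hr₂r : r₂ ≤ r) :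
    ∃ τ s₁ l₀ c₀ w₀, Section p σ ξ t₀ ψ r₂ τ s₁ l₀ c₀ w₀ := by
  obtain ⟨r₁, hr₁, hr₁r, has⟩ := F.asymp (β / 2) (by have := F.β_pos; positivity)
  -- a point of the connection near the focus
  have hlim := F.conn.tendsto_loop_atBot
  have h1 : ∀ᶠ t in atBot, ‖loop p σ ξ t₀ t - p‖ < r' := by
    have := hlim.eventually (Metric.ball_mem_nhds p F.chart.r'_pos)
    filter_upwards [this] with t ht
    rwa [← dist_eq_norm]
  have h2 : ∀ᶠ t in atBot, ‖π (loop p σ ξ t₀ t - p)‖ < min r₁ (r₂ / Real.exp 1) := by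
    have : Tendsto (fun t => ‖π (loop p σ ξ t₀ t - p)‖) atBot (𝓝 0) := by
      have h := ((π.continuous.tendsto _).comp (hlim.sub_const p)).norm
      simpa using h
    exact this.eventually_lt_const (by positivity)
  obtain ⟨t, ht1, ht2, ht0⟩ := (h1.and (h2.and (eventually_lt_atBot 0))).exists
  set w₀ := π (loop p σ ξ t₀ t - p) with hw₀
  obtain ⟨hw₀r, hψ⟩ := F.chart.surj _ ht1 (F.conn.h_loop_nonpos ht0.le)
  rw [← hw₀] at hw₀r hψ
  have hw₀0 : w₀ ≠ 0 := by
    intro h0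
    rw [h0, F.chart.ψ_zero] at hψ
    exact F.conn.loop_ne_p ht0.le hψ.symm
  have hw₀n : 0 < ‖w₀‖ := norm_pos_iff.mpr hw₀0
  set μ := π (slidingField h Z (ψ w₀)) / w₀ with hμ
  have hμim : β / 2 ≤ μ.im := by
    have h3 := has w₀ (ht2.trans_le (min_le_left _ _))
    have e : μ - (a + β * Complex.I) = (π (slidingField h Z (ψ w₀)) - (a + β * Complex.I) * w₀) / w₀ := by
      rw [hμ]; field_simp
    have h4 : ‖μ - (a + β * Complex.I)‖ ≤ β / 2 := by
      rw [e, norm_div, div_le_iff₀ hw₀n]; exact h3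
    have h5 := (Complex.abs_im_le_norm _).trans h4
    have e2 : (μ - (a + β * Complex.I)).im = μ.im - β := by simp
    rw [e2, abs_le] at h5
    linarith [h5.1]
  have hder : HasDerivAt (fun l => π (loop p σ ξ t₀ (t + l) - p)) (μ * w₀) 0 := by
    have e : loopVel h Z p σ ξ t₀ t = slidingField h Z (ψ w₀) := by
      rw [Connection.loopVel_nonpos ht0.le, hψ]
    have h3 := F.conn.hasDerivAt_loop ht0.ne (ht0.trans F.conn.t₀_pos)
    have h4 : HasDerivAt (fun l => loop p σ ξ t₀ (t + l)) (loopVel h Z p σ ξ t₀ t) 0 := by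
      have := HasDerivAt.comp_const_add t 0 (by rwa [add_zero])
      exact this
    have h5 := π.hasFDerivAt.comp_hasDerivAt (0 : ℝ) (h4.sub_const p)
    rw [e] at h5
    have e3 : μ * w₀ = π (slidingField h Z (ψ w₀)) := by rw [hμ]; field_simp
    rwa [e3]
  have hβ := F.β_pos
  have hlo := (hasDerivAt_iff_isLittleO.mp hder).def (show 0 < β / 8 * ‖w₀‖ by positivity)
  obtain ⟨l₁, hl₁, hl⟩ := Metric.eventually_nhds_iff.mp hlo
  set k := 1 + ‖μ‖ / (β / 2) with hk
  have hk0 : 0 < k := by positivity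
  have hπ0 : 0 < ‖π‖ + 1 := by positivity
  refine ⟨-t, min 1 (1 / (4 * k)), l₁ / 2, ‖w₀‖ / (2 * k) / (‖π‖ + 1), w₀, by linarith, by positivity,
    min_le_left _ _, by positivity, by positivity, hw₀0, ?_, ?_, fun s hs l hl2 => ?_⟩
  · have h3 := ht2.trans_le (min_le_right _ _)
    rw [lt_div_iff₀ (Real.exp_pos 1)] at h3
    refine lt_of_le_of_lt (mul_le_mul_of_nonneg_left (Real.exp_le_exp.mpr (min_le_left _ _)) hw₀n.le) h3
  · rw [neg_neg, hψ]
  · rw [neg_neg]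
    have hs1 : s ≤ 1 := hs.2.trans (min_le_left _ _)
    have hsk : s * k ≤ 1 / 4 := by
      have := hs.2.trans (min_le_right _ _)
      rw [le_div_iff₀ (by positivity)] at this
      linarith
    have h3 := hl (y := l) (by rw [Real.dist_eq, sub_zero]; linarith)
    simp only [add_zero, sub_zero, Complex.real_smul] at h3
    rw [← hw₀, Real.norm_eq_abs] at h3
    have h4 : ‖Complex.exp s - 1 - s‖ ≤ s ^ 2 := by
      have := Complex.norm_exp_sub_one_sub_id_le (x := (s : ℂ)) (by
        rw [Complex.norm_real, Real.norm_of_nonneg hs.1]; exact hs1)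
      rwa [Complex.norm_real, Real.norm_of_nonneg hs.1] at this
    have hm : w₀ * Complex.exp s ∈ Metric.ball (0 : ℂ) r := by
      rw [mem_ball_zero_iff, norm_mul, Complex.norm_exp, Complex.ofReal_re]
      have h5 := ht2.trans_le (min_le_right _ _)
      rw [lt_div_iff₀ (Real.exp_pos 1)] at h5
      refine lt_of_le_of_lt (mul_le_mul_of_nonneg_left (Real.exp_le_exp.mpr hs1) hw₀n.le)
        (h5.trans_le hr₂r)
    have h5 := norm_le_of_affine_combination (μ := μ) (s := s) (l := l) (β := β / 2) (e := β / 8)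
      (by positivity) hμim hs.1 (by linarith) hsk
    have e1 : π (ψ (w₀ * Complex.exp s) - loop p σ ξ t₀ (t + l)) =
        w₀ * ((s : ℂ) - l * μ) + w₀ * (Complex.exp s - 1 - s) -
          (π (loop p σ ξ t₀ (t + l) - p) - w₀ - l * (μ * w₀)) := by
      have e2 : ψ (w₀ * Complex.exp s) - loop p σ ξ t₀ (t + l) =
        (ψ (w₀ * Complex.exp s) - p) - (loop p σ ξ t₀ (t + l) - p) := by abel
      rw [e2, map_sub, F.chart.π_ψ _ hm]
      ring
    have h6 : ‖w₀‖ * (‖(s : ℂ) - l * μ‖ - β / 8 * |l| - s ^ 2) ≤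
        ‖π (ψ (w₀ * Complex.exp s) - loop p σ ξ t₀ (t + l))‖ := by
      rw [e1]
      have h7 := norm_sub_norm_le (w₀ * ((s : ℂ) - l * μ) + w₀ * (Complex.exp s - 1 - s))
        (π (loop p σ ξ t₀ (t + l) - p) - w₀ - l * (μ * w₀))
      have h8 := norm_sub_norm_le (w₀ * ((s : ℂ) - l * μ)) (-(w₀ * (Complex.exp s - 1 - s)))
      rw [norm_neg, sub_neg_eq_add, norm_mul, norm_mul] at h8
      have h9 := mul_le_mul_of_nonneg_left h4 hw₀n.le
      nlinarith
    have h7 := π.le_opNorm (ψ (w₀ * Complex.exp s) - loop p σ ξ t₀ (t + l))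
    rw [div_mul_eq_mul_div, div_le_iff₀ hπ0]
    have h8 := norm_nonneg (ψ (w₀ * Complex.exp s) - loop p σ ξ t₀ (t + l))
    have h9 := mul_le_mul_of_nonneg_left h5 hw₀n.le
    rw [← hk] at h9
    calc _ = ‖w₀‖ * (s / (2 * k)) := by ring
      _ ≤ _ := by linarith

end SaddleFocus

end PWField

namespace PWField

namespace Connection

variable {U : Set E3} {h : E3 → ℝ} {Z : PWField} {p q : E3} {σ ξ : ℝ → E3} {t₀ : ℝ}

theorem loop_taylor (C : Connection U h Z p q σ ξ t₀) {M : NNReal}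
    (hM : LipschitzWith M (loopVel h Z p σ ξ t₀)) {t l : ℝ} (ht : t < t₀) (htl : t + l < t₀)
    (hs : t < 0 ∧ t + l < 0 ∨ 0 < t ∧ 0 < t + l) :
    ‖loop p σ ξ t₀ (t + l) - loop p σ ξ t₀ t - l • loopVel h Z p σ ξ t₀ t‖ ≤ M * |l| * |l| := by
  have hd : ∀ x ∈ uIcc t (t + l), HasDerivWithinAt (fun x => loop p σ ξ t₀ x -
      x • loopVel h Z p σ ξ t₀ t) (loopVel h Z p σ ξ t₀ x - loopVel h Z p σ ξ t₀ t)
      (uIcc t (t + l)) x := by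
    intro x hx
    have hx' : x ≠ 0 ∧ x < t₀ := by
      rcases mem_uIcc.mp hx with h1 | h1 <;> rcases hs with h2 | h2
      · exact ⟨(h1.2.trans_lt h2.2).ne, h1.2.trans_lt htl⟩
      · exact ⟨(h2.1.trans_le h1.1).ne', h1.2.trans_lt htl⟩
      · exact ⟨(h1.2.trans_lt h2.1).ne, h1.2.trans_lt ht⟩
      · exact ⟨(h2.2.trans_le h1.1).ne', h1.2.trans_lt ht⟩
    have h3 := (hasDerivAt_id x).smul_const (loopVel h Z p σ ξ t₀ t)
    simp only [id_eq, one_smul] at h3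
    exact ((C.hasDerivAt_loop hx'.1 hx'.2).sub h3).hasDerivWithinAt
  have hb : ∀ x ∈ uIcc t (t + l),
      ‖loopVel h Z p σ ξ t₀ x - loopVel h Z p σ ξ t₀ t‖ ≤ M * |l| := by
    intro x hx
    have h1 := hM.dist_le_mul x t
    rw [dist_eq_norm, Real.dist_eq] at h1
    refine h1.trans (mul_le_mul_of_nonneg_left ?_ M.2)
    have := abs_sub_left_of_mem_uIcc hx
    rwa [add_sub_cancel_left] at this
  have := (convex_uIcc t (t + l)).norm_image_sub_le_of_norm_hasDerivWithin_le hd hb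
    left_mem_uIcc right_mem_uIcc
  rw [add_sub_cancel_left, Real.norm_eq_abs] at this
  refine le_trans (le_of_eq ?_) this
  congr 1
  module

/-- If a displacement from the loop is not a displacement along the loop, then neither is its
image under a projection along the loop. -/
theorem projection_lower_bound (C : Connection U h Z p q σ ξ t₀) {M : NNReal}
    (hM : LipschitzWith M (loopVel h Z p σ ξ t₀)) {P : E3 →L[ℝ] ℂ} {t CP A c s δ : ℝ}
    {D : E3} (hCP : 0 < CP) (hk : ∃ k : ℝ, |k| ≤ CP * ‖D‖ ∧
      ‖D - k • loopVel h Z p σ ξ t₀ t‖ ≤ CP * ‖P D‖)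
    (hD : ‖D‖ ≤ A * s) (ht : t < -δ ∨ δ < t) (ht₀ : t + δ < t₀) (hδ : 0 < δ) (hs : 0 ≤ s)
    (hsδ : CP * A * s ≤ δ) (hsM : M * (CP * A) ^ 2 * s ≤ c / 2)
    (hl : ∀ l : ℝ, |l| ≤ CP * A * s → c * s ≤ ‖loop p σ ξ t₀ t + D - loop p σ ξ t₀ (t + l)‖) :
    c / (2 * CP) * s ≤ ‖P D‖ := by
  obtain ⟨k, hk1, hk2⟩ := hk
  have hkA : |k| ≤ CP * A * s := by
    refine hk1.trans ?_
    rw [mul_assoc]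
    exact mul_le_mul_of_nonneg_left hD hCP.le
  have hkδ := abs_le.mp (hkA.trans hsδ)
  have h1 := hl k hkA
  have h2 := C.loop_taylor hM (t := t) (l := k) (by linarith) (by linarith [hkδ.2]) (by
    rcases ht with h | h
    · left; constructor <;> linarith [hkδ.2]
    · right; constructor <;> linarith [hkδ.1])
  have h3 : (M : ℝ) * |k| * |k| ≤ c / 2 * s := by
    calc (M : ℝ) * |k| * |k| ≤ M * (CP * A * s) * (CP * A * s) := by
          have hB := (abs_nonneg k).trans hkA
          exact mul_le_mul (mul_le_mul_of_nonneg_left hkA M.2) hkA (abs_nonneg k)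
            (mul_nonneg M.2 hB)
      _ = M * (CP * A) ^ 2 * s * s := by ring
      _ ≤ c / 2 * s := by gcongr
  have e : loop p σ ξ t₀ t + D - loop p σ ξ t₀ (t + k) =
      (D - k • loopVel h Z p σ ξ t₀ t) -
        (loop p σ ξ t₀ (t + k) - loop p σ ξ t₀ t - k • loopVel h Z p σ ξ t₀ t) := by abel
  rw [e] at h1
  have h4 := norm_sub_le (D - k • loopVel h Z p σ ξ t₀ t)
    (loop p σ ξ t₀ (t + k) - loop p σ ξ t₀ t - k • loopVel h Z p σ ξ t₀ t)
  rw [div_mul_eq_mul_div, div_le_iff₀ (by positivity)]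
  linarith

theorem follows_loop_add (C : Connection U h Z p q σ ξ t₀) (l a b : ℝ) :
    Follows h Z 0 a b fun t => loop p σ ξ t₀ (t + l) := by
  have := (C.follows_loop (a + l) (b + l)).comp_add l
  rwa [add_sub_cancel_right, add_sub_cancel_right] at this

end Connection

namespace SaddleFocus

variable {U : Set E3} {h : E3 → ℝ} {Z : PWField} {p q : E3} {σ ξ : ℝ → E3} {t₀ : ℝ}
  {π : E3 →L[ℝ] ℂ} {ι : ℂ →L[ℝ] E3} {ψ : ℂ → E3} {r Cψ r' a β : ℝ}

theorem Section.mem_ball {r₂ τ s₁ l₀ c₀ : ℝ} {w₀ : ℂ} (S : Section p σ ξ t₀ ψ r₂ τ s₁ l₀ c₀ w₀)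
    {s : ℝ} (hs : s ≤ s₁) : w₀ * Complex.exp s ∈ Metric.ball (0 : ℂ) r₂ := by
  rw [mem_ball_zero_iff, norm_mul, Complex.norm_exp, Complex.ofReal_re]
  exact lt_of_le_of_lt (mul_le_mul_of_nonneg_left (Real.exp_le_exp.mpr hs) (norm_nonneg _)) S.lt

theorem norm_section_sub_le (F : SaddleFocus U h Z p q σ ξ t₀ π ι ψ r Cψ r' a β)
    {r₂ τ s₁ l₀ c₀ : ℝ} {w₀ : ℂ} (hr₂ : r₂ ≤ r) (S : Section p σ ξ t₀ ψ r₂ τ s₁ l₀ c₀ w₀)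
    {s : ℝ} (hs : s ∈ Icc 0 s₁) :
    ‖ψ (w₀ * Complex.exp s) - loop p σ ξ t₀ (-τ)‖ ≤ 2 * Cψ * ‖w₀‖ * s := by
  have hb := Metric.ball_subset_ball (x := (0 : ℂ)) hr₂
  have h0 := S.mem_ball S.s₁_pos.le (s := 0)
  rw [Complex.ofReal_zero, Complex.exp_zero, mul_one] at h0
  rw [← S.eq]
  refine (F.chart.lip _ (hb (S.mem_ball hs.2)) _ (hb h0)).trans ?_
  have e : w₀ * Complex.exp s - w₀ = w₀ * (Complex.exp s - 1) := by ring
  have h1 := Complex.norm_exp_sub_one_le (x := (s : ℂ)) (by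
    rw [Complex.norm_real, Real.norm_of_nonneg hs.1]; exact hs.2.trans S.s₁_le)
  rw [Complex.norm_real, Real.norm_of_nonneg hs.1] at h1
  rw [e, norm_mul]
  calc _ ≤ Cψ * (‖w₀‖ * (2 * s)) := by have := F.chart.C_pos; gcongr
    _ = _ := by ring

theorem π_jump (F : SaddleFocus U h Z p q σ ξ t₀ π ι ψ r Cψ r' a β) :
    π (Z.X p - Z.Y p) = 0 := by
  have h1 := F.conn.p_zero
  have h2 := F.conn.p_mem.2
  rw [slidingField] at h1
  have h3 : lieDeriv Z.Y h p - lieDeriv Z.X h p ≠ 0 := by linarith [h2.1, h2.2]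
  rw [smul_eq_zero, or_iff_right (inv_ne_zero h3)] at h1
  have h4 := congrArg π h1
  rw [map_sub, map_smul, map_smul, F.coord.π_X, smul_zero, zero_sub, map_zero, neg_eq_zero,
    smul_eq_zero, or_iff_right h2.1.ne] at h4
  rw [map_sub, F.coord.π_X, h4, sub_zero]

set_option maxHeartbeats 1600000 in
/-- The arguments of the landing points of the trajectories through a section are bounded: the
flow isotopes the section to its image, without winding. -/
theorem exists_boundedLog_landing (F : SaddleFocus U h Z p q σ ξ t₀ π ι ψ r Cψ r' a β)
    {K : Set E3} {L c ρ R : ℝ} (H : Controlled h Z K L c ρ) (hR : 0 < R)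
    (hK : Metric.cthickening R (range (loop p σ ξ t₀)) ⊆ K)
    {τ s₁ l₀ c₀ r₂ : ℝ} {w₀ : ℂ} (hr₂ : r₂ ≤ r) (S : Section p σ ξ t₀ ψ r₂ τ s₁ l₀ c₀ w₀) {δ₀ : ℝ}
    (hδ₀ : 0 < δ₀) :
    ∃ δ > 0, δ ≤ δ₀ ∧ ∃ ε > 0, ∃ s₂ > 0, s₂ ≤ s₁ ∧ ∀ s₅ ≤ s₂, ∀ x : ℝ → ℝ → E3,
      (∀ s ∈ Ioc 0 s₅, x s (-τ) = ψ (w₀ * Complex.exp s) ∧ Follows h Z 0 (-τ) (t₀ + δ) (x s) ∧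
        ∀ t ∈ Icc (-τ) (t₀ + δ), ‖x s t - loop p σ ξ t₀ t‖ ≤ ε) →
      HasBoundedLog (Ioc 0 s₅) fun s => π (x s (t₀ + δ) - p) := by
  have C := F.conn
  have hτ := S.τ_pos
  have ht₀ := C.t₀_pos
  have hL : 0 < L := zero_lt_one.trans_le H.one_le
  have hc := H.c_pos
  have hrate := H.rate_pos
  have hloopK : ∀ t, loop p σ ξ t₀ t ∈ K := fun t =>
    hK (Connection.mem_cthickening t (by rw [sub_self, norm_zero]; exact hR.le))
  set T := t₀ + 1 + τ with hT
  have hT0 : 0 ≤ T := by linarith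
  set Fl := Controlled.flowConst L c ρ T with hFl
  have hFl1 : 1 ≤ Fl := H.one_le_flowConst hT0
  set C₁ := Controlled.stepConst L c ρ T with hC₁
  have hC₁0 : 0 < C₁ := H.stepConst_pos hT0
  have hCψ := F.chart.C_pos
  set A := Fl * (2 * Cψ * ‖w₀‖) with hA
  have hw₀n : 0 < ‖w₀‖ := norm_pos_iff.mpr S.w₀_ne
  have hA0 : 0 < A := by positivity
  obtain ⟨Ml, hMl⟩ := C.exists_lipschitzWith_loop
  obtain ⟨Mv, hMv⟩ := C.exists_lipschitzWith_loopVel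
  have hτt : -τ ≤ t₀ := by linarith
  obtain ⟨P, hPc, hPt₀, hP⟩ := exists_projection_path (u := loopVel h Z p σ ξ t₀) hτt hMv.continuous
    (fun t ht => C.loopVel_ne_zero ht.2) π
    (by rw [C.loopVel_nonneg ht₀.le, C.loop_ge le_rfl, F.coord.π_X])
    (fun x hx => by
      rw [C.loopVel_nonneg ht₀.le, C.loop_ge le_rfl]
      have := F.coord.decomp x
      rw [hx, map_zero, zero_add] at this
      exact ⟨_, this⟩)
  obtain ⟨CP, hCP, hPb⟩ := exists_projection_bound (a := -τ) (b := t₀) hMv.continuous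
    (fun t ht => C.loopVel_ne_zero ht.2) hPc hP
  obtain ⟨MP, hMP⟩ := isCompact_Icc.exists_bound_of_continuousOn hPc
  have hMP0 : 0 ≤ MP := (norm_nonneg _).trans (hMP t₀ ⟨hτt, le_rfl⟩)
  set c₁ := 1 / 2 * Real.exp (-(2 * C₁ * T)) with hc₁
  have hc₁0 : 0 < c₁ := by positivity
  have hc₁1 : c₁ ≤ 1 := by
    have : Real.exp (-(2 * C₁ * T)) ≤ 1 := Real.exp_le_one_iff.mpr (by
      have : 0 ≤ 2 * C₁ * T := by positivity
      linarith)
    linarith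
  have hc₀ := S.c₀_pos
  set c₃ := c₁ * c₀ / (2 * CP) with hc₃
  have hc₃0 : 0 < c₃ := by positivity
  -- modulus of continuity of `P`
  have hPu := isCompact_Icc.uniformContinuousOn_of_continuous hPc
  rw [Metric.uniformContinuousOn_iff_le] at hPu
  obtain ⟨θ, hθ, hPθ⟩ := hPu (c₃ / (8 * A)) (by positivity)
  set θ' := min θ (c₃ / (8 * ((MP + 1) * C₁ * A))) with hθ'
  have hθ'0 : 0 < θ' := by positivity
  -- the jump is almost vertical near `p`
  set κ := c₃ * c / (8 * (L * A)) with hκ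
  have hκ0 : 0 < κ := by positivity
  have hpU : p ∈ U := C.p_mem.1.1
  obtain ⟨εp, hεp, hjump⟩ : ∃ εp > 0, ∀ y, ‖y - p‖ < εp → ‖π (Z.X y - Z.Y y)‖ ≤ κ := by
    have h1 : ContinuousAt (fun y => π (Z.X y - Z.Y y)) p :=
      π.continuous.continuousAt.comp ((C.lip_X.continuousOn.continuousAt
        (C.isOpen.mem_nhds hpU)).sub (C.lip_Y.continuousOn.continuousAt (C.isOpen.mem_nhds hpU)))
    obtain ⟨εp, hεp, h2⟩ := Metric.continuousAt_iff.mp h1 κ hκ0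
    refine ⟨εp, hεp, fun y hy => ?_⟩
    have := h2 (x := y) (by rwa [dist_eq_norm])
    rw [F.π_jump, dist_zero_right] at this
    exact this.le
  obtain ⟨δp, hδp, hloopp⟩ := Metric.continuousAt_iff.mp (C.continuous_loop.continuousAt (x := t₀))
    (εp / 2) (by positivity)
  set δ := min (min (min δ₀ (τ / 2)) (min (t₀ / 4) 1)) (min (min (θ' / 2) (1 / (4 * C₁)))
    (min (δp / 2) (c₃ / (16 * ((‖π‖ + κ / c) * Controlled.rate L c ρ * A))))) with hδ
  have hκc : 0 < ‖π‖ + κ / c := by positivity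
  have hδ0 : 0 < δ := by positivity
  have hδδ₀ : δ ≤ δ₀ := by rw [hδ]; exact (min_le_left _ _).trans ((min_le_left _ _).trans (min_le_left _ _))
  have hδτ : δ ≤ τ / 2 := by rw [hδ]; exact (min_le_left _ _).trans ((min_le_left _ _).trans (min_le_right _ _))
  have hδt : δ ≤ t₀ / 4 := by rw [hδ]; exact (min_le_left _ _).trans ((min_le_right _ _).trans (min_le_left _ _))
  have hδ1 : δ ≤ 1 := by rw [hδ]; exact (min_le_left _ _).trans ((min_le_right _ _).trans (min_le_right _ _))
  have hδθ : δ ≤ θ' / 2 := by rw [hδ]; exact (min_le_right _ _).trans ((min_le_left _ _).trans (min_le_left _ _))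
  have hδC : δ ≤ 1 / (4 * C₁) := by rw [hδ]; exact (min_le_right _ _).trans ((min_le_left _ _).trans (min_le_right _ _))
  have hδδp : δ ≤ δp / 2 := by rw [hδ]; exact (min_le_right _ _).trans ((min_le_right _ _).trans (min_le_left _ _))
  have hδr : δ ≤ c₃ / (16 * ((‖π‖ + κ / c) * Controlled.rate L c ρ * A)) := by
    rw [hδ]; exact (min_le_right _ _).trans ((min_le_right _ _).trans (min_le_right _ _))
  clear_value δ
  set t₁ := t₀ - δ with ht₁
  obtain ⟨-, -, εt, hεt, hεtR, -, htk2, htk3⟩ := C.exists_takeoff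
    (fun t ht => ((C.σ_slide t ht).1).2.1) H hR hK (τ := τ) (δ := δ) (t₁ := t₁) hδ0 (by linarith)
  -- takeoff of curves near the loop
  have htake : ∀ y, Follows h Z 0 (-τ) t₁ y → h (y (-τ)) = 0 →
      (∀ t ∈ Icc (-τ) t₁, ‖y t - loop p σ ξ t₀ t‖ ≤ εt) → Takeoff h Z K (-τ) δ t₁ y := by
    intro y hy hy0 hcl
    refine ⟨hy, fun t ht => hK (Connection.mem_cthickening t ((hcl t ht).trans hεtR)), ?_, fun t ht =>
      htk2 t ht _ (hcl t ⟨by linarith [ht.1], ht.2⟩)⟩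
    exact htk3 0 hεt.le y (hy.mono le_rfl le_rfl (by linarith)) hy0
      fun t ht => hcl t ⟨ht.1, by linarith [ht.2]⟩
  have hshift : ∀ l, |l| ≤ δ / 2 → |l| ≤ εt / (Ml + 1) →
      Takeoff h Z K (-τ) δ t₁ fun t => loop p σ ξ t₀ (t + l) := by
    intro l hl1 hl2
    have := abs_le.mp hl1
    refine htake _ (C.follows_loop_add l _ _) (C.h_loop_nonpos (by linarith)) fun t _ => ?_
    have h1 := hMl.dist_le_mul (t + l) t
    rw [dist_eq_norm, Real.dist_eq, add_sub_cancel_left] at h1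
    rw [le_div_iff₀ (by positivity)] at hl2
    have := abs_nonneg l
    linarith
  have hloopT : Takeoff h Z K (-τ) δ t₁ (loop p σ ξ t₀) := by
    have := hshift 0 (by rw [abs_zero]; positivity) (by rw [abs_zero]; positivity)
    simpa only [add_zero] using this
  -- the logarithm of the initial displacement
  set z₀ : ℝ → ℂ := fun s => P (-τ) (ψ (w₀ * Complex.exp s) - loop p σ ξ t₀ (-τ)) with hz₀
  have hball := Metric.ball_subset_ball (x := (0 : ℂ)) hr₂
  have hw₀m : w₀ ∈ Metric.ball (0 : ℂ) r := by
    have := hball (S.mem_ball S.s₁_pos.le (s := 0))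
    rwa [Complex.ofReal_zero, Complex.exp_zero, mul_one] at this
  have hsub : ∀ s ∈ Icc 0 s₁, ‖ψ (w₀ * Complex.exp s) - loop p σ ξ t₀ (-τ)‖ ≤ A * s := by
    intro s hs
    refine (F.norm_section_sub_le hr₂ S hs).trans ?_
    rw [hA]
    have : 0 ≤ 2 * Cψ * ‖w₀‖ * s := mul_nonneg (by positivity) hs.1
    calc _ ≤ Fl * (2 * Cψ * ‖w₀‖ * s) := le_mul_of_one_le_left this hFl1
      _ = _ := by ring
  set s₃ := min (min s₁ (l₀ / (CP * A))) (min (min (δ / 2 / (CP * A)) (εt / (Ml + 1) / (CP * A)))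
    (c₁ * c₀ / 2 / ((Mv + 1) * (CP * A) ^ 2))) with hs₃
  have hl₀ := S.l₀_pos
  have hs₁ := S.s₁_pos
  have hs₃0 : 0 < s₃ := by positivity
  have hs₃1 : s₃ ≤ s₁ := (min_le_left _ _).trans (min_le_left _ _)
  have hs₃l : s₃ ≤ l₀ / (CP * A) := (min_le_left _ _).trans (min_le_right _ _)
  have hs₃δ : s₃ ≤ δ / 2 / (CP * A) :=
    (min_le_right _ _).trans ((min_le_left _ _).trans (min_le_left _ _))
  have hs₃ε : s₃ ≤ εt / (Ml + 1) / (CP * A) :=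
    (min_le_right _ _).trans ((min_le_left _ _).trans (min_le_right _ _))
  have hs₃M : s₃ ≤ c₁ * c₀ / 2 / ((Mv + 1) * (CP * A) ^ 2) := (min_le_right _ _).trans (min_le_right _ _)
  clear_value s₃
  have hCPA : 0 < CP * A := by positivity
  have hsmall : ∀ s ∈ Ioc 0 s₃, CP * A * s ≤ l₀ ∧ CP * A * s ≤ δ / 2 ∧ CP * A * s ≤ εt / (Ml + 1) ∧
      Mv * (CP * A) ^ 2 * s ≤ c₁ * c₀ / 2 := by
    intro s hs
    have e1 := hs.2.trans hs₃l
    have e2 := hs.2.trans hs₃δ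
    have e3 := hs.2.trans hs₃ε
    have e4 := hs.2.trans hs₃M
    rw [le_div_iff₀ hCPA] at e1 e2 e3
    rw [le_div_iff₀ (by positivity)] at e4
    refine ⟨by linarith, by linarith, by linarith, ?_⟩
    have : 0 ≤ (CP * A) ^ 2 * s := mul_nonneg (by positivity) hs.1.le
    linarith
  have hz₀low : ∀ s ∈ Ioc 0 s₃, c₃ * s ≤ ‖z₀ s‖ := by
    intro s hs
    obtain ⟨e1, e2, e3, e4⟩ := hsmall s hs
    have hsI : s ∈ Icc 0 s₁ := ⟨hs.1.le, hs.2.trans hs₃1⟩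
    refine C.projection_lower_bound hMv hCP (hPb (-τ) ⟨le_rfl, hτt⟩ _) (hsub s hsI) (δ := δ / 2)
      (Or.inl (by linarith)) (by linarith) (by positivity) hs.1.le e2 e4 fun l hl => ?_
    rw [add_sub_cancel]
    refine le_trans ?_ (S.trans s hsI l (hl.trans e1))
    refine mul_le_mul_of_nonneg_right ?_ hs.1.le
    exact mul_le_of_le_one_left hc₀.le hc₁1
  obtain ⟨ζ, hζ⟩ : ∃ ζ, HasDerivAt z₀ ζ 0 := by
    have h1 : DifferentiableAt ℝ ψ (w₀ * Complex.exp (0 : ℝ)) := by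
      rw [Complex.ofReal_zero, Complex.exp_zero, mul_one]; exact F.chart.diff _ hw₀m
    have h2 : HasDerivAt (fun s : ℝ => w₀ * Complex.exp s) (w₀ * (Complex.exp (0 : ℝ) * 1)) 0 :=
      ((Complex.ofRealCLM.hasDerivAt (x := (0 : ℝ))).cexp).const_mul w₀
    have h3 := h1.hasFDerivAt.comp_hasDerivAt (0 : ℝ) h2
    exact ⟨_, (P (-τ)).hasFDerivAt.comp_hasDerivAt (0 : ℝ) (h3.sub_const (loop p σ ξ t₀ (-τ)))⟩
  have hz₀0 : z₀ 0 = 0 := by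
    simp only [hz₀, Complex.ofReal_zero, Complex.exp_zero, mul_one, S.eq, sub_self, map_zero]
  have hζ0 : ζ ≠ 0 := by
    intro h0
    rw [h0] at hζ
    have h1 := (hasDerivAt_iff_isLittleO.mp hζ).def (half_pos hc₃0)
    obtain ⟨ν, hν, h2⟩ := Metric.eventually_nhds_iff.mp h1
    set s := min (ν / 2) s₃ with hs
    have hs0 : 0 < s := by positivity
    have h3 := h2 (y := s) (by
      rw [Real.dist_eq, sub_zero, abs_of_pos hs0]
      have := min_le_left (ν / 2) s₃
      linarith)
    rw [hz₀0, sub_zero, sub_zero, smul_zero, sub_zero, Real.norm_of_nonneg hs0.le] at h3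
    have h4 := hz₀low s ⟨hs0, min_le_right _ _⟩
    have h5 := mul_pos hc₃0 hs0
    linarith
  obtain ⟨s₄, hs₄, hlog₀⟩ := HasBoundedLog.of_hasDerivAt hζ hz₀0 hζ0
  refine ⟨δ, hδ0, hδδ₀, min εt (εp / 4), by positivity, min s₃ s₄, by positivity,
    (min_le_left _ _).trans hs₃1, fun s₅ hs₅ x hx => ?_⟩
  have hs₅3 : s₅ ≤ s₃ := hs₅.trans (min_le_left _ _)
  -- displacements
  have hxT : ∀ s ∈ Ioc 0 s₅, Takeoff h Z K (-τ) δ t₁ (x s) := by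
    intro s hs
    obtain ⟨e1, e2, e3⟩ := hx s hs
    have hs1 : s ≤ s₁ := (hs.2.trans hs₅3).trans hs₃1
    refine htake _ (e2.mono le_rfl le_rfl (by linarith)) ?_ fun t ht =>
      (e3 t ⟨ht.1, by linarith [ht.2]⟩).trans (min_le_left _ _)
    rw [e1]
    exact F.chart.h_ψ _ (hball (S.mem_ball hs1))
  have hxK : ∀ s ∈ Ioc 0 s₅, ∀ t ∈ Icc (-τ) (t₀ + δ), x s t ∈ K := by
    intro s hs t ht
    exact hK (Connection.mem_cthickening t (((hx s hs).2.2 t ht).trans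
      ((min_le_left _ _).trans hεtR)))
  have hDle : ∀ s ∈ Ioc 0 s₅, ∀ t ∈ Icc (-τ) (t₀ + δ), ‖x s t - loop p σ ξ t₀ t‖ ≤ A * s := by
    intro s hs t ht
    have hs1 : s ∈ Icc 0 s₁ := ⟨hs.1.le, (hs.2.trans hs₅3).trans hs₃1⟩
    have h1 := H.norm_sub_le le_rfl zero_le_one ht.1 ((hx s hs).2.1.mono le_rfl le_rfl ht.2)
      (C.follows_loop (-τ) t) (fun r hr => hxK s hs r ⟨hr.1, hr.2.trans ht.2⟩) fun r _ => hloopK r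
    rw [add_zero, (hx s hs).1] at h1
    refine h1.trans ?_
    have h2 := F.norm_section_sub_le hr₂ S hs1
    have h3 := H.flowConst_mono (sub_nonneg.mpr ht.1) (T' := T) (by linarith [ht.2])
    calc _ ≤ Fl * (2 * Cψ * ‖w₀‖ * s) := mul_le_mul h3 h2 (norm_nonneg _) (by linarith)
      _ = _ := by rw [hA]; ring
  set z : ℝ → ℝ → ℂ := fun t s => P t (x s t - loop p σ ξ t₀ t) with hz
  have hlow : ∀ s ∈ Ioc 0 s₅, ∀ t, -τ ≤ t → t ≤ t₁ → (t ≤ -δ ∨ δ ≤ t) → c₃ * s ≤ ‖z t s‖ := by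
    intro s hs t h1 h2 h3
    have hs' : s ∈ Ioc 0 s₃ := ⟨hs.1, hs.2.trans hs₅3⟩
    have hs1 : s ∈ Icc 0 s₁ := ⟨hs.1.le, hs'.2.trans hs₃1⟩
    obtain ⟨e1, e2, e3, e4⟩ := hsmall s hs'
    refine C.projection_lower_bound hMv hCP (hPb t ⟨h1, by linarith⟩ _)
      (hDle s hs t ⟨h1, by linarith⟩) (δ := δ / 2)
      (by rcases h3 with h3 | h3
          · left; linarith
          · right; linarith) (by linarith) (by positivity) hs.1.le e2 e4 fun l hl => ?_
    rw [add_sub_cancel]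
    have h4 := (hxT s hs).norm_sub_ge (hshift l (hl.trans e2) (hl.trans e3)) H (T := T)
      (by linarith) hδ0 (by linarith) (by linarith) (by
        rw [le_div_iff₀ (by positivity)] at hδC
        rw [← hC₁]; linarith) h1 h2 h3
    refine le_trans ?_ h4
    rw [(hx s hs).1, mul_assoc]
    exact mul_le_mul_of_nonneg_left (S.trans s hs1 l (hl.trans e1)) hc₁0.le
  have hzc : ∀ t ∈ Icc (-τ) (t₀ + δ), ContinuousOn (fun s => x s t) (Ioc 0 s₅) := by
    intro t ht
    have hsec : ContinuousOn (fun s : ℝ => ψ (w₀ * Complex.exp s)) (Ioc 0 s₅) := by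
      refine F.chart.continuousOn.comp (by fun_prop) fun s hs => hball (S.mem_ball ?_)
      exact (hs.2.trans hs₅3).trans hs₃1
    intro s hs
    have h1 := (hsec s hs).tendsto
    rw [tendsto_iff_norm_sub_tendsto_zero] at h1
    rw [ContinuousWithinAt, tendsto_iff_norm_sub_tendsto_zero]
    have h2 := h1.const_mul Fl
    rw [mul_zero] at h2
    refine squeeze_zero' (Eventually.of_forall fun _ => norm_nonneg _) ?_ h2
    filter_upwards [self_mem_nhdsWithin] with s' hs'
    have h3 := H.norm_sub_le le_rfl zero_le_one ht.1 ((hx s' hs').2.1.mono le_rfl le_rfl ht.2)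
      ((hx s hs).2.1.mono le_rfl le_rfl ht.2) (fun r hr => hxK s' hs' r ⟨hr.1, hr.2.trans ht.2⟩)
      fun r hr => hxK s hs r ⟨hr.1, hr.2.trans ht.2⟩
    rw [add_zero, (hx s' hs').1, (hx s hs).1] at h3
    exact h3.trans (mul_le_mul_of_nonneg_right
      (H.flowConst_mono (sub_nonneg.mpr ht.1) (by linarith [ht.2])) (norm_nonneg _))
  have hzcont : ∀ t ∈ Icc (-τ) (t₀ + δ), ContinuousOn (z t) (Ioc 0 s₅) := fun t ht =>
    (P t).continuous.comp_continuousOn ((hzc t ht).sub continuousOn_const)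
  -- one step
  have hstep : ∀ t t', -τ ≤ t → t ≤ t' → t' ≤ t₁ → (t ≤ -δ ∨ δ ≤ t) → t' - t ≤ θ' →
      ∀ s ∈ Ioc 0 s₅, ‖z t' s - z t s‖ ≤ 1 / 2 * ‖z t s‖ := by
    intro t t' h1 h2 h3 h4 h5 s hs
    have hl := hlow s hs t h1 (h2.trans h3) h4
    have hst := (hxT s hs).step_le hloopT H (T := T) (by linarith) h1 h2 h3 h4
    have hP1 := hPθ t' ⟨h1.trans h2, by linarith⟩ t ⟨h1, by linarith⟩ (by
      rw [Real.dist_eq, abs_of_nonneg (by linarith)]; exact h5.trans (min_le_left _ _))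
    rw [dist_eq_norm] at hP1
    have hd1 := hDle s hs t ⟨h1, by linarith⟩
    have hd2 := hDle s hs t' ⟨h1.trans h2, by linarith⟩
    have hMt := hMP t ⟨h1, by linarith⟩
    have e : z t' s - z t s = (P t' - P t) (x s t' - loop p σ ξ t₀ t') +
        P t ((x s t' - loop p σ ξ t₀ t') - (x s t - loop p σ ξ t₀ t)) := by
      simp only [hz, _root_.sub_apply, map_sub]; ring
    rw [e]
    refine (norm_add_le _ _).trans ?_
    have k1 : ‖(P t' - P t) (x s t' - loop p σ ξ t₀ t')‖ ≤ c₃ / 8 * s := by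
      refine ((P t' - P t).le_opNorm _).trans ?_
      calc _ ≤ c₃ / (8 * A) * (A * s) := mul_le_mul hP1 hd2 (norm_nonneg _) (by positivity)
        _ = _ := by field_simp
    have k2 : ‖P t ((x s t' - loop p σ ξ t₀ t') - (x s t - loop p σ ξ t₀ t))‖ ≤ c₃ / 8 * s := by
      refine ((P t).le_opNorm _).trans ?_
      have h6 : (MP + 1) * C₁ * A * (t' - t) ≤ c₃ / 8 := by
        have := h5.trans (min_le_right _ _)
        rw [le_div_iff₀ (by positivity)] at this
        linarith
      have hs0 : 0 ≤ s := hs.1.le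
      have htt : 0 ≤ t' - t := sub_nonneg.mpr h2
      calc _ ≤ (MP + 1) * (C₁ * (t' - t) * (A * s)) := by
            refine mul_le_mul (by linarith) (hst.trans ?_) (norm_nonneg _) (by linarith)
            exact mul_le_mul_of_nonneg_left hd1 (by positivity)
        _ = (MP + 1) * C₁ * A * (t' - t) * s := by ring
        _ ≤ _ := mul_le_mul_of_nonneg_right h6 hs0
    have : 0 ≤ c₃ * s := mul_nonneg hc₃0.le hs.1.le
    linarith
  have hL0 : HasBoundedLog (Ioc 0 s₅) (z (-τ)) := by
    have e : ∀ s ∈ Ioc 0 s₅, z (-τ) s = z₀ s := fun s hs => by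
      simp only [hz, hz₀, (hx s hs).1]
    obtain ⟨E, B, h1, h2⟩ := hlog₀ s₅ (hs₅.trans (min_le_right _ _))
      ((hzcont (-τ) ⟨le_rfl, by linarith⟩).congr fun s hs => (e s hs).symm)
    exact ⟨E, B, h1, fun s hs => ⟨by rw [(h2 s hs).1, e s hs], (h2 s hs).2⟩⟩
  have hL1 : HasBoundedLog (Ioc 0 s₅) (z (-δ)) :=
    HasBoundedLog.transport (by linarith) hθ'0 (fun t ht => hzcont t ⟨ht.1, by linarith [ht.2]⟩)
      (fun t ht t' ht' htt hd => hstep t t' ht.1 htt (by linarith [ht'.2]) (Or.inl ht.2) hd) hL0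
  have hL2 : HasBoundedLog (Ioc 0 s₅) (z δ) :=
    hL1.step (hzcont δ ⟨by linarith, by linarith⟩)
      (hstep (-δ) δ (by linarith) (by linarith) (by linarith) (Or.inl le_rfl) (by linarith))
  have hL3 : HasBoundedLog (Ioc 0 s₅) (z t₁) :=
    HasBoundedLog.transport (by linarith) hθ'0
      (fun t ht => hzcont t ⟨by linarith [ht.1], by linarith [ht.2]⟩)
      (fun t ht t' ht' htt hd => hstep t t' (by linarith [ht.1]) htt ht'.2 (Or.inr ht.1) hd) hL2
  -- landing
  refine hL3.step (π.continuous.comp_continuousOn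
    ((hzc _ ⟨by linarith, le_rfl⟩).sub continuousOn_const)) fun s hs => ?_
  have hs0 : 0 ≤ s := hs.1.le
  have hl := hlow s hs t₁ (by linarith) le_rfl (Or.inr (by linarith))
  have hsub2 : ∀ t ∈ Icc t₁ (t₀ + δ), t ∈ Icc (-τ) (t₀ + δ) := fun t ht =>
    ⟨by linarith [ht.1], ht.2⟩
  have hdis := H.displacement_le π (κ := κ) (B := A * s) le_rfl zero_le_one
    (a := t₁) (b := t₀ + δ) (by linarith)
    ((hx s hs).2.1.mono le_rfl (by linarith) le_rfl) (C.follows_loop _ _)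
    (fun t ht => hxK s hs t (hsub2 t ht)) (fun t _ => hloopK t)
    (fun t ht => hjump _ (by
      have h1 := ((hx s hs).2.2 t (hsub2 t ht)).trans (min_le_right _ _)
      have h2 := hloopp (x := t) (by
        rw [Real.dist_eq]
        have : |t - t₀| ≤ δ := abs_le.mpr ⟨by linarith [ht.1], by linarith [ht.2]⟩
        linarith)
      rw [C.loop_ge le_rfl, dist_eq_norm] at h2
      have h3 := norm_add_le (x s t - loop p σ ξ t₀ t) (loop p σ ξ t₀ t - p)
      rw [sub_add_sub_cancel] at h3
      linarith)) (fun t ht => hDle s hs t (hsub2 t ht))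
  have ht₁m : t₁ ∈ Icc (-τ) (t₀ + δ) := ⟨by linarith, by linarith⟩
  have hd1 := hDle s hs t₁ ht₁m
  rw [C.loop_ge (t := t₀ + δ) (by linarith)] at hdis
  have hh1 := H.lip_h _ (hxK s hs t₁ ht₁m) _ (hloopK t₁)
  have k1 : κ / c * |h (x s t₁) - h (loop p σ ξ t₀ t₁)| ≤ c₃ / 8 * s := by
    calc _ ≤ κ / c * (L * (A * s)) := by
          refine mul_le_mul_of_nonneg_left (hh1.trans ?_) (by positivity)
          exact mul_le_mul_of_nonneg_left hd1 hL.le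
      _ = _ := by rw [hκ]; field_simp
  have k2 : (‖π‖ + κ / c) * Controlled.rate L c ρ * (A * s + 0) * (t₀ + δ - t₁) ≤ c₃ / 8 * s := by
    rw [le_div_iff₀ (by positivity)] at hδr
    have e : t₀ + δ - t₁ = 2 * δ := by rw [ht₁]; ring
    rw [e, add_zero]
    have h6 := mul_le_mul_of_nonneg_right hδr hs0
    linarith
  have hP1 := hPθ t₁ ⟨by linarith, by linarith⟩ t₀ ⟨hτt, le_rfl⟩ (by
    rw [Real.dist_eq, abs_sub_comm, abs_of_nonneg (by linarith)]
    have := min_le_left θ (c₃ / (8 * ((MP + 1) * C₁ * A)))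
    linarith)
  rw [dist_eq_norm, hPt₀] at hP1
  have k3 : ‖(P t₁ - π) (x s t₁ - loop p σ ξ t₀ t₁)‖ ≤ c₃ / 8 * s := by
    refine ((P t₁ - π).le_opNorm _).trans ?_
    calc _ ≤ c₃ / (8 * A) * (A * s) := mul_le_mul hP1 hd1 (norm_nonneg _) (by positivity)
      _ = _ := by field_simp
  have e : π (x s (t₀ + δ) - p) - z t₁ s =
      (π (x s (t₀ + δ) - p) - π (x s t₁ - loop p σ ξ t₀ t₁)) -
        (P t₁ - π) (x s t₁ - loop p σ ξ t₀ t₁) := by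
    simp only [hz, _root_.sub_apply]; ring
  rw [e]
  refine (norm_sub_le _ _).trans ?_
  have : 0 ≤ c₃ * s := mul_nonneg hc₃0.le hs0
  linarith

end SaddleFocus

end PWField

namespace PWField

theorem blend_mem_velocities {h : E3 → ℝ} {Z : PWField} {x : E3} {l : ℝ} (hl : Admissible h x l) :
    blend Z l x ∈ velocities h Z x := by
  rcases lt_trichotomy (h x) 0 with h0 | h0 | h0
  · exact Or.inr (Or.inl ⟨h0, by simp [blend, hl.2.2 h0]⟩)
  · exact Or.inr (Or.inr ⟨h0, l, 1 - l, hl.1.1, sub_nonneg.mpr hl.1.2, by ring, rfl⟩)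
  · exact Or.inl ⟨h0, by simp [blend, hl.2.1 h0]⟩

theorem exists_blend_of_mem_velocities {h : E3 → ℝ} {Z : PWField} {x v : E3}
    (hv : v ∈ velocities h Z x) : ∃ l, Admissible h x l ∧ v = blend Z l x := by
  rcases hv with ⟨h0, rfl⟩ | ⟨h0, rfl⟩ | ⟨h0, s, t, hs, ht, hst, rfl⟩
  · exact ⟨1, ⟨by simp, fun _ => rfl, fun h1 => absurd h1 (not_lt.mpr h0.le)⟩, by simp [blend]⟩
  · exact ⟨0, ⟨by simp, fun h1 => absurd h1 (not_lt.mpr h0.le), fun _ => rfl⟩, by simp [blend]⟩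
  · refine ⟨s, ⟨⟨hs, by linarith⟩, fun h1 => absurd h0 h1.ne', fun h1 => absurd h0 h1.ne⟩, ?_⟩
    rw [blend, ← hst, add_sub_cancel_left]

theorem Follows.velocities {h : E3 → ℝ} {Z : PWField} {a b : ℝ} {γ : ℝ → E3}
    (hγ : Follows h Z 0 a b γ) :
    ∀ᵐ t, t ∈ Ioo a b → ∃ v ∈ velocities h Z (γ t), HasDerivAt γ v t := by
  filter_upwards [hγ.2] with t ht htab
  obtain ⟨v, hv, l, hl, hle⟩ := ht htab
  rw [norm_le_zero_iff, sub_eq_zero] at hle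
  exact ⟨v, hle ▸ blend_mem_velocities hl, hv⟩

theorem IsTrajectory.follows {U : Set E3} {h : E3 → ℝ} {Z : PWField} {γ : ℝ → E3}
    (hγ : IsTrajectory U h Z γ) (a b : ℝ) : Follows h Z 0 a b γ := by
  refine ⟨hγ.1, ?_⟩
  filter_upwards [hγ.2.2] with t ht _
  obtain ⟨v, hv, hd⟩ := ht
  obtain ⟨l, hl, rfl⟩ := exists_blend_of_mem_velocities hv
  exact ⟨_, hd, l, hl, by rw [sub_self, norm_zero]⟩

/-- A closed arc of trajectory extends to a periodic trajectory. -/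
theorem exists_periodic_trajectory {U : Set E3} {h : E3 → ℝ} {Z : PWField} {y : ℝ → E3} {A B : ℝ}
    (hAB : A < B) {C : NNReal} (hy : LipschitzOnWith C y (Icc A B)) (hyAB : y A = y B)
    (hyU : ∀ t ∈ Icc A B, y t ∈ U)
    (hv : ∀ᵐ t, t ∈ Ioo A B → ∃ v ∈ velocities h Z (y t), HasDerivAt y v t) :
    ∃ γ, IsTrajectory U h Z γ ∧ Function.Periodic γ (B - A) ∧ (∀ t ∈ Ico A B, γ t = y t) ∧
      range γ = y '' Icc A B := by
  set T := B - A with hT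
  have hT0 : 0 < T := sub_pos.mpr hAB
  have hAT : A + T = B := by rw [hT]; ring
  set γ : ℝ → E3 := fun t => y (toIcoMod hT0 A t) with hγ
  have hmem : ∀ t, toIcoMod hT0 A t ∈ Ico A B := fun t => by
    have := toIcoMod_mem_Ico hT0 A t
    rwa [hAT] at this
  have hγn : ∀ (n : ℤ) t, t - n * T ∈ Ico A B → γ t = y (t - n * T) := by
    intro n t ht
    simp only [hγ]
    congr 1
    rw [toIcoMod_eq_iff, hAT]
    exact ⟨ht, n, by rw [zsmul_eq_mul]; ring⟩
  have hγy : ∀ t ∈ Ico A B, γ t = y t := fun t ht => by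
    have := hγn 0 t (by simpa using ht)
    simpa using this
  have hper : Function.Periodic γ T := fun t => by simp only [hγ, toIcoMod_add_right]
  refine ⟨γ, ⟨?_, fun t => hyU _ (Ico_subset_Icc_self (hmem t)), ?_⟩, hper, hγy, ?_⟩
  · intro t₀
    set n := toIcoDiv hT0 A t₀ with hn
    set b := A + n * T with hb
    have hbt : b ≤ t₀ ∧ t₀ < b + T := by
      have h1 := hmem t₀
      have h2 := self_sub_toIcoDiv_zsmul hT0 A t₀
      rw [zsmul_eq_mul, ← hn] at h2
      rw [← h2] at h1
      constructor <;> linarith [h1.1, h1.2]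
    set yc : ℝ → E3 := fun t => y (max A (min B t)) with hyc
    have hclamp : ∀ t, max A (min B t) ∈ Icc A B := fun t =>
      ⟨le_max_left _ _, max_le hAB.le (min_le_left _ _)⟩
    have hycl : LipschitzWith C yc := by
      refine LipschitzWith.of_dist_le_mul fun s t => ?_
      refine (hy.dist_le_mul _ (hclamp s) _ (hclamp t)).trans ?_
      gcongr
      rw [Real.dist_eq, Real.dist_eq]
      have h1 : |max A (min B s) - max A (min B t)| ≤ |min B s - min B t| := by
        simpa using abs_max_sub_max_le_max A (min B s) A (min B t)
      have h2 : |min B s - min B t| ≤ |s - t| := by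
        simpa using abs_min_sub_min_le_max B s B t
      exact h1.trans h2
    have hloc : ∀ t ∈ Ioo (b - T) (b + T),
        γ t = yc (min (t - b) 0 + B) + yc (max (t - b) 0 + A) - y A := by
      intro t ht
      rcases lt_or_ge t b with h1 | h1
      · have e : t - ((n - 1 : ℤ) : ℝ) * T = t - b + B := by push_cast; rw [hb]; linarith
        rw [hγn (n - 1) t (by rw [e]; constructor <;> linarith [ht.1]), e]
        have e1 : min (t - b) 0 = t - b := min_eq_left (by linarith)
        have e2 : max (t - b) 0 = 0 := max_eq_right (by linarith)
        simp only [hyc, e1, e2, zero_add, min_eq_right hAB.le, max_self, add_sub_cancel_right]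
        rw [min_eq_right (by linarith : t - b + B ≤ B), max_eq_right (by linarith [ht.1])]
      · have e : t - (n : ℝ) * T = t - b + A := by rw [hb]; ring
        rw [hγn n t (by rw [e]; constructor <;> linarith [ht.2]), e]
        have e1 : min (t - b) 0 = 0 := min_eq_right (by linarith)
        have e2 : max (t - b) 0 = t - b := max_eq_left (by linarith)
        simp only [hyc, e1, e2, zero_add, min_self, max_eq_right hAB.le, ← hyAB,
          add_sub_cancel_left]
        rw [min_eq_right (by linarith [ht.2] : t - b + A ≤ B), max_eq_right (by linarith)]
    have hL : LipschitzWith (C * 1 + C * 1 + 0)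
        (fun t => yc (min (t - b) 0 + B) + yc (max (t - b) 0 + A) - y A) := by
      have hsub : LipschitzWith 1 fun t : ℝ => t - b :=
        LipschitzWith.of_dist_le_mul fun s t => by simp
      have h1 : LipschitzWith 1 fun t : ℝ => min (t - b) 0 + B := by
        refine LipschitzWith.of_dist_le_mul fun s t => ?_
        have := (hsub.min_const 0).dist_le_mul s t
        simpa [dist_add_right] using this
      have h2 : LipschitzWith 1 fun t : ℝ => max (t - b) 0 + A := by
        refine LipschitzWith.of_dist_le_mul fun s t => ?_
        have := (hsub.max_const 0).dist_le_mul s t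
        simpa [dist_add_right] using this
      exact ((hycl.comp h1).add (hycl.comp h2)).sub (LipschitzWith.const (y A))
    refine ⟨C * 1 + C * 1 + 0, Ioo (b - T) (b + T), Ioo_mem_nhds (by linarith) hbt.2,
      fun s hs t ht => ?_⟩
    rw [hloc s hs, hloc t ht]
    exact hL s t
  · have h1 : ∀ᵐ t : ℝ, ∀ n : ℤ, t - n * T ∈ Ioo A B →
        ∃ v ∈ velocities h Z (y (t - n * T)), HasDerivAt y v (t - n * T) := by
      rw [ae_all_iff]
      intro n
      exact (measurePreserving_sub_right volume (n * T)).quasiMeasurePreserving.ae hv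
    have h2 : ∀ᵐ t : ℝ, t ∉ range fun n : ℤ => A + n * T := by
      have : (range fun n : ℤ => A + n * T).Countable := countable_range _
      exact this.ae_notMem volume
    filter_upwards [h1, h2] with t ht1 ht2
    set n := toIcoDiv hT0 A t with hn
    have h3 := hmem t
    have h4 := self_sub_toIcoDiv_zsmul hT0 A t
    rw [zsmul_eq_mul, ← hn] at h4
    rw [← h4] at h3
    have h5 : A ≠ t - n * T := fun h => ht2 ⟨n, by simp only; linarith⟩
    have h6 : t - n * T ∈ Ioo A B := ⟨lt_of_le_of_ne h3.1 h5, h3.2⟩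
    obtain ⟨v, hv1, hv2⟩ := ht1 n h6
    refine ⟨v, ?_, ?_⟩
    · rw [hγn n t h3]; exact hv1
    · have h7 : HasDerivAt (fun t => y (t - n * T)) v t := HasDerivAt.comp_sub_const t (n * T) hv2
      refine h7.congr_of_eventuallyEq ?_
      have : ∀ᶠ s in 𝓝 t, s - n * T ∈ Ioo A B :=
        (by fun_prop : Continuous fun s : ℝ => s - n * T).continuousAt.eventually_mem
          (isOpen_Ioo.mem_nhds h6)
      filter_upwards [this] with s hs
      exact hγn n s (Ioo_subset_Ico_self hs)
  · apply Subset.antisymm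
    · rintro _ ⟨t, rfl⟩
      exact ⟨_, Ico_subset_Icc_self (hmem t), rfl⟩
    · rintro _ ⟨t, ht, rfl⟩
      rcases ht.2.lt_or_eq with h1 | h1
      · exact ⟨t, hγy t ⟨ht.1, h1⟩⟩
      · exact ⟨A, by rw [hγy A ⟨le_rfl, hAB⟩, h1, hyAB]⟩

/-- The sliding field depends continuously on the system. -/
theorem slidingField_sub_le_of_close {h : E3 → ℝ} {Z Z' : PWField} {x : E3} {L m η : ℝ}
    (hdh : ‖fderiv ℝ h x‖ ≤ L) (hX : ‖Z.X x‖ ≤ L) (hY : ‖Z.Y x‖ ≤ L) (hm : 0 < m)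
    (hX' : ‖Z'.X x - Z.X x‖ ≤ η) (hY' : ‖Z'.Y x - Z.Y x‖ ≤ η)
    (h1 : lieDeriv Z.X h x < 0) (h2 : 0 < lieDeriv Z.Y h x)
    (h3 : lieDeriv Z'.X h x ≤ -m) (h4 : m ≤ lieDeriv Z'.Y h x) :
    ‖slidingField h Z' x - slidingField h Z x‖ ≤ (1 + L ^ 2 / m) * η := by
  have hL : 0 ≤ L := (norm_nonneg _).trans hX
  have hη : 0 ≤ η := (norm_nonneg _).trans hX'
  set A := lieDeriv Z.Y h x with hA
  set B := lieDeriv Z.X h x with hB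
  set A' := lieDeriv Z'.Y h x with hA'
  set B' := lieDeriv Z'.X h x with hB'
  have dA : |A' - A| ≤ L * η := by
    rw [hA, hA', lieDeriv, lieDeriv, ← map_sub, ← Real.norm_eq_abs]
    exact ((fderiv ℝ h x).le_of_opNorm_le hdh _).trans (mul_le_mul_of_nonneg_left hY' hL)
  have dB : |B' - B| ≤ L * η := by
    rw [hB, hB', lieDeriv, lieDeriv, ← map_sub, ← Real.norm_eq_abs]
    exact ((fderiv ℝ h x).le_of_opNorm_le hdh _).trans (mul_le_mul_of_nonneg_left hX' hL)
  have hAB : 0 < A - B := by linarith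
  have hAB' : 2 * m ≤ A' - B' := by linarith
  have hAB0 : 0 < A' - B' := by linarith
  set l := A / (A - B) with hl
  set l' := A' / (A' - B') with hl'
  have hl'0 : 0 ≤ l' := div_nonneg (by linarith) hAB0.le
  have hl'1 : l' ≤ 1 := (div_le_one hAB0).mpr (by linarith)
  have dl : |l' - l| ≤ L * η / (2 * m) := by
    have e : l' - l = (A * (B' - B) - (A' - A) * B) / ((A' - B') * (A - B)) := by
      rw [hl, hl', div_sub_div _ _ hAB0.ne' hAB.ne']
      congr 1
      ring
    rw [e, abs_div, abs_of_pos (by positivity : 0 < (A' - B') * (A - B)), div_le_div_iff₀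
      (by positivity) (by positivity)]
    have h5 : |A * (B' - B) - (A' - A) * B| ≤ (A - B) * (L * η) := by
      refine (abs_sub _ _).trans ?_
      rw [abs_mul, abs_mul, abs_of_pos h2, abs_of_neg h1]
      nlinarith
    calc _ ≤ (A - B) * (L * η) * (2 * m) := by gcongr
      _ = (L * η) * (2 * m * (A - B)) := by ring
      _ ≤ L * η * ((A' - B') * (A - B)) := by gcongr
  rw [slidingField_eq_blend hAB.ne', slidingField_eq_blend hAB0.ne']
  have e : blend Z' l' x - blend Z l x = (l' • (Z'.X x - Z.X x) + (1 - l') • (Z'.Y x - Z.Y x)) +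
      (l' - l) • (Z.X x - Z.Y x) := by
    simp only [blend]; module
  rw [e]
  have h5 : ‖l' • (Z'.X x - Z.X x) + (1 - l') • (Z'.Y x - Z.Y x)‖ ≤ η := by
    refine (norm_add_le _ _).trans ?_
    rw [norm_smul, norm_smul, Real.norm_of_nonneg hl'0, Real.norm_of_nonneg (sub_nonneg.mpr hl'1)]
    have := mul_le_mul_of_nonneg_left hX' hl'0
    have := mul_le_mul_of_nonneg_left hY' (sub_nonneg.mpr hl'1)
    linarith
  have h6 : ‖(l' - l) • (Z.X x - Z.Y x)‖ ≤ L ^ 2 / m * η := by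
    rw [norm_smul, Real.norm_eq_abs]
    have h7 : ‖Z.X x - Z.Y x‖ ≤ 2 * L := (norm_sub_le _ _).trans (by linarith)
    calc _ ≤ L * η / (2 * m) * (2 * L) := mul_le_mul dl h7 (norm_nonneg _) (by positivity)
      _ = _ := by field_simp
  refine (norm_add_le _ _).trans ?_
  linarith

end PWField

namespace PWField

namespace SaddleFocus

variable {U : Set E3} {h : E3 → ℝ} {Z : PWField} {p q : E3} {σ ξ : ℝ → E3} {t₀ : ℝ}
  {π : E3 →L[ℝ] ℂ} {ι : ℂ →L[ℝ] E3} {ψ : ℂ → E3} {r Cψ r' a β : ℝ}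

/-- A trajectory arc that is closed up by an arc of the sliding flow near the focus. -/
theorem isSlidingPeriodicOrbit_of_arcs (F : SaddleFocus U h Z p q σ ξ t₀ π ι ψ r Cψ r' a β)
    {Z' : PWField} (hX' : ContinuousOn Z'.X U) (hY' : ContinuousOn Z'.Y U) {A b τ : ℝ}
    (hAb : A < b) (hτ : 0 ≤ τ) {x : ℝ → E3} (hx : Follows h Z' 0 A b x)
    (hxU : ∀ t ∈ Icc A b, x t ∈ U) {ω : ℝ → ℂ}
    (hω : ∀ t ∈ Icc 0 τ, Complex.exp (ω t) ∈ Metric.ball (0 : ℂ) r ∧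
      lieDeriv Z'.X h (ψ (Complex.exp (ω t))) ≤ 0 ∧ 0 < lieDeriv Z'.Y h (ψ (Complex.exp (ω t))) ∧
      HasDerivAt (fun t => Complex.exp (ω t))
        (π (slidingField h Z' (ψ (Complex.exp (ω t))))) t)
    (h0 : ψ (Complex.exp (ω 0)) = x b) (h1 : ψ (Complex.exp (ω τ)) = x A)
    {c d : ℝ} (hcd : c < d) (hAc : A ≤ c) (hdb : d ≤ b)
    (hslide : ∀ t ∈ Ioo c d, x t ∈ slidingRegion U h Z')
    (hfly : ∃ t ∈ Ioo A b, h (x t) ≠ 0) :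
    IsSlidingPeriodicOrbit U h Z' (x '' Icc A b ∪ (fun t => ψ (Complex.exp (ω t))) '' Icc 0 τ) := by
  have C := F.conn
  set g : ℝ → E3 := fun t => ψ (Complex.exp (ω (t - b))) with hg
  set B := b + τ with hB
  have hbB : b ≤ B := by linarith
  have hmem : ∀ t ∈ Icc b B, t - b ∈ Icc 0 τ := fun t ht => ⟨by linarith [ht.1], by linarith [ht.2]⟩
  have hgd : ∀ t ∈ Icc b B, HasDerivAt g (slidingField h Z' (g t)) t := by
    intro t ht
    obtain ⟨e1, -, -, e4⟩ := hω _ (hmem t ht)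
    have h2 := F.chart.hasDerivAt F.coord C.isOpen C.smooth
      (w := fun t => Complex.exp (ω t)) e1 (fderiv_slidingField _) e4
    exact HasDerivAt.comp_sub_const t b h2
  have hgU : ∀ t ∈ Icc b B, g t ∈ U := fun t ht => F.chart.ψ_mem _ (hω _ (hmem t ht)).1
  have hgh : ∀ t ∈ Icc b B, h (g t) = 0 := fun t ht => F.chart.h_ψ _ (hω _ (hmem t ht)).1
  have hgc : ContinuousOn g (Icc b B) := fun t ht => (hgd t ht).continuousAt.continuousWithinAt
  obtain ⟨M, hM⟩ := isCompact_Icc.exists_bound_of_continuousOn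
    (f := fun t => slidingField h Z' (g t)) (s := Icc b B)
    ((continuousOn_slidingField C.isOpen C.smooth hX' hY').comp hgc fun t ht => by
      obtain ⟨-, e2, e3, -⟩ := hω _ (hmem t ht)
      exact ⟨hgU t ht, by change lieDeriv Z'.Y h (ψ _) - lieDeriv Z'.X h (ψ _) ≠ 0; linarith⟩)
  have hM0 : 0 ≤ M := (norm_nonneg _).trans (hM b ⟨le_rfl, hbB⟩)
  have hgl : LipschitzOnWith ⟨M, hM0⟩ g (Icc b B) :=
    (convex_Icc b B).lipschitzOnWith_of_nnnorm_hasDerivWithin_le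
      (fun t ht => (hgd t ht).hasDerivWithinAt) fun t ht => hM t ht
  obtain ⟨Cx, hCx⟩ := LocallyLipschitz.exists_lipschitzOnWith_Icc hx.1 A b
  have hgb : g b = x b := by simp only [hg, sub_self, h0]
  have hgB : g B = x A := by simp only [hg, hB, add_sub_cancel_left, h1]
  set y : ℝ → E3 := fun t => x (min t b) + g (max t b) - x b with hy
  have hy1 : ∀ t ≤ b, y t = x t := fun t ht => by
    simp only [hy, min_eq_left ht, max_eq_right ht, hgb, add_sub_cancel_right]
  have hy2 : ∀ t, b ≤ t → y t = g t := fun t ht => by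
    simp only [hy, min_eq_right ht, max_eq_left ht, add_sub_cancel_left]
  have hAB : A < B := by linarith
  have hyl : LipschitzOnWith (Cx * 1 + ⟨M, hM0⟩ * 1 + 0) y (Icc A B) := by
    have h2 : LipschitzWith 1 fun t : ℝ => min t b := LipschitzWith.id.min_const b
    have h3 : LipschitzWith 1 fun t : ℝ => max t b := LipschitzWith.id.max_const b
    exact ((hCx.comp h2.lipschitzOnWith fun t ht => ⟨le_min ht.1 hAb.le, min_le_right _ _⟩).add
      (hgl.comp h3.lipschitzOnWith fun t ht => ⟨le_max_right _ _, max_le ht.2 hbB⟩)).sub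
      (LipschitzWith.const (x b)).lipschitzOnWith
  have hyv : ∀ᵐ t, t ∈ Ioo A B → ∃ v ∈ velocities h Z' (y t), HasDerivAt y v t := by
    filter_upwards [hx.velocities, (countable_singleton b).ae_notMem volume] with t ht1 ht2 ht
    rcases lt_or_gt_of_ne (show t ≠ b from ht2) with h2 | h2
    · obtain ⟨v, hv, hd⟩ := ht1 ⟨ht.1, h2⟩
      refine ⟨v, by rwa [hy1 t h2.le], hd.congr_of_eventuallyEq ?_⟩
      filter_upwards [Iio_mem_nhds h2] with s hs using hy1 s (le_of_lt hs)
    · have htI : t ∈ Icc b B := ⟨h2.le, ht.2.le⟩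
      refine ⟨slidingField h Z' (g t), ?_, (hgd t htI).congr_of_eventuallyEq ?_⟩
      · rw [hy2 t h2.le]
        obtain ⟨-, e2, e3, -⟩ := hω _ (hmem t htI)
        obtain ⟨l, hl, hle⟩ := Connection.admissible_slidingField (Z := Z') (hgh t htI) e2 e3
        rw [hle]
        exact blend_mem_velocities hl
      · filter_upwards [Ioi_mem_nhds h2] with s hs using hy2 s (le_of_lt hs)
  obtain ⟨γ, hγ, hγp, hγy, hγr⟩ := exists_periodic_trajectory (U := U) hAB hyl
    (by rw [hy1 A hAb.le, hy2 B hbB, hgB]) (fun t ht => by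
      rcases le_total t b with h2 | h2
      · rw [hy1 t h2]; exact hxU t ⟨ht.1, h2⟩
      · rw [hy2 t h2]; exact hgU t ⟨h2, ht.2⟩) hyv
  have hγx : ∀ t ∈ Ico A b, γ t = x t := fun t ht => by
    rw [hγy t ⟨ht.1, ht.2.trans_le hbB⟩, hy1 t ht.2.le]
  obtain ⟨t, ht, hth⟩ := hfly
  refine ⟨γ, B - A, sub_pos.mpr hAB, hγ, hγp, ⟨c, d, hcd, fun s hs => Or.inl ?_⟩, ⟨t, ?_⟩, ?_⟩
  · rw [hγx s ⟨hAc.trans hs.1.le, hs.2.trans_le hdb⟩]; exact hslide s hs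
  · rw [hγx t ⟨ht.1.le, ht.2⟩]; exact hth
  · rw [hγr]
    apply Subset.antisymm
    · rintro _ (⟨s, hs, rfl⟩ | ⟨s, hs, rfl⟩)
      · exact ⟨s, ⟨hs.1, hs.2.trans hbB⟩, hy1 s hs.2⟩
      · refine ⟨b + s, ⟨by linarith [hs.1], by linarith [hs.2]⟩, ?_⟩
        rw [hy2 _ (by linarith [hs.1])]
        simp only [hg, add_sub_cancel_left]
    · rintro _ ⟨s, hs, rfl⟩
      rcases le_total s b with h2 | h2
      · exact Or.inl ⟨s, ⟨hs.1, h2⟩, (hy1 s h2).symm⟩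
      · exact Or.inr ⟨s - b, hmem s ⟨h2, hs.2⟩, (hy2 s h2).symm⟩

end SaddleFocus

end PWField

namespace PWField

/-- `Z'` is `η`-close to `Z` on `K`. -/
def Close (K : Set E3) (η : ℝ) (Z' Z : PWField) : Prop :=
  (∀ x ∈ K, ‖Z'.X x - Z.X x‖ ≤ η) ∧ ∀ x ∈ K, ‖Z'.Y x - Z.Y x‖ ≤ η

theorem Close.mono {K K' : Set E3} {η η' : ℝ} {Z Z' : PWField} (hZ : Close K η Z' Z) (hK : K' ⊆ K)
    (hη : η ≤ η') : Close K' η' Z' Z :=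
  ⟨fun x hx => (hZ.1 x (hK hx)).trans hη, fun x hx => (hZ.2 x (hK hx)).trans hη⟩

theorem Follows.of_close {h : E3 → ℝ} {K : Set E3} {η a b : ℝ} {Z Z' : PWField} {γ : ℝ → E3}
    (hγ : Follows h Z' 0 a b γ) (hZ : Close K η Z' Z) (hK : ∀ t ∈ Ioo a b, γ t ∈ K) :
    Follows h Z η a b γ := by
  have := hγ.change (fun t ht => hZ.1 _ (hK t ht)) fun t ht => hZ.2 _ (hK t ht)
  rwa [zero_add] at this

theorem Controlled.lieDeriv_sub_le {h : E3 → ℝ} {Z Z' : PWField} {K : Set E3} {L c ρ η : ℝ}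
    (H : Controlled h Z K L c ρ) (hZ : Close K η Z' Z) {x : E3} (hx : x ∈ K) :
    |lieDeriv Z'.X h x - lieDeriv Z.X h x| ≤ L * η ∧
      |lieDeriv Z'.Y h x - lieDeriv Z.Y h x| ≤ L * η := by
  have hL : 0 ≤ L := zero_le_one.trans H.one_le
  simp only [lieDeriv, ← map_sub, ← Real.norm_eq_abs]
  exact ⟨((fderiv ℝ h x).le_of_opNorm_le (H.dh_le x hx) _).trans
      (mul_le_mul_of_nonneg_left (hZ.1 x hx) hL),
    ((fderiv ℝ h x).le_of_opNorm_le (H.dh_le x hx) _).trans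
      (mul_le_mul_of_nonneg_left (hZ.2 x hx) hL)⟩

theorem Controlled.of_close {U : Set E3} {h : E3 → ℝ} {Z Z' : PWField} {K : Set E3} {L c ρ η : ℝ}
    (H : Controlled h Z K L c ρ) (hU : IsOpen U) (hh : ContDiffOn ℝ 2 h U)
    (hX : LocallyLipschitzOn U Z'.X) (hY : LocallyLipschitzOn U Z'.Y) (hK : IsCompact K)
    (hKU : K ⊆ U) (hZ : Close K η Z' Z) (hη : 2 * L * η < c) :
    ∃ L' c' ρ', Controlled h Z' K L' c' ρ' := by
  refine exists_controlled hU hh hX hY hK hKU fun x hx hx0 => ?_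
  obtain ⟨h1, h2⟩ := H.lieDeriv_sub_le hZ hx
  have h3 := H.gap x hx (by rw [hx0, abs_zero]; exact H.rho_pos.le)
  rw [abs_le] at h1 h2
  linarith [h1.2, h2.1]

namespace SaddleFocus

variable {U : Set E3} {h : E3 → ℝ} {Z : PWField} {p q : E3} {σ ξ : ℝ → E3} {t₀ : ℝ}
  {π : E3 →L[ℝ] ℂ} {ι : ℂ →L[ℝ] E3} {ψ : ℂ → E3} {r Cψ r' a β : ℝ}

/-- A disc around the focus on which the sliding fields of the nearby systems are under control. -/
theorem exists_focus_ball (F : SaddleFocus U h Z p q σ ξ t₀ π ι ψ r Cψ r' a β)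
    {K : Set E3} {L c ρ R : ℝ} (H : Controlled h Z K L c ρ) (hR : 0 < R)
    (hK : Metric.cthickening R (range (loop p σ ξ t₀)) ⊆ K) {κ ε : ℝ} (hκ : 0 < κ) (hε : 0 < ε) :
    ∃ r₂ > 0, r₂ ≤ r ∧ ∃ m > 0, ∃ M > 0, ∃ η₁ > 0, ∀ w ∈ Metric.ball (0 : ℂ) r₂,
      ψ w ∈ K ∧ ‖ψ w - p‖ ≤ ε ∧ ∀ Z' η, η ≤ η₁ → Close K η Z' Z →
        lieDeriv Z'.X h (ψ w) ≤ -m ∧ m ≤ lieDeriv Z'.Y h (ψ w) ∧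
        ‖π (slidingField h Z' (ψ w)) - (a + β * Complex.I) * w‖ ≤ κ * ‖w‖ + M * η := by
  have C := F.conn
  obtain ⟨r₁, hr₁, hr₁r, has⟩ := F.asymp κ hκ
  have hpU : {p} ⊆ U := singleton_subset_iff.mpr C.p_mem.1.1
  obtain ⟨m₁, hm₁, ε₁, hε₁, h1⟩ := (isCompact_singleton (x := p)).exists_margin C.isOpen hpU
    (continuousOn_lieDeriv C.isOpen C.smooth C.lip_X.continuousOn).neg
    (fun x hx => by rw [mem_singleton_iff.mp hx]; exact neg_pos.mpr C.p_mem.2.1)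
  obtain ⟨m₂, hm₂, ε₂, hε₂, h2⟩ := (isCompact_singleton (x := p)).exists_margin C.isOpen hpU
    (continuousOn_lieDeriv C.isOpen C.smooth C.lip_Y.continuousOn)
    (fun x hx => by rw [mem_singleton_iff.mp hx]; exact C.p_mem.2.2)
  set m := min m₁ m₂ / 2 with hm
  have hm0 : 0 < m := by positivity
  have hL : 0 < L := zero_lt_one.trans_le H.one_le
  have hCψ := F.chart.C_pos
  have hm12 : 2 * m ≤ m₁ ∧ 2 * m ≤ m₂ := by
    have := min_le_left m₁ m₂
    have := min_le_right m₁ m₂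
    constructor <;> linarith
  refine ⟨min r₁ (min (min ε₁ ε₂) (min R ε) / Cψ), by positivity, (min_le_left _ _).trans hr₁r, m,
    hm0, ‖π‖ * (1 + L ^ 2 / m) + 1, by positivity, m / L, by positivity, fun w hw => ?_⟩
  rw [mem_ball_zero_iff] at hw
  have hw1 : ‖w‖ < r₁ := hw.trans_le (min_le_left _ _)
  have hwr : w ∈ Metric.ball (0 : ℂ) r := mem_ball_zero_iff.mpr (hw1.trans_le hr₁r)
  have hψ : ‖ψ w - p‖ ≤ min (min ε₁ ε₂) (min R ε) := by
    refine (F.chart.norm_sub_le hwr).trans ?_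
    have := hw.trans_le (min_le_right _ _)
    rw [lt_div_iff₀ hCψ] at this
    linarith
  have hψK : ψ w ∈ K := by
    refine hK (Connection.mem_cthickening t₀ ?_)
    rw [C.loop_ge le_rfl]
    exact hψ.trans ((min_le_right _ _).trans (min_le_left _ _))
  refine ⟨hψK, hψ.trans ((min_le_right _ _).trans (min_le_right _ _)), fun Z' η hη hZ => ?_⟩
  have e1 := h1 p rfl _ (hψ.trans ((min_le_left _ _).trans (min_le_left _ _)))
  have e2 := h2 p rfl _ (hψ.trans ((min_le_left _ _).trans (min_le_right _ _)))
  rw [Pi.neg_apply] at e1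
  obtain ⟨e3, e4⟩ := H.lieDeriv_sub_le hZ hψK
  rw [abs_le] at e3 e4
  have e5 : L * η ≤ m := by rw [le_div_iff₀ hL] at hη; linarith
  have e6 : lieDeriv Z'.X h (ψ w) ≤ -m := by linarith [e3.2, hm12.1]
  have e7 : m ≤ lieDeriv Z'.Y h (ψ w) := by linarith [e4.1, hm12.2]
  refine ⟨e6, e7, ?_⟩
  have e8 := slidingField_sub_le_of_close (H.dh_le _ hψK) (H.X_le _ hψK) (H.Y_le _ hψK) hm0
    (hZ.1 _ hψK) (hZ.2 _ hψK) (by linarith [hm12.1]) (by linarith [hm12.2]) e6 e7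
  have hη0 : 0 ≤ η := (norm_nonneg _).trans (hZ.1 _ hψK)
  have e : π (slidingField h Z' (ψ w)) - (a + β * Complex.I) * w =
      (π (slidingField h Z (ψ w)) - (a + β * Complex.I) * w) +
        π (slidingField h Z' (ψ w) - slidingField h Z (ψ w)) := by rw [map_sub]; ring
  rw [e]
  refine (norm_add_le _ _).trans (add_le_add (has w hw1) ?_)
  refine (π.le_opNorm _).trans ?_
  calc _ ≤ ‖π‖ * ((1 + L ^ 2 / m) * η) := by gcongr
    _ ≤ _ := by linarith

theorem lipschitzOnWith_slidingField (F : SaddleFocus U h Z p q σ ξ t₀ π ι ψ r Cψ r' a β)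
    {Z' : PWField} {K : Set E3} {L c ρ : ℝ} (H : Controlled h Z' K L c ρ) {S : Set ℂ}
    (hS : ∀ w ∈ S, w ∈ Metric.ball (0 : ℂ) r ∧ ψ w ∈ K ∧ lieDeriv Z'.X h (ψ w) ≤ 0 ∧
      0 ≤ lieDeriv Z'.Y h (ψ w)) :
    ∃ M, LipschitzOnWith M (fun w => π (slidingField h Z' (ψ w))) S := by
  have hL : 0 < L := zero_lt_one.trans_le H.one_le
  have hc := H.c_pos
  have hCψ := F.chart.C_pos
  refine ⟨⟨‖π‖ * ((6 * L ^ 3 / c + L) * Cψ), by positivity⟩,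
    LipschitzOnWith.of_dist_le_mul fun w hw w' hw' => ?_⟩
  obtain ⟨h1, h2, h3, h4⟩ := hS w hw
  obtain ⟨h1', h2', h3', h4'⟩ := hS w' hw'
  rw [dist_eq_norm, dist_eq_norm, ← map_sub]
  refine (π.le_opNorm _).trans ?_
  change _ ≤ ‖π‖ * ((6 * L ^ 3 / c + L) * Cψ) * _
  rw [mul_assoc]
  refine mul_le_mul_of_nonneg_left ?_ (norm_nonneg _)
  have e1 := H.slidingField_sub_le h2 h2' (by rw [F.chart.h_ψ w h1, abs_zero]; exact H.rho_pos.le)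
    (by rw [F.chart.h_ψ w' h1', abs_zero]; exact H.rho_pos.le) h3' h4'
  refine e1.trans ?_
  rw [mul_assoc]
  exact mul_le_mul_of_nonneg_left (F.chart.lip w h1 w' h1') (by positivity)

end SaddleFocus

/-- A continuous logarithm of a small perturbation. -/
theorem exists_log_perturbation {S : Set ℝ} {E₀ z z' : ℝ → ℂ} (hE : ContinuousOn E₀ S)
    (hEz : ∀ s ∈ S, Complex.exp (E₀ s) = z s) (hz' : ContinuousOn z' S)
    (h : ∀ s ∈ S, ‖z' s - z s‖ ≤ 1 / 2 * ‖z s‖) :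
    ∃ E : ℝ → ℂ, ContinuousOn E S ∧ ∀ s ∈ S, Complex.exp (E s) = z' s ∧ ‖E s - E₀ s‖ ≤ 1 := by
  have hne : ∀ s ∈ S, z s ≠ 0 := fun s hs => by rw [← hEz s hs]; exact Complex.exp_ne_zero _
  have hz : ContinuousOn z S :=
    (Complex.continuous_exp.comp_continuousOn hE).congr fun s hs => (hEz s hs).symm
  refine ⟨fun s => E₀ s + Complex.log (z' s / z s),
    hE.add ((hz'.div hz hne).clog fun s hs => div_mem_slitPlane (hne s hs) (h s hs)),
    fun s hs => ⟨?_, ?_⟩⟩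
  · have h1 := Complex.slitPlane_ne_zero (div_mem_slitPlane (hne s hs) (h s hs))
    rw [Complex.exp_add, Complex.exp_log h1, hEz s hs, mul_div_cancel₀ _ (hne s hs)]
  · rw [add_sub_cancel_left]
    have e : z' s / z s - 1 = (z' s - z s) / z s := by have := hne s hs; field_simp
    have h2 : ‖z' s / z s - 1‖ ≤ 1 / 2 := by
      rw [e, norm_div, div_le_iff₀ (norm_pos_iff.mpr (hne s hs))]; exact h s hs
    have h3 := Complex.norm_log_one_add_half_le_self h2
    rw [add_sub_cancel] at h3
    linarith

end PWField

theorem exists_spiral_parameters {E₀ : ℝ → ℂ} {s₁ B M a β κ : ℝ} (ρ θ₀ : ℝ) (hs₁ : 0 < s₁)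
    (hM : 0 < M) (hE : ContinuousOn E₀ (Ioc 0 s₁)) (hB : ∀ s ∈ Ioc 0 s₁, |(E₀ s).im| ≤ B)
    (hre : ∀ s ∈ Ioc 0 s₁, Real.exp (E₀ s).re ≤ M * s) (hκ : 0 < κ) (ha : κ < a) (hβ : κ < β) :
    ∃ (N : ℕ) (s₀ r₀ : ℝ), 0 < s₀ ∧ s₀ ≤ s₁ ∧ r₀ ≤ ρ + s₁ ∧
      (∀ s ∈ Icc s₀ s₁, r₀ ≤ (E₀ s).re) ∧
      ∀ E : ℝ → ℂ, (∀ s ∈ Icc s₀ s₁, ‖E s - E₀ s‖ ≤ 1) →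
        (∀ s ∈ Icc s₀ s₁, r₀ ≤ (E s).re) ∧
        (∀ s ∈ Icc s₀ s₁, (E s).im ≤ θ₀ + N * (2 * Real.pi)) ∧
        (E s₀).re + (a + κ) * ((θ₀ + N * (2 * Real.pi) - (E s₀).im) / (β - κ)) ≤ ρ + s₀ ∧
        ρ + s₁ ≤ (E s₁).re + (a - κ) * ((θ₀ + N * (2 * Real.pi) - (E s₁).im) / (β + κ)) := by
  have hβκ : 0 < β - κ := by linarith
  have hβκ' : 0 < β + κ := by linarith
  have haκ : 0 < a - κ := by linarith
  have hm1 : s₁ ∈ Ioc 0 s₁ := ⟨hs₁, le_rfl⟩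
  obtain ⟨N, hN⟩ := exists_nat_ge ((max (B + 1)
    ((ρ + s₁ - (E₀ s₁).re + 1) * (β + κ) / (a - κ) + B + 1) - θ₀) / (2 * Real.pi))
  rw [div_le_iff₀ Real.two_pi_pos] at hN
  set Θ := θ₀ + N * (2 * Real.pi) with hΘ
  have hΘ1 : B + 1 ≤ Θ := by
    have := le_max_left (B + 1) ((ρ + s₁ - (E₀ s₁).re + 1) * (β + κ) / (a - κ) + B + 1)
    linarith
  have hΘ2 : (ρ + s₁ - (E₀ s₁).re + 1) * (β + κ) / (a - κ) ≤ Θ - B - 1 := by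
    have := le_max_right (B + 1) ((ρ + s₁ - (E₀ s₁).re + 1) * (β + κ) / (a - κ) + B + 1)
    linarith
  set b := ρ - 1 - (a + κ) * ((Θ + B + 1) / (β - κ)) with hb
  set s₀ := min s₁ (Real.exp b / M) with hs₀
  have hs₀0 : 0 < s₀ := by positivity
  have hs₀1 : s₀ ≤ s₁ := min_le_left _ _
  have hm0 : s₀ ∈ Ioc 0 s₁ := ⟨hs₀0, hs₀1⟩
  have hb0 : (E₀ s₀).re ≤ b := by
    have h1 := hre s₀ hm0
    have h2 : M * s₀ ≤ Real.exp b := by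
      have := min_le_right s₁ (Real.exp b / M)
      rw [← hs₀, le_div_iff₀ hM] at this
      linarith
    exact Real.exp_le_exp.mp (h1.trans h2)
  have hsub : Icc s₀ s₁ ⊆ Ioc 0 s₁ := fun s hs => ⟨hs₀0.trans_le hs.1, hs.2⟩
  obtain ⟨m, hm⟩ := isCompact_Icc.exists_bound_of_continuousOn (hE.mono hsub)
  refine ⟨N, s₀, min (-m) (ρ + s₁ + 1) - 1, hs₀0, hs₀1, ?_, fun s hs => ?_, fun E hEE => ?_⟩
  · have := min_le_right (-m) (ρ + s₁ + 1); linarith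
  · have h1 := min_le_left (-m) (ρ + s₁ + 1)
    have h2 := (Complex.abs_re_le_norm _).trans (hm s hs)
    rw [abs_le] at h2
    linarith [h2.1]
  have hEre : ∀ s ∈ Icc s₀ s₁, |(E s).re - (E₀ s).re| ≤ 1 := fun s hs => by
    rw [← Complex.sub_re]; exact (Complex.abs_re_le_norm _).trans (hEE s hs)
  have hEim : ∀ s ∈ Icc s₀ s₁, |(E s).im| ≤ B + 1 := fun s hs => by
    have h1 := (Complex.abs_im_le_norm _).trans (hEE s hs)
    rw [Complex.sub_im] at h1
    have h2 := hB s (hsub hs)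
    have := abs_sub_abs_le_abs_sub (E s).im (E₀ s).im
    linarith
  have h0 : s₀ ∈ Icc s₀ s₁ := ⟨le_rfl, hs₀1⟩
  have h1 : s₁ ∈ Icc s₀ s₁ := ⟨hs₀1, le_rfl⟩
  refine ⟨fun s hs => ?_, fun s hs => ?_, ?_, ?_⟩
  · have h1 := min_le_left (-m) (ρ + s₁ + 1)
    have h2 := (Complex.abs_re_le_norm _).trans (hm s hs)
    have h3 := hEre s hs
    rw [abs_le] at h2 h3
    linarith [h2.1, h3.1]
  · have := (abs_le.mp (hEim s hs)).2; linarith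
  · have e1 := abs_le.mp (hEre s₀ h0)
    have e2 := abs_le.mp (hEim s₀ h0)
    have e3 : (a + κ) * ((Θ - (E s₀).im) / (β - κ)) ≤ (a + κ) * ((Θ + B + 1) / (β - κ)) := by
      have : 0 ≤ a + κ := by linarith
      gcongr
      linarith [e2.1]
    linarith [e1.2]
  · have e1 := abs_le.mp (hEre s₁ h1)
    have e2 := abs_le.mp (hEim s₁ h1)
    have e3 : ρ + s₁ - (E₀ s₁).re + 1 ≤ (a - κ) * ((Θ - (E s₁).im) / (β + κ)) := by
      rw [div_le_iff₀ haκ] at hΘ2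
      rw [← mul_div_assoc, le_div_iff₀ hβκ']
      refine hΘ2.trans ?_
      rw [mul_comm]
      exact mul_le_mul_of_nonneg_left (by linarith [e2.2]) haκ.le
    linarith [e1.1]

namespace PWField

namespace SaddleFocus

variable {U : Set E3} {h : E3 → ℝ} {Z : PWField} {p q : E3} {σ ξ : ℝ → E3} {t₀ : ℝ}
  {π : E3 →L[ℝ] ℂ} {ι : ℂ →L[ℝ] E3} {ψ : ℂ → E3} {r Cψ r' a β : ℝ}

set_option maxHeartbeats 1600000 in
/-- Systems close to one with a sliding Shilnikov connection have sliding periodic orbits near the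
connection, that come close to the focus but not too close. -/
theorem exists_sliding_orbit (F : SaddleFocus U h Z p q σ ξ t₀ π ι ψ r Cψ r' a β) {G : Set E3}
    (hG : G ∈ 𝓝ˢ (range (loop p σ ξ t₀))) {ε : ℝ} (hε : 0 < ε) :
    ∃ d > 0, ∃ η > 0, ∀ Z' : PWField, LocallyLipschitzOn U Z'.X → LocallyLipschitzOn U Z'.Y →
      Close U η Z' Z → ∃ P, IsSlidingPeriodicOrbit U h Z' P ∧ P ⊆ G ∧ (∃ x ∈ P, ‖x - p‖ < ε) ∧
        ∀ x ∈ P, d ≤ ‖x - p‖ := by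
  have C := F.conn
  obtain ⟨R, hR, K, hKdef, hKc, hKG, hKU, -, L, c, ρ, H⟩ := C.exists_controlled hG
  have hK : Metric.cthickening R (range (loop p σ ξ t₀)) ⊆ K := hKdef.ge
  have ht₀ := C.t₀_pos
  have ha := F.a_pos
  have hβ := F.β_pos
  have hCψ := F.chart.C_pos
  have hL : 0 < L := zero_lt_one.trans_le H.one_le
  have hc := H.c_pos
  have hloopK : ∀ t, loop p σ ξ t₀ t ∈ K := fun t =>
    hK (Connection.mem_cthickening t (by rw [sub_self, norm_zero]; exact hR.le))
  set κ := min a β / 2 with hκ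
  have hκ0 : 0 < κ := by positivity
  have hκa : κ < a := by have := min_le_left a β; linarith
  have hκβ : κ < β := by have := min_le_right a β; linarith
  obtain ⟨r₂, hr₂, hr₂r, m, hm, M, hM, η₁, hη₁, hball⟩ :=
    F.exists_focus_ball H hR hK (half_pos hκ0) hε
  obtain ⟨τ, s₁, l₀, c₀, w₀, S⟩ := F.exists_section hr₂ hr₂r
  have hτ := S.τ_pos
  have hw₀n : 0 < ‖w₀‖ := norm_pos_iff.mpr S.w₀_ne
  obtain ⟨δ, hδ, hδδ, ε₁, hε₁, s₂, hs₂, hs₂1, hwind⟩ := F.exists_boundedLog_landing H hR hK hr₂r S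
    (δ₀ := min (τ / 2) (t₀ / 4)) (by positivity)
  have hδτ : δ ≤ τ / 2 := hδδ.trans (min_le_left _ _)
  have hδt : δ ≤ t₀ / 4 := hδδ.trans (min_le_right _ _)
  obtain ⟨mt, hmt, ε₂, hε₂, hε₂R, htk1, htk2, htk3⟩ := C.exists_takeoff
    (fun t ht => ((C.σ_slide t ht).1).2.1) H hR hK (τ := τ) (δ := δ) (t₁ := t₀ - δ) hδ (by linarith)
  obtain ⟨ν, hν, hνt, ε₃, hε₃, hland⟩ := C.exists_landing H hR hK hδ
  have hr' := F.chart.r'_pos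
  set e := min (min (min ε₁ ε₂) (min ε₃ (ε / 2))) (min (min (R / 2) (r' / 2)) 1) with he
  have he0 : 0 < e := by positivity
  have he1 : e ≤ ε₁ := (min_le_left _ _).trans ((min_le_left _ _).trans (min_le_left _ _))
  have he2 : e ≤ ε₂ := (min_le_left _ _).trans ((min_le_left _ _).trans (min_le_right _ _))
  have he3 : e ≤ ε₃ := (min_le_left _ _).trans ((min_le_right _ _).trans (min_le_left _ _))
  have he4 : e ≤ ε / 2 := (min_le_left _ _).trans ((min_le_right _ _).trans (min_le_right _ _))
  have he5 : e ≤ R / 2 := (min_le_right _ _).trans ((min_le_left _ _).trans (min_le_left _ _))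
  have he6 : e ≤ r' / 2 := (min_le_right _ _).trans ((min_le_left _ _).trans (min_le_right _ _))
  have he7 : e ≤ 1 := (min_le_right _ _).trans (min_le_right _ _)
  clear_value e
  set b := t₀ + δ with hb
  have hab : -τ < b := by linarith
  set Fl := Controlled.flowConst L c ρ (b - -τ) with hFl
  have hFl1 : 1 ≤ Fl := H.one_le_flowConst (by linarith)
  set Cy := 2 * Cψ * ‖w₀‖ with hCy
  have hCy0 : 0 < Cy := by positivity
  set s₃ := min s₂ (e / (2 * Fl * Cy)) with hs₃
  have hs₃0 : 0 < s₃ := by positivity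
  have hs₃2 : s₃ ≤ s₂ := min_le_left _ _
  have hs₃1 : s₃ ≤ s₁ := hs₃2.trans hs₂1
  have hs₃e : Fl * (Cy * s₃) ≤ e / 2 := by
    have := min_le_right s₂ (e / (2 * Fl * Cy))
    rw [← hs₃, le_div_iff₀ (by positivity)] at this
    linarith
  clear_value s₃
  -- trajectories through the section
  have hclB : ∀ t ∈ Icc (-τ) b, Metric.closedBall (loop p σ ξ t₀ t) e ⊆ interior K := by
    intro t _ y hy
    rw [hKdef]
    refine Metric.thickening_subset_interior_cthickening _ _ ?_
    refine Metric.mem_thickening_iff.mpr ⟨_, mem_range_self t, ?_⟩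
    exact lt_of_le_of_lt (Metric.mem_closedBall.mp hy) (by linarith)
  have hshadow : ∀ Z' : PWField, ContinuousOn Z'.X U → ContinuousOn Z'.Y U → ∀ η, 0 ≤ η →
      Fl * η ≤ e / 2 → Close U η Z' Z → ∀ s ∈ Ioc 0 s₃, ∃ x : ℝ → E3,
        x (-τ) = ψ (w₀ * Complex.exp s) ∧ Follows h Z' 0 (-τ) b x ∧
        ∀ t ∈ Icc (-τ) b, x t ∈ K ∧ ‖x t - loop p σ ξ t₀ t‖ ≤ e := by
    intro Z' hX hY η hη0 hη hZ s hs
    have hs1 : s ∈ Icc 0 s₁ := ⟨hs.1.le, hs.2.trans hs₃1⟩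
    have h1 := F.norm_section_sub_le hr₂r S hs1
    have h2 : Fl * (‖ψ (w₀ * Complex.exp s) - loop p σ ξ t₀ (-τ)‖ + η) ≤ e := by
      have : Fl * ‖ψ (w₀ * Complex.exp s) - loop p σ ξ t₀ (-τ)‖ ≤ Fl * (Cy * s₃) := by
        gcongr
        exact h1.trans (mul_le_mul_of_nonneg_left hs.2 hCy0.le)
      linarith
    have hη1 : η ≤ 1 := (le_mul_of_one_le_left hη0 hFl1).trans (by linarith)
    obtain ⟨x, hx0, hx, -, hxcl⟩ := H.exists_shadow hKc.isClosed hη0 hη1 hab.le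
      (hX.mono hKU) (hY.mono hKU) (fun x hx => hZ.1 x (hKU hx)) (fun x hx => hZ.2 x (hKU hx))
      (C.follows_loop (-τ) b) hclB h2
    exact ⟨x, hx0, hx, fun t ht => ⟨interior_subset (hxcl t ht).1, (hxcl t ht).2.trans h2⟩⟩
  -- the unperturbed landing curve
  have hshadow₀ := hshadow Z C.lip_X.continuousOn C.lip_Y.continuousOn 0 le_rfl
    (by rw [mul_zero]; positivity) ⟨fun x _ => by simp, fun x _ => by simp⟩
  choose! x hx0 hx hxcl using hshadow₀
  obtain ⟨E₀, B, hE₀, hE₀B⟩ := hwind s₃ hs₃2 x fun s hs =>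
    ⟨hx0 s hs, hx s hs, fun t ht => (hxcl s hs t ht).2.trans he1⟩
  have hE₀B : ∀ s ∈ Ioc 0 s₃, Complex.exp (E₀ s) = π (x s b - p) ∧ |(E₀ s).im| ≤ B := hE₀B
  have hbI : b ∈ Icc (-τ) b := ⟨hab.le, le_rfl⟩
  have hloopb : loop p σ ξ t₀ b = p := C.loop_ge (by linarith)
  have hpK : p ∈ K := hloopb ▸ hloopK b
  have hexpE : ∀ s ∈ Ioc 0 s₃, Real.exp (E₀ s).re ≤ (‖π‖ + 1) * Fl * Cy * s := by
    intro s hs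
    rw [← Complex.norm_exp, (hE₀B s hs).1]
    have h1 := H.norm_sub_le le_rfl zero_le_one hab.le (hx s hs) (C.follows_loop (-τ) b)
      (fun t ht => (hxcl s hs t ht).1) fun t _ => hloopK t
    rw [add_zero, hx0 s hs, hloopb] at h1
    have h2 := F.norm_section_sub_le hr₂r S (s := s) ⟨hs.1.le, hs.2.trans hs₃1⟩
    refine (π.le_opNorm _).trans ?_
    calc _ ≤ (‖π‖ + 1) * (Fl * (Cy * s)) := by
          refine mul_le_mul (by linarith) (h1.trans ?_) (norm_nonneg _) (by positivity)
          exact mul_le_mul_of_nonneg_left h2 (by linarith)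
      _ = _ := by ring
  set θ₀ := Complex.arg w₀ with hθ₀
  set ρ₀ := Real.log ‖w₀‖ with hρ₀
  obtain ⟨N, s₀, r₀, hs₀0, hs₀3, hr₀, hr₀E, hpar⟩ := exists_spiral_parameters ρ₀ θ₀ hs₃0
    (by positivity : 0 < (‖π‖ + 1) * Fl * Cy) hE₀ (fun s hs => (hE₀B s hs).2) hexpE hκ0 hκa hκβ
  set Θ := θ₀ + N * (2 * Real.pi) with hΘ
  have hexp_ρ : Real.exp (ρ₀ + s₃) = ‖w₀‖ * Real.exp s₃ := by
    rw [Real.exp_add, hρ₀, Real.exp_log hw₀n]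
  have hann : ∀ w : ℂ, ‖w‖ ≤ Real.exp (ρ₀ + s₃) → w ∈ Metric.ball (0 : ℂ) r₂ := by
    intro w hw
    rw [mem_ball_zero_iff]
    rw [hexp_ρ] at hw
    refine hw.trans_lt (lt_of_le_of_lt ?_ S.lt)
    exact mul_le_mul_of_nonneg_left (Real.exp_le_exp.mpr hs₃1) hw₀n.le
  -- the size of the perturbation
  set D := Real.exp r₀ with hD
  have hD0 : 0 < D := Real.exp_pos _
  set η := min (min (min η₁ ε₂) (min ε₃ (e / (2 * Fl)))) (min (min (D / (4 * (‖π‖ + 1) * Fl))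
    (κ * D / (2 * M))) (min (c / (4 * L)) (mt / (2 * L)))) with hηdef
  have hη0 : 0 < η := by positivity
  have hη1 : η ≤ η₁ := (min_le_left _ _).trans ((min_le_left _ _).trans (min_le_left _ _))
  have hη2 : η ≤ ε₂ := (min_le_left _ _).trans ((min_le_left _ _).trans (min_le_right _ _))
  have hη3 : η ≤ ε₃ := (min_le_left _ _).trans ((min_le_right _ _).trans (min_le_left _ _))
  have hη4 : η ≤ e / (2 * Fl) := (min_le_left _ _).trans ((min_le_right _ _).trans (min_le_right _ _))
  have hη5 : η ≤ D / (4 * (‖π‖ + 1) * Fl) :=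
    (min_le_right _ _).trans ((min_le_left _ _).trans (min_le_left _ _))
  have hη6 : η ≤ κ * D / (2 * M) :=
    (min_le_right _ _).trans ((min_le_left _ _).trans (min_le_right _ _))
  have hη7 : η ≤ c / (4 * L) :=
    (min_le_right _ _).trans ((min_le_right _ _).trans (min_le_left _ _))
  have hη8 : η ≤ mt / (2 * L) :=
    (min_le_right _ _).trans ((min_le_right _ _).trans (min_le_right _ _))
  clear_value η
  have hFlη : Fl * η ≤ e / 2 := by
    rw [le_div_iff₀ (by positivity)] at hη4; linarith
  have hη1' : η ≤ 1 := (le_mul_of_one_le_left hη0.le hFl1).trans (by linarith)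
  refine ⟨D / (4 * (‖π‖ + 1) * Fl), by positivity, η, hη0, fun Z' hX' hY' hZ => ?_⟩
  have hZK : Close K η Z' Z := hZ.mono hKU le_rfl
  obtain ⟨L', c', ρ', H'⟩ := H.of_close C.isOpen C.smooth hX' hY' hKc hKU hZK (by
    rw [le_div_iff₀ (by positivity)] at hη7
    linarith)
  have hshadow' := hshadow Z' hX'.continuousOn hY'.continuousOn η hη0.le hFlη hZ
  choose! x' hx0' hx' hxcl' using hshadow'
  have hsub : Icc s₀ s₃ ⊆ Ioc 0 s₃ := fun s hs => ⟨hs₀0.trans_le hs.1, hs.2⟩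
  have hxη : ∀ s ∈ Ioc 0 s₃, Follows h Z η (-τ) b (x' s) := fun s hs =>
    (hx' s hs).of_close hZK fun t ht => (hxcl' s hs t (Ioo_subset_Icc_self ht)).1
  -- the perturbed landing curve
  have hclose : ∀ s ∈ Icc s₀ s₃, ‖π (x' s b - p) - π (x s b - p)‖ ≤ 1 / 2 * ‖π (x s b - p)‖ := by
    intro s hs
    have hs' := hsub hs
    have h1 := H.norm_sub_le hη0.le hη1' hab.le (hxη s hs') ((hx s hs').mono hη0.le le_rfl le_rfl)
      (fun t ht => (hxcl' s hs' t ht).1) fun t ht => (hxcl s hs' t ht).1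
    rw [hx0' s hs', hx0 s hs', sub_self, norm_zero, zero_add] at h1
    have h2 : D ≤ ‖π (x s b - p)‖ := by
      rw [← (hE₀B s hs').1, Complex.norm_exp]; exact Real.exp_le_exp.mpr (hr₀E s hs)
    rw [← map_sub, sub_sub_sub_cancel_right]
    refine (π.le_opNorm _).trans ?_
    rw [le_div_iff₀ (by positivity)] at hη5
    have h3 : ‖π‖ * ‖x' s b - x s b‖ ≤ ‖π‖ * (Fl * η) := by gcongr
    have h4 : 0 ≤ Fl * η := by positivity
    have h5 : 0 ≤ ‖π‖ * (Fl * η) := by positivity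
    linarith
  have hz'c : ContinuousOn (fun s => π (x' s b - p)) (Icc s₀ s₃) := by
    refine π.continuous.comp_continuousOn (ContinuousOn.sub ?_ continuousOn_const)
    have hsec : ContinuousOn (fun s : ℝ => ψ (w₀ * Complex.exp s)) (Icc s₀ s₃) := by
      refine F.chart.continuousOn.comp (by fun_prop) fun s hs =>
        Metric.ball_subset_ball hr₂r (S.mem_ball (hs.2.trans hs₃1))
    intro s hs
    have h1 := (hsec s hs).tendsto
    rw [tendsto_iff_norm_sub_tendsto_zero] at h1
    rw [ContinuousWithinAt, tendsto_iff_norm_sub_tendsto_zero]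
    have h2 := h1.const_mul (Controlled.flowConst L' c' ρ' (b - -τ))
    rw [mul_zero] at h2
    refine squeeze_zero' (Eventually.of_forall fun _ => norm_nonneg _) ?_ h2
    filter_upwards [self_mem_nhdsWithin] with s' hs'
    have h3 := H'.norm_sub_le le_rfl zero_le_one hab.le (hx' s' (hsub hs')) (hx' s (hsub hs))
      (fun t ht => (hxcl' s' (hsub hs') t ht).1) fun t ht => (hxcl' s (hsub hs) t ht).1
    rwa [add_zero, hx0' s' (hsub hs'), hx0' s (hsub hs)] at h3
  obtain ⟨E, hEc, hE⟩ := exists_log_perturbation (hE₀.mono hsub) (fun s hs => (hE₀B s (hsub hs)).1)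
    hz'c hclose
  have hE : ∀ s ∈ Icc s₀ s₃, Complex.exp (E s) = π (x' s b - p) ∧ ‖E s - E₀ s‖ ≤ 1 := hE
  obtain ⟨hp1, hp2, hp3, hp4⟩ := hpar E fun s hs => (hE s hs).2
  -- the sliding field near the focus
  set f : ℂ → ℂ := fun w => π (slidingField h Z' (ψ w)) with hf
  obtain ⟨Kf, hKf⟩ := F.lipschitzOnWith_slidingField H'
    (S := {w | Real.exp r₀ ≤ ‖w‖ ∧ ‖w‖ ≤ Real.exp (ρ₀ + s₃)}) fun w hw => by
      have hwb := hann w hw.2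
      obtain ⟨e1, -, e3⟩ := hball w hwb
      obtain ⟨e4, e5, -⟩ := e3 Z' η hη1 hZK
      exact ⟨Metric.ball_subset_ball hr₂r hwb, e1, by linarith, by linarith⟩
  have hfb : ∀ w : ℂ, Real.exp r₀ ≤ ‖w‖ → ‖w‖ ≤ Real.exp (ρ₀ + s₃) →
      ‖f w - (a + β * Complex.I) * w‖ ≤ κ * ‖w‖ := by
    intro w h1 h2
    obtain ⟨-, -, e3⟩ := hball w (hann w h2)
    refine (e3 Z' η hη1 hZK).2.2.trans ?_
    rw [le_div_iff₀ (by positivity)] at hη6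
    have : κ * D ≤ κ * ‖w‖ := mul_le_mul_of_nonneg_left h1 hκ0.le
    linarith
  obtain ⟨s, hs, τ', hτ', ω, hω0, hω1, hω⟩ := exists_spiral_hit hκa hκβ hκ0 hr₀ hs₀3 hKf hfb hEc
    hp1 hp2 le_rfl hp3 hp4
  have hs' := hsub hs
  have hs1 : s ≤ s₁ := hs.2.trans hs₃1
  -- the landing point and the end point
  have hlanded : h (x' s b) = 0 := hland η hη3 (x' s) ((hxη s hs').mono le_rfl (by linarith) le_rfl)
    fun t ht => (hxcl' s hs' t ⟨by linarith [ht.1], ht.2⟩).2.trans he3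
  have hbp : ‖x' s b - p‖ ≤ e := by
    have := (hxcl' s hs' b hbI).2
    rwa [hloopb] at this
  have hstart : ψ (Complex.exp (ω 0)) = x' s b := by
    rw [hω0, (hE s hs).1]
    exact (F.chart.surj _ (by linarith) hlanded).2
  have hend : ψ (Complex.exp (ω τ')) = x' s (-τ) := by
    rw [hω1, hx0' s hs']
    congr 1
    have h1 : ((ρ₀ + s : ℝ) : ℂ) + Θ * Complex.I =
        (ρ₀ + θ₀ * Complex.I) + s + N * (2 * Real.pi * Complex.I) := by
      rw [hΘ]; push_cast; ring
    have h2 : (ρ₀ : ℂ) + θ₀ * Complex.I = Complex.log w₀ := by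
      rw [Complex.log, hρ₀, hθ₀]
    rw [h1, h2, Complex.exp_add, Complex.exp_add, Complex.exp_log S.w₀_ne,
      Complex.exp_nat_mul_two_pi_mul_I, mul_one]
  have hωb : ∀ t ∈ Icc 0 τ', Complex.exp (ω t) ∈ Metric.ball (0 : ℂ) r₂ := by
    intro t ht
    refine hann _ ?_
    rw [Complex.norm_exp]
    exact Real.exp_le_exp.mpr (hω t ht).2.1
  have hT := F.isSlidingPeriodicOrbit_of_arcs hX'.continuousOn hY'.continuousOn hab hτ' (hx' s hs')
    (fun t ht => hKU (hxcl' s hs' t ht).1) (ω := ω) (fun t ht => by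
      obtain ⟨e1, -, e3⟩ := hball _ (hωb t ht)
      obtain ⟨e4, e5, -⟩ := e3 Z' η hη1 hZK
      exact ⟨Metric.ball_subset_ball hr₂r (hωb t ht), by linarith, by linarith, (hω t ht).2.2⟩)
    hstart hend (c := -τ) (d := -δ) (by linarith) le_rfl (by linarith) (fun t ht => by
      have htI : t ∈ Icc (-τ) (-δ) := Ioo_subset_Icc_self ht
      have h1 := htk3 η hη2 (x' s) ((hxη s hs').mono le_rfl le_rfl (by linarith)) (by
        rw [hx0' s hs']
        exact F.chart.h_ψ _ (Metric.ball_subset_ball hr₂r (S.mem_ball hs1)))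
        (fun t ht => (hxcl' s hs' t ⟨ht.1, by linarith [ht.2]⟩).2.trans he2) t htI
      have htb : t ∈ Icc (-τ) b := ⟨htI.1, by linarith [htI.2]⟩
      obtain ⟨h2, h3⟩ := htk1 t htI (x' s t) ((hxcl' s hs' t htb).2.trans he2)
      obtain ⟨h4, h5⟩ := H.lieDeriv_sub_le hZK (hxcl' s hs' t htb).1
      rw [abs_le] at h4 h5
      rw [le_div_iff₀ (by positivity)] at hη8
      exact ⟨⟨hKU (hxcl' s hs' t htb).1, h1⟩, by linarith [h4.2], by linarith [h5.1]⟩)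
    ⟨t₀ / 2, ⟨by linarith, by linarith⟩, (htk2 (t₀ / 2) ⟨by linarith, by linarith⟩ _
      ((hxcl' s hs' _ ⟨by linarith, by linarith⟩).2.trans he2)).ne'⟩
  refine ⟨_, hT, ?_, ⟨x' s b, Or.inl ⟨b, hbI, rfl⟩, by linarith⟩, ?_⟩
  · rintro _ (⟨t, ht, rfl⟩ | ⟨t, ht, rfl⟩)
    · exact hKG (hxcl' s hs' t ht).1
    · exact hKG (hball _ (hωb t ht)).1
  · have hπ1 : 0 < ‖π‖ + 1 := by positivity
    rintro _ (⟨t, ht, rfl⟩ | ⟨t, ht, rfl⟩)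
    · have h1 := H.norm_sub_le hη0.le hη1' ht.2 ((hxη s hs').mono le_rfl ht.1 le_rfl)
        ((Connection.follows_const C.p_mem.1.2 C.p_mem.2.1.le C.p_mem.2.2 C.p_zero t b).mono
          hη0.le le_rfl le_rfl) (fun t' ht' => (hxcl' s hs' t' ⟨ht.1.trans ht'.1, ht'.2⟩).1)
        fun _ _ => hpK
      have h2 : ‖x' s b - p‖ ≤ Fl * (‖x' s t - p‖ + η) := by
        refine h1.trans (mul_le_mul_of_nonneg_right ?_ (by positivity))
        exact H.flowConst_mono (sub_nonneg.mpr ht.2) (by linarith [ht.1])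
      have h3 : D ≤ ‖π (x' s b - p)‖ := by
        rw [← (hE s hs).1, Complex.norm_exp]; exact Real.exp_le_exp.mpr (hp1 s hs)
      have h4 := π.le_opNorm (x' s b - p)
      have h5 : D ≤ (‖π‖ + 1) * (Fl * (‖x' s t - p‖ + η)) := by
        refine h3.trans (h4.trans ?_)
        exact mul_le_mul (by linarith) h2 (norm_nonneg _) hπ1.le
      rw [le_div_iff₀ (by positivity)] at hη5
      rw [div_le_iff₀ (by positivity)]
      have h6 : 0 ≤ (‖π‖ + 1) * Fl * ‖x' s t - p‖ := by positivity
      linarith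
    · have h1 : π (ψ (Complex.exp (ω t)) - p) = Complex.exp (ω t) :=
        F.chart.π_ψ _ (Metric.ball_subset_ball hr₂r (hωb t ht))
      have h2 : D ≤ ‖π (ψ (Complex.exp (ω t)) - p)‖ := by
        rw [h1, Complex.norm_exp]
        exact Real.exp_le_exp.mpr ((hp1 s hs).trans (hω t ht).1)
      have h3 := π.le_opNorm (ψ (Complex.exp (ω t)) - p)
      have h4 := norm_nonneg (ψ (Complex.exp (ω t)) - p)
      rw [div_le_iff₀ (by positivity)]
      have h5 : 0 ≤ ‖ψ (Complex.exp (ω t)) - p‖ * (‖π‖ + 1) := by positivity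
      have h6 := le_mul_of_one_le_right h5 hFl1
      linarith

end SaddleFocus

end PWField

namespace PWField

/-! ### Exact trajectories -/

theorem continuousAt_lieDeriv_comp {U : Set E3} {h : E3 → ℝ} {X : E3 → E3} {γ : ℝ → E3}
    (hU : IsOpen U) (hh : ContDiffOn ℝ 2 h U) (hX : ContinuousOn X U) (hγ : Continuous γ) {t : ℝ}
    (ht : γ t ∈ U) : ContinuousAt (fun s => lieDeriv X h (γ s)) t :=
  ContinuousAt.comp (f := γ) (g := lieDeriv X h)
    ((continuousOn_lieDeriv hU hh hX).continuousAt (hU.mem_nhds ht)) hγ.continuousAt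

theorem lieDeriv_blend {h : E3 → ℝ} {Z : PWField} {l : ℝ} {x : E3} :
    fderiv ℝ h x (blend Z l x) = l * lieDeriv Z.X h x + (1 - l) * lieDeriv Z.Y h x := by
  simp [blend, lieDeriv]

namespace IsTrajectory

variable {U : Set E3} {h : E3 → ℝ} {Z : PWField} {γ : ℝ → E3}

theorem continuous (hγ : IsTrajectory U h Z γ) : Continuous γ := hγ.1.continuous

theorem continuous_h (hγ : IsTrajectory U h Z γ) (hU : IsOpen U) (hh : ContDiffOn ℝ 2 h U) :
    Continuous fun t => h (γ t) := continuous_iff_continuousAt.mpr fun t =>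
  ContinuousAt.comp (f := γ) (hh.continuousOn.continuousAt (hU.mem_nhds (hγ.2.1 t)))
    hγ.continuous.continuousAt

theorem comp_add (hγ : IsTrajectory U h Z γ) (s : ℝ) : IsTrajectory U h Z fun t => γ (t + s) := by
  refine ⟨hγ.1.comp (LipschitzWith.id.add (LipschitzWith.const s)).locallyLipschitz,
    fun t => hγ.2.1 _, ?_⟩
  have := (measurePreserving_add_right volume s).quasiMeasurePreserving.ae hγ.2.2
  filter_upwards [this] with t ht
  obtain ⟨v, hv, hd⟩ := ht
  exact ⟨v, hv, HasDerivAt.comp_add_const t s hd⟩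

theorem ae_hasDerivAt (hγ : IsTrajectory U h Z γ) :
    ∀ᵐ t, ∃ l, Admissible h (γ t) l ∧ HasDerivAt γ (blend Z l (γ t)) t := by
  filter_upwards [hγ.2.2] with t ht
  obtain ⟨v, hv, hd⟩ := ht
  obtain ⟨l, hl, rfl⟩ := exists_blend_of_mem_velocities hv
  exact ⟨l, hl, hd⟩

theorem ae_hasDerivAt_h (hγ : IsTrajectory U h Z γ) (hU : IsOpen U) (hh : ContDiffOn ℝ 2 h U) :
    ∀ᵐ t, ∃ l, Admissible h (γ t) l ∧
      HasDerivAt (fun s => h (γ s)) (l * lieDeriv Z.X h (γ t) + (1 - l) * lieDeriv Z.Y h (γ t)) t := by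
  filter_upwards [hγ.ae_hasDerivAt] with t ht
  obtain ⟨l, hl, hd⟩ := ht
  refine ⟨l, hl, ?_⟩
  have h1 : DifferentiableAt ℝ h (γ t) :=
    (hh.contDiffAt (hU.mem_nhds (hγ.2.1 t))).differentiableAt (by norm_num)
  have := h1.hasFDerivAt.comp_hasDerivAt t hd
  rwa [lieDeriv_blend] at this

theorem exists_lipschitzOnWith_h (hγ : IsTrajectory U h Z γ) (hU : IsOpen U)
    (hh : ContDiffOn ℝ 2 h U) (a b : ℝ) :
    ∃ C, LipschitzOnWith C (fun s => h (γ s)) (Icc a b) := by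
  have : LocallyLipschitz fun s => h (γ s) := by
    intro t
    obtain ⟨C, V, hV, hC⟩ := ((hh.contDiffAt (hU.mem_nhds (hγ.2.1 t))).of_le
      (by norm_num : (1 : WithTop ℕ∞) ≤ 2)).exists_lipschitzOnWith
    obtain ⟨C', V', hV', hC'⟩ := hγ.1 t
    refine ⟨C * C', V' ∩ γ ⁻¹' V, inter_mem hV' (hγ.continuous.continuousAt hV), ?_⟩
    exact hC.comp (hC'.mono inter_subset_left) fun s hs => hs.2
  exact (this.locallyLipschitzOn).exists_lipschitzOnWith_of_compact isCompact_Icc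

theorem h_nonneg_of_periodic (hγ : IsTrajectory U h Z γ) (hU : IsOpen U) (hh : ContDiffOn ℝ 2 h U)
    {T m : ℝ} (hT : 0 < T) (hper : Function.Periodic γ T) (hm : 0 < m)
    (hY : ∀ t, 0 < h (γ t) ∨ m ≤ lieDeriv Z.Y h (γ t)) (t : ℝ) : 0 ≤ h (γ t) := by
  by_contra! hneg
  obtain ⟨n, hn⟩ := exists_nat_gt (-h (γ t) / (m * T))
  have hmT : 0 < m * T := mul_pos hm hT
  rw [div_lt_iff₀ hmT] at hn
  have hle : t ≤ t + n * T := le_add_of_nonneg_right (by positivity)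
  have := le_max_of_ae_hasDerivAt (u := fun s => -h (γ s)) hle hm.le ?_ ?_
  · have hp : γ (t + n * T) = γ t := hper.nat_mul n t
    rw [hp] at this
    rcases le_max_iff.mp this with h1 | h1 <;> nlinarith
  · obtain ⟨C, hC⟩ := hγ.exists_lipschitzOnWith_h hU hh t (t + n * T)
    exact ⟨C, hC.neg⟩
  · filter_upwards [hγ.ae_hasDerivAt_h hU hh] with s hs _ hpos d hd
    obtain ⟨l, hl, hd'⟩ := hs
    have hl0 : l = 0 := hl.2.2 (by linarith)
    have e := hd.unique hd'.neg
    rcases hY s with h1 | h1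
    · linarith
    · rw [e, hl0]; linarith

/-- A trajectory arriving from `h ≥ 0` at a point of `Σ` with `Yh > 0` has `Xh ≤ 0` there. -/
theorem lieDeriv_X_nonpos (hγ : IsTrajectory U h Z γ) (hU : IsOpen U) (hh : ContDiffOn ℝ 2 h U)
    (hX : ContinuousOn Z.X U) (hY : ContinuousOn Z.Y U) {s : ℝ} (h0 : h (γ s) = 0)
    (hpos : ∀ t, 0 ≤ h (γ t)) (hYs : 0 < lieDeriv Z.Y h (γ s)) : lieDeriv Z.X h (γ s) ≤ 0 := by
  by_contra! hXs
  have cX := continuousAt_lieDeriv_comp hU hh hX hγ.continuous (hγ.2.1 s)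
  have cY := continuousAt_lieDeriv_comp hU hh hY hγ.continuous (hγ.2.1 s)
  obtain ⟨δ, hδ, hb⟩ := Metric.eventually_nhds_iff.mp
    ((cX.eventually (lt_mem_nhds (half_lt_self hXs))).and
      (cY.eventually (lt_mem_nhds (half_lt_self hYs))))
  set m := min (lieDeriv Z.X h (γ s) / 2) (lieDeriv Z.Y h (γ s) / 2) with hm
  have hm0 : 0 < m := lt_min (half_pos hXs) (half_pos hYs)
  have hmX : m ≤ lieDeriv Z.X h (γ s) / 2 := min_le_left _ _
  have hmY : m ≤ lieDeriv Z.Y h (γ s) / 2 := min_le_right _ _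
  have key := le_of_ae_hasDerivAt_nonpos (f := fun t => -h (γ t) + m * t) (a := s - δ / 2) (b := s)
    (by linarith) ?_ ?_
  · have := hpos (s - δ / 2)
    have h3 : 0 < m * (δ / 2) := by positivity
    simp only [h0] at key
    nlinarith
  · obtain ⟨C, hC⟩ := hγ.exists_lipschitzOnWith_h hU hh (s - δ / 2) s
    exact ⟨_, hC.neg.add (LipschitzWith.lipschitzOnWith
      (LipschitzWith.of_dist_le_mul (K := ‖m‖₊) fun x y => by
        rw [Real.dist_eq, Real.dist_eq, ← mul_sub, abs_mul]; rfl))⟩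
  · filter_upwards [hγ.ae_hasDerivAt_h hU hh] with t ht htI d hd
    obtain ⟨l, hl, hd'⟩ := ht
    have e := hd.unique (hd'.neg.add ((hasDerivAt_id t).const_mul m))
    obtain ⟨b1, b2⟩ := hb (y := t) (by rw [Real.dist_eq, abs_lt]; constructor <;> linarith [htI.1, htI.2])
    have i1 := mul_le_mul_of_nonneg_left (hmX.trans b1.le) hl.1.1
    have i2 := mul_le_mul_of_nonneg_left (hmY.trans b2.le) (sub_nonneg.mpr hl.1.2)
    rw [e]; linarith

/-- A trajectory leaving `Σ` towards `h > 0` has `Xh ≥ 0` at the point of departure. -/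
theorem lieDeriv_X_nonneg (hγ : IsTrajectory U h Z γ) (hU : IsOpen U) (hh : ContDiffOn ℝ 2 h U)
    (hX : ContinuousOn Z.X U) {s b : ℝ} (hsb : s < b) (h0 : h (γ s) = 0)
    (hpos : ∀ t ∈ Ioc s b, 0 < h (γ t)) : 0 ≤ lieDeriv Z.X h (γ s) := by
  by_contra! hXs
  have cX := continuousAt_lieDeriv_comp hU hh hX hγ.continuous (hγ.2.1 s)
  obtain ⟨δ, hδ, hb⟩ := Metric.eventually_nhds_iff.mp (cX.eventually (gt_mem_nhds hXs))
  have hlt : s < min b (s + δ) := lt_min hsb (by linarith)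
  have key := le_of_ae_hasDerivAt_nonpos (f := fun t => h (γ t)) hlt.le
    (hγ.exists_lipschitzOnWith_h hU hh _ _) ?_
  · have := hpos (min b (s + δ)) ⟨hlt, min_le_left _ _⟩
    simp only [h0] at key
    linarith
  · filter_upwards [hγ.ae_hasDerivAt_h hU hh] with t ht htI d hd
    obtain ⟨l, hl, hd'⟩ := ht
    have hl1 : l = 1 := hl.2.1 (hpos t ⟨htI.1, htI.2.le.trans (min_le_left _ _)⟩)
    have e := hd.unique hd'
    have := hb (y := t) (by
      rw [Real.dist_eq, abs_lt]
      constructor <;> linarith [htI.1, htI.2, min_le_right b (s + δ)])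
    rw [e, hl1]; linarith

theorem exists_last_zero (hγ : IsTrajectory U h Z γ) (hU : IsOpen U) (hh : ContDiffOn ℝ 2 h U)
    {a b : ℝ} (hab : a ≤ b) (ha : h (γ a) = 0) (hb : 0 < h (γ b)) :
    ∃ s ∈ Ico a b, h (γ s) = 0 ∧ ∀ t ∈ Ioc s b, 0 < h (γ t) := by
  have hc := hγ.continuous_h hU hh
  have hcpt : IsCompact (Icc a b ∩ {t | h (γ t) ≤ 0}) :=
    isCompact_Icc.inter_right (isClosed_le hc continuous_const)
  obtain ⟨s, ⟨hs, hs0⟩, hmax⟩ := hcpt.exists_isGreatest ⟨a, ⟨le_rfl, hab⟩, ha.le⟩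
  have hsb : s < b := lt_of_le_of_ne hs.2 fun e => by rw [e] at hs0; exact absurd hs0 (not_le.mpr hb)
  have hpos : ∀ t ∈ Ioc s b, 0 < h (γ t) := fun t ht => by
    by_contra! hle
    exact absurd (hmax ⟨⟨hs.1.trans ht.1.le, ht.2⟩, hle⟩) (not_le.mpr ht.1)
  refine ⟨s, ⟨hs.1, hsb⟩, le_antisymm hs0 ?_, hpos⟩
  refine ge_of_tendsto (x := 𝓝[>] s) ((hc.tendsto s).mono_left nhdsWithin_le_nhds) ?_
  filter_upwards [Ioc_mem_nhdsGT hsb] with t ht using (hpos t ht).le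

theorem exists_first_zero (hγ : IsTrajectory U h Z γ) (hU : IsOpen U) (hh : ContDiffOn ℝ 2 h U)
    {a b : ℝ} (hab : a ≤ b) (ha : 0 < h (γ a)) (hb : h (γ b) = 0) :
    ∃ s ∈ Ioc a b, h (γ s) = 0 ∧ ∀ t ∈ Ico a s, 0 < h (γ t) := by
  have hc := hγ.continuous_h hU hh
  have hcpt : IsCompact (Icc a b ∩ {t | h (γ t) ≤ 0}) :=
    isCompact_Icc.inter_right (isClosed_le hc continuous_const)
  obtain ⟨s, ⟨hs, hs0⟩, hmin⟩ := hcpt.exists_isLeast ⟨b, ⟨hab, le_rfl⟩, hb.le⟩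
  have has : a < s := lt_of_le_of_ne hs.1 fun e => by rw [← e] at hs0; exact absurd hs0 (not_le.mpr ha)
  have hpos : ∀ t ∈ Ico a s, 0 < h (γ t) := fun t ht => by
    by_contra! hle
    exact absurd (hmin ⟨⟨ht.1, ht.2.le.trans hs.2⟩, hle⟩) (not_le.mpr ht.2)
  refine ⟨s, ⟨has, hs.2⟩, le_antisymm hs0 ?_, hpos⟩
  refine ge_of_tendsto (x := 𝓝[<] s) ((hc.tendsto s).mono_left nhdsWithin_le_nhds) ?_
  filter_upwards [Ico_mem_nhdsLT has] with t ht using (hpos t ht).le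

theorem exists_tangency_of_periodic (hγ : IsTrajectory U h Z γ) (hU : IsOpen U)
    (hh : ContDiffOn ℝ 2 h U) (hX : ContinuousOn Z.X U) (hY : ContinuousOn Z.Y U)
    {T m : ℝ} (hT : 0 < T) (hper : Function.Periodic γ T) (hm : 0 < m)
    (hYm : ∀ t, 0 < h (γ t) ∨ m ≤ lieDeriv Z.Y h (γ t)) {a b : ℝ} (ha : h (γ a) = 0)
    (hb : h (γ b) ≠ 0) : ∃ s, h (γ s) = 0 ∧ lieDeriv Z.X h (γ s) = 0 := by
  have hnn := hγ.h_nonneg_of_periodic hU hh hT hper hm hYm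
  obtain ⟨n, hn⟩ := exists_nat_gt ((a - b) / T)
  rw [div_lt_iff₀ hT] at hn
  have hp : γ (b + n * T) = γ b := hper.nat_mul n b
  obtain ⟨s, hs, hs0, hpos⟩ := hγ.exists_last_zero hU hh (a := a) (b := b + n * T) (by linarith) ha
    (by rw [hp]; exact lt_of_le_of_ne (hnn b) hb.symm)
  refine ⟨s, hs0, le_antisymm ?_ (hγ.lieDeriv_X_nonneg hU hh hX hs.2 hs0 hpos)⟩
  exact hγ.lieDeriv_X_nonpos hU hh hX hY hs0 hnn (hm.trans_le ((hYm s).resolve_left (by simp [hs0])))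

/-- Where a trajectory stays in `Σ`, it moves with the velocity of the sliding field. -/
theorem hasDerivAt_sliding (hγ : IsTrajectory U h Z γ) (hU : IsOpen U) (hh : ContDiffOn ℝ 2 h U)
    (hX : ContinuousOn Z.X U) (hY : ContinuousOn Z.Y U) {a b : ℝ}
    (h0 : ∀ t ∈ Icc a b, h (γ t) = 0)
    (hgap : ∀ t ∈ Icc a b, lieDeriv Z.Y h (γ t) - lieDeriv Z.X h (γ t) ≠ 0) :
    ∀ t ∈ Icc a b, HasDerivWithinAt γ (slidingField h Z (γ t)) (Icc a b) t := by
  intro t ht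
  refine hasDerivWithinAt_of_ae_hasDerivAt (w := fun s => slidingField h Z (γ s))
    (LocallyLipschitz.exists_lipschitzOnWith_Icc hγ.1 a b) ?_ ?_ ht
  · exact (continuousOn_slidingField hU hh hX hY).comp hγ.continuous.continuousOn
      fun s hs => ⟨hγ.2.1 s, hgap s hs⟩
  · filter_upwards [hγ.ae_hasDerivAt] with s hs hsI
    obtain ⟨l, hl, hd⟩ := hs
    have hsI' := Ioo_subset_Icc_self hsI
    have h1 : DifferentiableAt ℝ h (γ s) :=
      (hh.contDiffAt (hU.mem_nhds (hγ.2.1 s))).differentiableAt (by norm_num)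
    have h2 := h1.hasFDerivAt.comp_hasDerivAt s hd
    have h3 : HasDerivAt (h ∘ γ) 0 s := (hasDerivAt_const s (0 : ℝ)).congr_of_eventuallyEq (by
      filter_upwards [Ioo_mem_nhds hsI.1 hsI.2] with τ hτ using h0 τ (Ioo_subset_Icc_self hτ))
    have e := h2.unique h3
    rw [lieDeriv_blend] at e
    have hg := hgap s hsI'
    have hl' : l = lieDeriv Z.Y h (γ s) / (lieDeriv Z.Y h (γ s) - lieDeriv Z.X h (γ s)) := by
      rw [eq_div_iff hg]; linarith
    show HasDerivAt γ (slidingField h Z (γ s)) s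
    rw [slidingField_eq_blend hg, ← hl']; exact hd

/-- Where a trajectory stays in `h > 0`, it is an orbit of `X`. -/
theorem hasDerivWithinAt_of_pos (hγ : IsTrajectory U h Z γ) (hX : ContinuousOn Z.X U) {a b : ℝ}
    (h0 : ∀ t ∈ Ioo a b, 0 < h (γ t)) {t : ℝ} (ht : t ∈ Icc a b) :
    HasDerivWithinAt γ (Z.X (γ t)) (Icc a b) t := by
  refine hasDerivWithinAt_of_ae_hasDerivAt (w := fun s => Z.X (γ s))
    (LocallyLipschitz.exists_lipschitzOnWith_Icc hγ.1 a b)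
    (hX.comp hγ.continuous.continuousOn fun s _ => hγ.2.1 s) ?_ ht
  filter_upwards [hγ.ae_hasDerivAt] with s hs hsI
  obtain ⟨l, hl, hd⟩ := hs
  have hl1 : l = 1 := hl.2.1 (h0 s hsI)
  simpa [blend, hl1] using hd

/-- A trajectory cannot leave the sliding region at an interior point. -/
theorem h_eq_zero_of_sliding (hγ : IsTrajectory U h Z γ) (hU : IsOpen U) (hh : ContDiffOn ℝ 2 h U)
    {a b : ℝ} (h0 : h (γ a) = 0) (hX : ∀ t ∈ Icc a b, lieDeriv Z.X h (γ t) ≤ 0)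
    (hY : ∀ t ∈ Icc a b, 0 ≤ lieDeriv Z.Y h (γ t)) {t : ℝ} (ht : t ∈ Icc a b) : h (γ t) = 0 := by
  have key := le_max_of_ae_hasDerivAt (u := fun s => |h (γ s)|) ht.1 le_rfl ?_ ?_
  · simpa [h0] using key
  · obtain ⟨C, hC⟩ := hγ.exists_lipschitzOnWith_h hU hh a t
    exact ⟨C, LipschitzOnWith.of_dist_le_mul fun x hx y hy => by
      rw [Real.dist_eq]
      exact (abs_abs_sub_abs_le _ _).trans (by simpa [Real.dist_eq] using hC.dist_le_mul x hx y hy)⟩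
  · filter_upwards [hγ.ae_hasDerivAt_h hU hh] with s hs hsI hpos d hd
    obtain ⟨l, hl, hd'⟩ := hs
    have hs' : s ∈ Icc a b := ⟨hsI.1.le, hsI.2.le.trans ht.2⟩
    have i1 := hX s hs'
    have i2 := hY s hs'
    rcases HasDerivAt.of_abs hd' hd with ⟨h1, e⟩ | ⟨h1, e⟩ | ⟨h1, -, e⟩
    · rw [e, hl.2.1 h1]; linarith
    · rw [e, hl.2.2 h1]; linarith
    · rw [e]; simp

end IsTrajectory

end PWField

namespace PWField

/-- If sliding periodic orbits accumulate at the compact set `Γ`, then `Γ` contains a complete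
trajectory through a tangency point of `X`. -/
theorem exists_tangent_trajectory {U : Set E3} {h : E3 → ℝ} {Z : PWField} {Γ : Set E3}
    (hU : IsOpen U) (hh : ContDiffOn ℝ 2 h U) (hX : ContinuousOn Z.X U) (hY : ContinuousOn Z.Y U)
    (hΓ : IsCompact Γ) (hΓU : Γ ⊆ U) (hpos : ∀ x ∈ Γ, 0 ≤ h x)
    (hYp : ∀ x ∈ Γ, h x = 0 → 0 < lieDeriv Z.Y h x)
    (hper : ∀ W ∈ 𝓝ˢ Γ, ∃ P, IsSlidingPeriodicOrbit U h Z P ∧ P ⊆ W) :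
    ∃ y, IsTrajectory U h Z y ∧ (∀ t, y t ∈ Γ) ∧ h (y 0) = 0 ∧ lieDeriv Z.X h (y 0) = 0 := by
  obtain ⟨R, hR, hRU⟩ := hΓ.exists_cthickening_subset_open hU hΓU
  set K := Metric.cthickening R Γ with hKdef
  have hK : IsCompact K := hΓ.cthickening
  have hΓK : Γ ⊆ interior K := by
    refine (Metric.self_subset_thickening hR Γ).trans ?_
    exact interior_maximal (Metric.thickening_subset_cthickening R Γ) Metric.isOpen_thickening
  obtain ⟨M₁, hM₁⟩ := hK.exists_bound_of_continuousOn (hX.mono hRU)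
  obtain ⟨M₂, hM₂⟩ := hK.exists_bound_of_continuousOn (hY.mono hRU)
  set M : NNReal := Real.toNNReal (max M₁ M₂) with hM
  have hMX : ∀ x ∈ K, ‖Z.X x‖ ≤ M := fun x hx =>
    (hM₁ x hx).trans ((le_max_left _ _).trans (Real.le_coe_toNNReal _))
  have hMY : ∀ x ∈ K, ‖Z.Y x‖ ≤ M := fun x hx =>
    (hM₂ x hx).trans ((le_max_right _ _).trans (Real.le_coe_toNNReal _))
  have hQ : IsCompact (Γ ∩ h ⁻¹' {0}) :=
    hΓ.of_isClosed_subset ((hh.continuousOn.mono hΓU).preimage_isClosed_of_isClosed hΓ.isClosed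
      isClosed_singleton) inter_subset_left
  obtain ⟨m, hm, ε, hε, hmar⟩ := hQ.exists_margin hU (inter_subset_left.trans hΓU)
    (continuousOn_lieDeriv hU hh hY) fun x hx => hYp x hx.1 hx.2
  have hW₀ : {x | x ∈ U ∧ (0 < h x ∨ m / 2 < lieDeriv Z.Y h x)} ∈ 𝓝ˢ Γ := by
    rw [mem_nhdsSet_iff_forall]
    intro x hx
    have hxU := hU.mem_nhds (hΓU hx)
    rcases (hpos x hx).eq_or_lt with h0 | h0
    · have : m / 2 < lieDeriv Z.Y h x :=
        (half_lt_self hm).trans_le (hmar x ⟨hx, h0.symm⟩ x (by simpa using hε.le))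
      filter_upwards [hxU, ((continuousOn_lieDeriv hU hh hY).continuousAt hxU).eventually
        (lt_mem_nhds this)] with z h1 h2 using ⟨h1, Or.inr h2⟩
    · filter_upwards [hxU, (hh.continuousOn.continuousAt hxU).eventually (lt_mem_nhds h0)]
        with z h1 h2 using ⟨h1, Or.inl h2⟩
  have hstep : ∀ n : ℕ, ∃ γ : ℝ → E3, IsTrajectory U h Z γ ∧
      (∀ t, γ t ∈ K ∧ Metric.infDist (γ t) Γ ≤ 1 / ((n : ℝ) + 1)) ∧
      h (γ 0) = 0 ∧ lieDeriv Z.X h (γ 0) = 0 := by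
    intro n
    have hd : 0 < min R (1 / ((n : ℝ) + 1)) := lt_min hR (by positivity)
    obtain ⟨P, ⟨γ, T, hT, hγ, hγT, ⟨a, b, hab, hs⟩, ⟨b', hb'⟩, rfl⟩, hPW⟩ :=
      hper _ (inter_mem hW₀ (Metric.isOpen_thickening.mem_nhdsSet.mpr
        (Metric.self_subset_thickening hd Γ)))
    have hmid := hs ((a + b) / 2) ⟨by linarith, by linarith⟩
    have h0 : h (γ ((a + b) / 2)) = 0 := by
      rcases hmid with h1 | h1
      · exact h1.1.2
      · exact h1.1.2
    obtain ⟨s, hs0, hsX⟩ := hγ.exists_tangency_of_periodic hU hh hX hY hT hγT (half_pos hm)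
      (fun t => ((hPW (mem_range_self t)).1.2).imp_right le_of_lt) h0 hb'
    refine ⟨fun t => γ (t + s), hγ.comp_add s, fun t => ?_, by simpa using hs0, by simpa using hsX⟩
    have h1 := (hPW (mem_range_self (t + s))).2
    have hne : Γ.Nonempty := by
      obtain ⟨z, hz, -⟩ := Metric.mem_thickening_iff.mp h1
      exact ⟨z, hz⟩
    refine ⟨?_, ?_⟩
    · exact Metric.thickening_subset_cthickening _ _
        (Metric.thickening_mono (min_le_left _ _) Γ h1)
    · exact ((Metric.infDist_lt_iff hne).mpr (Metric.mem_thickening_iff.mp h1)).le.trans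
        (min_le_right _ _)
  choose γn hγn hγK h0n hXn using hstep
  have hlip : ∀ n, LipschitzWith M (γn n) := by
    intro n
    have key : ∀ a b, a ≤ b → ‖γn n b - γn n a‖ ≤ M * (b - a) := fun a b hab => by
      refine norm_sub_le_of_ae_hasDerivAt hab (LocallyLipschitz.exists_lipschitzOnWith_Icc (hγn n).1 a b) ?_
      filter_upwards [(hγn n).ae_hasDerivAt] with t ht _
      obtain ⟨l, hl, hd⟩ := ht
      refine ⟨_, hd, (norm_add_le _ _).trans ?_⟩
      rw [norm_smul, norm_smul, Real.norm_of_nonneg hl.1.1,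
        Real.norm_of_nonneg (sub_nonneg.mpr hl.1.2)]
      have i1 := mul_le_mul_of_nonneg_left (hMX _ (hγK n t).1) hl.1.1
      have i2 := mul_le_mul_of_nonneg_left (hMY _ (hγK n t).1) (sub_nonneg.mpr hl.1.2)
      linarith
    refine LipschitzWith.of_dist_le_mul fun a b => ?_
    rcases le_total a b with hab | hab
    · rw [dist_comm, dist_eq_norm, dist_comm, Real.dist_eq, abs_of_nonneg (sub_nonneg.mpr hab)]
      exact key a b hab
    · rw [dist_eq_norm, Real.dist_eq, abs_of_nonneg (sub_nonneg.mpr hab)]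
      exact key b a hab
  let F : Ultrafilter ℕ := hyperfilter ℕ
  have hF : (F : Filter ℕ) ≤ atTop := Nat.hyperfilter_le_atTop
  obtain ⟨y, hyM, hy⟩ := exists_ultralimit hlip F hK fun n => (hγK n 0).1
  have hne : Γ.Nonempty := by
    by_contra he
    rw [not_nonempty_iff_eq_empty] at he
    have := (hγK 0 0).1
    rw [hKdef, he, Metric.cthickening_empty] at this
    exact this
  have hyΓ : ∀ t, y t ∈ Γ := fun t => by
    rw [hΓ.isClosed.mem_iff_infDist_zero hne]
    refine le_antisymm ?_ Metric.infDist_nonneg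
    exact le_of_tendsto_of_tendsto
      ((Metric.continuous_infDist_pt Γ).continuousAt.tendsto.comp (hy t))
      (tendsto_one_div_add_atTop_nhds_zero_nat.mono_left hF)
      (Eventually.of_forall fun n => (hγK n t).2)
  refine ⟨y, ⟨hyM.locallyLipschitz, fun t => hΓU (hyΓ t), ?_⟩, hyΓ, ?_, ?_⟩
  · filter_upwards [hyM.ae_differentiableAt] with t ht
    obtain ⟨l, hl, e⟩ := velocity_of_tendsto (F := (F : Filter ℕ)) (K := K) (Z := Z)
      (hh.continuousOn.mono hRU)
      (hX.mono hRU) (hY.mono hRU) (a := t - 1) (b := t + 1) (ε := fun _ => 0) hlip hy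
      tendsto_const_nhds (fun n => by
        filter_upwards [(hγn n).ae_hasDerivAt] with s hs _
        obtain ⟨l, hl, hd⟩ := hs
        exact ⟨_, γn n s, l, hd, by simp, fun _ => ⟨hl, rfl⟩⟩)
      ⟨by linarith, by linarith⟩ (hΓK (hyΓ t)) ht.hasDerivAt
    exact ⟨_, e ▸ blend_mem_velocities hl, ht.hasDerivAt⟩
  · have hc := (hh.continuousOn.continuousAt (hU.mem_nhds (hΓU (hyΓ 0)))).tendsto.comp (hy 0)
    refine tendsto_nhds_unique hc (tendsto_const_nhds.congr fun n => (h0n n).symm)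
  · have hc := ((continuousOn_lieDeriv hU hh hX).continuousAt
      (hU.mem_nhds (hΓU (hyΓ 0)))).tendsto.comp (hy 0)
    exact tendsto_nhds_unique hc (tendsto_const_nhds.congr fun n => (hXn n).symm)

end PWField

theorem HasDerivWithinAt.eventually_mul_pos {f : ℝ → ℝ} {f' x : ℝ} {s : Set ℝ}
    (hf : HasDerivWithinAt f f' s x) (hf' : 0 < f') :
    ∀ᶠ y in 𝓝[s \ {x}] x, 0 < (y - x) * (f y - f x) := by
  have h1 := (hasDerivWithinAt_iff_tendsto_slope.mp hf).eventually (lt_mem_nhds hf')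
  filter_upwards [h1, self_mem_nhdsWithin] with y hy hys
  have hne : y - x ≠ 0 := sub_ne_zero.mpr hys.2
  rw [slope_def_field] at hy
  have h2 : 0 < (y - x) ^ 2 := by positivity
  have := mul_pos hy h2
  rwa [div_mul_eq_mul_div, sq, ← mul_assoc, mul_div_assoc, div_self hne, mul_one, mul_comm] at this

theorem HasDerivWithinAt.exists_gt_of_pos {f : ℝ → ℝ} {f' a b : ℝ} (hab : a < b)
    (hf : HasDerivWithinAt f f' (Icc a b) a) (hf' : 0 < f') :
    ∃ c ∈ Ioc a b, ∀ y ∈ Ioc a c, f a < f y := by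
  have h1 := hf.eventually_mul_pos hf'
  rw [Icc_sdiff_left, nhdsWithin_Ioc_eq_nhdsGT hab] at h1
  obtain ⟨c, hc, hc'⟩ := (mem_nhdsGT_iff_exists_Ioc_subset).mp h1
  refine ⟨min b c, ⟨lt_min hab hc, min_le_left _ _⟩, fun y hy => ?_⟩
  have h2 : 0 < (y - a) * (f y - f a) := hc' ⟨hy.1, hy.2.trans (min_le_right _ _)⟩
  have h3 : 0 < y - a := sub_pos.mpr hy.1
  exact sub_pos.mp (pos_of_mul_pos_right h2 h3.le)

theorem HasDerivWithinAt.exists_lt_of_pos {f : ℝ → ℝ} {f' a b : ℝ} (hab : a < b)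
    (hf : HasDerivWithinAt f f' (Icc a b) b) (hf' : 0 < f') :
    ∃ c ∈ Ico a b, ∀ y ∈ Ico c b, f y < f b := by
  have h1 := hf.eventually_mul_pos hf'
  rw [Icc_sdiff_right, nhdsWithin_Ico_eq_nhdsLT hab] at h1
  obtain ⟨c, hc, hc'⟩ := (mem_nhdsLT_iff_exists_Ico_subset).mp h1
  refine ⟨max a c, ⟨le_max_left _ _, max_lt hab hc⟩, fun y hy => ?_⟩
  have h2 : 0 < (y - b) * (f y - f b) := hc' ⟨(le_max_right _ _).trans hy.1, hy.2⟩
  have h3 : y - b < 0 := sub_neg.mpr hy.2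
  exact sub_neg.mp (neg_of_mul_pos_right h2 h3.le)

namespace PWField

theorem contDiffOn_lieDeriv {U : Set E3} {h : E3 → ℝ} {X : E3 → E3} (hU : IsOpen U)
    (hh : ContDiffOn ℝ 2 h U) (hX : ContDiffOn ℝ 1 X U) : ContDiffOn ℝ 1 (lieDeriv X h) U := by
  have h1 : ContDiffOn ℝ 1 (fderiv ℝ h) U := hh.fderiv_of_isOpen hU (by norm_num)
  exact h1.clm_apply hX

theorem locallyLipschitzOn_of_contDiffOn {U : Set E3} {X : E3 → E3} (hU : IsOpen U)
    (hX : ContDiffOn ℝ 1 X U) : LocallyLipschitzOn U X := fun x hx => by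
  obtain ⟨C, V, hV, hC⟩ := (hX.contDiffAt (hU.mem_nhds hx)).exists_lipschitzOnWith
  exact ⟨C, V, mem_nhdsWithin_of_mem_nhds hV, hC⟩

/-- At a visible fold, a trajectory takes off along the orbit of `X`. -/
theorem IsTrajectory.takeoff {U : Set E3} {h : E3 → ℝ} {Z : PWField} {y : ℝ → E3}
    (hy : IsTrajectory U h Z y) (hU : IsOpen U) (hh : ContDiffOn ℝ 2 h U)
    (hX : ContDiffOn ℝ 1 Z.X U) (hY : ContDiffOn ℝ 1 Z.Y U) (h0 : h (y 0) = 0)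
    (hX0 : lieDeriv Z.X h (y 0) = 0) (hXX : 0 < lieDeriv Z.X (lieDeriv Z.X h) (y 0))
    (hY0 : 0 < lieDeriv Z.Y h (y 0)) : ∃ δ > 0, ∀ t ∈ Ioc 0 δ, 0 < h (y t) := by
  have hU0 := hU.mem_nhds (hy.2.1 0)
  have cX := continuousOn_lieDeriv hU hh hX.continuousOn
  have cY := continuousOn_lieDeriv hU hh hY.continuousOn
  have hev : ∀ᶠ z in 𝓝 (y 0), z ∈ U ∧ 0 < lieDeriv Z.Y h z - lieDeriv Z.X h z := by
    filter_upwards [hU0, ((cY.continuousAt hU0).sub (cX.continuousAt hU0)).eventually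
      (lt_mem_nhds (a := 0) (by simpa [hX0] using hY0))] with z h1 h2 using ⟨h1, h2⟩
  obtain ⟨ρ, hρ, hball⟩ := Metric.nhds_basis_closedBall.mem_iff.mp hev
  set K := Metric.closedBall (y 0) ρ with hKdef
  have hK : IsCompact K := isCompact_closedBall _ _
  have hKU : K ⊆ U := fun z hz => (hball hz).1
  obtain ⟨L, c, ρ', H⟩ := exists_controlled hU hh (locallyLipschitzOn_of_contDiffOn hU hX)
    (locallyLipschitzOn_of_contDiffOn hU hY) hK hKU fun z hz _ => (hball hz).2
  obtain ⟨M₁, hM₁⟩ := hK.exists_bound_of_continuousOn (hX.continuousOn.mono hKU)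
  have hMX : ∀ x ∈ K, ‖Z.X x‖ ≤ M₁.toNNReal := fun x hx => (hM₁ x hx).trans (Real.le_coe_toNNReal _)
  obtain ⟨ζ, hζM, hζ0, hζd⟩ := exists_trajectory (h := h) (Z := ⟨Z.X, Z.X⟩) (K := K)
    (hh.continuousOn.mono hKU) (hX.continuousOn.mono hKU) (hX.continuousOn.mono hKU) hMX hMX (y 0)
  have hin : ∀ᶠ t in 𝓝[>] (0 : ℝ), ∀ s ∈ Icc 0 t, y s ∈ K ∧ ζ s ∈ interior K := by
    have h1 : ∀ᶠ s in 𝓝 (0 : ℝ), y s ∈ K ∧ ζ s ∈ interior K :=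
      (hy.continuous.continuousAt.eventually_mem (Metric.closedBall_mem_nhds _ hρ)).and
        (hζM.continuous.continuousAt.eventually_mem (by
          rw [hζ0]; exact interior_mem_nhds.mpr (Metric.closedBall_mem_nhds _ hρ)))
    obtain ⟨ε, hε, hb⟩ := Metric.eventually_nhds_iff.mp h1
    filter_upwards [Ioo_mem_nhdsGT hε] with t ht s hs
    exact hb (by rw [Real.dist_eq, sub_zero, abs_of_nonneg hs.1]; exact hs.2.trans_lt ht.2)
  obtain ⟨δ₀, hδ₀in, hδ₀⟩ := (hin.and self_mem_nhdsWithin).exists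
  replace hδ₀ : 0 < δ₀ := hδ₀
  have hζae : ∀ᵐ t, t ∈ Ioo 0 δ₀ → HasDerivAt ζ (Z.X (ζ t)) t := by
    filter_upwards [hζd] with t ht htI
    obtain ⟨v, hv, l, -, rfl⟩ := ht htI.1 (hδ₀in t (Ioo_subset_Icc_self htI)).2
    have e : blend ⟨Z.X, Z.X⟩ l (ζ t) = Z.X (ζ t) := by simp only [blend]; module
    rwa [e] at hv
  have hζU : ∀ t ∈ Icc 0 δ₀, ζ t ∈ U := fun t ht => hKU (interior_subset (hδ₀in t ht).2)
  have hζder : ∀ t ∈ Icc 0 δ₀, HasDerivWithinAt ζ (Z.X (ζ t)) (Icc 0 δ₀) t := fun t ht =>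
    hasDerivWithinAt_of_ae_hasDerivAt (w := fun t => Z.X (ζ t)) ⟨M₁.toNNReal, hζM.lipschitzOnWith⟩
      (hX.continuousOn.comp hζM.continuous.continuousOn hζU) hζae ht
  have hk : HasDerivWithinAt (fun t => lieDeriv Z.X h (ζ t))
      (lieDeriv Z.X (lieDeriv Z.X h) (y 0)) (Icc 0 δ₀) 0 := by
    have hd : DifferentiableAt ℝ (lieDeriv Z.X h) (ζ 0) := by
      rw [hζ0]
      exact ((contDiffOn_lieDeriv hU hh hX).contDiffAt hU0).differentiableAt one_ne_zero
    have := hd.hasFDerivAt.comp_hasDerivWithinAt 0 (hζder 0 ⟨le_rfl, hδ₀.le⟩)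
    rwa [hζ0] at this
  obtain ⟨δ, hδ, hδpos⟩ := hk.exists_gt_of_pos hδ₀ hXX
  have hhζ : ∀ t ∈ Ioc 0 δ, 0 < h (ζ t) := by
    intro t ht
    have hder : ∀ s ∈ Ioo 0 t, HasDerivAt (fun τ => h (ζ τ)) (lieDeriv Z.X h (ζ s)) s := by
      intro s hs
      have hsI : s ∈ Ioo 0 δ₀ := ⟨hs.1, hs.2.trans_le (ht.2.trans hδ.2)⟩
      have h1 : DifferentiableAt ℝ h (ζ s) :=
        (hh.contDiffAt (hU.mem_nhds (hζU s (Ioo_subset_Icc_self hsI)))).differentiableAt (by norm_num)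
      exact h1.hasFDerivAt.comp_hasDerivAt s
        ((hζder s (Ioo_subset_Icc_self hsI)).hasDerivAt (Icc_mem_nhds hsI.1 hsI.2))
    have hcont : ContinuousOn (fun τ => h (ζ τ)) (Icc 0 t) :=
      hh.continuousOn.comp hζM.continuous.continuousOn fun s hs =>
        hζU s ⟨hs.1, hs.2.trans (ht.2.trans hδ.2)⟩
    obtain ⟨s, hs, e⟩ := exists_hasDerivAt_eq_slope _ _ ht.1 hcont hder
    have h1 := hδpos s ⟨hs.1, hs.2.le.trans ht.2⟩
    simp only [hζ0, h0, hX0, sub_zero] at e h1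
    rw [e] at h1
    exact (div_pos_iff_of_pos_right ht.1).mp h1
  refine ⟨δ, hδ.1, fun t ht => ?_⟩
  have hf : Follows h Z 0 0 t ζ := by
    refine ⟨hζM.locallyLipschitz, ?_⟩
    filter_upwards [hζae] with s hs hsI
    refine ⟨_, hs ⟨hsI.1, hsI.2.trans_le (ht.2.trans hδ.2)⟩, 1, ⟨⟨zero_le_one, le_rfl⟩, fun _ => rfl,
      fun hneg => absurd (hhζ s ⟨hsI.1, hsI.2.le.trans ht.2⟩) (not_lt.mpr hneg.le)⟩, ?_⟩
    simp [blend]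
  have := H.norm_sub_le le_rfl zero_le_one ht.1.le (hy.follows 0 t) hf
    (fun s hs => (hδ₀in s ⟨hs.1, hs.2.trans (ht.2.trans hδ.2)⟩).1)
    (fun s hs => interior_subset (hδ₀in s ⟨hs.1, hs.2.trans (ht.2.trans hδ.2)⟩).2)
  rw [hζ0, sub_self, norm_zero, add_zero, mul_zero] at this
  rw [sub_eq_zero.mp (norm_le_zero_iff.mp this)]
  exact hhζ t ht

/-- Two trajectories in a set where the discontinuity is transversal coincide after any common
point. -/
theorem IsTrajectory.eq_of_eq {U : Set E3} {h : E3 → ℝ} {Z : PWField} {y z : ℝ → E3} {K : Set E3}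
    {L c ρ : ℝ} (H : Controlled h Z K L c ρ) (hy : IsTrajectory U h Z y) (hz : IsTrajectory U h Z z)
    (hyK : ∀ t, y t ∈ K) (hzK : ∀ t, z t ∈ K) {s t : ℝ} (hst : s ≤ t) (e : y s = z s) :
    y t = z t := by
  have := H.norm_sub_le le_rfl zero_le_one hst (hy.follows s t) (hz.follows s t)
    (fun s _ => hyK s) (fun s _ => hzK s)
  rw [e, sub_self, norm_zero, add_zero, mul_zero] at this
  exact sub_eq_zero.mp (norm_le_zero_iff.mp this)

/-- Periodic trajectories that meet have the same image. -/
theorem IsSlidingPeriodicOrbit.eq_of_inter_nonempty {U : Set E3} {h : E3 → ℝ} {Z : PWField}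
    {K P Q : Set E3} {L c ρ : ℝ} (H : Controlled h Z K L c ρ) (hP : IsSlidingPeriodicOrbit U h Z P)
    (hQ : IsSlidingPeriodicOrbit U h Z Q) (hPK : P ⊆ K) (hQK : Q ⊆ K) (hne : (P ∩ Q).Nonempty) :
    P = Q := by
  obtain ⟨y, T, hT, hy, hyT, -, -, rfl⟩ := hP
  obtain ⟨z, S, hS, hz, hzS, -, -, rfl⟩ := hQ
  obtain ⟨x, ⟨s, hs⟩, ⟨t, ht⟩⟩ := hne
  have key : ∀ u, 0 ≤ u → y (u + s) = z (u + t) := fun u hu =>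
    IsTrajectory.eq_of_eq H (hy.comp_add s) (hz.comp_add t) (fun t => hPK (mem_range_self _))
      (fun t => hQK (mem_range_self _)) hu (by simp [hs, ht])
  apply Subset.antisymm
  · rintro _ ⟨u, rfl⟩
    obtain ⟨n, hn⟩ := exists_nat_gt ((s - u) / T)
    rw [div_lt_iff₀ hT] at hn
    refine ⟨u + n * T - s + t, ?_⟩
    rw [← key _ (by linarith), sub_add_cancel]
    exact hyT.nat_mul n u
  · rintro _ ⟨u, rfl⟩
    obtain ⟨n, hn⟩ := exists_nat_gt ((t - u) / S)
    rw [div_lt_iff₀ hS] at hn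
    refine ⟨u + n * S - t + s, ?_⟩
    rw [key _ (by linarith), sub_add_cancel]
    exact hzS.nat_mul n u

end PWField

theorem inner_ge_of_focus {w w' : ℂ} {a β κ : ℝ} (hw : ‖w' - (a + β * Complex.I) * w‖ ≤ κ * ‖w‖) :
    (a - κ) * ‖w‖ ^ 2 ≤ inner ℝ w w' := by
  have e : inner ℝ w w' = a * ‖w‖ ^ 2 + inner ℝ w (w' - (a + β * Complex.I) * w) := by
    rw [inner_sub_right]
    have : inner ℝ w ((a + β * Complex.I) * w) = a * ‖w‖ ^ 2 := by
      rw [Complex.inner, ← Complex.normSq_eq_norm_sq, Complex.normSq_apply]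
      simp only [Complex.mul_re, Complex.mul_im, Complex.conj_re, Complex.conj_im, Complex.add_re,
        Complex.add_im, Complex.ofReal_re, Complex.ofReal_im, Complex.I_re, Complex.I_im]
      ring
    rw [this]; ring
  have h1 := (abs_le.mp (abs_real_inner_le_norm w (w' - (a + β * Complex.I) * w))).1
  have h2 := mul_le_mul_of_nonneg_left hw (norm_nonneg w)
  rw [e]; nlinarith

theorem im_div_ge_of_focus {w w' : ℂ} {a β κ : ℝ} (h0 : w ≠ 0)
    (hw : ‖w' - (a + β * Complex.I) * w‖ ≤ κ * ‖w‖) : β - κ ≤ (w' / w).im := by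
  have h1 : ‖w' / w - (a + β * Complex.I)‖ ≤ κ := by
    have e : w' / w - (a + β * Complex.I) = (w' - (a + β * Complex.I) * w) / w := by
      field_simp
    rw [e, norm_div, div_le_iff₀ (norm_pos_iff.mpr h0)]; exact hw
  have h2 := (abs_le.mp ((Complex.abs_im_le_norm _).trans h1)).1
  simp at h2
  linarith

namespace PWField

namespace SaddleFocus

variable {U : Set E3} {h : E3 → ℝ} {Z : PWField} {p q : E3} {σ ξ : ℝ → E3} {t₀ : ℝ}
  {π : E3 →L[ℝ] ℂ} {ι : ℂ →L[ℝ] E3} {ψ : ℂ → E3} {r Cψ r' a β : ℝ}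

theorem exists_spiral (F : SaddleFocus U h Z p q σ ξ t₀ π ι ψ r Cψ r' a β) {κ : ℝ} (hκ : 0 < κ) :
    ∃ T > 0, ∀ s ≤ -T, π (σ s - p) ≠ 0 ∧
      HasDerivAt (fun s => π (σ s - p)) (π (slidingField h Z (σ s))) s ∧
      ‖π (slidingField h Z (σ s)) - (a + β * Complex.I) * π (σ s - p)‖ ≤ κ * ‖π (σ s - p)‖ := by
  obtain ⟨r₁, hr₁, hr₁r, has⟩ := F.asymp κ hκ
  have hlim : Tendsto (fun s => π (σ s - p)) atBot (𝓝 0) := by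
    have : Tendsto (fun s => π (σ s - p)) atBot (𝓝 (π (p - p))) :=
      (π.continuous.tendsto _).comp (F.conn.σ_lim.sub_const p)
    simpa using this
  have hev := (F.conn.σ_lim.eventually (Metric.ball_mem_nhds p F.chart.r'_pos)).and
    (hlim.eventually (Metric.ball_mem_nhds (0 : ℂ) hr₁))
  obtain ⟨T, hT⟩ := eventually_atBot.mp hev
  refine ⟨max 1 (-T), lt_max_of_lt_left one_pos, fun s hs => ?_⟩
  have hsT : s ≤ T := by linarith [le_max_right 1 (-T)]
  have hs0 : s < 0 := by linarith [le_max_left 1 (-T)]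
  obtain ⟨h1, h2⟩ := hT s hsT
  obtain ⟨hslide, hd⟩ := F.conn.σ_slide s hs0
  obtain ⟨-, e⟩ := F.chart.surj (σ s) (by simpa [dist_eq_norm] using h1) hslide.1.2
  refine ⟨fun h0 => ?_, ?_, ?_⟩
  · rw [h0, F.chart.ψ_zero] at e
    exact F.conn.loop_ne_p hs0.le (by rw [Connection.loop_nonpos hs0.le, e])
  · exact (π.hasFDerivAt.comp_hasDerivAt s (hd.sub_const p))
  · have := has (π (σ s - p)) (by simpa using h2)
    rwa [e] at this

theorem exists_strictMonoOn (F : SaddleFocus U h Z p q σ ξ t₀ π ι ψ r Cψ r' a β) :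
    ∃ T > 0, StrictMonoOn (fun s => ‖π (σ s - p)‖ ^ 2) (Iic (-T)) ∧ ∀ s ≤ -T, π (σ s - p) ≠ 0 := by
  obtain ⟨T, hT, hs⟩ := F.exists_spiral (half_pos F.a_pos)
  refine ⟨T, hT, ?_, fun s hsT => (hs s hsT).1⟩
  have hd : ∀ s ≤ -T, HasDerivAt (fun s => ‖π (σ s - p)‖ ^ 2)
      (2 * inner ℝ (π (σ s - p)) (π (slidingField h Z (σ s)))) s := fun s hsT =>
    (hs s hsT).2.1.norm_sq
  refine strictMonoOn_of_deriv_pos (convex_Iic _)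
    (fun s hsT => (hd s hsT).continuousAt.continuousWithinAt) fun s hsT => ?_
  rw [interior_Iic] at hsT
  rw [(hd s hsT.le).deriv]
  have h1 := inner_ge_of_focus (hs s hsT.le).2.2
  have h2 : 0 < (a - a / 2) * ‖π (σ s - p)‖ ^ 2 :=
    mul_pos (by linarith [F.a_pos]) (pow_pos (norm_pos_iff.mpr (hs s hsT.le).1) 2)
  linarith

/-- The sliding orbit winds around the focus, so that its tail lies in no half-plane. -/
theorem exists_re_nonpos (F : SaddleFocus U h Z p q σ ξ t₀ π ι ψ r Cψ r' a β) (w₀ : ℂ) (T' : ℝ) :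
    ∃ s ≤ T', (w₀ * π (σ s - p)).re ≤ 0 := by
  by_contra! hpos
  obtain ⟨T, hT, hs⟩ := F.exists_spiral (half_pos F.β_pos)
  set s₁ := min (-T) T' with hs₁
  have hd : ∀ s ≤ s₁, ∃ d, β / 2 ≤ d ∧
      HasDerivAt (fun s => (Complex.log (w₀ * π (σ s - p))).im) d s := by
    intro s hss
    obtain ⟨h1, h2, h3⟩ := hs s (hss.trans (min_le_left _ _))
    have hp := hpos s (hss.trans (min_le_right _ _))
    have hw₀ : w₀ ≠ 0 := fun e => by simp [e] at hp
    refine ⟨_, ?_, Complex.imCLM.hasFDerivAt.comp_hasDerivAt s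
      ((h2.const_mul w₀).clog_real (Or.inl hp))⟩
    rw [mul_div_mul_left _ _ hw₀]
    have := im_div_ge_of_focus h1 h3
    simp only [Complex.imCLM_apply]
    linarith
  have hβ := F.β_pos
  set s₀ := s₁ - (4 * Real.pi / β + 1) with hs₀
  have hlt : s₀ < s₁ := by
    have : 0 < 4 * Real.pi / β := by positivity
    linarith
  choose! d hd1 hd2 using hd
  obtain ⟨s, hsI, e⟩ := exists_hasDerivAt_eq_slope _ d hlt
    (fun s hsI => (hd2 s hsI.2).continuousAt.continuousWithinAt) fun s hsI => hd2 s hsI.2.le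
  have h1 := hd1 s hsI.2.le
  rw [e, le_div_iff₀ (sub_pos.mpr hlt)] at h1
  simp only [Complex.log_im] at h1
  have h2 := Complex.arg_le_pi (w₀ * π (σ s₁ - p))
  have h3 := Complex.neg_pi_lt_arg (w₀ * π (σ s₀ - p))
  have h4 : β / 2 * (s₁ - s₀) = 2 * Real.pi + β / 2 := by
    rw [hs₀]; field_simp; ring
  rw [h4] at h1
  linarith

end SaddleFocus

end PWField

namespace PWField

/-- Qualitative properties, on the connection of `Z`, of a field `Z'` close to `Z`. -/
structure NearConnection (U : Set E3) (h : E3 → ℝ) (Z : PWField) (p q : E3) (σ ξ : ℝ → E3)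
    (t₀ : ℝ) (Z' : PWField) : Prop where
  smooth_X : ContDiffOn ℝ 1 Z'.X U
  smooth_Y : ContDiffOn ℝ 1 Z'.Y U
  Yh : ∀ x ∈ range (loop p σ ξ t₀), h x = 0 → 0 < lieDeriv Z'.Y h x
  gap : ∀ x ∈ range (loop p σ ξ t₀), h x = 0 → 0 < lieDeriv Z'.Y h x - lieDeriv Z'.X h x
  Xh_p : lieDeriv Z'.X h p < 0
  fold : ∀ x ∈ range (loop p σ ξ t₀), h x = 0 → lieDeriv Z'.X h x = 0 →
    0 < lieDeriv Z'.X (lieDeriv Z'.X h) x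
  dir : 0 < inner ℝ (Z'.X q) (Z.X q)

namespace Connection

variable {U : Set E3} {h : E3 → ℝ} {Z : PWField} {p q : E3} {σ ξ : ℝ → E3} {t₀ : ℝ}

theorem range_subset (C : Connection U h Z p q σ ξ t₀) : range (loop p σ ξ t₀) ⊆ U := by
  rintro _ ⟨t, rfl⟩; exact C.loop_mem t

theorem p_mem_range (C : Connection U h Z p q σ ξ t₀) : p ∈ range (loop p σ ξ t₀) :=
  ⟨t₀, C.loop_ge le_rfl⟩

theorem h_nonneg (C : Connection U h Z p q σ ξ t₀) {x : E3} (hx : x ∈ range (loop p σ ξ t₀)) :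
    0 ≤ h x := by
  obtain ⟨t, rfl⟩ := hx
  rcases le_or_gt t 0 with h0 | h0
  · exact (C.h_loop_nonpos h0).ge
  · rcases lt_or_ge t t₀ with h1 | h1
    · exact (C.h_loop_pos ⟨h0, h1⟩).le
    · exact (C.h_loop_ge h1).ge

theorem p_ne_q (C : Connection U h Z p q σ ξ t₀) : p ≠ q := fun e => by
  have := C.p_mem.2.1
  rw [e, C.Xh_q] at this
  exact lt_irrefl _ this

theorem continuousOn_ξ (C : Connection U h Z p q σ ξ t₀) : ContinuousOn ξ (Icc 0 t₀) :=
  fun t ht => (C.ξ_deriv t ht).continuousWithinAt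

theorem mem_ξ_of_pos (C : Connection U h Z p q σ ξ t₀) {x : E3} (hx : x ∈ range (loop p σ ξ t₀))
    (h0 : 0 < h x) : x ∈ ξ '' Icc 0 t₀ := by
  rw [C.range_loop] at hx
  rcases hx with ⟨t, ht, rfl⟩ | hx
  · rw [← loop_nonpos (p := p) (σ := σ) (ξ := ξ) (t₀ := t₀) ht, C.h_loop_nonpos ht] at h0
    exact absurd h0 (lt_irrefl _)
  · exact hx

/-- The only points of `Σ` where a curve in the connection can enter or leave `h > 0`. -/
theorem eq_or_eq_of_frequently (C : Connection U h Z p q σ ξ t₀) {y : ℝ → E3} {s : ℝ}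
    {l : Filter ℝ} [l.NeBot] (hy : Tendsto y l (𝓝 (y s))) (hyΓ : ∀ t, y t ∈ range (loop p σ ξ t₀))
    (h0 : h (y s) = 0) (hl : ∀ᶠ t in l, 0 < h (y t)) : y s = p ∨ y s = q := by
  have hc : IsClosed (ξ '' Icc 0 t₀) := (isCompact_Icc.image_of_continuousOn C.continuousOn_ξ).isClosed
  obtain ⟨t, ht, e⟩ := hc.mem_of_tendsto hy (hl.mono fun t ht => C.mem_ξ_of_pos (hyΓ t) ht)
  rcases ht.1.eq_or_lt with h1 | h1
  · right; rw [← e, ← h1, C.ξ_zero]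
  rcases ht.2.eq_or_lt with h2 | h2
  · left; rw [← e, h2, C.ξ_end]
  · have := (C.ξ_pos t ⟨h1, h2⟩).2
    rw [e, h0] at this
    exact absurd this (lt_irrefl _)

theorem exists_inner_nonneg (C : Connection U h Z p q σ ξ t₀) :
    ∃ ε > 0, ∀ x ∈ ξ '' Icc 0 t₀, ‖x - q‖ < ε → 0 ≤ inner ℝ (x - q) (Z.X q) := by
  have hXq : Z.X q ≠ 0 := by
    rw [← C.loopVel_zero]; exact C.loopVel_ne_zero C.t₀_pos.le
  have hd : HasDerivWithinAt (fun t => inner ℝ (ξ t - q) (Z.X q)) (inner ℝ (Z.X q) (Z.X q))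
      (Icc 0 t₀) 0 := by
    have h1 := ((C.ξ_deriv 0 ⟨le_rfl, C.t₀_pos.le⟩).sub_const q).inner ℝ
      (hasDerivWithinAt_const 0 (Icc 0 t₀) (Z.X q))
    rw [C.ξ_zero] at h1
    simpa using h1
  obtain ⟨c, hc, hpos⟩ := hd.exists_gt_of_pos C.t₀_pos (real_inner_self_pos.mpr hXq)
  have hcpt : IsCompact (ξ '' Icc c t₀) := isCompact_Icc.image_of_continuousOn
    (C.continuousOn_ξ.mono (Icc_subset_Icc_left hc.1.le))
  have hq : q ∉ ξ '' Icc c t₀ := by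
    rintro ⟨t, ht, e⟩
    rcases ht.2.eq_or_lt with h2 | h2
    · rw [h2, C.ξ_end] at e; exact C.p_ne_q e
    · have := (C.ξ_pos t ⟨hc.1.trans_le ht.1, h2⟩).2
      rw [e, C.q_mem.2] at this
      exact lt_irrefl _ this
  obtain ⟨ε, hε, hb⟩ := Metric.mem_nhds_iff.mp (hcpt.isClosed.isOpen_compl.mem_nhds hq)
  refine ⟨ε, hε, ?_⟩
  rintro _ ⟨t, ht, rfl⟩ hlt
  rcases lt_or_ge t c with h1 | h1
  · rcases ht.1.eq_or_lt with h2 | h2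
    · rw [← h2, C.ξ_zero, sub_self, inner_zero_left]
    · have := hpos t ⟨h2, h1.le⟩
      simp only [C.ξ_zero, sub_self, inner_zero_left] at this
      exact this.le
  · exact absurd ⟨t, ⟨h1, ht.2⟩, rfl⟩ (hb (by simpa [dist_eq_norm] using hlt))

end Connection

namespace NearConnection

variable {U : Set E3} {h : E3 → ℝ} {Z Z' : PWField} {p q : E3} {σ ξ : ℝ → E3} {t₀ : ℝ} {y : ℝ → E3}

theorem tangency (N : NearConnection U h Z p q σ ξ t₀ Z') (C : Connection U h Z p q σ ξ t₀)
    (hy : IsTrajectory U h Z' y) (hyΓ : ∀ t, y t ∈ range (loop p σ ξ t₀)) {s : ℝ}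
    (h0 : h (y s) = 0) (hX : lieDeriv Z'.X h (y s) = 0) :
    y s = q ∧ ∃ δ > 0, ∀ t ∈ Ioc s (s + δ), 0 < h (y t) := by
  obtain ⟨δ, hδ, hpos⟩ := (hy.comp_add s).takeoff C.isOpen C.smooth N.smooth_X N.smooth_Y
    (by simpa using h0) (by simpa using hX) (by simpa using N.fold _ (hyΓ s) h0 hX)
    (by simpa using N.Yh _ (hyΓ s) h0)
  have hpos' : ∀ t ∈ Ioc s (s + δ), 0 < h (y t) := fun t ht => by
    simpa using hpos (t - s) ⟨by linarith [ht.1], by linarith [ht.2]⟩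
  refine ⟨?_, δ, hδ, hpos'⟩
  have hev : ∀ᶠ t in 𝓝[>] s, 0 < h (y t) := by
    filter_upwards [Ioc_mem_nhdsGT (by linarith : s < s + δ)] with t ht using hpos' t ht
  refine (C.eq_or_eq_of_frequently (hy.continuous.continuousAt.mono_left nhdsWithin_le_nhds) hyΓ h0
    hev).resolve_left fun e => ?_
  have := N.Xh_p
  rw [← e, hX] at this
  exact lt_irrefl _ this

theorem landing (N : NearConnection U h Z p q σ ξ t₀ Z') (C : Connection U h Z p q σ ξ t₀)
    (hy : IsTrajectory U h Z' y) (hyΓ : ∀ t, y t ∈ range (loop p σ ξ t₀)) {a b : ℝ} (hab : a ≤ b)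
    (ha : 0 < h (y a)) (hb : h (y b) = 0) :
    ∃ s ∈ Ioc a b, y s = p ∧ ∀ t ∈ Ico a s, 0 < h (y t) := by
  obtain ⟨s, hs, hs0, hpos⟩ := hy.exists_first_zero C.isOpen C.smooth hab ha hb
  refine ⟨s, hs, ?_, hpos⟩
  have hev : ∀ᶠ t in 𝓝[<] s, 0 < h (y t) := by
    filter_upwards [Ico_mem_nhdsLT hs.1] with t ht using hpos t ht
  refine (C.eq_or_eq_of_frequently (hy.continuous.continuousAt.mono_left nhdsWithin_le_nhds) hyΓ
    hs0 hev).resolve_right fun e => ?_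
  obtain ⟨ε, hε, hin⟩ := C.exists_inner_nonneg
  have hd : HasDerivWithinAt (fun t => inner ℝ (y t - q) (Z.X q)) (inner ℝ (Z'.X q) (Z.X q))
      (Icc a s) s := by
    have h1 := ((hy.hasDerivWithinAt_of_pos N.smooth_X.continuousOn
      (fun t ht => hpos t ⟨ht.1.le, ht.2⟩) (t := s) ⟨hs.1.le, le_rfl⟩).sub_const q).inner ℝ
      (hasDerivWithinAt_const s (Icc a s) (Z.X q))
    rw [e] at h1
    simpa using h1
  obtain ⟨c, hc, hneg⟩ := hd.exists_lt_of_pos hs.1 N.dir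
  have hclose : ∀ᶠ t in 𝓝[<] s, ‖y t - q‖ < ε := by
    have h2 : Tendsto (fun t => ‖y t - q‖) (𝓝[<] s) (𝓝 ‖y s - q‖) :=
      ((hy.continuous.sub continuous_const).norm.tendsto s).mono_left nhdsWithin_le_nhds
    rw [e, sub_self, norm_zero] at h2
    exact h2.eventually (gt_mem_nhds hε)
  obtain ⟨t, ht1, ht2, ht3⟩ := (hclose.and (hev.and (Ico_mem_nhdsLT hc.2))).exists
  have h3 := hneg t ht3
  simp only [e, sub_self, inner_zero_left] at h3
  exact absurd (hin (y t) (C.mem_ξ_of_pos (hyΓ t) ht2) ht1) (not_le.mpr h3)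

theorem exists_controlled (N : NearConnection U h Z p q σ ξ t₀ Z')
    (C : Connection U h Z p q σ ξ t₀) :
    ∃ L c ρ, Controlled h Z' (range (loop p σ ξ t₀)) L c ρ :=
  PWField.exists_controlled C.isOpen C.smooth (locallyLipschitzOn_of_contDiffOn C.isOpen N.smooth_X)
    (locallyLipschitzOn_of_contDiffOn C.isOpen N.smooth_Y) C.isCompact_range_loop C.range_subset N.gap

theorem eq_p_of_zero (N : NearConnection U h Z p q σ ξ t₀ Z') (C : Connection U h Z p q σ ξ t₀)
    (hy : IsTrajectory U h Z' y) (hyΓ : ∀ t, y t ∈ range (loop p σ ξ t₀))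
    (hz : slidingField h Z' p = 0) {s t : ℝ} (hst : s ≤ t) (e : y s = p) : y t = p := by
  obtain ⟨L, c, ρ, H⟩ := N.exists_controlled C
  have := H.norm_sub_le le_rfl zero_le_one hst (hy.follows s t)
    (Connection.follows_const C.p_mem.1.2 N.Xh_p.le (N.Yh p C.p_mem_range C.p_mem.1.2) hz s t)
    (fun s _ => hyΓ s) (fun s _ => C.p_mem_range)
  rw [e, sub_self, norm_zero, add_zero, mul_zero] at this
  exact sub_eq_zero.mp (norm_le_zero_iff.mp this)

end NearConnection

namespace SaddleFocus

variable {U : Set E3} {h : E3 → ℝ} {Z Z' : PWField} {p q : E3} {σ ξ : ℝ → E3} {t₀ : ℝ}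
  {π : E3 →L[ℝ] ℂ} {ι : ℂ →L[ℝ] E3} {ψ : ℂ → E3} {r Cψ r' a β : ℝ} {y : ℝ → E3}

/-- Since the connection spirals into `p`, a trajectory of `Z'` inside the connection can only pass
through `p` if `p` is an equilibrium of the sliding field. -/
theorem slidingField_eq_zero (F : SaddleFocus U h Z p q σ ξ t₀ π ι ψ r Cψ r' a β)
    (N : NearConnection U h Z p q σ ξ t₀ Z') (hy : IsTrajectory U h Z' y)
    (hyΓ : ∀ t, y t ∈ range (loop p σ ξ t₀)) (e0 : y 0 = p) : slidingField h Z' p = 0 := by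
  by_contra hne
  have C := F.conn
  have cX := continuousAt_lieDeriv_comp C.isOpen C.smooth N.smooth_X.continuousOn hy.continuous (hy.2.1 0)
  have cY := continuousAt_lieDeriv_comp C.isOpen C.smooth N.smooth_Y.continuousOn hy.continuous (hy.2.1 0)
  have hYp := N.Yh p C.p_mem_range C.p_mem.1.2
  obtain ⟨δ₀, hδ₀, hb⟩ := Metric.eventually_nhds_iff.mp
    ((cX.eventually (gt_mem_nhds (show lieDeriv Z'.X h (y 0) < 0 by simpa [e0] using N.Xh_p))).and
      (cY.eventually (lt_mem_nhds (a := 0) (by simpa [e0] using hYp))))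
  have hb' : ∀ t ∈ Icc 0 (δ₀ / 2), lieDeriv Z'.X h (y t) < 0 ∧ 0 < lieDeriv Z'.Y h (y t) :=
    fun t ht => hb (by rw [Real.dist_eq, sub_zero, abs_of_nonneg ht.1]; linarith [ht.2])
  have hh0 : ∀ t ∈ Icc 0 (δ₀ / 2), h (y t) = 0 := fun t ht =>
    hy.h_eq_zero_of_sliding C.isOpen C.smooth (by rw [e0]; exact C.p_mem.1.2)
      (fun t ht => (hb' t ht).1.le) (fun t ht => (hb' t ht).2.le) ht
  have hder := hy.hasDerivAt_sliding C.isOpen C.smooth N.smooth_X.continuousOn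
    N.smooth_Y.continuousOn hh0 (fun t ht => by have := hb' t ht; exact ne_of_gt (by linarith))
    0 ⟨le_rfl, by linarith⟩
  rw [e0] at hder
  set w₀ : ℂ := π (slidingField h Z' p) with hw₀
  have hw₀ne : w₀ ≠ 0 := fun h1 => hne (by
    have := F.coord.decomp (slidingField h Z' p)
    rw [fderiv_slidingField, ← hw₀, h1] at this
    simpa using this)
  set k := starRingEnd ℂ w₀ with hk
  have hw : Continuous fun t => π (y t - p) := π.continuous.comp (hy.continuous.sub continuous_const)
  have hd : HasDerivWithinAt (fun t => (k * π (y t - p)).re) (k * w₀).re (Icc 0 (δ₀ / 2)) 0 :=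
    Complex.reCLM.hasFDerivAt.comp_hasDerivWithinAt 0
      ((π.hasFDerivAt.comp_hasDerivWithinAt 0 (hder.sub_const p)).const_mul k)
  have hk0 : 0 < (k * w₀).re := by
    rw [hk, mul_comm, Complex.mul_conj, Complex.ofReal_re]; exact Complex.normSq_pos.mpr hw₀ne
  obtain ⟨c, hc, hpos⟩ := hd.exists_gt_of_pos (half_pos hδ₀) hk0
  simp only [e0, sub_self, map_zero, mul_zero, Complex.zero_re] at hpos
  obtain ⟨T, hT, hmono, hTne⟩ := F.exists_strictMonoOn
  have hcpt : IsCompact (loop p σ ξ t₀ '' Icc (-T) 0) := isCompact_Icc.image C.continuous_loop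
  have hpn : p ∉ loop p σ ξ t₀ '' Icc (-T) 0 := by
    rintro ⟨t, ht, e⟩; exact C.loop_ne_p ht.2 e
  have hfar : ∀ᶠ t in 𝓝 (0 : ℝ), y t ∉ loop p σ ξ t₀ '' Icc (-T) 0 :=
    hy.continuous.continuousAt.eventually_mem (by
      rw [e0]; exact hcpt.isClosed.isOpen_compl.mem_nhds hpn)
  obtain ⟨δ₁, hδ₁, hfar⟩ := Metric.eventually_nhds_iff.mp hfar
  set δ := min c (δ₁ / 2) with hδ
  have hδ0 : 0 < δ := lt_min hc.1 (half_pos hδ₁)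
  have hσ : ∀ t ∈ Ioc 0 δ, ∃ s ≤ -T, y t = σ s := by
    intro t ht
    have h1 := hpos t ⟨ht.1, ht.2.trans (min_le_left _ _)⟩
    have hnp : y t ≠ p := fun e => by simp [e] at h1
    obtain ⟨s, hs⟩ := hyΓ t
    have hs0 : s ≤ 0 := by
      by_contra! hs0
      rcases lt_or_ge s t₀ with h2 | h2
      · have := C.h_loop_pos ⟨hs0, h2⟩
        rw [hs, hh0 t ⟨ht.1.le, ht.2.trans ((min_le_left _ _).trans hc.2)⟩] at this
        exact lt_irrefl _ this
      · exact hnp (by rw [← hs, C.loop_ge h2])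
    refine ⟨s, ?_, by rw [← hs, Connection.loop_nonpos hs0]⟩
    by_contra! hsT
    refine hfar (y := t) ?_ ⟨s, ⟨hsT.le, hs0⟩, hs⟩
    rw [Real.dist_eq, sub_zero, abs_of_pos ht.1]
    linarith [ht.2, min_le_right c (δ₁ / 2)]
  have hlim : Tendsto (fun s => ‖π (σ s - p)‖ ^ 2) atBot (𝓝 0) := by
    have : Tendsto (fun s => ‖π (σ s - p)‖ ^ 2) atBot (𝓝 (‖π (p - p)‖ ^ 2)) :=
      (((π.continuous.tendsto _).comp (C.σ_lim.sub_const p)).norm.pow 2)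
    simpa using this
  have hδne : 0 < ‖π (y δ - p)‖ ^ 2 := by
    have h1 := hpos δ ⟨hδ0, min_le_left _ _⟩
    have : π (y δ - p) ≠ 0 := fun e => by simp [e] at h1
    positivity
  obtain ⟨T₂, hT₂⟩ := eventually_atBot.mp (hlim.eventually (gt_mem_nhds hδne))
  obtain ⟨s, hs, hre⟩ := F.exists_re_nonpos k (min T₂ (-T))
  have hsT : s ≤ -T := hs.trans (min_le_right _ _)
  have hivt : ‖π (σ s - p)‖ ^ 2 ∈ (fun t => ‖π (y t - p)‖ ^ 2) '' Icc 0 δ := by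
    refine intermediate_value_Icc hδ0.le (hw.norm.pow 2).continuousOn ⟨?_, ?_⟩
    · show ‖π (y 0 - p)‖ ^ 2 ≤ ‖π (σ s - p)‖ ^ 2
      rw [e0, sub_self, map_zero, norm_zero, zero_pow two_ne_zero]; positivity
    · exact (hT₂ s (hs.trans (min_le_left _ _))).le
  obtain ⟨t, ht, e⟩ := hivt
  have ht0 : 0 < t := lt_of_le_of_ne ht.1 fun h1 => by
    rw [← h1] at e
    simp only [e0, sub_self, map_zero, norm_zero] at e
    have := hTne s hsT
    have : 0 < ‖π (σ s - p)‖ ^ 2 := by positivity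
    rw [← e] at this
    norm_num at this
  obtain ⟨s', hs', es⟩ := hσ t ⟨ht0, ht.2⟩
  have hss : s' = s := hmono.injOn hs' hsT (by simpa [es] using e)
  rw [hss] at es
  have := hpos t ⟨ht0, ht.2.trans (min_le_left _ _)⟩
  rw [es] at this
  linarith

end SaddleFocus

end PWField

/-- A planar linear map close to the multiplication by `a + i β` has a pair of non-real
eigenvalues with positive real part. -/
theorem exists_eigenvalues_of_near {E : Type*} [AddCommGroup E] [Module ℝ E] {A : E →ₗ[ℝ] E}
    {B : ℂ →ₗ[ℝ] ℂ} {ι : ℂ →ₗ[ℝ] E} (hAB : ∀ z, A (ι z) = ι (B z)) {a β κ : ℝ} (ha : κ < a)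
    (hβ : 2 * κ < β) (h1 : ‖B 1 - (a + β * Complex.I)‖ ≤ κ)
    (hI : ‖B Complex.I - (a + β * Complex.I) * Complex.I‖ ≤ κ) :
    ∃ a' b' : ℝ, 0 < a' ∧ b' ≠ 0 ∧ ∃ w : ℂ, A (ι 1) = a' • ι 1 - b' • ι w ∧
      A (ι w) = b' • ι 1 + a' • ι w := by
  have hκ : 0 ≤ κ := (norm_nonneg _).trans h1
  have e1 := abs_le.mp ((Complex.abs_re_le_norm _).trans h1)
  have e2 := abs_le.mp ((Complex.abs_im_le_norm _).trans h1)
  have e3 := abs_le.mp ((Complex.abs_re_le_norm _).trans hI)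
  have e4 := abs_le.mp ((Complex.abs_im_le_norm _).trans hI)
  simp at e1 e2 e3 e4
  obtain ⟨x₁, hx₁⟩ : ∃ x, (B 1).re = x := ⟨_, rfl⟩
  obtain ⟨y₁, hy₁⟩ : ∃ x, (B 1).im = x := ⟨_, rfl⟩
  obtain ⟨x₂, hx₂⟩ : ∃ x, (B Complex.I).re = x := ⟨_, rfl⟩
  obtain ⟨y₂, hy₂⟩ : ∃ x, (B Complex.I).im = x := ⟨_, rfl⟩
  rw [hx₁] at e1; rw [hy₁] at e2; rw [hx₂] at e3; rw [hy₂] at e4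
  have hd : 0 < -(x₂ * y₁) - ((x₁ - y₂) / 2) ^ 2 := by
    have i1 : ((x₁ - y₂) / 2) ^ 2 ≤ κ ^ 2 := by
      refine sq_le_sq.mpr ?_
      rw [abs_of_nonneg hκ, abs_le]
      constructor <;> linarith
    have i2 : κ * κ < (-x₂) * y₁ := mul_lt_mul'' (by linarith) (by linarith) hκ hκ
    linarith
  set a' := (x₁ + y₂) / 2 with ha'
  set b' := √(-(x₂ * y₁) - ((x₁ - y₂) / 2) ^ 2) with hb'
  have hb0 : 0 < b' := Real.sqrt_pos.mpr hd
  have hbsq : b' ^ 2 = -(x₂ * y₁) - ((x₁ - y₂) / 2) ^ 2 := Real.sq_sqrt hd.le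
  have hB : ∀ z : ℂ, B z = z.re • B 1 + z.im • B Complex.I := fun z => by
    rw [← map_smul, ← map_smul, ← map_add]
    congr 1
    simp
  have hBB : B (B 1) = (2 * a') • B 1 - (a' ^ 2 + b' ^ 2) • (1 : ℂ) := by
    have hdet : a' ^ 2 + b' ^ 2 = x₁ * y₂ - x₂ * y₁ := by rw [hbsq, ha']; ring
    have htr : 2 * a' = x₁ + y₂ := by rw [ha']; ring
    rw [hB (B 1), hx₁, hy₁, hdet, htr]
    apply Complex.ext
    · simp only [Complex.add_re, Complex.sub_re, Complex.smul_re, hx₁, hx₂, smul_eq_mul,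
        Complex.one_re]; ring
    · simp only [Complex.add_im, Complex.sub_im, Complex.smul_im, hy₁, hy₂, smul_eq_mul,
        Complex.one_im]; ring
  refine ⟨a', b', by rw [ha']; linarith, hb0.ne', b'⁻¹ • (a' • 1 - B 1), ?_, ?_⟩
  · rw [hAB, map_smul, map_sub, map_smul, smul_smul, mul_inv_cancel₀ hb0.ne']
    module
  · have hBw : B (b'⁻¹ • (a' • 1 - B 1)) = b'⁻¹ • (a' • B 1 - B (B 1)) := by
      rw [map_smul, map_sub, map_smul]
    rw [hAB, hBw, hBB, ← ι.map_smul, ← ι.map_smul, ← ι.map_add]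
    congr 1
    simp only [Complex.real_smul]
    push_cast
    have : (b' : ℂ) ≠ 0 := Complex.ofReal_ne_zero.mpr hb0.ne'
    field_simp
    ring

namespace PWField

theorem differentiableAt_slidingField {U : Set E3} {h : E3 → ℝ} {Z : PWField} (hU : IsOpen U)
    (hh : ContDiffOn ℝ 2 h U) (hX : ContDiffOn ℝ 1 Z.X U) (hY : ContDiffOn ℝ 1 Z.Y U) {x : E3}
    (hx : x ∈ U) (hgap : lieDeriv Z.Y h x - lieDeriv Z.X h x ≠ 0) :
    DifferentiableAt ℝ (slidingField h Z) x := by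
  have n := hU.mem_nhds hx
  have dX := (hX.contDiffAt n).differentiableAt one_ne_zero
  have dY := (hY.contDiffAt n).differentiableAt one_ne_zero
  have dA := ((contDiffOn_lieDeriv hU hh hX).contDiffAt n).differentiableAt one_ne_zero
  have dB := ((contDiffOn_lieDeriv hU hh hY).contDiffAt n).differentiableAt one_ne_zero
  exact ((dB.sub dA).inv hgap).smul ((dB.smul dX).sub (dA.smul dY))

namespace SaddleFocus

variable {U : Set E3} {h : E3 → ℝ} {Z Z' : PWField} {p q : E3} {σ ξ : ℝ → E3} {t₀ : ℝ}
  {π : E3 →L[ℝ] ℂ} {ι : ℂ →L[ℝ] E3} {ψ : ℂ → E3} {r Cψ r' a β κ ρ : ℝ} {y : ℝ → E3}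

theorem isFocusWith (F : SaddleFocus U h Z p q σ ξ t₀ π ι ψ r Cψ r' a β)
    (N : NearConnection U h Z p q σ ξ t₀ Z') (hzero : slidingField h Z' p = 0)
    (hκa : κ < a) (hκβ : 2 * κ < β) (hρ : 0 < ρ)
    (hfoc : ∀ x, h x = 0 → ‖x - p‖ < ρ →
      ‖π (slidingField h Z' x) - (a + β * Complex.I) * π (x - p)‖ ≤ κ * ‖π (x - p)‖) :
    ∃ a' b' : ℝ, 0 < a' ∧ IsFocusWith U h Z' p a' b' := by
  have C := F.conn
  have hpU : p ∈ U := C.p_mem.1.1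
  have hd := (differentiableAt_slidingField C.isOpen C.smooth N.smooth_X N.smooth_Y hpU
    (N.gap p C.p_mem_range C.p_mem.1.2).ne').hasFDerivAt
  set A := fderiv ℝ (slidingField h Z') p with hA
  have hdhA : ∀ e, fderiv ℝ h p (A e) = 0 := by
    intro e
    have h1 : DifferentiableAt ℝ (fderiv ℝ h) p :=
      ((C.smooth.fderiv_of_isOpen C.isOpen (by norm_num : (1 : WithTop ℕ∞) + 1 ≤ 2)).contDiffAt
        (C.isOpen.mem_nhds hpU)).differentiableAt one_ne_zero
    have h2 := h1.hasFDerivAt.clm_apply hd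
    have h3 : (fun x => fderiv ℝ h x (slidingField h Z' x)) = fun _ => (0 : ℝ) :=
      funext fun x => fderiv_slidingField x
    rw [h3] at h2
    have h4 := congrArg (fun L : E3 →L[ℝ] ℝ => L e) (h2.unique (hasFDerivAt_const (0 : ℝ) p))
    simpa [hzero] using h4
  have hAι : ∀ z, A (ι z) = ι (π (A (ι z))) := fun z => by
    have := F.coord.decomp (A (ι z))
    rwa [hdhA, zero_div, zero_smul, add_zero] at this
  have hest : ∀ z, ‖π (A (ι z)) - (a + β * Complex.I) * z‖ ≤ κ * ‖z‖ := by
    intro z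
    have hmem : ∀ᶠ τ : ℝ in 𝓝 0, ((τ : ℂ) * z) ∈ Metric.ball (0 : ℂ) r := by
      have hc : Continuous fun τ : ℝ => (τ : ℂ) * z := by fun_prop
      exact hc.continuousAt.eventually_mem (by
        rw [Complex.ofReal_zero, zero_mul]; exact Metric.ball_mem_nhds (0 : ℂ) F.chart.r_pos)
    have hw : HasDerivAt (fun τ : ℝ => (τ : ℂ) * z) (π (ι z)) 0 := by
      rw [F.coord.π_ι]
      simpa using (Complex.ofRealCLM.hasDerivAt (x := (0 : ℝ))).mul_const z
    have hψ : HasDerivAt (fun τ : ℝ => ψ ((τ : ℂ) * z)) (ι z) 0 :=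
      F.chart.hasDerivAt F.coord C.isOpen C.smooth (w := fun τ : ℝ => (τ : ℂ) * z) (t := 0)
        hmem.self_of_nhds (by simpa [F.chart.ψ_zero] using F.coord.dh_ι z) hw
    have hψ0 : ψ (((0 : ℝ) : ℂ) * z) = p := by simp [F.chart.ψ_zero]
    have hs : HasDerivAt (fun τ : ℝ => π (slidingField h Z' (ψ ((τ : ℂ) * z)))) (π (A (ι z))) 0 := by
      have hd' : HasFDerivAt (slidingField h Z') A (ψ (((0 : ℝ) : ℂ) * z)) := by rw [hψ0]; exact hd
      have h1 := hd'.comp_hasDerivAt 0 hψ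
      exact π.hasFDerivAt.comp_hasDerivAt 0 h1
    have hclose : ∀ᶠ τ : ℝ in 𝓝 0, ‖ψ ((τ : ℂ) * z) - p‖ < ρ := by
      have h1 := (hψ.continuousAt.tendsto.sub_const p).norm
      simp only [hψ0, sub_self, norm_zero] at h1
      exact h1.eventually (gt_mem_nhds hρ)
    have hg := hs.sub (hw.const_mul ((a : ℂ) + β * Complex.I))
    rw [F.coord.π_ι] at hg
    have hκ0 : 0 ≤ κ * ‖z‖ ∨ z = 0 := by
      by_cases hz : z = 0
      · exact Or.inr hz
      left
      have hev := (hmem.and hclose).filter_mono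
          (nhdsWithin_le_nhds (s := Ioi 0))
      obtain ⟨τ, ⟨h1, h2⟩, hτ⟩ := (hev.and self_mem_nhdsWithin).exists
      have h3 := (norm_nonneg _).trans (hfoc (ψ (τ * z)) (F.chart.h_ψ _ h1) h2)
      rw [F.chart.π_ψ _ h1, norm_mul] at h3
      have hτ0 : 0 < ‖(τ : ℂ)‖ := norm_pos_iff.mpr (Complex.ofReal_ne_zero.mpr (ne_of_gt hτ))
      have h4 : 0 ≤ ‖(τ : ℂ)‖ * (κ * ‖z‖) := by linarith
      exact nonneg_of_mul_nonneg_right h4 hτ0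
    rcases hκ0 with hκ0 | rfl
    · refine hg.le_of_lip' hκ0 ?_
      filter_upwards [hmem, hclose] with τ h1 h2
      have h3 := hfoc (ψ (τ * z)) (F.chart.h_ψ _ h1) h2
      rw [F.chart.π_ψ _ h1] at h3
      simp only [Pi.sub_apply, Complex.ofReal_zero, zero_mul, mul_zero, F.chart.ψ_zero, hzero,
        map_zero, sub_zero]
      refine h3.trans (le_of_eq ?_)
      rw [norm_mul, Complex.norm_real]; ring
    · simp
  obtain ⟨a', b', ha', hb', w, e1, e2⟩ := exists_eigenvalues_of_near (A := A.toLinearMap)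
    (B := (π.comp (A.comp ι)).toLinearMap) (ι := ι.toLinearMap) hAι hκa hκβ
    (by simpa using hest 1) (by simpa using hest Complex.I)
  refine ⟨a', b', ha', hzero, hb', A, hd.hasFDerivWithinAt, ι 1, ι w, F.coord.dh_ι 1,
    F.coord.dh_ι w, Or.inl fun e => ?_, e1, e2⟩
  have := F.coord.π_ι 1
  rw [e, map_zero] at this
  exact zero_ne_one this

/-- A backward sliding trajectory that comes close to the repelling focus converges to it. -/
theorem tendsto_atBot (F : SaddleFocus U h Z p q σ ξ t₀ π ι ψ r Cψ r' a β)
    (N : NearConnection U h Z p q σ ξ t₀ Z') (hκa : κ < a) (hρ : ρ < r')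
    (hfoc : ∀ x, h x = 0 → ‖x - p‖ < ρ →
      ‖π (slidingField h Z' x) - (a + β * Complex.I) * π (x - p)‖ ≤ κ * ‖π (x - p)‖)
    (hy : IsTrajectory U h Z' y) (hyΓ : ∀ t, y t ∈ range (loop p σ ξ t₀))
    (hy0 : ∀ t ≤ 0, h (y t) = 0) {T : ℝ} (hT : 0 < T) (hyT : ‖y (-T) - p‖ < ρ)
    (hyT' : Cψ * (‖π‖ * ‖y (-T) - p‖) < ρ) : Tendsto y atBot (𝓝 p) := by
  have C := F.conn
  have hder : ∀ t < 0, HasDerivAt y (slidingField h Z' (y t)) t := fun t ht =>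
    (hy.hasDerivAt_sliding C.isOpen C.smooth N.smooth_X.continuousOn N.smooth_Y.continuousOn
      (a := t - 1) (b := 0) (fun s hs => hy0 s hs.2)
      (fun s hs => (N.gap _ (hyΓ s) (hy0 s hs.2)).ne') t ⟨by linarith, ht.le⟩).hasDerivAt
      (Icc_mem_nhds (by linarith) ht)
  set Y : ℝ → E3 := fun u => y (-T - u) with hYdef
  have hYc : Continuous Y := hy.continuous.comp (by fun_prop)
  set n : ℝ → ℝ := fun u => ‖π (Y u - p)‖ ^ 2 with hn
  have hnd : ∀ u ≥ 0, HasDerivAt n (-(2 * inner ℝ (π (Y u - p)) (π (slidingField h Z' (Y u))))) u := by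
    intro u hu
    have h1 : HasDerivAt Y (-slidingField h Z' (Y u)) u := by
      have h2 := HasDerivAt.scomp u (hder (-T - u) (by linarith)) ((hasDerivAt_id u).const_sub (-T))
      rw [neg_one_smul] at h2
      exact h2
    have h3 := (π.hasFDerivAt.comp_hasDerivAt u (h1.sub_const p)).norm_sq
    rw [map_neg, inner_neg_right, mul_neg] at h3
    exact h3
  have hY0 : ∀ u ≥ 0, h (Y u) = 0 := fun u hu => hy0 _ (by linarith)
  have hchart : ∀ u ≥ 0, ‖Y u - p‖ ≤ ρ → ‖Y u - p‖ ≤ Cψ * ‖π (Y u - p)‖ := fun u hu hle => by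
    obtain ⟨h1, h2⟩ := F.chart.surj (Y u) (hle.trans_lt hρ) (hY0 u hu)
    have := F.chart.norm_sub_le h1
    rwa [h2] at this
  have hin : ∀ u ≥ 0, ‖Y u - p‖ < ρ → 0 ≤ (a - κ) * n u ∧
      (a - κ) * n u ≤ inner ℝ (π (Y u - p)) (π (slidingField h Z' (Y u))) := fun u hu hlt =>
    ⟨mul_nonneg (by linarith) (sq_nonneg _), inner_ge_of_focus (hfoc _ (hY0 u hu) hlt)⟩
  have hball : ∀ b ≥ 0, Y b ∈ Metric.ball p ρ := by
    intro b hb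
    refine forall_mem_Icc_of_first_exit (a := 0) (b := b) Metric.isOpen_ball hYc.continuousOn ?_ b
      ⟨hb, le_rfl⟩
    intro t ht hbef
    rcases ht.1.eq_or_lt with h0 | h0
    · rw [← h0]; simpa [hYdef, dist_eq_norm] using hyT
    have hanti : AntitoneOn n (Icc 0 t) := by
      refine antitoneOn_of_deriv_nonpos (convex_Icc 0 t)
        (fun u hu => (hnd u hu.1).continuousAt.continuousWithinAt)
        (fun u hu => by
          rw [interior_Icc] at hu
          exact (hnd u hu.1.le).differentiableAt.differentiableWithinAt) fun u hu => ?_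
      rw [interior_Icc] at hu
      rw [(hnd u hu.1.le).deriv]
      obtain ⟨i1, i2⟩ := hin u hu.1.le (by simpa [dist_eq_norm] using hbef u ⟨hu.1.le, hu.2⟩)
      linarith
    have hle : ‖π (Y t - p)‖ ≤ ‖π (Y 0 - p)‖ :=
      pow_le_pow_iff_left₀ (norm_nonneg _) (norm_nonneg _) two_ne_zero |>.mp
        (hanti ⟨le_rfl, h0.le⟩ ⟨h0.le, le_rfl⟩ h0.le)
    have hcl : ‖Y t - p‖ ≤ ρ := by
      refine le_of_tendsto (x := 𝓝[<] t)
        (((hYc.sub continuous_const).norm.tendsto t).mono_left nhdsWithin_le_nhds) ?_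
      filter_upwards [Ico_mem_nhdsLT h0] with u hu
      have := hbef u hu
      rw [mem_ball_iff_norm] at this
      exact this.le
    rw [mem_ball_iff_norm]
    calc ‖Y t - p‖ ≤ Cψ * ‖π (Y t - p)‖ := hchart t h0.le hcl
      _ ≤ Cψ * (‖π‖ * ‖y (-T) - p‖) := by
        refine mul_le_mul_of_nonneg_left (hle.trans ?_) F.chart.C_pos.le
        simpa [hYdef] using π.le_opNorm (y (-T) - p)
      _ < ρ := hyT'
  have hdec : AntitoneOn (fun u => n u * Real.exp (2 * (a - κ) * u)) (Ici 0) := by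
    have hd : ∀ u ≥ 0, HasDerivAt (fun u => n u * Real.exp (2 * (a - κ) * u))
        (-(2 * inner ℝ (π (Y u - p)) (π (slidingField h Z' (Y u)))) * Real.exp (2 * (a - κ) * u) +
          n u * (Real.exp (2 * (a - κ) * u) * (2 * (a - κ)))) u := fun u hu => by
      refine (hnd u hu).mul ?_
      simpa using ((hasDerivAt_id u).const_mul (2 * (a - κ))).exp
    refine antitoneOn_of_deriv_nonpos (convex_Ici 0)
        (fun u hu => (hd u hu).continuousAt.continuousWithinAt)
        (fun u hu => by
          rw [interior_Ici] at hu
          exact (hd u (le_of_lt hu)).differentiableAt.differentiableWithinAt) fun u hu => ?_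
    rw [interior_Ici] at hu
    rw [(hd u (le_of_lt hu)).deriv]
    obtain ⟨-, i2⟩ := hin u (le_of_lt hu) (mem_ball_iff_norm.mp (hball u (le_of_lt hu)))
    have i3 := mul_le_mul_of_nonneg_right i2 (Real.exp_pos (2 * (a - κ) * u)).le
    linarith
  have hn0 : Tendsto n atTop (𝓝 0) := by
    have h1 : Tendsto (fun u => n 0 * Real.exp (-(2 * (a - κ) * u))) atTop (𝓝 (n 0 * 0)) := by
      refine (Real.tendsto_exp_neg_atTop_nhds_zero.comp ?_).const_mul _
      exact tendsto_id.const_mul_atTop (by linarith)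
    rw [mul_zero] at h1
    refine tendsto_of_tendsto_of_tendsto_of_le_of_le' tendsto_const_nhds h1
      (Eventually.of_forall fun u => sq_nonneg _) ?_
    filter_upwards [eventually_ge_atTop 0] with u hu
    have h2 := hdec (mem_Ici.mpr le_rfl) hu hu
    simp only [mul_zero, Real.exp_zero, mul_one] at h2
    rw [Real.exp_neg, ← div_eq_mul_inv, le_div_iff₀ (Real.exp_pos _)]
    exact h2
  have hw0 : Tendsto (fun u => ‖π (Y u - p)‖) atTop (𝓝 0) := by
    have := hn0.sqrt
    simpa [hn, Real.sqrt_sq (norm_nonneg _)] using this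
  have hY : Tendsto Y atTop (𝓝 p) := by
    rw [tendsto_iff_norm_sub_tendsto_zero]
    refine tendsto_of_tendsto_of_tendsto_of_le_of_le' tendsto_const_nhds
      (by rw [← mul_zero Cψ]; exact hw0.const_mul Cψ) (Eventually.of_forall fun u => norm_nonneg _) ?_
    filter_upwards [eventually_ge_atTop 0] with u hu
    exact hchart u hu (mem_ball_iff_norm.mp (hball u hu)).le
  have h1 : Tendsto (fun t : ℝ => -T - t) atBot atTop :=
    tendsto_atTop_add_const_left _ (-T) tendsto_neg_atBot_atTop
  refine (hY.comp h1).congr fun t => ?_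
  simp [hYdef]

/-- A trajectory of the nearby field `Z'` inside the connection of `Z`, through a tangency point,
is itself a sliding Shilnikov connection of `Z'`. -/
theorem exists_isShilnikovSliding (F : SaddleFocus U h Z p q σ ξ t₀ π ι ψ r Cψ r' a β)
    (N : NearConnection U h Z p q σ ξ t₀ Z') (hκa : κ < a) (hκβ : 2 * κ < β) (hρ0 : 0 < ρ)
    (hρ : ρ < r')
    (hfoc : ∀ x, h x = 0 → ‖x - p‖ < ρ →
      ‖π (slidingField h Z' x - slidingField h Z' p) - (a + β * Complex.I) * π (x - p)‖
        ≤ κ * ‖π (x - p)‖)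
    (hland : ∀ y, IsTrajectory U h Z' y → (∀ t, y t ∈ range (loop p σ ξ t₀)) → y 0 = q →
      ∃ t > 0, h (y t) = 0)
    (hback : ∀ y, IsTrajectory U h Z' y → (∀ t, y t ∈ range (loop p σ ξ t₀)) → y 0 = q →
      (∀ t ≤ 0, h (y t) = 0) →
      ∃ T > 0, ‖y (-T) - p‖ < ρ ∧ Cψ * (‖π‖ * ‖y (-T) - p‖) < ρ)
    (hy : IsTrajectory U h Z' y) (hyΓ : ∀ t, y t ∈ range (loop p σ ξ t₀))
    (hy0 : h (y 0) = 0) (hyX : lieDeriv Z'.X h (y 0) = 0) :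
    ∃ Γ ⊆ range (loop p σ ξ t₀), IsShilnikovSliding U h Z' Γ := by
  have C := F.conn
  obtain ⟨eq0, δ, hδ, hpos⟩ := N.tangency C hy hyΓ hy0 hyX
  obtain ⟨t₂, ht₂, hzero₂⟩ := hland y hy hyΓ eq0
  simp only [zero_add] at hpos
  have hδt : δ < t₂ := by
    by_contra! hle
    exact absurd hzero₂ (hpos t₂ ⟨ht₂, hle⟩).ne'
  obtain ⟨s, hs, esp, hspos⟩ := N.landing C hy hyΓ hδt.le (hpos δ ⟨hδ, le_rfl⟩) hzero₂
  have hzero : slidingField h Z' p = 0 :=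
    F.slidingField_eq_zero N (hy.comp_add s) (fun t => hyΓ _) (by simpa using esp)
  have hneg : ∀ t ≤ 0, h (y t) = 0 := by
    intro t ht
    by_contra hne
    obtain ⟨s', hs', e', -⟩ := N.landing C hy hyΓ ht
      (lt_of_le_of_ne (C.h_nonneg (hyΓ t)) (Ne.symm hne)) hy0
    have := N.eq_p_of_zero C hy hyΓ hzero hs'.2 e'
    exact C.p_ne_q (this.symm.trans eq0)
  have hslide : ∀ t < 0, y t ∈ slidingRegion U h Z' := by
    intro t ht
    refine ⟨⟨hy.2.1 t, hneg t ht.le⟩, lt_of_le_of_ne ?_ fun e => ?_, N.Yh _ (hyΓ t) (hneg t ht.le)⟩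
    · exact hy.lieDeriv_X_nonpos C.isOpen C.smooth N.smooth_X.continuousOn N.smooth_Y.continuousOn
        (hneg t ht.le) (fun s => C.h_nonneg (hyΓ s)) (N.Yh _ (hyΓ t) (hneg t ht.le))
    · obtain ⟨-, δ', hδ', hp'⟩ := N.tangency C hy hyΓ (hneg t ht.le) e
      have h1 : t < min 0 (t + δ') := lt_min ht (by linarith)
      have := hp' _ ⟨h1, min_le_right _ _⟩
      rw [hneg _ (min_le_left _ _)] at this
      exact lt_irrefl _ this
  obtain ⟨T, hT, hyT, hyT'⟩ := hback y hy hyΓ eq0 hneg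
  simp only [hzero, sub_zero] at hfoc
  have hlim := F.tendsto_atBot N hκa hρ hfoc hy hyΓ hneg hT hyT hyT'
  have hqΓ : q ∈ range (loop p σ ξ t₀) := eq0 ▸ hyΓ 0
  have hspos' : ∀ t ∈ Ioo 0 s, 0 < h (y t) := fun t ht => by
    rcases le_or_gt t δ with h1 | h1
    · exact hpos t ⟨ht.1, h1⟩
    · exact hspos t ⟨h1.le, ht.2⟩
  refine ⟨y '' Iic 0 ∪ y '' Icc 0 s, ?_, p, q,
    ⟨C.p_mem.1, N.Xh_p, N.Yh p C.p_mem_range C.p_mem.1.2⟩, ?_, ⟨?_, ?_⟩, ⟨C.q_mem, ?_, ?_, ?_⟩, ?_,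
    y, y, s, ⟨eq0, hy.continuous.continuousOn, fun t ht => ⟨hslide t ht, ?_⟩, hlim⟩,
    ⟨hδ.trans hs.1, eq0, esp, fun t ht => hy.hasDerivWithinAt_of_pos N.smooth_X.continuousOn hspos' ht,
      fun t ht => ⟨hy.2.1 t, hspos' t ht⟩⟩, rfl⟩
  · rintro _ (⟨t, -, rfl⟩ | ⟨t, -, rfl⟩) <;> exact hyΓ t
  · obtain ⟨a', b', ha', hf⟩ := F.isFocusWith N hzero hκa hκβ hρ0 hfoc
    exact ⟨a', b', ha', hf⟩
  · refine mem_closure_of_tendsto (f := y) (b := 𝓝[<] (0 : ℝ)) (eq0 ▸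
      hy.continuous.continuousAt.mono_left nhdsWithin_le_nhds) ?_
    filter_upwards [self_mem_nhdsWithin] with t ht using hslide t ht
  · intro hq
    have := hq.2.1
    rw [← eq0, hyX] at this
    exact lt_irrefl _ this
  · rw [← eq0]; exact hyX
  · exact ((contDiffOn_lieDeriv C.isOpen C.smooth N.smooth_X).contDiffAt
      (C.isOpen.mem_nhds C.q_mem.1)).differentiableAt one_ne_zero
  · rw [← eq0]; exact N.fold _ (hyΓ 0) hy0 hyX
  · exact N.Yh q hqΓ C.q_mem.2
  · exact (hy.hasDerivAt_sliding C.isOpen C.smooth N.smooth_X.continuousOn N.smooth_Y.continuousOn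
      (a := t - 1) (b := 0) (fun s hs => hneg s hs.2)
      (fun s hs => (N.gap _ (hyΓ s) (hneg s hs.2)).ne') t ⟨by linarith, ht.le⟩).hasDerivAt
      (Icc_mem_nhds (by linarith) ht)

end SaddleFocus

end PWField

namespace PWField

/-- A family of fields of class `C¹` that converges in the `C¹` topology as the parameter tends
to `0`. -/
structure SmoothFamily (U : Set E3) (Z : ℝ → PWField) : Prop where
  smooth : ∀ᶠ α in 𝓝 0, ContDiffOn ℝ 1 (Z α).X U ∧ ContDiffOn ℝ 1 (Z α).Y U
  lim_X : TendstoUniformlyOn (fun α => (Z α).X) (Z 0).X (𝓝 0) U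
  lim_Y : TendstoUniformlyOn (fun α => (Z α).Y) (Z 0).Y (𝓝 0) U
  lim_dX : TendstoUniformlyOn (fun α => fderiv ℝ (Z α).X) (fderiv ℝ (Z 0).X) (𝓝 0) U
  lim_dY : TendstoUniformlyOn (fun α => fderiv ℝ (Z α).Y) (fderiv ℝ (Z 0).Y) (𝓝 0) U

theorem _root_.TendstoUniformlyOn.tendsto_nhds_prod {F : Type*} [NormedAddCommGroup F] {U : Set E3}
    {f : ℝ → E3 → F} (hf : TendstoUniformlyOn f (f 0) (𝓝 0) U) {x : E3} (hU : U ∈ 𝓝 x)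
    (hc : ContinuousAt (f 0) x) :
    Tendsto (fun z : ℝ × E3 => f z.1 z.2) (𝓝 (0, x)) (𝓝 (f 0 x)) := by
  refine tendsto_comp_of_locally_uniform_limit (F := fun z : ℝ × E3 => f z.1) hc
    (continuous_snd.tendsto (0, x)) fun u hu => ⟨U, hU, ?_⟩
  exact (continuous_fst.tendsto ((0 : ℝ), x)).eventually (hf u hu)

/-- The data on which the Lie derivatives and the sliding field depend. -/
noncomputable def jetArg (h : E3 → ℝ) (Z : PWField) (x : E3) : (E3 →L[ℝ] ℝ) × E3 × E3 :=
  (fderiv ℝ h x, Z.X x, Z.Y x)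

/-- The sliding field as a function of `jetArg`. -/
noncomputable def slidingOf (m : (E3 →L[ℝ] ℝ) × E3 × E3) : E3 :=
  (m.1 m.2.2 - m.1 m.2.1)⁻¹ • (m.1 m.2.2 • m.2.1 - m.1 m.2.1 • m.2.2)

theorem IsTrajectory.hasDerivWithinAt_backward {U : Set E3} {h : E3 → ℝ} {Z : PWField}
    {y : ℝ → E3} (hy : IsTrajectory U h Z y) (hU : IsOpen U) (hh : ContDiffOn ℝ 2 h U)
    (hX : ContinuousOn Z.X U) (hY : ContinuousOn Z.Y U) (h0 : ∀ t ≤ 0, h (y t) = 0)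
    (hgap : ∀ t ≤ 0, 0 < lieDeriv Z.Y h (y t) - lieDeriv Z.X h (y t)) {t : ℝ} (ht : 0 ≤ t) :
    HasDerivWithinAt (fun s => y (-s)) (-slidingField h Z (y (-t))) (Ici t) t := by
  have h1 := hy.hasDerivAt_sliding hU hh hX hY (a := -t - 1) (b := -t)
    (fun s hs => h0 s (by linarith [hs.2])) (fun s hs => (hgap s (by linarith [hs.2])).ne') (-t)
    ⟨by linarith, le_rfl⟩
  have h2 := HasDerivWithinAt.scomp t h1 (hasDerivAt_neg t).hasDerivWithinAt
    (fun s (hs : s ∈ Icc t (t + 1)) => ⟨by linarith [hs.2], by linarith [hs.1]⟩)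
  rw [neg_one_smul] at h2
  exact h2.mono_of_mem_nhdsWithin (Icc_mem_nhdsGE (by linarith))

namespace SmoothFamily

variable {U : Set E3} {h : E3 → ℝ} {Z : ℝ → PWField} {x : E3}

theorem tendsto_jetArg (D : SmoothFamily U Z) (hU : IsOpen U) (hh : ContDiffOn ℝ 2 h U)
    (hx : x ∈ U) :
    Tendsto (fun z : ℝ × E3 => jetArg h (Z z.1) z.2) (𝓝 (0, x)) (𝓝 (jetArg h (Z 0) x)) := by
  have n := hU.mem_nhds hx
  obtain ⟨hX, hY⟩ := D.smooth.self_of_nhds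
  exact (((continuousOn_fderiv hU hh).continuousAt n).tendsto.comp (continuous_snd.tendsto (0, x))
    ).prodMk_nhds ((D.lim_X.tendsto_nhds_prod n (hX.continuousOn.continuousAt n)).prodMk_nhds
      (D.lim_Y.tendsto_nhds_prod n (hY.continuousOn.continuousAt n)))

/-- Convergence of the derivative of any `C¹` expression in `dh`, `X` and `Y`. -/
theorem tendsto_fderiv {F : Type*} [NormedAddCommGroup F] [NormedSpace ℝ F]
    {S : (E3 →L[ℝ] ℝ) × E3 × E3 → F} (D : SmoothFamily U Z) (hU : IsOpen U)
    (hh : ContDiffOn ℝ 2 h U) (hx : x ∈ U) (hS : ContDiffAt ℝ 1 S (jetArg h (Z 0) x)) :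
    Tendsto (fun z : ℝ × E3 => fderiv ℝ (fun y => S (jetArg h (Z z.1) y)) z.2) (𝓝 (0, x))
      (𝓝 (fderiv ℝ (fun y => S (jetArg h (Z 0) y)) x)) := by
  have n := hU.mem_nhds hx
  obtain ⟨hX, hY⟩ := D.smooth.self_of_nhds
  have hdh : ContDiffOn ℝ 1 (fderiv ℝ h) U := hh.fderiv_of_isOpen hU (by norm_num)
  have hj := D.tendsto_jetArg hU hh hx
  have key : ∀ (α : ℝ) (z : E3), z ∈ U → ContDiffOn ℝ 1 (Z α).X U → ContDiffOn ℝ 1 (Z α).Y U →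
      ContDiffAt ℝ 1 S (jetArg h (Z α) z) →
      fderiv ℝ (fun y => S (jetArg h (Z α) y)) z = (fderiv ℝ S (jetArg h (Z α) z)).comp
        ((fderiv ℝ (fderiv ℝ h) z).prod ((fderiv ℝ (Z α).X z).prod (fderiv ℝ (Z α).Y z))) := by
    intro α z hz hX hY hS
    have n := hU.mem_nhds hz
    have d1 := ((hdh.contDiffAt n).differentiableAt one_ne_zero).hasFDerivAt.prodMk
      ((((hX.contDiffAt n).differentiableAt one_ne_zero).hasFDerivAt).prodMk
        ((hY.contDiffAt n).differentiableAt one_ne_zero).hasFDerivAt)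
    exact ((hS.differentiableAt one_ne_zero).hasFDerivAt.comp z d1).fderiv
  have cdf : ∀ {G : Type _} [NormedAddCommGroup G] [NormedSpace ℝ G] {f : E3 → G},
      ContDiffOn ℝ 1 f U → ContinuousAt (fderiv ℝ f) x := fun hf =>
    ((hf.contDiffAt n).fderiv_right (m := 0) (by norm_num)).continuousAt
  have c1 := (hS.fderiv_right (m := 0) (by norm_num)).continuousAt.tendsto.comp hj
  have c2 := (cdf hdh).tendsto.comp (continuous_snd.tendsto ((0 : ℝ), x))
  have c3 := D.lim_dX.tendsto_nhds_prod n (cdf hX)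
  have c4 := D.lim_dY.tendsto_nhds_prod n (cdf hY)
  have c5 := ((ContinuousLinearMap.prodₗᵢ (𝕜 := ℝ) (E := E3) (F := E3) (G := E3)
    ℝ).continuous.tendsto _).comp (c3.prodMk_nhds c4)
  have c6 := ((ContinuousLinearMap.prodₗᵢ (𝕜 := ℝ) (E := E3) (F := E3 →L[ℝ] ℝ) (G := E3 × E3)
    ℝ).continuous.tendsto _).comp (c2.prodMk_nhds c5)
  have c7 := (isBoundedBilinearMap_comp (𝕜 := ℝ) (E := E3) (F := (E3 →L[ℝ] ℝ) × E3 × E3)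
    (G := F)).continuous.tendsto _ |>.comp (c1.prodMk_nhds c6)
  rw [key 0 x hx hX hY hS]
  refine c7.congr' ?_
  filter_upwards [hj.eventually (hS.eventually (by simp)),
    (continuous_snd.tendsto ((0 : ℝ), x)).eventually n,
    (continuous_fst.tendsto ((0 : ℝ), x)).eventually D.smooth] with z h1 h2 h3
  exact (key z.1 z.2 h2 h3.1 h3.2 h1).symm

theorem contDiffAt_apply (m : (E3 →L[ℝ] ℝ) × E3 × E3) :
    ContDiffAt ℝ 1 (fun m : (E3 →L[ℝ] ℝ) × E3 × E3 => m.1 m.2.1) m ∧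
      ContDiffAt ℝ 1 (fun m : (E3 →L[ℝ] ℝ) × E3 × E3 => m.1 m.2.2) m :=
  ⟨(contDiff_fst.clm_apply contDiff_snd.fst).contDiffAt,
    (contDiff_fst.clm_apply contDiff_snd.snd).contDiffAt⟩

theorem tendsto_lieDeriv (D : SmoothFamily U Z) (hU : IsOpen U) (hh : ContDiffOn ℝ 2 h U)
    (hx : x ∈ U) :
    Tendsto (fun z : ℝ × E3 => lieDeriv (Z z.1).X h z.2) (𝓝 (0, x)) (𝓝 (lieDeriv (Z 0).X h x)) ∧
    Tendsto (fun z : ℝ × E3 => lieDeriv (Z z.1).Y h z.2) (𝓝 (0, x)) (𝓝 (lieDeriv (Z 0).Y h x)) :=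
  ⟨(contDiffAt_apply _).1.continuousAt.tendsto.comp (D.tendsto_jetArg hU hh hx),
    (contDiffAt_apply _).2.continuousAt.tendsto.comp (D.tendsto_jetArg hU hh hx)⟩

theorem tendsto_X (D : SmoothFamily U Z) (hU : IsOpen U) (hx : x ∈ U) :
    Tendsto (fun z : ℝ × E3 => (Z z.1).X z.2) (𝓝 (0, x)) (𝓝 ((Z 0).X x)) :=
  D.lim_X.tendsto_nhds_prod (hU.mem_nhds hx)
    (D.smooth.self_of_nhds.1.continuousOn.continuousAt (hU.mem_nhds hx))

theorem tendsto_lieDeriv_lieDeriv (D : SmoothFamily U Z) (hU : IsOpen U) (hh : ContDiffOn ℝ 2 h U)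
    (hx : x ∈ U) :
    Tendsto (fun z : ℝ × E3 => lieDeriv (Z z.1).X (lieDeriv (Z z.1).X h) z.2) (𝓝 (0, x))
      (𝓝 (lieDeriv (Z 0).X (lieDeriv (Z 0).X h) x)) := by
  have h1 := D.tendsto_fderiv hU hh hx (contDiffAt_apply _).1
  have h2 := D.tendsto_X hU hx
  exact (isBoundedBilinearMap_apply (𝕜 := ℝ) (E := E3) (F := ℝ)).continuous.tendsto _ |>.comp
    (h1.prodMk_nhds h2)

theorem contDiffAt_slidingOf {m : (E3 →L[ℝ] ℝ) × E3 × E3} (hm : m.1 m.2.2 - m.1 m.2.1 ≠ 0) :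
    ContDiffAt ℝ 1 slidingOf m := by
  obtain ⟨h1, h2⟩ := contDiffAt_apply m
  exact ((h2.sub h1).inv hm).smul ((h2.smul contDiff_snd.fst.contDiffAt).sub
    (h1.smul contDiff_snd.snd.contDiffAt))

theorem tendsto_slidingField (D : SmoothFamily U Z) (hU : IsOpen U) (hh : ContDiffOn ℝ 2 h U)
    (hx : x ∈ U) (hg : lieDeriv (Z 0).Y h x - lieDeriv (Z 0).X h x ≠ 0) :
    Tendsto (fun z : ℝ × E3 => slidingField h (Z z.1) z.2) (𝓝 (0, x))
      (𝓝 (slidingField h (Z 0) x)) ∧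
    Tendsto (fun z : ℝ × E3 => fderiv ℝ (slidingField h (Z z.1)) z.2) (𝓝 (0, x))
      (𝓝 (fderiv ℝ (slidingField h (Z 0)) x)) := by
  have e : ∀ Z, slidingField h Z = fun y => slidingOf (jetArg h Z y) := fun _ => rfl
  simp only [e]
  have hS : ContDiffAt ℝ 1 slidingOf (jetArg h (Z 0) x) := contDiffAt_slidingOf hg
  exact ⟨hS.continuousAt.tendsto.comp (D.tendsto_jetArg hU hh hx), D.tendsto_fderiv hU hh hx hS⟩

end SmoothFamily

namespace Connection

variable {U : Set E3} {h : E3 → ℝ} {Z : ℝ → PWField} {p q : E3} {σ ξ : ℝ → E3} {t₀ : ℝ}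

theorem isTrajectory_loop {Z : PWField} (C : Connection U h Z p q σ ξ t₀) :
    IsTrajectory U h Z (loop p σ ξ t₀) := by
  refine ⟨(C.follows_loop 0 0).1, C.loop_mem, ?_⟩
  filter_upwards [ae_all_iff.mpr fun n : ℕ => (C.follows_loop (-n) n).velocities] with t ht
  obtain ⟨n, hn⟩ := exists_nat_gt |t|
  exact ht n (abs_lt.mp hn)

theorem eventually_nearConnection (C : Connection U h (Z 0) p q σ ξ t₀) (D : SmoothFamily U Z) :
    ∀ᶠ α in 𝓝 0, NearConnection U h (Z 0) p q σ ξ t₀ (Z α) := by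
  have hQ := C.isCompact_range_inter
  have lim := fun x (hx : x ∈ U) => D.tendsto_lieDeriv C.isOpen C.smooth hx
  have hY := hQ.eventually_forall_of_forall_eventually (x₀ := (0 : ℝ))
    (P := fun α x => 0 < lieDeriv (Z α).Y h x) fun x hx =>
      (lim x (C.range_subset hx.1)).2.eventually (lt_mem_nhds (C.lieDeriv_of_mem_range hx.1 hx.2).2)
  have hg := hQ.eventually_forall_of_forall_eventually (x₀ := (0 : ℝ))
    (P := fun α x => 0 < lieDeriv (Z α).Y h x - lieDeriv (Z α).X h x) fun x hx =>
      ((lim x (C.range_subset hx.1)).2.sub (lim x (C.range_subset hx.1)).1).eventually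
        (lt_mem_nhds (by have := C.lieDeriv_of_mem_range hx.1 hx.2; linarith))
  have hf := hQ.eventually_forall_of_forall_eventually (x₀ := (0 : ℝ))
    (P := fun α x => lieDeriv (Z α).X h x = 0 → 0 < lieDeriv (Z α).X (lieDeriv (Z α).X h) x) <| by
      rintro x ⟨⟨t, rfl⟩, hx⟩
      by_cases h0 : lieDeriv (Z 0).X h (loop p σ ξ t₀ t) = 0
      · have ht : loop p σ ξ t₀ t = q := by
          rcases lt_trichotomy t 0 with h1 | h1 | h1
          · rw [loop_nonpos h1.le] at h0
            exact absurd h0 (C.σ_slide t h1).1.2.1.ne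
          · rw [loop_nonpos h1.le, h1, C.σ_zero]
          · rcases lt_or_ge t t₀ with h2 | h2
            · exact absurd hx (C.h_loop_pos ⟨h1, h2⟩).ne'
            · rw [C.loop_ge h2] at h0
              exact absurd h0 C.p_mem.2.1.ne
        have := (D.tendsto_lieDeriv_lieDeriv C.isOpen C.smooth C.q_mem.1).eventually
          (lt_mem_nhds C.XXh_q)
        rw [ht]
        exact this.mono fun z hz _ => hz
      · have := (lim _ (C.loop_mem t)).1.eventually (isOpen_ne.mem_nhds h0)
        exact this.mono fun z hz h1 => absurd h1 hz
  have slice : ∀ x : E3, Tendsto (fun α : ℝ => (α, x)) (𝓝 0) (𝓝 (0, x)) := fun x =>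
    (by fun_prop : Continuous fun α : ℝ => (α, x)).tendsto 0
  have hXp := ((lim p C.p_mem.1.1).1.comp (slice p)).eventually (gt_mem_nhds C.p_mem.2.1)
  have hXq : (Z 0).X q ≠ 0 := by
    rw [← C.loopVel_zero]; exact C.loopVel_ne_zero C.t₀_pos.le
  have hdir := (((D.tendsto_X C.isOpen C.q_mem.1).comp (slice q)).inner
    (tendsto_const_nhds (x := (Z 0).X q)) (𝕜 := ℝ)).eventually
    (lt_mem_nhds (real_inner_self_pos.mpr hXq))
  filter_upwards [D.smooth, hY, hg, hf, hXp, hdir] with α h1 h2 h3 h4 h5 h6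
  exact ⟨h1.1, h1.2, fun x hx h0 => h2 x ⟨hx, h0⟩, fun x hx h0 => h3 x ⟨hx, h0⟩, h5,
    fun x hx h0 => h4 x ⟨hx, h0⟩, h6⟩

theorem eventually_close
    (hX : TendstoUniformlyOn (fun α => (Z α).X) (Z 0).X (𝓝 0) U)
    (hY : TendstoUniformlyOn (fun α => (Z α).Y) (Z 0).Y (𝓝 0) U) {η : ℝ} (hη : 0 < η) :
    ∀ᶠ α in 𝓝 0, Close U η (Z α) (Z 0) := by
  filter_upwards [Metric.tendstoUniformlyOn_iff.mp hX η hη,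
    Metric.tendstoUniformlyOn_iff.mp hY η hη] with α h1 h2
  constructor <;> intro x hx
  · rw [← dist_eq_norm, dist_comm]; exact (h1 x hx).le
  · rw [← dist_eq_norm, dist_comm]; exact (h2 x hx).le

theorem eventually_landing (C : Connection U h (Z 0) p q σ ξ t₀) (D : SmoothFamily U Z) :
    ∀ᶠ α in 𝓝 0, ∀ y, IsTrajectory U h (Z α) y → (∀ t, y t ∈ range (loop p σ ξ t₀)) → y 0 = q →
      ∃ t > 0, h (y t) = 0 := by
  obtain ⟨R, hR, K, hKR, -, -, hKU, -, L, c, ρ, H⟩ := C.exists_controlled univ_mem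
  obtain ⟨ν, hν, hνt, ε, hε, hland⟩ := C.exists_landing H hR hKR.ge one_pos
  have hΓK : range (loop p σ ξ t₀) ⊆ K := by
    rw [hKR]; exact Metric.self_subset_cthickening _
  have ht := C.t₀_pos
  have hc := H.one_le_flowConst (by linarith : 0 ≤ t₀ + 1)
  set Fl := Controlled.flowConst L c ρ (t₀ + 1) with hFl
  have hFl0 : 0 < Fl := by linarith
  set η := min (min 1 ε) (ε / Fl) with hη
  have hη0 : 0 < η := by positivity
  filter_upwards [eventually_close D.lim_X D.lim_Y hη0] with α hα y hy hyΓ hyq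
  refine ⟨t₀ + 1, by linarith, ?_⟩
  have hf : Follows h (Z 0) η 0 (t₀ + 1) y :=
    (hy.follows 0 (t₀ + 1)).of_close hα fun t _ => C.range_subset (hyΓ t)
  refine hland η ((min_le_left _ _).trans (min_le_right _ _)) y
    (hf.mono le_rfl (by linarith) le_rfl) fun t htI => ?_
  have ht0 : 0 ≤ t := by linarith [htI.1]
  have h1 := H.norm_sub_le hη0.le ((min_le_left _ _).trans (min_le_left _ _)) ht0
    (hf.mono le_rfl le_rfl htI.2) ((C.follows_loop 0 t).mono hη0.le le_rfl le_rfl)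
    (fun s _ => hΓK (hyΓ s)) fun s _ => hΓK (mem_range_self s)
  rw [hyq, loop_nonpos le_rfl, C.σ_zero, sub_self, norm_zero, zero_add] at h1
  refine h1.trans ?_
  have h2 : Controlled.flowConst L c ρ (t - 0) ≤ Fl :=
    H.flowConst_mono (by linarith) (by linarith [htI.2])
  calc _ ≤ Fl * η := mul_le_mul_of_nonneg_right h2 hη0.le
    _ ≤ Fl * (ε / Fl) := mul_le_mul_of_nonneg_left (min_le_right _ _) hFl0.le
    _ = ε := mul_div_cancel₀ _ hFl0.ne'

/-- The backward sliding trajectory through the fold follows the one of `Z 0`. -/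
theorem eventually_near_focus (C : Connection U h (Z 0) p q σ ξ t₀) (D : SmoothFamily U Z) {ε : ℝ}
    (hε : 0 < ε) :
    ∀ᶠ α in 𝓝 0, ∀ y, IsTrajectory U h (Z α) y → (∀ t, y t ∈ range (loop p σ ξ t₀)) → y 0 = q →
      (∀ t ≤ 0, h (y t) = 0) → ∃ T > 0, ‖y (-T) - p‖ < ε := by
  obtain ⟨T₁, hT₁⟩ := eventually_atBot.mp
    (C.σ_lim.eventually (Metric.ball_mem_nhds p (half_pos hε)))
  set T := max 1 (-T₁) with hT
  have hT0 : 0 < T := lt_max_of_lt_left one_pos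
  obtain ⟨R, hR, K, hKR, -, -, hKU, -, L, c, ρ, H⟩ := C.exists_controlled univ_mem
  have hΓK : range (loop p σ ξ t₀) ⊆ K := by
    rw [hKR]; exact Metric.self_subset_cthickening _
  set Q := range (loop p σ ξ t₀) ∩ h ⁻¹' {0} with hQ
  have hLip : LipschitzOnWith (6 * L ^ 3 / c + L).toNNReal (fun x => -slidingField h (Z 0) x) Q := by
    refine LipschitzOnWith.neg (LipschitzOnWith.of_dist_le_mul fun x hx y hy => ?_)
    have h0 : ∀ {z}, z ∈ Q → |h z| ≤ ρ := fun hz => by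
      rw [(hz.2 : h _ = 0), abs_zero]; exact H.rho_pos.le
    have hL := C.lieDeriv_of_mem_range hy.1 hy.2
    have := H.slidingField_sub_le (hΓK hx.1) (hΓK hy.1) (h0 hx) (h0 hy) hL.1 hL.2.le
    rw [dist_eq_norm, dist_eq_norm]
    exact this.trans (mul_le_mul_of_nonneg_right (Real.le_coe_toNNReal _) (norm_nonneg _))
  set k : NNReal := (6 * L ^ 3 / c + L).toNNReal with hk
  have hbound : ∀ᶠ e in 𝓝 (0 : ℝ), gronwallBound 0 k e T < ε / 2 := by
    have : Continuous fun e => gronwallBound 0 k e T := by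
      unfold gronwallBound; split_ifs <;> fun_prop
    refine this.continuousAt.eventually (gt_mem_nhds ?_)
    show gronwallBound 0 k 0 T < ε / 2
    rw [gronwallBound_ε0]; simpa using hε
  obtain ⟨e, he, he0⟩ := ((hbound.filter_mono (nhdsWithin_le_nhds (s := Ioi 0))).and
    self_mem_nhdsWithin).exists
  have hcl := C.isCompact_range_inter.eventually_forall_of_forall_eventually (x₀ := (0 : ℝ))
    (P := fun α x => ‖slidingField h (Z α) x - slidingField h (Z 0) x‖ < e) <| by
      intro x hx
      have hg : lieDeriv (Z 0).Y h x - lieDeriv (Z 0).X h x ≠ 0 := by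
        have := C.lieDeriv_of_mem_range hx.1 hx.2
        exact ne_of_gt (by linarith)
      have hxU := C.range_subset hx.1
      have h1 := (D.tendsto_slidingField C.isOpen C.smooth hxU hg).1
      have h2 := h1.comp ((by fun_prop : Continuous fun z : ℝ × E3 => ((0 : ℝ), z.2)).tendsto (0, x))
      have h3 := (h1.sub h2).norm
      rw [sub_self, norm_zero] at h3
      exact h3.eventually (gt_mem_nhds he0)
  filter_upwards [hcl, C.eventually_nearConnection D] with α hα N y hy hyΓ hyq hy0
  refine ⟨T, hT0, ?_⟩
  have hnl : ∀ {t : ℝ}, 0 ≤ t → -t ≤ 0 := fun ht => by linarith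
  have h0' := fun t (ht : t ≤ 0) => C.h_loop_nonpos ht
  have hgr := dist_le_of_approx_trajectories_ODE_of_mem (v := fun _ x => -slidingField h (Z 0) x)
    (s := fun _ => Q) (K := k) (a := 0) (b := T) (f := fun t => y (-t))
    (f' := fun t => -slidingField h (Z α) (y (-t))) (g := fun t => loop p σ ξ t₀ (-t))
    (g' := fun t => -slidingField h (Z 0) (loop p σ ξ t₀ (-t))) (εf := e) (εg := 0) (δ := 0)
    (fun _ _ => hLip) (hy.continuous.comp continuous_neg).continuousOn
    (fun t ht => hy.hasDerivWithinAt_backward C.isOpen C.smooth N.smooth_X.continuousOn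
      N.smooth_Y.continuousOn hy0 (fun s hs => N.gap _ (hyΓ s) (hy0 s hs)) ht.1)
    (fun t ht => by
      rw [dist_neg_neg, dist_eq_norm]; exact (hα _ ⟨hyΓ _, hy0 _ (hnl ht.1)⟩).le)
    (fun t ht => ⟨hyΓ _, hy0 _ (hnl ht.1)⟩) (C.continuous_loop.comp continuous_neg).continuousOn
    (fun t ht => C.isTrajectory_loop.hasDerivWithinAt_backward C.isOpen C.smooth
      C.lip_X.continuousOn C.lip_Y.continuousOn h0'
      (fun s hs => by have := C.lieDeriv_loop hs; linarith) ht.1)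
    (fun t ht => by rw [dist_self])
    (fun t ht => ⟨mem_range_self _, h0' _ (hnl ht.1)⟩)
    (by simp [hyq, loop_nonpos, C.σ_zero]) T ⟨hT0.le, le_rfl⟩
  rw [add_zero, sub_zero] at hgr
  have h1 : -T ≤ T₁ := by have := le_max_right 1 (-T₁); linarith
  have h2 := hT₁ _ h1
  rw [loop_nonpos (by linarith)] at hgr
  rw [← dist_eq_norm]
  have := dist_triangle (y (-T)) (σ (-T)) p
  linarith

/-- Near the focus, the linear part of the sliding field varies little with the parameter. -/
theorem eventually_focus (C : Connection U h (Z 0) p q σ ξ t₀) (D : SmoothFamily U Z) {κ : ℝ}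
    (hκ : 0 < κ) : ∃ ρ > 0, ∀ᶠ α in 𝓝 0, ∀ x, ‖x - p‖ < ρ →
      ‖(slidingField h (Z α) x - slidingField h (Z α) p) - slidingField h (Z 0) x‖
        ≤ κ * ‖x - p‖ := by
  have hpU := C.p_mem.1.1
  have hg : 0 < lieDeriv (Z 0).Y h p - lieDeriv (Z 0).X h p := by
    have := C.p_mem.2; linarith
  have hl := D.tendsto_lieDeriv C.isOpen C.smooth hpU
  have hev := ((D.tendsto_slidingField C.isOpen C.smooth hpU hg.ne').2.eventually
    (Metric.ball_mem_nhds _ (half_pos hκ))).and (((hl.2.sub hl.1).eventually (lt_mem_nhds hg)).and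
    ((continuous_snd.tendsto ((0 : ℝ), p)).eventually (C.isOpen.mem_nhds hpU)))
  rw [nhds_prod_eq, eventually_prod_iff] at hev
  obtain ⟨P, hP, P', hP', hev⟩ := hev
  obtain ⟨ρ, hρ, hball⟩ := Metric.mem_nhds_iff.mp hP'
  have key : ∀ α, P α → ContDiffOn ℝ 1 (Z α).X U ∧ ContDiffOn ℝ 1 (Z α).Y U → ∀ x, ‖x - p‖ < ρ →
      ‖slidingField h (Z α) x - slidingField h (Z α) p -
        fderiv ℝ (slidingField h (Z 0)) p (x - p)‖ ≤ κ / 2 * ‖x - p‖ := fun α hα hs x hx =>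
    (convex_ball p ρ).norm_image_sub_le_of_norm_fderiv_le'
      (fun z hz => by
        obtain ⟨-, h2, h3⟩ := hev hα (hball hz)
        exact differentiableAt_slidingField C.isOpen C.smooth hs.1 hs.2 h3 h2.ne')
      (fun z hz => by
        rw [← dist_eq_norm]; exact (hev hα (hball hz)).1.le) (Metric.mem_ball_self hρ) (mem_ball_iff_norm.mpr hx)
  refine ⟨ρ, hρ, ?_⟩
  filter_upwards [hP, D.smooth] with α h1 h2 x hx
  have e1 := key α h1 h2 x hx
  have e2 := key 0 hP.self_of_nhds D.smooth.self_of_nhds x hx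
  rw [C.p_zero, sub_zero] at e2
  calc _ = ‖(slidingField h (Z α) x - slidingField h (Z α) p -
        fderiv ℝ (slidingField h (Z 0)) p (x - p)) - (slidingField h (Z 0) x -
        fderiv ℝ (slidingField h (Z 0)) p (x - p))‖ := by congr 1; abel
    _ ≤ κ / 2 * ‖x - p‖ + κ / 2 * ‖x - p‖ := (norm_sub_le _ _).trans (add_le_add e1 e2)
    _ = _ := by ring

end Connection

/-- If the sliding periodic orbits of a nearby field accumulate at the connection, then the
connection persists. -/
theorem SaddleFocus.eventually_isShilnikovSliding {U : Set E3} {h : E3 → ℝ} {Z : ℝ → PWField}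
    {p q : E3} {σ ξ : ℝ → E3} {t₀ : ℝ} {π : E3 →L[ℝ] ℂ} {ι : ℂ →L[ℝ] E3} {ψ : ℂ → E3}
    {r Cψ r' a β : ℝ} (F : SaddleFocus U h (Z 0) p q σ ξ t₀ π ι ψ r Cψ r' a β)
    (D : SmoothFamily U Z) :
    ∀ᶠ α in 𝓝 0, (∀ W ∈ 𝓝ˢ (range (loop p σ ξ t₀)),
      ∃ P, IsSlidingPeriodicOrbit U h (Z α) P ∧ P ⊆ W) →
      ∃ Γ ⊆ range (loop p σ ξ t₀), IsShilnikovSliding U h (Z α) Γ := by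
  have C := F.conn
  have hCψ := F.chart.C_pos
  set κ := min (a / 2) (β / 4) with hκ
  have hκ0 : 0 < κ := lt_min (half_pos F.a_pos) (by linarith [F.β_pos])
  have hκa : κ < a := (min_le_left _ _).trans_lt (half_lt_self F.a_pos)
  have hκβ : 2 * κ < β := by have := min_le_right (a / 2) (β / 4); linarith [F.β_pos]
  obtain ⟨r₁, hr₁, hr₁r, has⟩ := F.asymp (κ / 2) (half_pos hκ0)
  set M := ‖π‖ * Cψ + ‖π‖ + 1 with hM
  have hM0 : 0 < M := by positivity
  obtain ⟨ρ₁, hρ₁, hfoc⟩ := C.eventually_focus D (κ := κ / (2 * M)) (by positivity)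
  set ρ := min ρ₁ (min (r' / 2) (r₁ / M)) with hρ
  have hr' := F.chart.r'_pos
  have hρ0 : 0 < ρ := by positivity
  have hρr' : ρ < r' := by
    have := (min_le_right ρ₁ (min (r' / 2) (r₁ / M))).trans (min_le_left _ _)
    linarith
  have hMρ : ρ * M ≤ r₁ := by
    rw [← le_div_iff₀ hM0]
    exact (min_le_right ρ₁ (min (r' / 2) (r₁ / M))).trans (min_le_right _ _)
  have hπ := norm_nonneg π
  have hπC : 0 ≤ ‖π‖ * Cψ := by positivity
  filter_upwards [hfoc, C.eventually_nearConnection D, C.eventually_landing D,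
    C.eventually_near_focus D (div_pos hρ0 hM0)] with α h1 N h3 h4 hper
  obtain ⟨y, hy, hyΓ, hy0, hyX⟩ := exists_tangent_trajectory C.isOpen C.smooth
    N.smooth_X.continuousOn N.smooth_Y.continuousOn C.isCompact_range_loop C.range_subset
    (fun x hx => C.h_nonneg hx) N.Yh hper
  refine F.exists_isShilnikovSliding N hκa hκβ hρ0 hρr' (fun x hx0 hx => ?_) h3
    (fun y hy hyΓ hyq hy0 => ?_) hy hyΓ hy0 hyX
  · obtain ⟨hw, e⟩ := F.chart.surj x (hx.trans hρr') hx0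
    set w := π (x - p) with hwdef
    have i1 : ‖w‖ < r₁ := by
      refine (π.le_opNorm _).trans_lt ?_
      have : ‖π‖ * ‖x - p‖ ≤ ‖π‖ * ρ := mul_le_mul_of_nonneg_left hx.le hπ
      have : 0 ≤ (‖π‖ * Cψ) * ρ := by positivity
      have : ρ * M = (‖π‖ * Cψ) * ρ + ‖π‖ * ρ + ρ := by rw [hM]; ring
      linarith
    have i2 := has w i1
    rw [e] at i2
    have i3 := h1 x (hx.trans_le (min_le_left _ _))
    have i4 := F.chart.norm_sub_le hw
    rw [e] at i4
    have i5 : ‖π (slidingField h (Z α) x - slidingField h (Z α) p - slidingField h (Z 0) x)‖ ≤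
        κ / 2 * ‖w‖ := by
      calc _ ≤ ‖π‖ * (κ / (2 * M) * (Cψ * ‖w‖)) := (π.le_opNorm _).trans
            (mul_le_mul_of_nonneg_left (i3.trans (mul_le_mul_of_nonneg_left i4 (by positivity))) hπ)
        _ = (‖π‖ * Cψ) / M * (κ / 2 * ‖w‖) := by field_simp
        _ ≤ 1 * (κ / 2 * ‖w‖) := mul_le_mul_of_nonneg_right
            ((div_le_one hM0).mpr (by rw [hM]; linarith)) (by positivity)
        _ = _ := one_mul _
    have e2 : π (slidingField h (Z α) x - slidingField h (Z α) p) - (a + β * Complex.I) * w =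
        π (slidingField h (Z α) x - slidingField h (Z α) p - slidingField h (Z 0) x) +
          (π (slidingField h (Z 0) x) - (a + β * Complex.I) * w) := by
      rw [map_sub π (slidingField h (Z α) x - slidingField h (Z α) p)]; ring
    rw [e2]
    refine (norm_add_le _ _).trans ((add_le_add i5 i2).trans (le_of_eq ?_))
    ring
  · obtain ⟨T, hT, hlt⟩ := h4 y hy hyΓ hyq hy0
    refine ⟨T, hT, ?_⟩
    rw [lt_div_iff₀ hM0] at hlt
    have n0 := norm_nonneg (y (-T) - p)
    have e1 : ‖y (-T) - p‖ * M = Cψ * (‖π‖ * ‖y (-T) - p‖) + ‖π‖ * ‖y (-T) - p‖ + ‖y (-T) - p‖ := by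
      rw [hM]; ring
    have i1 : 0 ≤ Cψ * (‖π‖ * ‖y (-T) - p‖) := by positivity
    have i2 : 0 ≤ ‖π‖ * ‖y (-T) - p‖ := by positivity
    constructor <;> linarith

end PWField

namespace PWField

theorem IsShilnikovSliding.exists_saddleFocus {U : Set E3} {h : E3 → ℝ} {Z : PWField} {Γ : Set E3}
    (hΓ : IsShilnikovSliding U h Z Γ) (hU : IsOpen U) (hh : ContDiffOn ℝ 2 h U)
    (hX : LocallyLipschitzOn U Z.X) (hY : LocallyLipschitzOn U Z.Y) :
    ∃ p q σ ξ t₀ π ι ψ r Cψ r' a β, SaddleFocus U h Z p q σ ξ t₀ π ι ψ r Cψ r' a β ∧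
      Γ = range (loop p σ ξ t₀) := by
  obtain ⟨p, q, hp, ⟨a, b, ha, hz, hb, A, hA, u, v, hu, hv, huv, hAu, hAv⟩, -, ⟨hq, hXq, -, hXXq⟩,
    hYq, σ, ξ, t₀, ⟨hσ0, hσc, hσ, hσl⟩, ⟨ht₀, hξ0, hξp, hξ, hξpos⟩, rfl⟩ := hΓ
  have C : Connection U h Z p q σ ξ t₀ := ⟨hU, hh, hX, hY, hp, hz, hq, hXq, hXXq, hYq, hσ0, hσc, hσ,
    hσl, ht₀, hξ0, hξp, hξ, hξpos⟩
  obtain ⟨π, ι, β, hβ, T, hT⟩ := exists_tangentCoord hp.2.1.ne hb hu hv huv hAu hAv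
  obtain ⟨ψ, r, Cψ, r', S⟩ := exists_surfaceChart hU hh hp.1.1 hp.1.2 T
  exact ⟨p, q, σ, ξ, t₀, π, ι, ψ, r, Cψ, r', a, β, ⟨C, T, S, ha, hβ, fun κ hκ =>
    S.focus_asymptotics T hU hh hp.1.1 hp.1.2 hA hz hT hκ⟩, C.range_loop.symm⟩

theorem SaddleFocus.exists_sliding_orbits {U : Set E3} {h : E3 → ℝ} {Z : PWField} {p q : E3}
    {σ ξ : ℝ → E3} {t₀ : ℝ} {π : E3 →L[ℝ] ℂ} {ι : ℂ →L[ℝ] E3} {ψ : ℂ → E3} {r Cψ r' a β : ℝ}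
    (F : SaddleFocus U h Z p q σ ξ t₀ π ι ψ r Cψ r' a β) {G : Set E3}
    (hG : G ∈ 𝓝ˢ (range (loop p σ ξ t₀))) (k : ℕ) :
    ∃ d > 0, ∃ η > 0, ∀ Z' : PWField, LocallyLipschitzOn U Z'.X → LocallyLipschitzOn U Z'.Y →
      Close U η Z' Z → ∃ S : Finset (Set E3), S.card = k ∧
        (S : Set (Set E3)) ⊆ slidingPeriodicOrbitsIn U h Z' G ∧ ∀ P ∈ S, ∀ x ∈ P, d ≤ ‖x - p‖ := by
  classical
  induction k with
  | zero => exact ⟨1, one_pos, 1, one_pos, fun Z' _ _ _ => ⟨∅, rfl, by simp, by simp⟩⟩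
  | succ k ih =>
    obtain ⟨d, hd, η, hη, ih⟩ := ih
    obtain ⟨d', hd', η', hη', hP⟩ := F.exists_sliding_orbit hG hd
    refine ⟨min d d', lt_min hd hd', min η η', lt_min hη hη', fun Z' hX hY hZ => ?_⟩
    obtain ⟨S, hS, hSG, hSd⟩ := ih Z' hX hY (hZ.mono Subset.rfl (min_le_left _ _))
    obtain ⟨P, hPo, hPG, ⟨x, hx, hxd⟩, hPd⟩ := hP Z' hX hY (hZ.mono Subset.rfl (min_le_right _ _))
    refine ⟨insert P S, ?_, ?_, fun Q hQ => ?_⟩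
    · rw [Finset.card_insert_of_notMem fun hPS => absurd (hSd P hPS x hx) (not_le.mpr hxd), hS]
    · rw [Finset.coe_insert]
      exact insert_subset ⟨hPo, hPG⟩ hSG
    · rcases Finset.mem_insert.mp hQ with rfl | hQ
      · exact fun x hx => (min_le_right _ _).trans (hPd x hx)
      · exact fun x hx => (min_le_left _ _).trans (hSd Q hQ x hx)

/-- Near `Γ` there are, for small parameters, arbitrarily many sliding periodic orbits. -/
def HasManyOrbits (U : Set E3) (h : E3 → ℝ) (Z : ℝ → PWField) (Γ : Set E3) : Prop :=
  ∀ G ∈ 𝓝ˢ Γ, ∀ k : ℕ, ∀ᶠ α in 𝓝 (0 : ℝ), ∃ S : Finset (Set E3), S.card = k ∧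
    (S : Set (Set E3)) ⊆ slidingPeriodicOrbitsIn U h (Z α) G

/-- For small nonzero parameters, any finite family of sliding periodic orbits near `Γ` is exactly
the family of those inside some neighbourhood of `Γ`. -/
def IsolatesOrbits (U : Set E3) (h : E3 → ℝ) (Z : ℝ → PWField) (Γ : Set E3) : Prop :=
  ∃ O ∈ 𝓝ˢ Γ, ∀ᶠ α in 𝓝[≠] (0 : ℝ), ∀ G ∈ 𝓝ˢ Γ, ∀ S : Finset (Set E3),
    (S : Set (Set E3)) ⊆ slidingPeriodicOrbitsIn U h (Z α) (G ∩ O) →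
      ∃ G' ∈ 𝓝ˢ Γ, G' ⊆ G ∧ slidingPeriodicOrbitsIn U h (Z α) G' = S

theorem hasManyOrbits_of_sliding {U : Set E3} {h : E3 → ℝ} {Z : ℝ → PWField} {Γ : Set E3}
    (hU : IsOpen U) (hh : ContDiffOn ℝ 2 h U)
    (hlip : ∀ᶠ α in 𝓝 0, LocallyLipschitzOn U (Z α).X ∧ LocallyLipschitzOn U (Z α).Y)
    (hX : TendstoUniformlyOn (fun α => (Z α).X) (Z 0).X (𝓝 0) U)
    (hY : TendstoUniformlyOn (fun α => (Z α).Y) (Z 0).Y (𝓝 0) U)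
    (hΓ : IsShilnikovSliding U h (Z 0) Γ) : HasManyOrbits U h Z Γ := by
  intro G hG k
  obtain ⟨p, q, σ, ξ, t₀, π, ι, ψ, r, Cψ, r', a, β, F, rfl⟩ :=
    hΓ.exists_saddleFocus hU hh hlip.self_of_nhds.1 hlip.self_of_nhds.2
  obtain ⟨d, -, η, hη, hS⟩ := F.exists_sliding_orbits hG k
  filter_upwards [hlip, Connection.eventually_close hX hY hη] with α h1 h2
  obtain ⟨S, h3, h4, -⟩ := hS (Z α) h1.1 h1.2 h2
  exact ⟨S, h3, h4⟩

theorem isolatesOrbits_of_sliding {U : Set E3} {h : E3 → ℝ} {Z : ℝ → PWField} {Γ : Set E3}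
    (hU : IsOpen U) (hh : ContDiffOn ℝ 2 h U) (D : SmoothFamily U Z)
    (hΓ : IsShilnikovSliding U h (Z 0) Γ)
    (hV : ∃ V ∈ 𝓝ˢ Γ, ∀ᶠ α in 𝓝[≠] 0, ∀ Γ' ⊆ V, ¬ IsShilnikovSliding U h (Z α) Γ') :
    IsolatesOrbits U h Z Γ := by
  have hlip : ∀ᶠ α in 𝓝 0, LocallyLipschitzOn U (Z α).X ∧ LocallyLipschitzOn U (Z α).Y :=
    D.smooth.mono fun α hα => ⟨locallyLipschitzOn_of_contDiffOn hU hα.1,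
      locallyLipschitzOn_of_contDiffOn hU hα.2⟩
  obtain ⟨p, q, σ, ξ, t₀, π, ι, ψ, r, Cψ, r', a, β, F, rfl⟩ :=
    hΓ.exists_saddleFocus hU hh hlip.self_of_nhds.1 hlip.self_of_nhds.2
  obtain ⟨V, hV, hVα⟩ := hV
  obtain ⟨R, hR, K, hKR, hK, -, hKU, -, L, c, ρ, H⟩ := F.conn.exists_controlled univ_mem
  have hKn : K ∈ 𝓝ˢ (range (loop p σ ξ t₀)) := by
    rw [hKR]; exact Metric.cthickening_mem_nhdsSet _ hR
  have hL : 0 < L := zero_lt_one.trans_le H.one_le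
  have hc := H.c_pos
  refine ⟨K, hKn, ?_⟩
  filter_upwards [hVα, (F.eventually_isShilnikovSliding D).filter_mono nhdsWithin_le_nhds,
    hlip.filter_mono nhdsWithin_le_nhds,
    (Connection.eventually_close D.lim_X D.lim_Y (η := c / (4 * L)) (by positivity)).filter_mono
      nhdsWithin_le_nhds] with α h1 h2 h3 h4 G hG S hS
  obtain ⟨L', c', ρ', H'⟩ := H.of_close hU hh h3.1 h3.2 hK hKU (h4.mono hKU le_rfl)
    (by field_simp; linarith)
  have hW : ∃ W ∈ 𝓝ˢ (range (loop p σ ξ t₀)), ∀ P, IsSlidingPeriodicOrbit U h (Z α) P → ¬ P ⊆ W := by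
    by_contra! hcon
    obtain ⟨Γ', hΓ', hsh⟩ := h2 hcon
    exact h1 Γ' (hΓ'.trans (subset_of_mem_nhdsSet hV)) hsh
  obtain ⟨W, hW, hWP⟩ := hW
  have hGS : (W ∩ (G ∩ K)) ∪ ⋃₀ (S : Set (Set E3)) ⊆ G ∩ K :=
    union_subset inter_subset_right (sUnion_subset fun P hP => (hS hP).2)
  refine ⟨(W ∩ (G ∩ K)) ∪ ⋃₀ (S : Set (Set E3)), mem_of_superset (inter_mem hW (inter_mem hG hKn))
    subset_union_left, hGS.trans inter_subset_left, Subset.antisymm (fun P hP => ?_) fun P hP =>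
      ⟨(hS hP).1, (subset_sUnion_of_mem hP).trans subset_union_right⟩⟩
  obtain ⟨x, hxP, hxW⟩ := not_subset.mp (hWP P hP.1)
  rcases hP.2 hxP with hx | ⟨Q, hQS, hxQ⟩
  · exact absurd hx.1 hxW
  · rwa [hP.1.eq_of_inter_nonempty H' (hS hQS).1 ((hP.2.trans hGS).trans inter_subset_right)
      ((hS hQS).2.trans inter_subset_right) ⟨x, hxP, hxQ⟩]

theorem exists_counting_of_eventually {Q : ℕ → ℝ → Prop} (hQ : ∀ k, ∀ᶠ α in 𝓝[≠] (0 : ℝ), Q k α) :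
    ∃ α₀ > 0, ∃ N : ℝ → ℕ, (∀ α, 0 < |α| → |α| < α₀ → 0 < N α ∧ Q (N α) α) ∧
      Tendsto N (𝓝[≠] 0) atTop := by
  classical
  have hinv : Tendsto (fun α : ℝ => ⌈|α|⁻¹⌉₊) (𝓝[≠] 0) atTop :=
    tendsto_nat_ceil_atTop.comp (tendsto_inv_nhdsGT_zero.comp (tendsto_abs_nhdsNE_zero))
  obtain ⟨α₀, hα₀, hb⟩ := Metric.eventually_nhds_iff.mp
    (eventually_nhdsWithin_iff.mp ((hQ 1).and (hinv.eventually_ge_atTop 1)))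
  refine ⟨α₀, hα₀, fun α => Nat.findGreatest (fun k => Q k α) ⌈|α|⁻¹⌉₊, fun α h0 h1 => ?_, ?_⟩
  · obtain ⟨h2, h3⟩ := hb (y := α) (by simpa using h1) (abs_pos.mp h0)
    exact ⟨Nat.le_findGreatest h3 h2, Nat.findGreatest_spec (P := fun k => Q k α) h3 h2⟩
  · refine tendsto_atTop.mpr fun k => ?_
    filter_upwards [hQ k, hinv.eventually_ge_atTop k] with α h1 h2 using Nat.le_findGreatest h2 h1

theorem exists_orbit_counts {U : Set E3} {h : E3 → ℝ} {Z : ℝ → PWField} {Γ G : Set E3} {r : ℕ}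
    (hA : HasManyOrbits U h Z Γ) (hE : 1 ≤ r → IsolatesOrbits U h Z Γ) (hG : G ∈ 𝓝ˢ Γ) :
    ∃ α₀ > 0, ∃ (N : ℝ → ℕ) (S : ℝ → Finset (Set E3)),
      (∀ α : ℝ, 0 < |α| → |α| < α₀ →
        0 < N α ∧ (S α).card = N α ∧
        (S α : Set (Set E3)) ⊆ slidingPeriodicOrbitsIn U h (Z α) G ∧
        (1 ≤ r → ∃ G' ∈ 𝓝ˢ Γ, G' ⊆ G ∧
          slidingPeriodicOrbitsIn U h (Z α) G' = (S α : Set (Set E3)))) ∧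
      Tendsto N (𝓝[≠] 0) atTop := by
  have hQ : ∀ k : ℕ, ∀ᶠ α in 𝓝[≠] (0 : ℝ), ∃ S : Finset (Set E3), S.card = k ∧
      (S : Set (Set E3)) ⊆ slidingPeriodicOrbitsIn U h (Z α) G ∧
      (1 ≤ r → ∃ G' ∈ 𝓝ˢ Γ, G' ⊆ G ∧ slidingPeriodicOrbitsIn U h (Z α) G' = S) := by
    intro k
    by_cases hr : 1 ≤ r
    · obtain ⟨O, hO, hE⟩ := hE hr
      filter_upwards [(hA (G ∩ O) (inter_mem hG hO) k).filter_mono nhdsWithin_le_nhds, hE]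
        with α h1 h2
      obtain ⟨S, hS, hSG⟩ := h1
      exact ⟨S, hS, fun P hP => ⟨(hSG hP).1, (hSG hP).2.trans inter_subset_left⟩,
        fun _ => h2 G hG S hSG⟩
    · filter_upwards [(hA G hG k).filter_mono nhdsWithin_le_nhds] with α h1
      obtain ⟨S, hS, hSG⟩ := h1
      exact ⟨S, hS, hSG, fun h => absurd h hr⟩
  obtain ⟨α₀, hα₀, N, hN, hlim⟩ := exists_counting_of_eventually hQ
  choose! S hS using fun (α : ℝ) (h : 0 < |α| ∧ |α| < α₀) => (hN α h.1 h.2).2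
  exact ⟨α₀, hα₀, N, S, fun α h0 h1 => ⟨(hN α h0 h1).1, hS α ⟨h0, h1⟩⟩, hlim⟩

theorem HasManyOrbits.exists_injective {U : Set E3} {h : E3 → ℝ} {Z : ℝ → PWField} {Γ G : Set E3}
    (hA : HasManyOrbits U h Z Γ) (hG : G ∈ 𝓝ˢ Γ) :
    ∃ P : ℕ → Set E3, Function.Injective P ∧ ∀ i, P i ∈ slidingPeriodicOrbitsIn U h (Z 0) G := by
  have hinf : (slidingPeriodicOrbitsIn U h (Z 0) G).Infinite := fun hfin => by
    obtain ⟨S, hS, hSG⟩ := (hA G hG (hfin.toFinset.card + 1)).self_of_nhds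
    have := Finset.card_le_card (show S ⊆ hfin.toFinset from fun P hP => hfin.mem_toFinset.mpr (hSG hP))
    omega
  exact ⟨fun i => hinf.natEmbedding _ i, Subtype.val_injective.comp (hinf.natEmbedding _).injective,
    fun i => (hinf.natEmbedding _ i).2⟩

end PWField

namespace PWField

/-! ### Time reversal -/

/-- The field whose trajectories are those of `Z`, run backwards. -/
def rev (Z : PWField) : PWField := ⟨fun x => -Z.X x, fun x => -Z.Y x⟩

@[simp]
theorem rev_rev (Z : PWField) : Z.rev.rev = Z := by simp [rev]

theorem lieDeriv_neg {X : E3 → E3} {h : E3 → ℝ} (x : E3) :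
    lieDeriv (fun y => -X y) h x = -lieDeriv X h x := by simp [lieDeriv]

theorem slidingRegion_rev {U : Set E3} {h : E3 → ℝ} {Z : PWField} :
    slidingRegion U h Z.rev = escapingRegion U h Z := by
  ext x; simp [slidingRegion, escapingRegion, rev, lieDeriv_neg]

theorem slidingField_rev {h : E3 → ℝ} {Z : PWField} (x : E3) :
    slidingField h Z.rev x = -slidingField h Z x := by
  simp only [slidingField, rev, lieDeriv_neg]
  rw [show -lieDeriv Z.Y h x - -lieDeriv Z.X h x = -(lieDeriv Z.Y h x - lieDeriv Z.X h x) by ring,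
    inv_neg, neg_smul]
  congr 2
  module

theorem _root_.HasDerivAt.comp_neg_time {γ : ℝ → E3} {v : E3} {t : ℝ} (hγ : HasDerivAt γ v (-t)) :
    HasDerivAt (fun s => γ (-s)) (-v) t := by
  have := HasDerivAt.scomp t hγ (hasDerivAt_neg t)
  rwa [neg_one_smul] at this

theorem IsTrajectory.rev {U : Set E3} {h : E3 → ℝ} {Z : PWField} {γ : ℝ → E3}
    (hγ : IsTrajectory U h Z γ) : IsTrajectory U h Z.rev fun t => γ (-t) := by
  refine ⟨hγ.1.comp LipschitzWith.id.neg.locallyLipschitz, fun t => hγ.2.1 _, ?_⟩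
  filter_upwards [(Measure.measurePreserving_neg volume).quasiMeasurePreserving.ae hγ.ae_hasDerivAt]
    with t ⟨l, hl, hd⟩
  refine ⟨_, blend_mem_velocities hl, ?_⟩
  have e : blend Z.rev l (γ (-t)) = -blend Z l (γ (-t)) := by
    simp only [blend, PWField.rev]; module
  rw [e]
  exact hd.comp_neg_time

theorem IsSlidingPeriodicOrbit.rev {U : Set E3} {h : E3 → ℝ} {Z : PWField} {P : Set E3}
    (hP : IsSlidingPeriodicOrbit U h Z P) : IsSlidingPeriodicOrbit U h Z.rev P := by
  obtain ⟨γ, T, hT, hγ, hper, ⟨a, b, hab, hs⟩, ⟨t, ht⟩, rfl⟩ := hP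
  refine ⟨fun t => γ (-t), T, hT, hγ.rev, fun t => ?_, ⟨-b, -a, by linarith, fun t ht => ?_⟩,
    ⟨-t, by simpa using ht⟩, ?_⟩
  · show γ (-(t + T)) = γ (-t)
    rw [neg_add, ← sub_eq_add_neg]; exact hper.sub_eq _
  · have := hs (-t) ⟨by linarith [ht.2], by linarith [ht.1]⟩
    rw [slidingRegion_rev, ← slidingRegion_rev (Z := Z.rev), Z.rev_rev, union_comm]
    exact this
  · exact ((Equiv.neg ℝ).surjective.range_comp γ).symm

theorem slidingPeriodicOrbitsIn_rev {U : Set E3} {h : E3 → ℝ} {Z : PWField} {G : Set E3} :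
    slidingPeriodicOrbitsIn U h Z.rev G = slidingPeriodicOrbitsIn U h Z G := by
  ext P
  exact and_congr_left fun _ => ⟨fun hP => by simpa using hP.rev, fun hP => hP.rev⟩

theorem IsFocusWith.rev {U : Set E3} {h : E3 → ℝ} {Z : PWField} {p : E3} {a b : ℝ}
    (hp : IsFocusWith U h Z p a b) : IsFocusWith U h Z.rev p (-a) (-b) := by
  obtain ⟨hz, hb, A, hA, u, v, hu, hv, huv, hAu, hAv⟩ := hp
  refine ⟨by rw [slidingField_rev, hz, neg_zero], neg_ne_zero.mpr hb, -A, ?_, u, v, hu, hv, huv, ?_,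
    ?_⟩
  · rw [funext slidingField_rev]; exact hA.neg
  · rw [_root_.neg_apply, hAu]; module
  · rw [_root_.neg_apply, hAv]; module

theorem IsVisibleFold.neg {U : Set E3} {h : E3 → ℝ} {X : E3 → E3} {q : E3}
    (hq : IsVisibleFold U h X q) : IsVisibleFold U h (fun x => -X x) q := by
  obtain ⟨h1, h2, h3, h4⟩ := hq
  have e : lieDeriv (fun x => -X x) h = -lieDeriv X h := funext lieDeriv_neg
  refine ⟨h1, by rw [lieDeriv_neg, h2, neg_zero], by rw [e]; exact h3.neg, ?_⟩
  rw [e, lieDeriv_neg, lieDeriv, fderiv_neg, _root_.neg_apply, neg_neg]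
  exact h4

theorem _root_.HasDerivWithinAt.comp_neg_time {γ : ℝ → E3} {v : E3} {a b t : ℝ}
    (hγ : HasDerivWithinAt γ v (Icc (-b) (-a)) (-t)) :
    HasDerivWithinAt (fun s => γ (-s)) (-v) (Icc a b) t := by
  have := HasDerivWithinAt.scomp t hγ (hasDerivAt_neg t).hasDerivWithinAt
    (fun s (hs : s ∈ Icc a b) => ⟨neg_le_neg hs.2, neg_le_neg hs.1⟩)
  rwa [neg_one_smul] at this

theorem image_comp_neg {γ : ℝ → E3} {s t : Set ℝ} (h : Neg.neg '' s = t) :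
    (fun u => γ (-u)) '' s = γ '' t := by rw [← h, image_image]

theorem IsShilnikovEscaping.rev {U : Set E3} {h : E3 → ℝ} {Z : PWField} {Γ : Set E3}
    (hΓ : IsShilnikovEscaping U h Z Γ) : IsShilnikovSliding U h Z.rev Γ := by
  obtain ⟨p, q, hp, ⟨a, b, ha, hf⟩, hq, hfold, hYq, σ, ξ, t₀, ⟨hσ0, hσc, hσ, hσl⟩,
    ⟨ht₀, hξ0, hξp, hξ, hξpos⟩, rfl⟩ := hΓ
  refine ⟨p, q, slidingRegion_rev ▸ hp, ⟨-a, -b, by linarith, hf.rev⟩, slidingRegion_rev ▸ hq,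
    hfold.neg, ?_, fun t => σ (-t), fun t => ξ (-t), -t₀, ⟨by simpa using hσ0, ?_, fun t ht => ?_,
      hσl.comp tendsto_neg_atBot_atTop⟩, ⟨by linarith, by simpa using hξ0, by simpa using hξp,
      fun t ht => ?_, fun t ht => hξpos _ ⟨by linarith [ht.2], by linarith [ht.1]⟩⟩, ?_⟩
  · show 0 < lieDeriv (fun x => -Z.Y x) h q
    rw [lieDeriv_neg]; linarith
  · exact hσc.comp continuous_neg.continuousOn fun t ht => neg_nonneg.mpr (mem_Iic.mp ht)
  · obtain ⟨h1, h2⟩ := hσ (-t) (by linarith)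
    rw [slidingRegion_rev, slidingField_rev]
    exact ⟨h1, h2.comp_neg_time⟩
  · refine HasDerivWithinAt.comp_neg_time (v := Z.X (ξ (-t))) ?_
    rw [neg_neg, neg_zero]
    exact hξ (-t) ⟨by linarith [ht.2], by linarith [ht.1]⟩
  · rw [image_comp_neg (s := Iic 0) (t := Ici 0) (by simp),
      image_comp_neg (s := Icc 0 (-t₀)) (t := Icc t₀ 0) (by simp)]

theorem IsShilnikovSliding.rev {U : Set E3} {h : E3 → ℝ} {Z : PWField} {Γ : Set E3}
    (hΓ : IsShilnikovSliding U h Z.rev Γ) : IsShilnikovEscaping U h Z Γ := by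
  obtain ⟨p, q, hp, ⟨a, b, ha, hf⟩, hq, hfold, hYq, σ, ξ, t₀, ⟨hσ0, hσc, hσ, hσl⟩,
    ⟨ht₀, hξ0, hξp, hξ, hξpos⟩, rfl⟩ := hΓ
  have hf' := hf.rev
  have hfold' := hfold.neg
  rw [rev_rev] at hf'
  rw [slidingRegion_rev] at hp hq
  refine ⟨p, q, hp, ⟨-a, -b, by linarith, hf'⟩, hq, by simpa [PWField.rev] using hfold', ?_,
    fun t => σ (-t), fun t => ξ (-t), -t₀, ⟨by simpa using hσ0, ?_, fun t ht => ?_,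
      hσl.comp tendsto_neg_atTop_atBot⟩, ⟨by linarith, by simpa using hξ0, by simpa using hξp,
      fun t ht => ?_, fun t ht => hξpos _ ⟨by linarith [ht.2], by linarith [ht.1]⟩⟩, ?_⟩
  · change 0 < lieDeriv (fun x => -Z.Y x) h q at hYq
    rw [lieDeriv_neg] at hYq; linarith
  · exact hσc.comp continuous_neg.continuousOn fun t ht => neg_nonpos.mpr (mem_Ici.mp ht)
  · obtain ⟨h1, h2⟩ := hσ (-t) (neg_neg_iff_pos.mpr ht)
    rw [slidingRegion_rev] at h1
    rw [slidingField_rev] at h2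
    exact ⟨h1, by simpa using h2.comp_neg_time⟩
  · have := HasDerivWithinAt.comp_neg_time (γ := ξ) (a := -t₀) (b := 0) (t := t)
      (v := -Z.X (ξ (-t))) (by
        rw [neg_neg, neg_zero]
        exact hξ (-t) ⟨by linarith [ht.2], by linarith [ht.1]⟩)
    rwa [neg_neg] at this
  · rw [image_comp_neg (s := Ici 0) (t := Iic 0) (by simp),
      image_comp_neg (s := Icc (-t₀) 0) (t := Icc 0 t₀) (by simp)]

theorem SmoothFamily.rev {U : Set E3} {Z : ℝ → PWField} (D : SmoothFamily U Z) :
    SmoothFamily U fun α => (Z α).rev := by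
  refine ⟨D.smooth.mono fun α hα => ⟨hα.1.neg, hα.2.neg⟩, D.lim_X.neg, D.lim_Y.neg, ?_, ?_⟩
  · have e : ∀ α, fderiv ℝ (Z α).rev.X = -fderiv ℝ (Z α).X := fun α => funext fun x => fderiv_neg
    simp only [e]; exact D.lim_dX.neg
  · have e : ∀ α, fderiv ℝ (Z α).rev.Y = -fderiv ℝ (Z α).Y := fun α => funext fun x => fderiv_neg
    simp only [e]; exact D.lim_dY.neg

theorem tendstoUniformlyOn_of_iteratedFDeriv_zero {U : Set E3} {f : ℝ → E3 → E3}
    (hf : TendstoUniformlyOn (fun α => iteratedFDeriv ℝ 0 (f α)) (iteratedFDeriv ℝ 0 (f 0)) (𝓝 0) U) :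
    TendstoUniformlyOn f (f 0) (𝓝 0) U := by
  rw [Metric.tendstoUniformlyOn_iff] at hf ⊢
  intro ε hε
  filter_upwards [hf ε hε] with α hα x hx
  refine lt_of_le_of_lt ?_ (hα x hx)
  have := (iteratedFDeriv ℝ 0 (f 0) x - iteratedFDeriv ℝ 0 (f α) x).le_opNorm 0
  simpa [dist_eq_norm] using this

theorem tendstoUniformlyOn_of_iteratedFDeriv_one {U : Set E3} {f : ℝ → E3 → E3}
    (hf : TendstoUniformlyOn (fun α => iteratedFDeriv ℝ 1 (f α)) (iteratedFDeriv ℝ 1 (f 0)) (𝓝 0) U) :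
    TendstoUniformlyOn (fun α => fderiv ℝ (f α)) (fderiv ℝ (f 0)) (𝓝 0) U := by
  rw [Metric.tendstoUniformlyOn_iff] at hf ⊢
  intro ε hε
  filter_upwards [hf ε hε] with α hα x hx
  refine lt_of_le_of_lt ?_ (hα x hx)
  rw [dist_eq_norm, dist_eq_norm]
  refine ContinuousLinearMap.opNorm_le_bound _ (norm_nonneg _) fun v => ?_
  have := (iteratedFDeriv ℝ 1 (f 0) x - iteratedFDeriv ℝ 1 (f α) x).le_opNorm fun _ => v
  simpa using this

end PWField

theorem theoremB (r : ℕ) (U : Set E3) (hU : IsOpen U) (h : E3 → ℝ)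
    (hh : ContDiffOn ℝ ((max (r + 1) 2 : ℕ) : WithTop ℕ∞) h U)
    (hreg : ∀ x ∈ U, h x = 0 → fderiv ℝ h x ≠ 0)
    (Z : ℝ → PWField) (Γ₀ : Set E3)
    (hΓ₀ : PWField.IsSlidingShilnikovOrbit U h (Z 0) Γ₀)
    (hZ : PWField.IsUnfolding r U h Z Γ₀) :
    -- (a)
    (∀ G ∈ 𝓝ˢ Γ₀, ∃ P : ℕ → Set E3, Function.Injective P ∧
      ∀ i, P i ∈ PWField.slidingPeriodicOrbitsIn U h (Z 0) G) ∧
    -- (b)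
    (∃ α₀ > 0, ∃ (G : ℝ → Set E3) (N : ℝ → ℕ) (S : ℝ → Finset (Set E3)),
      (∀ α : ℝ, 0 < |α| → |α| < α₀ →
        G α ∈ 𝓝ˢ Γ₀ ∧ 0 < N α ∧ (S α).card = N α ∧
        (S α : Set (Set E3)) ⊆ PWField.slidingPeriodicOrbitsIn U h (Z α) (G α) ∧
        (1 ≤ r → PWField.slidingPeriodicOrbitsIn U h (Z α) (G α) = (S α : Set (Set E3)))) ∧
      Tendsto N (𝓝[≠] 0) atTop) ∧
    -- (c)
    (∀ G ∈ 𝓝ˢ Γ₀, ∃ α₀ > 0, ∃ (N : ℝ → ℕ) (S : ℝ → Finset (Set E3)),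
      (∀ α : ℝ, 0 < |α| → |α| < α₀ →
        0 < N α ∧ (S α).card = N α ∧
        (S α : Set (Set E3)) ⊆ PWField.slidingPeriodicOrbitsIn U h (Z α) G ∧
        (1 ≤ r → ∃ G' ∈ 𝓝ˢ Γ₀, G' ⊆ G ∧
          PWField.slidingPeriodicOrbitsIn U h (Z α) G' = (S α : Set (Set E3)))) ∧
      Tendsto N (𝓝[≠] 0) atTop) := by
  obtain ⟨hΩ, hlim, V, hV, hVα⟩ := hZ
  have hh2 : ContDiffOn ℝ 2 h U := hh.of_le (by exact_mod_cast le_max_right (r + 1) 2)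
  have hX := PWField.tendstoUniformlyOn_of_iteratedFDeriv_zero (f := fun α => (Z α).X)
    (hlim 0 (Nat.zero_le r)).1
  have hY := PWField.tendstoUniformlyOn_of_iteratedFDeriv_zero (f := fun α => (Z α).Y)
    (hlim 0 (Nat.zero_le r)).2
  have D : 1 ≤ r → PWField.SmoothFamily U Z := fun hr =>
    ⟨hΩ.mono fun α hα => ⟨hα.1.of_le (by exact_mod_cast hr), hα.2.1.of_le (by exact_mod_cast hr)⟩,
      hX, hY, PWField.tendstoUniformlyOn_of_iteratedFDeriv_one (f := fun α => (Z α).X) (hlim 1 hr).1,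
      PWField.tendstoUniformlyOn_of_iteratedFDeriv_one (f := fun α => (Z α).Y) (hlim 1 hr).2⟩
  have hlip : ∀ᶠ α in 𝓝 0, LocallyLipschitzOn U (Z α).X ∧ LocallyLipschitzOn U (Z α).Y := by
    rcases Nat.eq_zero_or_pos r with h0 | h0
    · filter_upwards [hΩ] with α hα
      obtain ⟨⟨K, hK⟩, ⟨K', hK'⟩⟩ := hα.2.2 h0
      exact ⟨fun x _ => ⟨K, U, self_mem_nhdsWithin, hK⟩, fun x _ => ⟨K', U, self_mem_nhdsWithin, hK'⟩⟩
    · filter_upwards [(D h0).smooth] with α hα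
      exact ⟨PWField.locallyLipschitzOn_of_contDiffOn hU hα.1,
        PWField.locallyLipschitzOn_of_contDiffOn hU hα.2⟩
  obtain ⟨hA, hE⟩ : PWField.HasManyOrbits U h Z Γ₀ ∧ (1 ≤ r → PWField.IsolatesOrbits U h Z Γ₀) := by
    rcases hΓ₀ with hΓ | hΓ
    · exact ⟨PWField.hasManyOrbits_of_sliding hU hh2 hlip hX hY hΓ, fun hr =>
        PWField.isolatesOrbits_of_sliding hU hh2 (D hr) hΓ
          ⟨V, hV, hVα.mono fun α hα Γ hΓV hs => hα Γ hΓV (Or.inl hs)⟩⟩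
    · have hA := PWField.hasManyOrbits_of_sliding (Z := fun α => (Z α).rev) hU hh2
        (hlip.mono fun α hα => ⟨hα.1.neg, hα.2.neg⟩) hX.neg hY.neg hΓ.rev
      have hE := fun hr => PWField.isolatesOrbits_of_sliding (Z := fun α => (Z α).rev) hU hh2
        (D hr).rev hΓ.rev ⟨V, hV, hVα.mono fun α hα Γ hΓV hs => hα Γ hΓV (Or.inr hs.rev)⟩
      simp only [PWField.HasManyOrbits, PWField.IsolatesOrbits,
        PWField.slidingPeriodicOrbitsIn_rev] at hA hE
      exact ⟨hA, hE⟩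
  refine ⟨fun G hG => hA.exists_injective hG, ?_, fun G hG =>
    PWField.exists_orbit_counts hA hE hG⟩
  obtain ⟨α₀, hα₀, N, S, hS, hN⟩ := PWField.exists_orbit_counts hA hE univ_mem
  have hG : ∀ α : ℝ, ∃ G ∈ 𝓝ˢ Γ₀, 0 < |α| → |α| < α₀ →
      (S α : Set (Set E3)) ⊆ PWField.slidingPeriodicOrbitsIn U h (Z α) G ∧
      (1 ≤ r → PWField.slidingPeriodicOrbitsIn U h (Z α) G = (S α : Set (Set E3))) := by
    intro α
    by_cases hα : (0 < |α| ∧ |α| < α₀) ∧ 1 ≤ r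
    · obtain ⟨-, -, -, hs⟩ := hS α hα.1.1 hα.1.2
      obtain ⟨G, hG, -, e⟩ := hs hα.2
      exact ⟨G, hG, fun _ _ => ⟨e.ge, fun _ => e⟩⟩
    · exact ⟨univ, univ_mem, fun h1 h2 => ⟨(hS α h1 h2).2.2.1, fun hr => absurd ⟨⟨h1, h2⟩, hr⟩ hα⟩⟩
  choose G hG hGS using hG
  exact ⟨α₀, hα₀, G, N, S, fun α h1 h2 => ⟨hG α, (hS α h1 h2).1, (hS α h1 h2).2.1, hGS α h1 h2⟩, hN⟩
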